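/- Let $n,k\ge 1$ and let $(M,HM,J)$ be a smooth connected abstract CR manifold of type $(n,k)$: $M$ is a connected paracompact (Hausdorff) smooth manifold of real dimension $2n+k$, $HM\subset TM$ is a smooth subbundle of rank $2n$, and $J:HM\to HM$ is a smooth bundle isomorphism with $J^2=-\mathrm{Id}$ such that $[T^{0,1}M,T^{0,1}M]\subset T^{0,1}M$, where $T^{0,1}M=\{X+iJX\mid X\in\Gamma(M,HM)\}$. For $U\subset M$ open let $F^p\Omega^{m}(U)$ be the space of smooth complex valued $m$-forms on $U$ that lie pointwise in the $p$-th power of the ideal generated by the one-forms vanishing on $T^{0,1}M$ (equivalently, that vanish whenever more than $m-p$ of their arguments are in $T^{0,1}M$). The smooth $(p,q)$-forms on $U$ are the elements of $\mathcal C^\infty_{p,q}(U)=F^p\Omega^{p+q}(U)/F^{p+1}\Omega^{p+q}(U)$ (with $\mathcal C^\infty_{p,-1}(U)=0$), and $\bar\partial_M:\mathcal C^\infty_{p,q}(U)\to\mathcal C^\infty_{p,q+1}(U)$ is induced by the exterior derivative. Let $H^{p,q}(U)$ be the cohomology of $(\mathcal C^\infty_{p,*}(U),\bar\partial_M)$ at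 $\mathcal C^\infty_{p,q}(U)$, with the quotient topology coming from the $\mathcal C^\infty$ topology on forms (uniform convergence of all derivatives on compact sets). For $p_0\in M$ let $$H^{p,q}((p_0))=\varinjlim_{U\ni p_0}H^{p,q}(U)$$ be the local cohomology group, the direct limit over the open neighborhoods $U$ of $p_0$, with the inductive limit topology, i.e. the finest topology for which all maps $H^{p,q}(U)\to H^{p,q}((p_0))$ are continuous. The Poincaré lemma for $\bar\partial_M$ is valid at $p_0$ at bidegree $(p,q)$ if the sequence of germs at $p_0$ $$\mathcal C^\infty_{p,q-1}\{p_0\}\xrightarrow{\bar\partial_M}\mathcal C^\infty_{p,q}\{p_0\}\xrightarrow{\bar\partial_M}\mathcal C^\infty_{p,q+1}\{p_0\}$$ is exact. For $\xi\in T^*_{p_0}M$ vanishing on $H_{p_0}M$ (a characteristic conormal direction), the Levi form is the Hermitian form on the complex vector space $(H_{p_0}M,J)$ given by $\mathcal L_{p_0}(\xi,X)=\xi([J\tilde X,\tilde X])$, where $\tilde X$ is any smooth section of $HM$ extending $X\in H_{p_0}M$. **Theorem.** Assume that, for some $0\le q\le n$, there are a point $p_0\in M$ and a characteristic conormal direction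 $\xi$ at $p_0$ such that $\mathcal L_{p_0}(\xi,\cdot)$ has $q$ negative and $n-q$ positive eigenvalues. Then for every $0\le p\le n+k$: 1. either $H^{p,q}((p_0))$ is infinite dimensional or $H^{p,q+1}((p_0))$ is not Hausdorff; 2. either $H^{p,n-q}((p_0))$ is infinite dimensional or $H^{p,n-q+1}((p_0))$ is not Hausdorff; 3. the Poincaré lemma for $\bar\partial_M$ fails at $p_0$ at bidegree $(p,q)$ or at bidegree $(p,q+1)$; 4. the Poincaré lemma for $\bar\partial_M$ fails at $p_0$ at bidegree $(p,n-q)$ or at bidegree $(p,n-q+1)$. (All alternatives are inclusive.) -/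

import Mathlib

open Set Filter Topology TopologicalSpace
open scoped Manifold ContDiff

noncomputable section

/-! ### Complex valued differential forms on a smooth manifold -/

section Forms

variable {E : Type*} [NormedAddCommGroup E] [NormedSpace ℝ E]
  {M : Type*} [TopologicalSpace M] [ChartedSpace E M]

variable (E) in
/-- Complex valued alternating `m`-forms on the real tangent space at `x`. -/
abbrev CForm (m : ℕ) (x : M) : Type _ := (TangentSpace 𝓘(ℝ, E) x) [⋀^Fin m]→L[ℝ] ℂ

variable (E) in
/-- The complexified tangent space at `x`: the pair `(X, Y)` stands for `X + iY`. -/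
abbrev CTangent (x : M) : Type _ := TangentSpace 𝓘(ℝ, E) x × TangentSpace 𝓘(ℝ, E) x

/-- The value of the complex multilinear extension of `α` on complex tangent vectors,
`α(X₁ + iY₁, …, X_m + iY_m)`, expanded by multilinearity. -/
def CForm.complexEval {m : ℕ} {x : M} (α : CForm E m x) (Z : Fin m → CTangent E x) : ℂ :=
  ∑ s : Finset (Fin m), Complex.I ^ s.card * α (fun j => if j ∈ s then (Z j).2 else (Z j).1)

/-- The expression of a (not necessarily smooth) field of forms in the preferred chart at `x₀`, that
is, its pull-back by the inverse of the chart. -/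
def formInChart {m : ℕ} (α : ∀ x : M, CForm E m x) (x₀ : M) (y : E) : E [⋀^Fin m]→L[ℝ] ℂ :=
  (α ((extChartAt 𝓘(ℝ, E) x₀).symm y)).compContinuousLinearMap
    ((mfderiv 𝓘(ℝ, E) 𝓘(ℝ, E) (extChartAt 𝓘(ℝ, E) x₀).symm y).comp
      (NormedSpace.fromTangentSpace y).symm.toContinuousLinearMap)

variable (E) in
/-- The part of the target of the preferred chart at `x₀` that corresponds to points of `U`. -/
def chartDomain (U : Opens M) (x₀ : M) : Set E :=
  (extChartAt 𝓘(ℝ, E) x₀).target ∩ (extChartAt 𝓘(ℝ, E) x₀).symm ⁻¹' (U : Set M)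

/-- The exterior derivative, computed at each point in the preferred chart there (as Mathlib does for
the Lie bracket `VectorField.mlieBracket`). -/
def mextDeriv {m : ℕ} (α : ∀ x : M, CForm E m x) (x : M) : CForm E (m + 1) x :=
  (extDeriv (formInChart α x) (extChartAt 𝓘(ℝ, E) x x)).compContinuousLinearMap
    ((NormedSpace.fromTangentSpace (extChartAt 𝓘(ℝ, E) x x)).toContinuousLinearMap.comp
      (mfderiv 𝓘(ℝ, E) 𝓘(ℝ, E) (extChartAt 𝓘(ℝ, E) x) x))

lemma formInChart_add {m : ℕ} (α η : ∀ x : M, CForm E m x) (x₀ : M) :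
    formInChart (α + η) x₀ = formInChart α x₀ + formInChart η x₀ := rfl

lemma formInChart_smul {m : ℕ} (c : ℂ) (α : ∀ x : M, CForm E m x) (x₀ : M) :
    formInChart (c • α) x₀ = c • formInChart α x₀ := rfl

lemma formInChart_zero {m : ℕ} (x₀ : M) :
    formInChart (0 : ∀ x : M, CForm E m x) x₀ = 0 := rfl

lemma mem_chartDomain {U : Opens M} {x : M} (hx : x ∈ U) :
    extChartAt 𝓘(ℝ, E) x x ∈ chartDomain E U x :=
  ⟨mem_extChartAt_target x, by simpa using hx⟩

lemma isOpen_chartDomain (U : Opens M) (x₀ : M) : IsOpen (chartDomain E U x₀) :=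
  (continuousOn_extChartAt_symm (I := 𝓘(ℝ, E)) x₀).isOpen_inter_preimage
    (isOpen_extChartAt_target x₀) U.isOpen

variable (E) in
/-- Smooth complex valued `m`-forms on the open set `U`, as a space of fields of forms on `M`: a form
on `U` is represented by its extension by zero. -/
def smoothForms (m : ℕ) (U : Opens M) : Submodule ℂ (∀ x : M, CForm E m x) where
  carrier := {α | (∀ x₀ : M, ContDiffOn ℝ ∞ (formInChart α x₀) (chartDomain E U x₀)) ∧
    ∀ x ∉ U, α x = 0}
  zero_mem' := ⟨fun x₀ => by rw [formInChart_zero]; exact contDiffOn_const, fun _ _ => rfl⟩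
  add_mem' := by
    rintro α η ⟨h₁, h₂⟩ ⟨h₃, h₄⟩
    refine ⟨fun x₀ => ?_, fun x hx => ?_⟩
    · rw [formInChart_add]; exact (h₁ x₀).add (h₃ x₀)
    · simp [h₂ x hx, h₄ x hx]
  smul_mem' := by
    rintro c α ⟨h₁, h₂⟩
    refine ⟨fun x₀ => ?_, fun x hx => ?_⟩
    · rw [formInChart_smul]; exact (h₁ x₀).const_smul c
    · simp [h₂ x hx]

variable (E) in
/-- The space of smooth complex valued `m`-forms on `U`. -/
def SmoothForm (m : ℕ) (U : Opens M) : Type _ := smoothForms E m U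

instance (m : ℕ) (U : Opens M) : AddCommGroup (SmoothForm E m U) :=
  inferInstanceAs (AddCommGroup (smoothForms E m U))

instance (m : ℕ) (U : Opens M) : Module ℂ (SmoothForm E m U) :=
  inferInstanceAs (Module ℂ (smoothForms E m U))

/-- The field of forms underlying a smooth form. -/
def SmoothForm.field {m : ℕ} {U : Opens M} : SmoothForm E m U →ₗ[ℂ] (∀ x : M, CForm E m x) :=
  (smoothForms E m U).subtype

/-- The `C^∞` topology: uniform convergence of the coefficients in charts, together with all their
derivatives, on compact sets. -/
instance (m : ℕ) (U : Opens M) : TopologicalSpace (SmoothForm E m U) :=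
  ⨅ (x₀ : M) (r : ℕ), TopologicalSpace.induced
    (fun α : SmoothForm E m U =>
      UniformOnFun.ofFun {K : Set E | IsCompact K ∧ K ⊆ chartDomain E U x₀}
        (iteratedFDeriv ℝ r (formInChart α.field x₀)))
    inferInstance

lemma SmoothForm.differentiableAt {m : ℕ} {U : Opens M} (α : SmoothForm E m U) {x : M}
    (hx : x ∈ U) :
    DifferentiableAt ℝ (formInChart α.field x) (extChartAt 𝓘(ℝ, E) x x) :=
  ((α.2.1 x).contDiffAt ((isOpen_chartDomain U x).mem_nhds (mem_chartDomain hx))).differentiableAt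
    (by simp)

lemma SmoothForm.mextDeriv_add {m : ℕ} {U : Opens M} (α η : SmoothForm E m U) {x : M}
    (hx : x ∈ U) :
    mextDeriv (α + η).field x = mextDeriv α.field x + mextDeriv η.field x := by
  rw [map_add]
  simp only [mextDeriv, formInChart_add]
  rw [extDeriv_add (α.differentiableAt hx) (η.differentiableAt hx)]
  rfl

lemma SmoothForm.mextDeriv_smul {m : ℕ} {U : Opens M} (c : ℂ) (α : SmoothForm E m U) {x : M}
    (hx : x ∈ U) :
    mextDeriv (c • α).field x = c • mextDeriv α.field x := by
  rw [map_smul]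
  simp only [mextDeriv, formInChart_smul, extDeriv]
  rw [fderiv_const_smul (α.differentiableAt hx), ContinuousAlternatingMap.alternatizeUncurryFin_smul]
  rfl

lemma SmoothForm.mextDeriv_zero {m : ℕ} {U : Opens M} {x : M} (hx : x ∈ U) :
    mextDeriv (0 : SmoothForm E m U).field x = 0 := by
  have h := SmoothForm.mextDeriv_smul (0 : ℂ) (0 : SmoothForm E m U) hx
  rw [smul_zero] at h
  exact h.trans (zero_smul ℂ (mextDeriv (0 : SmoothForm E m U).field x))

open Classical in
/-- The restriction of a field of forms to `V`, extended by zero. -/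
def restrictField {m : ℕ} (V : Opens M) (α : ∀ x : M, CForm E m x) (x : M) : CForm E m x :=
  if x ∈ V then α x else 0

lemma restrictField_apply {m : ℕ} {V : Opens M} (α : ∀ x : M, CForm E m x) {x : M} (hx : x ∈ V) :
    restrictField V α x = α x := if_pos hx

lemma formInChart_restrictField {m : ℕ} (V : Opens M) (α : ∀ x : M, CForm E m x) (x₀ : M) :
    EqOn (formInChart (restrictField V α) x₀) (formInChart α x₀) (chartDomain E V x₀) := by
  intro y hy
  simp only [formInChart]
  rw [restrictField_apply α hy.2]

lemma mextDeriv_restrictField {m : ℕ} {V : Opens M} (α : ∀ x : M, CForm E m x) {x : M}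
    (hx : x ∈ V) : mextDeriv (restrictField V α) x = mextDeriv α x := by
  simp only [mextDeriv]
  rw [((formInChart_restrictField V α x).eventuallyEq_of_mem
    ((isOpen_chartDomain V x).mem_nhds (mem_chartDomain hx))).extDeriv_eq]

/-- The restriction map from smooth forms on `U` to smooth forms on `V ⊆ U`. -/
def SmoothForm.restrict {m : ℕ} {U V : Opens M} (h : V ≤ U) :
    SmoothForm E m U →ₗ[ℂ] SmoothForm E m V where
  toFun α := ⟨restrictField V α.field,
    fun x₀ => ((α.2.1 x₀).mono (fun _ hy => ⟨hy.1, h hy.2⟩)).congr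
      (formInChart_restrictField V α.field x₀),
    fun _ hx => if_neg hx⟩
  map_add' α η := Subtype.ext <| by
    funext x
    change restrictField V _ x = restrictField V _ x + restrictField V _ x
    by_cases hx : x ∈ V <;> simp [restrictField, hx]
  map_smul' c α := Subtype.ext <| by
    funext x
    change restrictField V _ x = c • restrictField V _ x
    by_cases hx : x ∈ V
    · simp [restrictField, hx]
    · simp only [restrictField, hx, if_false]; exact (smul_zero (A := CForm E m x) c).symm

lemma SmoothForm.restrict_field {m : ℕ} {U V : Opens M} (h : V ≤ U) (α : SmoothForm E m U) :
    (SmoothForm.restrict h α).field = restrictField V α.field := rfl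

end Forms

/-! ### Abstract Cauchy-Riemann manifolds -/

/-- A vector field is smooth on the open set `U`. -/
def SmoothVectorFieldOn {E : Type*} [NormedAddCommGroup E] [NormedSpace ℝ E]
    {M : Type*} [TopologicalSpace M] [ChartedSpace E M] [IsManifold 𝓘(ℝ, E) ∞ M]
    (X : ∀ x : M, TangentSpace 𝓘(ℝ, E) x) (U : Opens M) : Prop :=
  ContMDiffOn 𝓘(ℝ, E) (𝓘(ℝ, E)).tangent ∞ (fun x => (⟨x, X x⟩ : TangentBundle 𝓘(ℝ, E) M)) U

/-- The Lie bracket of complex vector fields, `[X + iY, X' + iY']`. -/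
def complexLieBracket {E : Type*} [NormedAddCommGroup E] [NormedSpace ℝ E]
    {M : Type*} [TopologicalSpace M] [ChartedSpace E M]
    (Z W : ∀ x : M, CTangent E x) (x : M) : CTangent E x :=
  let br (X Y : ∀ x : M, TangentSpace 𝓘(ℝ, E) x) := VectorField.mlieBracket 𝓘(ℝ, E) X Y x
  (br (fun x => (Z x).1) (fun x => (W x).1) - br (fun x => (Z x).2) (fun x => (W x).2),
    br (fun x => (Z x).1) (fun x => (W x).2) + br (fun x => (Z x).2) (fun x => (W x).1))

/-- An abstract CR structure of type `(n, k)` on a manifold `M` of dimension `2n + k`: a smooth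
subbundle `H` of rank `2n` of the tangent bundle with a smooth complex structure `J` on it that is
formally integrable.

A smooth section of `H` on the open set `U` is a family of vectors `X x ∈ H x` that is smooth on `U`;
its values outside of `U` play no role. -/
structure CRStructure (n k : ℕ) (M : Type*) [TopologicalSpace M]
    [ChartedSpace (EuclideanSpace ℝ (Fin (2 * n + k))) M] [IsManifold (𝓡 (2 * n + k)) ∞ M] where
  /-- The holomorphic tangent space `H x ⊆ T_x M`. -/
  H : ∀ x : M, Submodule ℝ (TangentSpace (𝓡 (2 * n + k)) x)
  /-- The partial complex structure. -/
  J : ∀ x : M, H x →ₗ[ℝ] H x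
  /-- `H` is a smooth subbundle of rank `2n`: it has smooth local frames of `2n` sections. -/
  exists_frame : ∀ x₀ : M, ∃ U : Opens M, x₀ ∈ U ∧ ∃ X : Fin (2 * n) → ∀ x : M, H x,
    (∀ j, SmoothVectorFieldOn (fun x => (X j x : TangentSpace (𝓡 (2 * n + k)) x)) U) ∧
    ∀ x ∈ U, LinearIndependent ℝ (fun j => X j x) ∧
      Submodule.span ℝ (range fun j => X j x) = ⊤
  J_sq : ∀ (x : M) (v : H x), J x (J x v) = -v
  /-- `J` is smooth: it maps smooth sections of `H` to smooth sections. -/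
  J_smooth : ∀ (U : Opens M) (X : ∀ x : M, H x),
    SmoothVectorFieldOn (fun x => (X x : TangentSpace (𝓡 (2 * n + k)) x)) U →
    SmoothVectorFieldOn (fun x => (J x (X x) : TangentSpace (𝓡 (2 * n + k)) x)) U
  /-- Formal integrability: the bracket of two sections `X + iJX`, `Y + iJY` of `T^{0,1}` is a
  section of `T^{0,1}`. -/
  integrable : ∀ (U : Opens M) (X Y : ∀ x : M, H x),
    SmoothVectorFieldOn (fun x => (X x : TangentSpace (𝓡 (2 * n + k)) x)) U →
    SmoothVectorFieldOn (fun x => (Y x : TangentSpace (𝓡 (2 * n + k)) x)) U →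
    ∀ x ∈ U, ∃ v : H x,
      complexLieBracket (E := EuclideanSpace ℝ (Fin (2 * n + k)))
        (fun x => ((X x).1, (J x (X x)).1)) (fun x => ((Y x).1, (J x (Y x)).1)) x =
          (v.1, (J x v).1)

namespace CRStructure

variable {n k : ℕ} {M : Type*} [TopologicalSpace M]
  [ChartedSpace (EuclideanSpace ℝ (Fin (2 * n + k))) M] [IsManifold (𝓡 (2 * n + k)) ∞ M]
  (S : CRStructure n k M)

/-- The fibre of `T^{0,1}M` at `x`, the complex vectors `v + iJv` with `v ∈ H x`. -/
def T01 (x : M) : Set (CTangent (EuclideanSpace ℝ (Fin (2 * n + k))) x) :=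
  range fun v : S.H x => (v.1, (S.J x v).1)

/-- The characteristic conormal space at `x`: real covectors that vanish on `H x`. -/
def conormal (x : M) : Set (TangentSpace (𝓡 (2 * n + k)) x →L[ℝ] ℝ) :=
  {ξ | ∀ v ∈ S.H x, ξ v = 0}

lemma exists_extension (x : M) (v : S.H x) : ∃ X : ∀ x : M, S.H x, X x = v ∧ ∃ U : Opens M, x ∈ U ∧
    SmoothVectorFieldOn (fun y => (X y : TangentSpace (𝓡 (2 * n + k)) y)) U := by
  obtain ⟨U, hU, X, hX, hspan⟩ := S.exists_frame x
  have hv : v ∈ Submodule.span ℝ (range fun j => X j x) := by rw [(hspan x hU).2]; trivial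
  obtain ⟨c, hc⟩ := (Submodule.mem_span_range_iff_exists_fun ℝ).1 hv
  refine ⟨fun y => ∑ j, c j • X j y, hc, U, hU, ?_⟩
  intro y hy
  have h := ContMDiffWithinAt.sum_section (s := Finset.univ)
    (t := fun j y => c j • (X j y : TangentSpace (𝓡 (2 * n + k)) y))
    (fun j _ => (hX j y hy).const_smul_section (a := c j))
  simpa using h

/-- A section of `H` that is smooth near `x` and extends the vector `v ∈ H x`. -/
def extension (x : M) (v : S.H x) : ∀ x : M, S.H x := (S.exists_extension x v).choose

/-- The Levi form `ξ([J X, X])` at `x`, where `X` is a section of `H` near `x` that extends `v`. For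
a characteristic conormal `ξ` the value does not depend on the extension. -/
def leviForm (x : M) (ξ : TangentSpace (𝓡 (2 * n + k)) x →L[ℝ] ℝ) (v : S.H x) : ℝ :=
  ξ (VectorField.mlieBracket (𝓡 (2 * n + k))
    (fun y => (S.J y (S.extension x v y) : TangentSpace (𝓡 (2 * n + k)) y))
    (fun y => (S.extension x v y : TangentSpace (𝓡 (2 * n + k)) y)) x)

/-- The Levi form at `ξ`, a Hermitian form on the `n`-dimensional complex vector space `(H x, J)`, has
`a` negative and `b` positive eigenvalues: this holds for its Hermitian matrix in a complex basis. -/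
def LeviSignature (x : M) (ξ : TangentSpace (𝓡 (2 * n + k)) x →L[ℝ] ℝ) (a b : ℕ) : Prop :=
  ∃ (e : Fin n → S.H x) (A : Matrix (Fin n) (Fin n) ℂ) (hA : A.IsHermitian),
    LinearIndependent ℝ (Sum.elim e fun j => S.J x (e j)) ∧
    (∀ c : Fin n → ℂ, (S.leviForm x ξ (∑ j, ((c j).re • e j + (c j).im • S.J x (e j))) : ℂ) =
      dotProduct (star c) (A.mulVec c)) ∧
    (Finset.univ.filter fun j => hA.eigenvalues j < 0).card = a ∧
    (Finset.univ.filter fun j => 0 < hA.eigenvalues j).card = b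

/-! ### The tangential Cauchy-Riemann complex -/

/-- The forms of degree `m` at `x` that lie in the `p`-th power of the ideal generated by the one-forms
vanishing on `T^{0,1}`; these are the forms that vanish as soon as more than `m - p` of
their arguments are in `T^{0,1}`. -/
def filtration (p m : ℕ) (x : M) :
    Submodule ℂ (CForm (EuclideanSpace ℝ (Fin (2 * n + k))) m x) where
  carrier := {α | ∀ (Z : Fin m → CTangent _ x) (s : Finset (Fin m)), m < p + s.card →
    (∀ j ∈ s, Z j ∈ S.T01 x) → α.complexEval Z = 0}
  zero_mem' := fun Z s _ _ => by simp [CForm.complexEval]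
  add_mem' := fun {α η} hα hη Z s hs hZ => by
    have h₁ := hα Z s hs hZ
    have h₂ := hη Z s hs hZ
    simp only [CForm.complexEval] at h₁ h₂ ⊢
    simp [mul_add, Finset.sum_add_distrib, h₁, h₂]
  smul_mem' := fun c α hα Z s hs hZ => by
    have h₁ := hα Z s hs hZ
    simp only [CForm.complexEval] at h₁ ⊢
    simp [mul_left_comm _ c, ← Finset.mul_sum, h₁]

/-- The smooth form `α` on `U` is a section of the `p`-th step of the filtration. -/
def InFiltration (p : ℕ) {m : ℕ} {U : Opens M}
    (α : SmoothForm (EuclideanSpace ℝ (Fin (2 * n + k))) m U) : Prop :=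
  ∀ x ∈ U, α.field x ∈ S.filtration p m x

/-- A smooth `(p,q)`-form on `U` is a class in `F^p Ω^{p+q}(U) / F^{p+1} Ω^{p+q}(U)`, where `F` is the
filtration above, and `∂̄_M` is induced by the exterior derivative. This is the space of the
representatives `α ∈ F^p Ω^{p+q}(U)` of the `∂̄_M`-closed `(p,q)`-forms. -/
def cocycles (p q : ℕ) (U : Opens M) :
    Submodule ℂ (SmoothForm (EuclideanSpace ℝ (Fin (2 * n + k))) (p + q) U) where
  carrier := {α | S.InFiltration p α ∧
    ∀ x ∈ U, mextDeriv α.field x ∈ S.filtration (p + 1) (p + q + 1) x}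
  zero_mem' := ⟨fun x _ => by rw [map_zero]; exact zero_mem _, fun x hx => by
    rw [SmoothForm.mextDeriv_zero hx]; exact zero_mem _⟩
  add_mem' := fun {α η} hα hη => ⟨fun x hx => by
    rw [map_add]; exact add_mem (hα.1 x hx) (hη.1 x hx), fun x hx => by
    rw [SmoothForm.mextDeriv_add α η hx]; exact add_mem (hα.2 x hx) (hη.2 x hx)⟩
  smul_mem' := fun c α hα => ⟨fun x hx => by
    rw [map_smul]; exact Submodule.smul_mem _ c (hα.1 x hx), fun x hx => by
    rw [SmoothForm.mextDeriv_smul c α hx]; exact Submodule.smul_mem _ c (hα.2 x hx)⟩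

/-- `α` represents a `∂̄_M`-exact `(p,q)`-form on `U`: for `q = 0` this means that it represents zero,
and otherwise that `α - dη ∈ F^{p+1}` for some `η ∈ F^p Ω^{p+q-1}(U)`. -/
def IsExact (p : ℕ) : ∀ (q : ℕ) {U : Opens M},
    SmoothForm (EuclideanSpace ℝ (Fin (2 * n + k))) (p + q) U → Prop
  | 0, _, α => S.InFiltration (p + 1) α
  | q + 1, U, α => ∃ η : SmoothForm (EuclideanSpace ℝ (Fin (2 * n + k))) (p + q) U,
      S.InFiltration p η ∧
      ∀ x ∈ U, α.field x - mextDeriv η.field x ∈ S.filtration (p + 1) (p + q + 1) x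

/-- The representatives of the exact `(p,q)`-forms on `U`. -/
def coboundaries (p q : ℕ) (U : Opens M) : Submodule ℂ (S.cocycles p q U) where
  carrier := {α | S.IsExact p q α.1}
  zero_mem' := by
    cases q with
    | zero => exact fun x _ => zero_mem _
    | succ q =>
      refine ⟨0, fun x _ => zero_mem _, fun x hx => ?_⟩
      rw [SmoothForm.mextDeriv_zero hx, sub_zero]; exact zero_mem _
  add_mem' := fun {α α'} h h' => by
    cases q with
    | zero => exact fun x hx => add_mem (h x hx) (h' x hx)
    | succ q =>
      obtain ⟨η, h₁, h₂⟩ := h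
      obtain ⟨η', h₁', h₂'⟩ := h'
      refine ⟨η + η', fun x hx => add_mem (h₁ x hx) (h₁' x hx), fun x hx => ?_⟩
      have := add_mem (h₂ x hx) (h₂' x hx)
      rw [sub_add_sub_comm] at this
      rw [SmoothForm.mextDeriv_add η η' hx]
      exact this
  smul_mem' := fun c α h => by
    cases q with
    | zero => exact fun x hx => Submodule.smul_mem _ c (h x hx)
    | succ q =>
      obtain ⟨η, h₁, h₂⟩ := h
      refine ⟨c • η, fun x hx => Submodule.smul_mem _ c (h₁ x hx), fun x hx => ?_⟩
      have := Submodule.smul_mem _ c (h₂ x hx)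
      rw [smul_sub] at this
      rw [SmoothForm.mextDeriv_smul c η hx]
      exact this

/-- The cohomology group `H^{p,q}(U)` of `∂̄_M` on smooth forms, with its quotient topology. -/
abbrev Cohomology (p q : ℕ) (U : Opens M) : Type _ := S.cocycles p q U ⧸ S.coboundaries p q U

variable {S} in
lemma InFiltration.restrict {p m : ℕ} {U V : Opens M} (h : V ≤ U)
    {α : SmoothForm (EuclideanSpace ℝ (Fin (2 * n + k))) m U} (hα : S.InFiltration p α) :
    S.InFiltration p (SmoothForm.restrict h α) := fun x hx => by
  rw [SmoothForm.restrict_field, restrictField_apply _ hx]; exact hα x (h hx)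

variable {S} in
lemma IsExact.restrict {p q : ℕ} {U V : Opens M} (h : V ≤ U)
    {α : SmoothForm (EuclideanSpace ℝ (Fin (2 * n + k))) (p + q) U} (hα : S.IsExact p q α) :
    S.IsExact p q (SmoothForm.restrict h α) := by
  cases q with
  | zero => exact InFiltration.restrict (S := S) (p := p + 1) h hα
  | succ q =>
    obtain ⟨η, h₁, h₂⟩ := hα
    refine ⟨SmoothForm.restrict h η, h₁.restrict h, fun x hx => ?_⟩
    rw [SmoothForm.restrict_field, SmoothForm.restrict_field, mextDeriv_restrictField _ hx,
      restrictField_apply _ hx]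
    exact h₂ x (h hx)

/-- Restriction of closed forms. -/
def restrictCocycles (p q : ℕ) {U V : Opens M} (h : V ≤ U) :
    S.cocycles p q U →ₗ[ℂ] S.cocycles p q V :=
  (SmoothForm.restrict h).restrict fun _ hα => ⟨hα.1.restrict h, fun x hx => by
    rw [SmoothForm.restrict_field, mextDeriv_restrictField _ hx]
    exact hα.2 x (h hx)⟩

/-- The restriction map `H^{p,q}(U) → H^{p,q}(V)` for `V ⊆ U`. -/
def restrictCohomology (p q : ℕ) {U V : Opens M} (h : V ≤ U) :
    S.Cohomology p q U →ₗ[ℂ] S.Cohomology p q V :=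
  Submodule.mapQ _ _ (S.restrictCocycles p q h) fun _ hα => IsExact.restrict h hα

open Classical in
/-- The local cohomology group `H^{p,q}((x)) = lim H^{p,q}(U)`, the direct limit over the open
neighborhoods `U` of `x`, ordered by reverse inclusion. -/
def LocalCohomology (p q : ℕ) (x : M) : Type _ :=
  Module.DirectLimit (R := ℂ) (ι := (OpenNhdsOf x)ᵒᵈ)
    (fun U => S.Cohomology p q (OrderDual.ofDual U).toOpens)
    (fun _ _ h => S.restrictCohomology p q h)

open Classical in
instance (p q : ℕ) (x : M) : AddCommGroup (S.LocalCohomology p q x) :=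
  inferInstanceAs (AddCommGroup (Module.DirectLimit (R := ℂ) (ι := (OpenNhdsOf x)ᵒᵈ)
    (fun U => S.Cohomology p q (OrderDual.ofDual U).toOpens)
    (fun _ _ h => S.restrictCohomology p q h)))

open Classical in
instance (p q : ℕ) (x : M) : Module ℂ (S.LocalCohomology p q x) :=
  inferInstanceAs (Module ℂ (Module.DirectLimit (R := ℂ) (ι := (OpenNhdsOf x)ᵒᵈ)
    (fun U => S.Cohomology p q (OrderDual.ofDual U).toOpens)
    (fun _ _ h => S.restrictCohomology p q h)))

open Classical in
/-- The canonical map `H^{p,q}(U) → H^{p,q}((x))`. -/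
def toLocalCohomology (p q : ℕ) {x : M} (U : OpenNhdsOf x) :
    S.Cohomology p q U.toOpens →ₗ[ℂ] S.LocalCohomology p q x :=
  Module.DirectLimit.of ℂ (OpenNhdsOf x)ᵒᵈ
    (fun U => S.Cohomology p q (OrderDual.ofDual U).toOpens)
    (fun _ _ h => S.restrictCohomology p q h) (OrderDual.toDual U)

/-- The inductive limit topology: the finest topology for which the canonical maps
`H^{p,q}(U) → H^{p,q}((x))` are continuous. -/
instance (p q : ℕ) (x : M) : TopologicalSpace (S.LocalCohomology p q x) :=
  ⨆ U : OpenNhdsOf x, TopologicalSpace.coinduced (S.toLocalCohomology p q U) inferInstance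

/-- The Poincaré lemma for `∂̄_M` is valid at `x` at bidegree `(p,q)`: the sequence of germs of smooth
forms of bidegrees `(p,q-1)`, `(p,q)`, `(p,q+1)` is exact, that is, every `∂̄_M`-closed
`(p,q)`-form on a neighborhood of `x` is `∂̄_M`-exact on some smaller neighborhood. -/
def PoincareLemma (p q : ℕ) (x : M) : Prop :=
  ∀ U : OpenNhdsOf x, ∀ α ∈ S.cocycles p q U.toOpens,
    ∃ (V : OpenNhdsOf x) (h : V.toOpens ≤ U.toOpens), S.IsExact p q (SmoothForm.restrict h α)

end CRStructure

end

/-! The proof is by contradiction: assume that the local group in degree q is finite dimensional and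
that the one in degree q+1 is Hausdorff. High-frequency forms that are almost closed are tested
against functionals that almost annihilate exact forms.

Near `p₀` the structure is described by a commuting frame `L j` of T^{0,1}, dual to constant
covectors, in complex linear coordinates: conjugate coordinates c_j, their conjugates, and real t_i
(`exists_localModel`). The Levi form becomes diagonal with nonzero entries λ_j, of which exactly q
are negative. There is a phase W, the sum of iξ and a quadratic function, with L_j W = O(|x|²) for
all j and Re W = -∑ λ_j |c_j|² (`LocalCR.flat_W`, `LocalCR.re_W`). Subtract from W a large multiple
of the |c_j|² with λ_j < 0 and of the t_i², and from -W the same multiple of the |c_j|² with λ_j > 0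
and of the t_i². The resulting phases φ, ψ have negative definite real part. To second order, φ is
annihilated by the L_j with λ_j > 0 and ψ by those with λ_j < 0. Since the frame is involutive,
`Coords.formal_solve` improves this to any finite order without changing the quadratic parts.

The approximate cocycle f_a is exp(σ²(a+1)φ) times a cut-off times θ_1 ∧ … ∧ θ_p ∧ ⋀ dc_j, the last
product over all j with λ_j < 0. In ∂̄f_a only the L_j φ with λ_j > 0 survive, so ∂̄f_a has a
representative g_a that is smaller than any prescribed negative power of σ (`Stage.extDeriv_f_sub`,
`Stage.g_bound`). The functional T_b integrates the value of a form on p normal fields and on the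
L_j with λ_j < 0 against a weight exp(σ²(b+1)ψ + β). These L_j have transposes that almost
annihilate the weight, hence T_b is almost zero on exact forms (`Stage.T_exact`). The phase (a+1)φ +
(b+1)ψ is i(a-b)ξ plus a negative definite quadratic part plus a cubic error. After rescaling by σ,
the pairing of T_b with f_a tends to a nonzero Gaussian integral if a = b, and to zero by the
Riemann-Lebesgue lemma if a ≠ b (`Stage.tendsto_T_f`). So for every ν there are ν approximate
cocycles and ν almost dual functionals, governed by a large parameter Λ
(`LocalCR.exists_testFamily`).

The rest is functional analysis. The Hausdorff property makes limits of exact germs exact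
(`closedExact_of_t2Space`). Take a sequence of test families with Λ_s growing geometrically.
Superpositions of the weighted forms g with arbitrary bounded coefficients are limits of exact
forms, hence exact, and Baire's theorem gives primitives on one fixed ball with uniform bounds
(`exists_uniform_primitive`). Subtracting small primitives turns the f into genuine cocycles on a
fixed ball (`exists_corrections`). If N classes span the group in degree q, take ν = N + 1; some
normalised combination of the ν functionals annihilates all N generators. Evaluated on a
superposition of the cocycles and scaled by Λ_s³, these combinations stay bounded, since only an
exact form is left. By Banach-Steinhaus they are uniformly bounded; yet on a single corrected
cocycle of the s-th family their size is at least Λ_s / 2 for large s, a contradiction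
(`LocalCR.false_of_closedExact_of_finiteCohomology`).

Replacing ξ by -ξ exchanges q and n - q. The Poincaré lemma makes the local cohomology zero, which
is finite dimensional and Hausdorff; this yields the statements about germs. -/

open MeasureTheory
open scoped ComplexConjugate BoundedContinuousFunction

noncomputable section

namespace CRLocal

/-! ### Complexified vectors, covectors and forms -/

/-- The real model space. -/
abbrev RV (d : ℕ) : Type := EuclideanSpace ℝ (Fin d)

/-- The complexified model space. -/
abbrev CV (d : ℕ) : Type := Fin d → ℂ

/-- Complex valued alternating forms on the real model space. -/
abbrev Alt (d m : ℕ) : Type := (RV d) [⋀^Fin m]→L[ℝ] ℂ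

variable {d : ℕ}

/-- The standard basis vectors. -/
def ev (r : Fin d) : RV d := EuclideanSpace.single r 1

lemma sum_ev (v : RV d) : v = ∑ r, v r • ev r := by
  ext i
  simp [ev, Pi.single_apply]

/-- Complex linear extension of a real linear functional. -/
def cext (l : RV d →L[ℝ] ℂ) : CV d →L[ℂ] ℂ :=
  ∑ r, l (ev r) • (ContinuousLinearMap.proj r : CV d →L[ℂ] ℂ)

lemma cext_apply (l : RV d →L[ℝ] ℂ) (Z : CV d) : cext l Z = ∑ r, Z r * l (ev r) := by
  simp [cext, mul_comm]

/-- The inclusion of real vectors in complex vectors. -/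
def incl (v : RV d) : CV d := fun r => (v r : ℂ)

lemma cext_incl (l : RV d →L[ℝ] ℂ) (v : RV d) : cext l (incl v) = l v := by
  conv_rhs => rw [sum_ev v]
  rw [cext_apply, map_sum]
  exact Finset.sum_congr rfl fun r _ => by simp [incl]

lemma cext_add (l l' : RV d →L[ℝ] ℂ) (Z : CV d) : cext (l + l') Z = cext l Z + cext l' Z := by
  simp [cext_apply, mul_add, Finset.sum_add_distrib]

lemma cext_smul (c : ℂ) (l : RV d →L[ℝ] ℂ) (Z : CV d) : cext (c • l) Z = c * cext l Z := by
  simp only [cext_apply, Finset.mul_sum]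
  exact Finset.sum_congr rfl fun r _ => by simp; ring

lemma cext_sub (l l' : RV d →L[ℝ] ℂ) (Z : CV d) : cext (l - l') Z = cext l Z - cext l' Z := by
  simp [cext_apply, mul_sub, Finset.sum_sub_distrib]

lemma cext_zero (Z : CV d) : cext (0 : RV d →L[ℝ] ℂ) Z = 0 := by simp [cext_apply]

lemma cext_sum {ι : Type*} (s : Finset ι) (l : ι → RV d →L[ℝ] ℂ) (Z : CV d) :
    cext (∑ i ∈ s, l i) Z = ∑ i ∈ s, cext (l i) Z := by
  classical
  induction s using Finset.induction_on with
  | empty => simp [cext_zero]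
  | insert a s ha ih => rw [Finset.sum_insert ha, Finset.sum_insert ha, cext_add, ih]

/-- The derivative of a complex valued function along a complex vector. -/
def dC (Z : CV d) (g : RV d → ℂ) (x : RV d) : ℂ := cext (fderiv ℝ g x) Z

/-- The componentwise derivative of a complex vector field along a complex vector. -/
def dV (Z : CV d) (W : RV d → CV d) (x : RV d) : CV d := fun r => dC Z (fun y => W y r) x

/-- The bracket of complex vector fields. -/
def brC (Z W : RV d → CV d) (x : RV d) : CV d := dV (Z x) W x - dV (W x) Z x

lemma dC_eq_sum (Z : CV d) (g : RV d → ℂ) (x : RV d) :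
    dC Z g x = ∑ r, Z r * fderiv ℝ g x (ev r) := cext_apply _ _

/-- The complex multilinear extension of a form. -/
def altC {m : ℕ} (α : Alt d m) : (CV d) [⋀^Fin m]→L[ℂ] ℂ where
  toFun Z := ∑ r : Fin m → Fin d, (∏ j, Z j (r j)) * α (fun j => ev (r j))
  map_update_add' := by
    intro _ Z i x y
    rw [← Finset.sum_add_distrib]
    refine Finset.sum_congr rfl fun r _ => ?_
    rw [← add_mul]
    congr 1
    have h : ∀ w : CV d, ∏ j, Function.update Z i w j (r j)
        = w (r i) * ∏ j ∈ Finset.univ.erase i, Z j (r j) := by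
      intro w
      rw [← Finset.mul_prod_erase _ _ (Finset.mem_univ i)]
      congr 1
      · simp
      · exact Finset.prod_congr rfl fun j hj => by
          rw [Function.update_of_ne (Finset.ne_of_mem_erase hj)]
    convert (by rw [h, h, h, Pi.add_apply, add_mul] :
      ∏ j, Function.update Z i (x + y) j (r j) = ∏ j, Function.update Z i x j (r j) +
        ∏ j, Function.update Z i y j (r j))
  map_update_smul' := by
    intro _ Z i c x
    rw [smul_eq_mul, Finset.mul_sum]
    refine Finset.sum_congr rfl fun r _ => ?_
    rw [← mul_assoc]
    congr 1
    have h : ∀ w : CV d, ∏ j, Function.update Z i w j (r j)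
        = w (r i) * ∏ j ∈ Finset.univ.erase i, Z j (r j) := by
      intro w
      rw [← Finset.mul_prod_erase _ _ (Finset.mem_univ i)]
      congr 1
      · simp
      · exact Finset.prod_congr rfl fun j hj => by
          rw [Function.update_of_ne (Finset.ne_of_mem_erase hj)]
    convert (by rw [h, h, Pi.smul_apply, smul_eq_mul, mul_assoc] :
      ∏ j, Function.update Z i (c • x) j (r j) = c * ∏ j, Function.update Z i x j (r j))
  cont := by fun_prop
  map_eq_zero_of_eq' := by
    intro Z i j hZ hij
    -- The index tuples `r` and `r ∘ swap i j` cancel: the product of coordinates is unchanged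
    -- because `Z i = Z j`, while `α` changes sign. A fixed tuple contributes zero by itself.
    refine Finset.sum_involution (fun r _ => r ∘ Equiv.swap i j) ?_ ?_ (by simp) ?_
    · intro r _
      have h1 : ∏ l, Z l ((r ∘ Equiv.swap i j) l) = ∏ l, Z l (r l) := by
        rw [← Equiv.prod_comp (Equiv.swap i j) (fun l => Z l (r l))]
        refine Finset.prod_congr rfl fun l _ => ?_
        have : Z (Equiv.swap i j l) = Z l := by
          by_cases h : l = i
          · subst h; rw [Equiv.swap_apply_left]; exact hZ.symm
          · by_cases h' : l = j
            · subst h'; rw [Equiv.swap_apply_right]; exact hZ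
            · rw [Equiv.swap_apply_of_ne_of_ne h h']
        simp [this]
      have h2 : α (fun l => ev ((r ∘ Equiv.swap i j) l)) = - α (fun l => ev (r l)) :=
        α.toAlternatingMap.map_swap (fun l => ev (r l)) hij
      rw [h1, h2]; ring
    · intro r _ hr heq
      apply hr
      have : r i = r j := by
        have := congrFun heq j
        simpa using this
      have h0 : α (fun l => ev (r l)) = 0 :=
        α.map_eq_zero_of_eq _ (by simp [this]) hij
      simp [h0]
    · intro r _
      funext l
      simp

lemma altC_apply {m : ℕ} (α : Alt d m) (Z : Fin m → CV d) :
    altC α Z = ∑ r : Fin m → Fin d, (∏ j, Z j (r j)) * α (fun j => ev (r j)) := rfl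

lemma altC_add {m : ℕ} (α β : Alt d m) : altC (α + β) = altC α + altC β := by
  ext Z
  simp [altC_apply, mul_add, Finset.sum_add_distrib]

lemma altC_smul {m : ℕ} (c : ℂ) (α : Alt d m) : altC (c • α) = c • altC α := by
  ext Z
  simp only [altC_apply, ContinuousAlternatingMap.smul_apply, smul_eq_mul, Finset.mul_sum]
  exact Finset.sum_congr rfl fun r _ => by ring

lemma altC_zero {m : ℕ} : altC (0 : Alt d m) = 0 := by
  ext Z; simp [altC_apply]

/-- The form evaluated on a real family. -/
lemma altC_incl {m : ℕ} (α : Alt d m) (v : Fin m → RV d) :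
    altC α (fun j => incl (v j)) = α v := by
  have h : α v = α (fun j => ∑ r, v j r • ev r) := by
    congr 1; funext j; exact sum_ev (v j)
  rw [h, altC_apply]
  have := α.toMultilinearMap.map_sum (fun j (r : Fin d) => v j r • ev r)
  have h2 : α (fun j => ∑ r, v j r • ev r) =
      ∑ r : Fin m → Fin d, α (fun j => v j (r j) • ev (r j)) := this
  rw [h2]
  refine Finset.sum_congr rfl fun r _ => ?_
  have h3 := α.toMultilinearMap.map_smul_univ (fun j => v j (r j)) (fun j => ev (r j))
  have h4 : α (fun j => v j (r j) • ev (r j)) = (∏ j, v j (r j)) • α (fun j => ev (r j)) := h3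
  rw [h4]
  simp [incl]

/-- The real and imaginary parts of a complex vector. -/
def reV (Z : CV d) : RV d := WithLp.toLp 2 fun r => (Z r).re
def imV (Z : CV d) : RV d := WithLp.toLp 2 fun r => (Z r).im

/-- The complex vector `X + iY`. -/
def mkC (X Y : RV d) : CV d := fun r => (X r : ℂ) + Complex.I * (Y r : ℂ)

/-- Connects the extension by coordinates with the expansion over subsets of imaginary slots that
defines `CForm.complexEval`. -/
lemma altC_mkC {m : ℕ} (α : Alt d m) (X Y : Fin m → RV d) :
    altC α (fun j => mkC (X j) (Y j)) =
      ∑ s : Finset (Fin m), Complex.I ^ s.card * α (fun j => if j ∈ s then Y j else X j) := by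
  have key : ∀ s : Finset (Fin m), α (fun j => if j ∈ s then Y j else X j) =
      ∑ r : Fin m → Fin d, ((∏ j ∈ s, (Y j (r j) : ℂ)) * ∏ j ∈ Finset.univ \ s, (X j (r j) : ℂ)) *
        α (fun j => ev (r j)) := by
    intro s
    rw [← altC_incl, altC_apply]
    refine Finset.sum_congr rfl fun r _ => ?_
    congr 1
    rw [← Finset.prod_sdiff (Finset.subset_univ s), mul_comm]
    congr 1
    · exact Finset.prod_congr rfl fun j hj => by simp [hj, incl]
    · refine Finset.prod_congr rfl fun j hj => ?_
      have : j ∉ s := by simpa using hj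
      simp [this, incl]
  simp_rw [key, Finset.mul_sum]
  rw [Finset.sum_comm, altC_apply]
  refine Finset.sum_congr rfl fun r _ => ?_
  simp_rw [← mul_assoc]
  rw [← Finset.sum_mul]
  congr 1
  simp only [mkC]
  simp_rw [add_comm (Complex.ofReal _)]
  rw [Finset.prod_add]
  refine Finset.sum_congr (by simp) fun s _ => ?_
  rw [Finset.prod_mul_distrib, Finset.prod_const]

lemma cext_mkC (l : RV d →L[ℝ] ℂ) (X Y : RV d) : cext l (mkC X Y) = l X + Complex.I * l Y := by
  have : mkC X Y = incl X + Complex.I • incl Y := by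
    funext r; simp [mkC, incl]
  rw [this, map_add, map_smul, cext_incl, cext_incl, smul_eq_mul]

/-- The derivative of a field of forms along a complex vector. -/
def dA {m : ℕ} (Z : CV d) (F : RV d → Alt d m) (x : RV d) : Alt d m :=
  ∑ s, Z s • fderiv ℝ F x (ev s)

/-- The formula for constant arguments. It is complex multilinear in `Z`, so it reduces to tuples of
basis vectors, where it is the definition of the exterior derivative. -/
lemma altC_extDeriv {m : ℕ} {F : RV d → Alt d m} {x : RV d} (hF : DifferentiableAt ℝ F x)
    (Z : Fin (m + 1) → CV d) :
    altC (extDeriv F x) Z = ∑ i : Fin (m + 1), (-1 : ℂ) ^ (i : ℕ) * altC (dA (Z i) F x) (i.removeNth Z) := by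
  rw [altC_apply]
  have h : ∀ r : Fin (m + 1) → Fin d, extDeriv F x (fun j => ev (r j)) =
      ∑ i : Fin (m + 1), (-1 : ℂ) ^ (i : ℕ) * fderiv ℝ F x (ev (r i)) (fun j => ev (i.removeNth r j)) := by
    intro r
    rw [extDeriv_apply hF]
    refine Finset.sum_congr rfl fun i _ => ?_
    have hd : fderiv ℝ (fun y => F y (i.removeNth fun j => ev (r j))) x (ev (r i)) =
        fderiv ℝ F x (ev (r i)) (i.removeNth fun j => ev (r j)) :=
      fderiv_continuousAlternatingMap_apply_const_apply hF _ _
    rw [hd]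
    rw [zsmul_eq_mul]
    push_cast
    rfl
  simp_rw [h, Finset.mul_sum]
  rw [Finset.sum_comm]
  refine Finset.sum_congr rfl fun i _ => ?_
  -- An index tuple splits into its `i`-th entry and the rest; the sum over the `i`-th entry
  -- assembles the derivative along `Z i`.
  rw [altC_apply, ← (Fin.insertNthEquiv (fun _ => Fin d) i).sum_comp, Fintype.sum_prod_type,
    Finset.sum_comm, Finset.mul_sum]
  refine Finset.sum_congr rfl fun r' _ => ?_
  simp only [dA]
  rw [show (∑ s, Z i s • fderiv ℝ F x (ev s)) (fun j => ev (r' j)) =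
    ∑ s, Z i s * fderiv ℝ F x (ev s) (fun j => ev (r' j)) by
      rw [ContinuousAlternatingMap.sum_apply]; rfl]
  rw [Finset.mul_sum, Finset.mul_sum]
  refine Finset.sum_congr rfl fun s _ => ?_
  rw [Fin.prod_univ_succAbove _ i]
  simp only [Fin.insertNthEquiv_apply, Fin.insertNth_apply_same, Fin.insertNth_apply_succAbove, Fin.removeNth]
  ring

variable {d : ℕ}

/-! ### The derivative along complex vectors is a derivation -/

lemma dC_add {f g : RV d → ℂ} {x : RV d} (Z : CV d) (hf : DifferentiableAt ℝ f x)
    (hg : DifferentiableAt ℝ g x) : dC Z (fun y => f y + g y) x = dC Z f x + dC Z g x := by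
  simp only [dC]
  rw [fderiv_fun_add hf hg, cext_add]

lemma dC_sub {f g : RV d → ℂ} {x : RV d} (Z : CV d) (hf : DifferentiableAt ℝ f x)
    (hg : DifferentiableAt ℝ g x) : dC Z (fun y => f y - g y) x = dC Z f x - dC Z g x := by
  simp only [dC]
  rw [fderiv_fun_sub hf hg, cext_sub]

lemma dC_mul {f g : RV d → ℂ} {x : RV d} (Z : CV d) (hf : DifferentiableAt ℝ f x)
    (hg : DifferentiableAt ℝ g x) :
    dC Z (fun y => f y * g y) x = f x * dC Z g x + dC Z f x * g x := by
  simp only [dC]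
  rw [fderiv_fun_mul hf hg, cext_add, cext_smul, cext_smul]
  ring

lemma dC_const (Z : CV d) (c : ℂ) (x : RV d) : dC Z (fun _ => c) x = 0 := by
  simp [dC, cext_zero]

lemma dC_const_mul {g : RV d → ℂ} {x : RV d} (Z : CV d) (c : ℂ) (hg : DifferentiableAt ℝ g x) :
    dC Z (fun y => c * g y) x = c * dC Z g x := by
  rw [dC_mul Z (differentiableAt_const c) hg, dC_const]; ring

lemma dC_sum {ι : Type*} (s : Finset ι) {f : ι → RV d → ℂ} {x : RV d} (Z : CV d)
    (hf : ∀ i ∈ s, DifferentiableAt ℝ (f i) x) :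
    dC Z (fun y => ∑ i ∈ s, f i y) x = ∑ i ∈ s, dC Z (f i) x := by
  simp only [dC]
  rw [fderiv_fun_sum hf, cext_sum]

lemma dC_prod {ι : Type*} [DecidableEq ι] (s : Finset ι) {f : ι → RV d → ℂ} {x : RV d} (Z : CV d)
    (hf : ∀ i ∈ s, DifferentiableAt ℝ (f i) x) :
    dC Z (fun y => ∏ i ∈ s, f i y) x = ∑ i ∈ s, (∏ j ∈ s.erase i, f j x) * dC Z (f i) x := by
  simp only [dC]
  rw [HasFDerivAt.fderiv (HasFDerivAt.finsetProd fun i hi => (hf i hi).hasFDerivAt), cext_sum]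
  exact Finset.sum_congr rfl fun i _ => cext_smul _ _ _

lemma dC_congr {f g : RV d → ℂ} {x : RV d} (Z : CV d) (h : f =ᶠ[𝓝 x] g) : dC Z f x = dC Z g x := by
  simp only [dC]; rw [h.fderiv_eq]

lemma altC_update {m : ℕ} (α : Alt d m) (W : Fin m → CV d) (j : Fin m) (V : CV d) :
    altC α (Function.update W j V) = ∑ r : Fin m → Fin d,
      ((∏ i ∈ Finset.univ.erase j, W i (r i)) * V (r j)) * α (fun j => ev (r j)) := by
  rw [altC_apply]
  refine Finset.sum_congr rfl fun r _ => ?_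
  congr 1
  rw [← Finset.prod_erase_mul _ _ (Finset.mem_univ j)]
  congr 1
  · exact Finset.prod_congr rfl fun i hi => by
      rw [Function.update_of_ne (Finset.ne_of_mem_erase hi)]
  · simp

lemma differentiableAt_altC_apply {m : ℕ} {F : RV d → Alt d m} {x : RV d}
    (hF : DifferentiableAt ℝ F x) (v : Fin m → RV d) : DifferentiableAt ℝ (fun y => F y v) x :=
  hF.continuousAlternatingMap_apply_const v

/-- The Leibniz rule, needed with real base variables and complex vector fields in order to match
Cartan's formula for complex affine data. -/
lemma dC_altC {m : ℕ} {F : RV d → Alt d m} {W : Fin m → RV d → CV d} {x : RV d}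
    (hF : DifferentiableAt ℝ F x) (hW : ∀ i, DifferentiableAt ℝ (W i) x) (Z : CV d) :
    dC Z (fun y => altC (F y) (fun j => W j y)) x =
      altC (dA Z F x) (fun j => W j x) +
        ∑ j, altC (F x) (Function.update (fun j => W j x) j (dV Z (W j) x)) := by
  have hWc : ∀ i r, DifferentiableAt ℝ (fun y => W i y r) x := fun i r =>
    differentiableAt_pi.1 (hW i) r
  have hprod : ∀ r : Fin m → Fin d, DifferentiableAt ℝ (fun y => ∏ j, W j y (r j)) x := fun r =>
    (HasFDerivAt.finsetProd (u := Finset.univ)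
      fun i _ => (hWc i (r i)).hasFDerivAt).differentiableAt
  have hFr : ∀ v : Fin m → RV d, DifferentiableAt ℝ (fun y => F y v) x := fun v =>
    differentiableAt_altC_apply hF v
  simp only [altC_update]
  have hl : (fun y => altC (F y) (fun j => W j y)) =
      fun y => ∑ r : Fin m → Fin d, (∏ j, W j y (r j)) * F y (fun j => ev (r j)) := rfl
  rw [hl, dC_sum _ _ fun r _ => (hprod r).fun_mul (hFr _)]
  rw [Finset.sum_comm, altC_apply, ← Finset.sum_add_distrib]
  refine Finset.sum_congr rfl fun r _ => ?_
  rw [dC_mul Z (hprod r) (hFr _), dC_prod _ _ fun i _ => hWc i (r i), Finset.sum_mul]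
  congr 1
  congr 1
  rw [dC_eq_sum, dA, ContinuousAlternatingMap.sum_apply]
  refine Finset.sum_congr rfl fun s _ => ?_
  rw [fderiv_continuousAlternatingMap_apply_const_apply hF]
  rfl

/-- Cartan's formula for the exterior derivative, evaluated on complex vector fields. -/
theorem altC_extDeriv_fields {m : ℕ} {F : RV d → Alt d (m + 1)} {Z : Fin (m + 2) → RV d → CV d}
    {x : RV d} (hF : DifferentiableAt ℝ F x) (hZ : ∀ i, DifferentiableAt ℝ (Z i) x) :
    altC (extDeriv F x) (fun i => Z i x) =
      (∑ i : Fin (m + 2), (-1 : ℂ) ^ (i : ℕ) *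
        dC (Z i x) (fun y => altC (F y) (i.removeNth fun l => Z l y)) x) -
      ∑ i : Fin (m + 1), ∑ j ≥ i, (-1 : ℂ) ^ (i + j : ℕ) *
        altC (F x) (Matrix.vecCons (brC (Z i.castSucc) (Z j.succ) x)
          (j.removeNth (i.castSucc.removeNth fun l => Z l x))) := by
  -- Both sides depend only on the 1-jets of `F` and of the fields at `x`. These are replaced by
  -- complex affine data `Ft`, `Zt` on the complexified space with the same 1-jets, placed at the
  -- origin; for them Cartan's formula holds over the complex field.
  set G : CV d →L[ℂ] ((CV d) [⋀^Fin (m + 1)]→L[ℂ] ℂ) :=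
    ∑ s, (ContinuousLinearMap.proj s : CV d →L[ℂ] ℂ).smulRight (altC (fderiv ℝ F x (ev s))) with hG
  have hGZ : ∀ V : CV d, G V = altC (dA V F x) := by
    intro V
    simp only [hG, sum_apply, ContinuousLinearMap.smulRight_apply,
      ContinuousLinearMap.proj_apply, dA]
    ext Y
    rw [ContinuousAlternatingMap.sum_apply]
    simp only [altC_apply, ContinuousAlternatingMap.sum_apply, ContinuousAlternatingMap.smul_apply,
      smul_eq_mul, Finset.mul_sum]
    rw [Finset.sum_comm]
    exact Finset.sum_congr rfl fun r _ => Finset.sum_congr rfl fun s _ => by ring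
  set Hd : Fin (m + 2) → CV d →L[ℂ] CV d := fun i =>
    ContinuousLinearMap.pi fun r => cext (fderiv ℝ (fun y => Z i y r) x) with hHd
  have hHdZ : ∀ i V, Hd i V = dV V (Z i) x := fun i V => rfl
  set Ft : CV d → (CV d) [⋀^Fin (m + 1)]→L[ℂ] ℂ := fun w => altC (F x) + G w with hFt
  set Zt : Fin (m + 2) → CV d → CV d := fun i w => Z i x + Hd i w with hZt
  have hFtd : HasFDerivAt Ft G 0 := G.hasFDerivAt.const_add _
  have hZtd : ∀ i, HasFDerivAt (Zt i) (Hd i) 0 := fun i => (Hd i).hasFDerivAt.const_add _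
  have hZt0 : ∀ i, Zt i 0 = Z i x := fun i => by simp [hZt]
  have hFt0 : Ft 0 = altC (F x) := by simp [hFt]
  have main := extDeriv_apply_vectorField (V := Zt) (x := 0)
    hFtd.differentiableAt (fun i => (hZtd i).differentiableAt)
  have e1 : extDeriv Ft 0 (fun i => Zt i 0) = altC (extDeriv F x) (fun i => Z i x) := by
    rw [altC_extDeriv hF, extDeriv_apply hFtd.differentiableAt]
    refine Finset.sum_congr rfl fun i _ => ?_
    rw [fderiv_continuousAlternatingMap_apply_const_apply hFtd.differentiableAt, hFtd.fderiv, hZt0,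
      hGZ, zsmul_eq_mul]
    push_cast
    congr 2
    funext l
    exact hZt0 _
  rw [← e1, main]
  congr 1
  · refine Finset.sum_congr rfl fun i _ => ?_
    rw [zsmul_eq_mul]
    push_cast
    congr 1
    have h1 := fderiv_continuousAlternatingMap_apply_apply (𝕜 := ℂ) (f := Ft) (x := 0)
      (g := fun (l : Fin (m + 1)) w => Zt (i.succAbove l) w) hFtd.differentiableAt
      (fun l => (hZtd (i.succAbove l)).differentiableAt) (Zt i 0)
    have h2 := dC_altC (F := F) (W := fun l y => Z (i.succAbove l) y) (x := x) hF
      (fun l => hZ (i.succAbove l)) (Z i x)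
    refine Eq.trans h1 (Eq.trans ?_ h2.symm)
    simp only [hFtd.fderiv, (hZtd _).fderiv, hZt0, hFt0, hGZ, hHdZ]
  · refine Finset.sum_congr rfl fun i _ => Finset.sum_congr rfl fun j _ => ?_
    rw [zsmul_eq_mul]
    push_cast
    congr 1
    rw [hFt0]
    congr 2
    · rw [VectorField.lieBracket, (hZtd _).fderiv, (hZtd _).fderiv, hZt0, hZt0, hHdZ, hHdZ]
      rfl
    · funext l
      exact hZt0 _

/-- Degree zero is separate: the formula for fields above has a bracket term that needs at least one
slot in the form. -/
lemma altC_extDeriv_zero {F : RV d → Alt d 0} {Z : Fin 1 → CV d}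
    {x : RV d} (hF : DifferentiableAt ℝ F x) :
    altC (extDeriv F x) Z = dC (Z 0) (fun y => altC (F y) ![]) x := by
  rw [altC_extDeriv hF, Fin.sum_univ_one]
  have := dC_altC (F := F) (W := fun (l : Fin 0) _ => l.elim0) (x := x) hF
    (fun l => l.elim0) (Z 0)
  simp only [Finset.univ_eq_empty, Finset.sum_empty, add_zero] at this
  rw [Fin.val_zero, pow_zero, one_mul]
  rw [Subsingleton.elim (Fin.removeNth 0 Z) (fun l : Fin 0 => l.elim0), ← this]
  congr 1

variable {d : ℕ}

/-! ### Functions that are flat of finite order at the origin -/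

lemma two_le_infty : (2 : WithTop ℕ∞) ≤ ∞ := by
  have h : ((2 : ℕ∞) : WithTop ℕ∞) ≤ ((⊤ : ℕ∞) : WithTop ℕ∞) := WithTop.coe_le_coe.2 le_top
  exact h

section Flat

variable {E : Type*} [NormedAddCommGroup E] [NormedSpace ℝ E]
  {F : Type*} [NormedAddCommGroup F] [NormedSpace ℝ F]
  {G : Type*} [NormedAddCommGroup G] [NormedSpace ℝ G]
  {H : Type*} [NormedAddCommGroup H] [NormedSpace ℝ H]

/-- All derivatives of order less than `m` vanish at the origin. -/
def Flat (m : ℕ) (g : E → F) : Prop := ∀ i < m, iteratedFDeriv ℝ i g 0 = 0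

lemma flat_zero (g : E → F) : Flat 0 g := fun i hi => absurd hi (Nat.not_lt_zero i)

lemma Flat.mono {m m' : ℕ} {g : E → F} (h : Flat m g) (hm : m' ≤ m) : Flat m' g :=
  fun i hi => h i (hi.trans_le hm)

/-- The iterated derivatives of `fderiv ℝ g` have the norms of those of `g` one order higher, which
allows induction on the order of flatness. -/
lemma flat_succ_iff {m : ℕ} {g : E → F} : Flat (m + 1) g ↔ g 0 = 0 ∧ Flat m (fderiv ℝ g) := by
  constructor
  · intro h
    refine ⟨?_, fun i hi => ?_⟩
    · have := h 0 (Nat.succ_pos m)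
      have h1 := norm_iteratedFDeriv_zero (𝕜 := ℝ) (f := g) (x := (0 : E))
      rw [this, norm_zero] at h1
      exact norm_eq_zero.1 h1.symm
    · rw [← norm_eq_zero, norm_iteratedFDeriv_fderiv, h (i + 1) (by omega), norm_zero]
  · rintro ⟨h0, h⟩ i hi
    rcases i with _ | i
    · rw [← norm_eq_zero, norm_iteratedFDeriv_zero, h0, norm_zero]
    · rw [← norm_eq_zero, ← norm_iteratedFDeriv_fderiv, h i (by omega), norm_zero]

lemma flat_one_iff {g : E → F} : Flat 1 g ↔ g 0 = 0 := by
  rw [flat_succ_iff]; exact ⟨fun h => h.1, fun h => ⟨h, flat_zero _⟩⟩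

lemma Flat.add {m : ℕ} {f g : E → F} (hf : Flat m f) (hg : Flat m g) (sf : ContDiff ℝ ∞ f)
    (sg : ContDiff ℝ ∞ g) : Flat m (fun x => f x + g x) := fun i hi => by
  have := iteratedFDeriv_add_apply (x := (0 : E)) (i := i) (f := f) (g := g)
    ((sf.of_le (by exact_mod_cast le_top)).contDiffAt)
    ((sg.of_le (by exact_mod_cast le_top)).contDiffAt)
  rw [hf i hi, hg i hi, add_zero] at this
  exact this

lemma Flat.clm {m : ℕ} {f : E → F} (hf : Flat m f) (sf : ContDiff ℝ ∞ f) (L : F →L[ℝ] G) :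
    Flat m (fun x => L (f x)) := fun i hi => by
  have := L.iteratedFDeriv_comp_left (x := (0 : E)) (i := i) (f := f) (n := i)
    ((sf.of_le (by exact_mod_cast le_top)).contDiffAt) le_rfl
  rw [hf i hi] at this
  have h2 : iteratedFDeriv ℝ i (L ∘ f) 0 = 0 := by
    rw [this]; ext; simp
  exact h2

lemma Flat.neg {m : ℕ} {f : E → F} (hf : Flat m f) (sf : ContDiff ℝ ∞ f) :
    Flat m (fun x => - f x) := hf.clm sf (-ContinuousLinearMap.id ℝ F)

lemma Flat.sub {m : ℕ} {f g : E → F} (hf : Flat m f) (hg : Flat m g) (sf : ContDiff ℝ ∞ f)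
    (sg : ContDiff ℝ ∞ g) : Flat m (fun x => f x - g x) := by
  simpa only [sub_eq_add_neg] using hf.add (hg.neg sg) sf sg.neg

lemma Flat.congr {m : ℕ} {f g : E → F} (hf : Flat m f) (h : f =ᶠ[𝓝 0] g) : Flat m g :=
  fun i hi => by
    rw [← hf i hi]; exact (Filter.EventuallyEq.iteratedFDeriv ℝ h i).symm.eq_of_nhds

lemma flat_of_eventually_zero (m : ℕ) {f : E → F} (h : ∀ᶠ x in 𝓝 0, f x = 0) : Flat m f := by
  refine Flat.congr (f := fun _ => (0 : F)) (fun i _ => ?_) (h.mono fun x hx => hx.symm)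
  rw [iteratedFDeriv_fun_zero]; rfl

lemma flat_fun_zero (m : ℕ) : Flat m (fun _ : E => (0 : F)) :=
  flat_of_eventually_zero m (Eventually.of_forall fun _ => rfl)

lemma Flat.sum {ι : Type*} {m : ℕ} (s : Finset ι) {f : ι → E → F} (hf : ∀ i ∈ s, Flat m (f i))
    (sf : ∀ i ∈ s, ContDiff ℝ ∞ (f i)) : Flat m (fun x => ∑ i ∈ s, f i x) := by
  classical
  induction s using Finset.induction_on with
  | empty => simpa using flat_fun_zero m
  | insert a s ha ih =>
    simp only [Finset.sum_insert ha]
    exact (hf a (by simp)).add (ih (fun i hi => hf i (by simp [hi])) fun i hi => sf i (by simp [hi]))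
      (sf a (by simp)) (ContDiff.sum fun i hi => sf i (by simp [hi]))

/-- Leibniz: a derivative of order less than a + b distributes so that one factor is differentiated
fewer times than its order of flatness. -/
lemma Flat.bilin {a b : ℕ} {f : E → F} {g : E → G} (B : F →L[ℝ] G →L[ℝ] H) (hf : Flat a f)
    (hg : Flat b g) (sf : ContDiff ℝ ∞ f) (sg : ContDiff ℝ ∞ g) :
    Flat (a + b) (fun x => B (f x) (g x)) := fun i hi => by
  have := B.norm_iteratedFDeriv_le_of_bilinear sf sg (0 : E) (n := i)
    (by exact_mod_cast le_top)
  rw [← norm_eq_zero]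
  refine le_antisymm (this.trans (le_of_eq ?_)) (norm_nonneg _)
  rw [Finset.sum_eq_zero, mul_zero]
  intro j hj
  by_cases h : j < a
  · rw [hf j h]; simp
  · rw [hg (i - j) (by simp at hj; omega)]; simp

lemma Flat.mul {a b : ℕ} {f g : E → ℂ} (hf : Flat a f) (hg : Flat b g) (sf : ContDiff ℝ ∞ f)
    (sg : ContDiff ℝ ∞ g) : Flat (a + b) (fun x => f x * g x) :=
  hf.bilin (ContinuousLinearMap.mul ℝ ℂ) hg sf sg

lemma Flat.mul_left {b : ℕ} {f g : E → ℂ} (hg : Flat b g) (sf : ContDiff ℝ ∞ f)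
    (sg : ContDiff ℝ ∞ g) : Flat b (fun x => f x * g x) := by
  simpa using (flat_zero f).mul hg sf sg

lemma Flat.mul_right {b : ℕ} {f g : E → ℂ} (hf : Flat b f) (sf : ContDiff ℝ ∞ f)
    (sg : ContDiff ℝ ∞ g) : Flat b (fun x => f x * g x) := by
  simpa using hf.mul (flat_zero g) sf sg

lemma Flat.deriv_flat {m : ℕ} {g : E → F} (h : Flat m g) : Flat (m - 1) (fderiv ℝ g) := by
  rcases m with _ | m
  · exact flat_zero _
  · exact (flat_succ_iff.1 h).2

lemma contDiff_fderiv {g : E → F} (h : ContDiff ℝ ∞ g) : ContDiff ℝ ∞ (fderiv ℝ g) :=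
  h.fderiv_right (by simp)

/-- A flat function is small near the origin. -/
lemma Flat.bound {E : Type} [NormedAddCommGroup E] [NormedSpace ℝ E] [FiniteDimensional ℝ E]
    {m : ℕ} : ∀ {F : Type} [NormedAddCommGroup F] [NormedSpace ℝ F] {g : E → F}, Flat m g → ContDiff ℝ ∞ g → ∀ R : ℝ, ∃ C : ℝ, 0 ≤ C ∧
    ∀ x : E, ‖x‖ ≤ R → ‖g x‖ ≤ C * ‖x‖ ^ m := by
  induction m with
  | zero =>
    intro F _ _ g _ sg R
    obtain ⟨C, hC⟩ := (isCompact_closedBall (0 : E) R).exists_bound_of_continuousOn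
      sg.continuous.continuousOn
    refine ⟨max C 0, le_max_right _ _, fun x hx => ?_⟩
    rw [pow_zero, mul_one]
    exact (hC x (by simpa using hx)).trans (le_max_left _ _)
  | succ m ih =>
    intro F _ _ g hg sg R
    obtain ⟨h0, h1⟩ := flat_succ_iff.1 hg
    obtain ⟨C, hC0, hC⟩ := ih h1 (contDiff_fderiv sg) R
    refine ⟨C, hC0, fun x hx => ?_⟩
    -- Mean value inequality on the closed ball of radius `‖x‖`, where the induction hypothesis
    -- bounds the derivative by `C * ‖x‖ ^ m`.
    have := (convex_closedBall (0 : E) ‖x‖).norm_image_sub_le_of_norm_fderiv_le (𝕜 := ℝ) (f := g)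
      (C := C * ‖x‖ ^ m) (x := 0) (y := x)
      (fun y _ => (sg.differentiable (by simp)).differentiableAt)
      (fun y hy => by
        have hy' : ‖y‖ ≤ ‖x‖ := by simpa using hy
        exact (hC y (hy'.trans hx)).trans (by gcongr)) (by simp) (by simp)
    rw [h0, sub_zero, sub_zero] at this
    rw [pow_succ, ← mul_assoc]; exact this

end Flat

lemma contDiff_dC {W : RV d → CV d} {g : RV d → ℂ} (hW : ContDiff ℝ ∞ W) (hg : ContDiff ℝ ∞ g) :
    ContDiff ℝ ∞ (fun x => dC (W x) g x) := by
  simp only [dC_eq_sum]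
  exact ContDiff.sum fun r _ => (contDiff_pi.1 hW r).mul
    ((contDiff_fderiv hg).clm_apply contDiff_const)

/-- One derivative costs one order of flatness, whatever the smooth field. -/
lemma Flat.along {m : ℕ} {W : RV d → CV d} {g : RV d → ℂ} (h : Flat (m + 1) g)
    (hW : ContDiff ℝ ∞ W) (hg : ContDiff ℝ ∞ g) : Flat m (fun x => dC (W x) g x) := by
  simp only [dC_eq_sum]
  have hs : ∀ r, ContDiff ℝ ∞ (fun x => fderiv ℝ g x (ev r)) := fun r =>
    (contDiff_fderiv hg).clm_apply contDiff_const
  refine Flat.sum _ (fun r _ => Flat.mul_left ?_ (contDiff_pi.1 hW r) (hs r)) fun r _ =>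
    (contDiff_pi.1 hW r).mul (hs r)
  exact (flat_succ_iff.1 h).2.clm (contDiff_fderiv hg) (ContinuousLinearMap.apply ℝ ℂ (ev r))

/-- A vector field that vanishes at the origin improves the order of flatness. -/
lemma Flat.along_of_zero {m a : ℕ} {W : RV d → CV d} {g : RV d → ℂ} (h : Flat m g)
    (hW : ContDiff ℝ ∞ W) (hW0 : Flat (a + 1) W) (hg : ContDiff ℝ ∞ g) :
    Flat (a + m) (fun x => dC (W x) g x) := by
  simp only [dC_eq_sum]
  have hs : ∀ r, ContDiff ℝ ∞ (fun x => fderiv ℝ g x (ev r)) := fun r =>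
    (contDiff_fderiv hg).clm_apply contDiff_const
  refine Flat.sum _ (fun r _ => ?_) fun r _ => (contDiff_pi.1 hW r).mul (hs r)
  have h1 : Flat (a + 1) (fun x => W x r) :=
    hW0.clm hW (ContinuousLinearMap.proj (R := ℝ) (φ := fun _ : Fin d => ℂ) r)
  have h2 : Flat (m - 1) (fun x => fderiv ℝ g x (ev r)) :=
    h.deriv_flat.clm (contDiff_fderiv hg) (ContinuousLinearMap.apply ℝ ℂ (ev r))
  -- The field supplies a + 1 orders and the derivative loses at most one; the truncated `m - 1` is
  -- harmless.
  exact (h1.mul h2 (contDiff_pi.1 hW r) (hs r)).mono (by omega)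

/-- Second derivatives along complex vector fields. -/
lemma dC_dC {V : CV d} {W : RV d → CV d} {g : RV d → ℂ} {x : RV d} (hW : DifferentiableAt ℝ W x)
    (hg : ContDiffAt ℝ 2 g x) :
    dC V (fun y => dC (W y) g y) x = dC (dV V W x) g x +
      ∑ r, ∑ s, V r * W x s * fderiv ℝ (fderiv ℝ g) x (ev r) (ev s) := by
  have hd : DifferentiableAt ℝ (fderiv ℝ g) x :=
    (hg.fderiv_right (m := 1) (by norm_num)).differentiableAt (by simp)
  have hWc : ∀ r, DifferentiableAt ℝ (fun y => W y r) x := fun r => differentiableAt_pi.1 hW r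
  have hds : ∀ s, DifferentiableAt ℝ (fun y => fderiv ℝ g y (ev s)) x := fun s =>
    hd.clm_apply (differentiableAt_const _)
  have e : ∀ s, dC V (fun y => fderiv ℝ g y (ev s)) x =
      ∑ r, V r * fderiv ℝ (fderiv ℝ g) x (ev r) (ev s) := by
    intro s
    rw [dC_eq_sum]
    refine Finset.sum_congr rfl fun r _ => ?_
    rw [fderiv_clm_apply hd (differentiableAt_const _)]
    simp
  have : (fun y => dC (W y) g y) = fun y => ∑ s, W y s * fderiv ℝ g y (ev s) := by
    funext y; exact dC_eq_sum _ _ _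
  rw [this, dC_sum _ _ fun s _ => (hWc s).fun_mul (hds s)]
  simp_rw [dC_mul V (hWc _) (hds _), Finset.sum_add_distrib, e]
  rw [add_comm, dC_eq_sum (dV V W x)]
  congr 1
  rw [Finset.sum_comm]
  refine Finset.sum_congr rfl fun r _ => ?_
  rw [Finset.mul_sum]
  exact Finset.sum_congr rfl fun s _ => by ring

/-- The second-order parts cancel by symmetry of the second derivative, leaving the derivative along
the bracket. -/
lemma dC_dC_sub {V W : RV d → CV d} {g : RV d → ℂ} {x : RV d} (hV : DifferentiableAt ℝ V x)
    (hW : DifferentiableAt ℝ W x) (hg : ContDiffAt ℝ 2 g x) :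
    dC (V x) (fun y => dC (W y) g y) x - dC (W x) (fun y => dC (V y) g y) x =
      dC (brC V W x) g x := by
  have hsymm := hg.isSymmSndFDerivAt (by simp [minSmoothness_of_isRCLikeNormedField])
  rw [dC_dC hW hg, dC_dC hV hg, Finset.sum_comm (f := fun r s => W x r * V x s * _)]
  have : ∑ r, ∑ s, V x r * W x s * fderiv ℝ (fderiv ℝ g) x (ev r) (ev s) =
      ∑ r, ∑ s, W x s * V x r * fderiv ℝ (fderiv ℝ g) x (ev s) (ev r) :=
    Finset.sum_congr rfl fun r _ => Finset.sum_congr rfl fun s _ => by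
      rw [hsymm.eq (ev r) (ev s)]; ring
  rw [this, add_sub_add_right_eq_sub, brC]
  simp only [dC]
  rw [map_sub]

lemma sum_smul_apply {ι : Type*} (s : Finset ι) (f : ι → ℂ) (l : ι → RV d →L[ℝ] ℂ) (v : RV d) :
    (∑ c ∈ s, f c • l c) v = ∑ c ∈ s, f c * l c v := by
  rw [_root_.sum_apply]; rfl

/-! ### Polynomials in complex coordinates -/

section Poly

open MvPolynomial

variable {ι : Type*} [Fintype ι]

/-- Complex linear coordinates `y` with the dual basis `b` of the complexified space. -/
structure Coords (d : ℕ) (ι : Type*) [Fintype ι] where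
  y : ι → RV d →L[ℝ] ℂ
  b : ι → CV d
  dual_self : ∀ a, cext (y a) (b a) = 1
  dual_ne : ∀ a c, a ≠ c → cext (y a) (b c) = 0
  expand : ∀ l : RV d →L[ℝ] ℂ, l = ∑ a, cext l (b a) • y a

variable (K : Coords d ι)

/-- The function defined by a polynomial in the coordinates. -/
def Coords.pev (P : MvPolynomial ι ℂ) (x : RV d) : ℂ := eval (fun a => K.y a x) P

lemma Coords.contDiff_pev (P : MvPolynomial ι ℂ) : ContDiff ℝ ∞ (K.pev P) := by
  unfold Coords.pev
  induction P using MvPolynomial.induction_on with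
  | C a => simpa using contDiff_const
  | add p q hp hq => simpa using hp.add hq
  | mul_X p i hp => simpa using hp.mul (K.y i).contDiff

lemma Coords.hasFDerivAt_pev (P : MvPolynomial ι ℂ) (x : RV d) :
    HasFDerivAt (K.pev P) (∑ a, K.pev (pderiv a P) x • K.y a) x := by
  classical
  induction P using MvPolynomial.induction_on with
  | C a =>
    have h : K.pev (C a) = fun _ => a := by funext x; simp [Coords.pev]
    have h2 : ∑ c, K.pev (pderiv c (C a)) x • K.y c = 0 :=
      ContinuousLinearMap.ext fun v => by rw [sum_smul_apply]; simp [Coords.pev]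
    rw [h, h2]; exact hasFDerivAt_const a x
  | add p q hp hq =>
    have h : K.pev (p + q) = fun x => K.pev p x + K.pev q x := by funext x; simp [Coords.pev]
    have h2 : ∑ c, K.pev (pderiv c (p + q)) x • K.y c =
        ∑ c, K.pev (pderiv c p) x • K.y c + ∑ c, K.pev (pderiv c q) x • K.y c :=
      ContinuousLinearMap.ext fun v => by
        rw [ContinuousLinearMap.add_apply]
        simp only [sum_smul_apply, ← Finset.sum_add_distrib]
        exact Finset.sum_congr rfl fun c _ => by simp [Coords.pev]; ring
    rw [h, h2]; exact hp.add hq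
  | mul_X p i hp =>
    have h : K.pev (p * X i) = fun x => K.pev p x * K.y i x := by funext x; simp [Coords.pev]
    have h2 : ∑ c, K.pev (pderiv c (p * X i)) x • K.y c =
        K.pev p x • K.y i + K.y i x • ∑ c, K.pev (pderiv c p) x • K.y c :=
      ContinuousLinearMap.ext fun v => by
        rw [ContinuousLinearMap.add_apply, ContinuousLinearMap.smul_apply,
          ContinuousLinearMap.smul_apply]
        simp only [sum_smul_apply, smul_eq_mul]
        have h3 : ∀ c, K.pev (pderiv c (p * X i)) x * K.y c v =
            (K.pev p x * (if i = c then 1 else 0)) * K.y c v +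
              K.y i x * (K.pev (pderiv c p) x * K.y c v) := by
          intro c
          simp only [Coords.pev, pderiv_mul, map_add, map_mul, eval_X, pderiv_X, Pi.single_apply]
          split_ifs with h1 <;> simp [h1] <;> ring
        simp_rw [h3, Finset.sum_add_distrib, Finset.mul_sum]
        congr 1
        rw [Finset.sum_eq_single i]
        · simp
        · intro c _ hc; simp [hc.symm]
        · simp
    rw [h, h2]; exact hp.mul (K.y i).hasFDerivAt

lemma Coords.fderiv_pev (P : MvPolynomial ι ℂ) (x : RV d) :
    fderiv ℝ (K.pev P) x = ∑ a, K.pev (pderiv a P) x • K.y a := (K.hasFDerivAt_pev P x).fderiv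

lemma Coords.dC_pev (P : MvPolynomial ι ℂ) (a : ι) (x : RV d) :
    dC (K.b a) (K.pev P) x = K.pev (pderiv a P) x := by
  rw [dC, K.fderiv_pev, cext_sum, Finset.sum_eq_single a]
  · rw [cext_smul, K.dual_self, mul_one]
  · intro c _ hc; rw [cext_smul, K.dual_ne c a hc, mul_zero]
  · simp

lemma Coords.pev_sub (P Q : MvPolynomial ι ℂ) (x : RV d) :
    K.pev (P - Q) x = K.pev P x - K.pev Q x := by simp [Coords.pev]

lemma Coords.pev_zero_of_homogeneous {P : MvPolynomial ι ℂ} {m : ℕ} (hP : P.IsHomogeneous (m + 1)) :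
    K.pev P 0 = 0 := by
  have h : (fun a => K.y a 0) = fun _ : ι => (0 : ℂ) := by funext a; simp
  rw [Coords.pev, h]
  have h2 : eval (fun _ : ι => (0 : ℂ)) P = coeff 0 P := by
    rw [← constantCoeff_eq]; exact congrFun (congrArg DFunLike.coe eval_zero) P
  rw [h2]
  by_contra hne
  have := hP hne
  simp at this

/-- By `expand` the differential is a combination of the constant covectors `y a` with the
derivatives along `b a` as coefficients, so flatness of the latter suffices. -/
lemma Coords.flat_succ {m : ℕ} {g : RV d → ℂ} (sg : ContDiff ℝ ∞ g) (h0 : g 0 = 0)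
    (h : ∀ a, Flat m (fun x => dC (K.b a) g x)) : Flat (m + 1) g := by
  refine flat_succ_iff.2 ⟨h0, ?_⟩
  have : fderiv ℝ g = fun x => ∑ a, (ContinuousLinearMap.lsmul ℝ ℂ).flip (K.y a) (dC (K.b a) g x) := by
    funext x; exact K.expand (fderiv ℝ g x)
  rw [this]
  exact Flat.sum _ (fun a _ => (h a).clm (contDiff_dC contDiff_const sg) _) fun a _ =>
    ContinuousLinearMap.contDiff _ |>.comp (contDiff_dC contDiff_const sg)

lemma Coords.flat_pev {m : ℕ} : ∀ {P : MvPolynomial ι ℂ}, P.IsHomogeneous m → Flat m (K.pev P) := by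
  induction m with
  | zero => exact fun _ => flat_zero _
  | succ m ih =>
    intro P hP
    refine K.flat_succ (K.contDiff_pev P) (K.pev_zero_of_homogeneous hP) fun a => ?_
    simp only [K.dC_pev]
    exact ih hP.pderiv

/-- All partial derivatives vanish by induction, and Euler's identity then kills a polynomial of
positive degree. -/
lemma Coords.eq_zero_of_flat {m : ℕ} : ∀ {P : MvPolynomial ι ℂ}, P.IsHomogeneous m →
    Flat (m + 1) (K.pev P) → P = 0 := by
  induction m with
  | zero =>
    intro P hP h
    have hc : P = C (coeff 0 P) := by
      rw [← totalDegree_eq_zero_iff_eq_C]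
      exact Nat.le_zero.1 hP.totalDegree_le
    have h0 := (flat_succ_iff.1 h).1
    rw [hc] at h0 ⊢
    simp only [Coords.pev, eval_C] at h0
    rw [h0, C_0]
  | succ m ih =>
    intro P hP h
    have hz : ∀ a, pderiv a P = 0 := fun a => by
      refine ih hP.pderiv ?_
      have : K.pev (pderiv a P) = fun x => dC (K.b a) (K.pev P) x := by
        funext x; rw [K.dC_pev]
      rw [this]
      exact h.along contDiff_const (K.contDiff_pev P)
    have := hP.sum_X_mul_pderiv
    simp only [hz, mul_zero, Finset.sum_const_zero] at this
    rw [nsmul_eq_mul] at this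
    exact ((mul_eq_zero.1 this.symm).resolve_left (by
      exact_mod_cast (Nat.cast_ne_zero (R := MvPolynomial ι ℂ)).2 (Nat.succ_ne_zero m)))

/-- The leading Taylor polynomial of a flat function. -/
lemma Coords.exists_taylor {m : ℕ} : ∀ {g : RV d → ℂ}, ContDiff ℝ ∞ g → Flat m g →
    ∃ P : MvPolynomial ι ℂ, P.IsHomogeneous m ∧ Flat (m + 1) (fun x => g x - K.pev P x) := by
  induction m with
  | zero =>
    intro g sg _
    exact ⟨C (g 0), isHomogeneous_C _ _, flat_one_iff.2 (by simp [Coords.pev])⟩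
  | succ m ih =>
    intro g sg hg
    have sD : ∀ a, ContDiff ℝ ∞ (fun x => dC (K.b a) g x) := fun a => contDiff_dC contDiff_const sg
    choose P hP hPf using fun a => ih (sD a) (hg.along (W := fun _ => K.b a) contDiff_const sg)
    -- Euler's identity dictates the candidate: a homogeneous polynomial of degree m + 1 is
    -- `1/(m+1)` times the sum of its partial derivatives multiplied by the variables.
    set Q : MvPolynomial ι ℂ := C (((m : ℂ) + 1)⁻¹) * ∑ a, X a * P a with hQ
    have hQh : Q.IsHomogeneous (m + 1) := by
      have h1 : (∑ a, X a * P a).IsHomogeneous (1 + m) :=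
        IsHomogeneous.sum _ _ _ fun a _ => (isHomogeneous_X ℂ a).mul (hP a)
      have := (isHomogeneous_C ι (((m : ℂ) + 1)⁻¹)).mul h1
      rw [show 0 + (1 + m) = m + 1 by ring] at this
      exact this
    refine ⟨Q, hQh, ?_⟩
    have hm : (m : ℂ) + 1 ≠ 0 := by exact_mod_cast Nat.succ_ne_zero m
    refine K.flat_succ (sg.sub (K.contDiff_pev Q)) ?_ fun b => ?_
    · rw [K.pev_zero_of_homogeneous hQh, (flat_succ_iff.1 hg).1, sub_zero]
    · -- the derivative of `Q` along `b` agrees with `P b` to the right order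
      have hcomp : ∀ a, Flat m (fun x => K.pev (pderiv b (P a) - pderiv a (P b)) x) := by
        intro a
        have h1 : Flat m (fun x => dC (K.b b) (fun y => dC (K.b a) g y - K.pev (P a) y) x) :=
          (hPf a).along contDiff_const ((sD a).sub (K.contDiff_pev _))
        have h2 : Flat m (fun x => dC (K.b a) (fun y => dC (K.b b) g y - K.pev (P b) y) x) :=
          (hPf b).along contDiff_const ((sD b).sub (K.contDiff_pev _))
        have h3 := h2.sub h1 (contDiff_dC contDiff_const ((sD b).sub (K.contDiff_pev _)))
          (contDiff_dC contDiff_const ((sD a).sub (K.contDiff_pev _)))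
        refine h3.congr (Eventually.of_forall fun x => ?_)
        have hda : DifferentiableAt ℝ (fun x => dC (K.b a) g x) x :=
          ((sD a).differentiable (by simp)).differentiableAt
        have hdb : DifferentiableAt ℝ (fun x => dC (K.b b) g x) x :=
          ((sD b).differentiable (by simp)).differentiableAt
        have hpa : ∀ R, DifferentiableAt ℝ (K.pev R) x := fun R =>
          ((K.contDiff_pev R).differentiable (by simp)).differentiableAt
        dsimp only
        rw [dC_sub _ hdb (hpa _), dC_sub _ hda (hpa _), K.pev_sub, K.dC_pev, K.dC_pev]
        have := dC_dC_sub (V := fun _ => K.b b) (W := fun _ => K.b a) (g := g) (x := x)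
          (differentiableAt_const _) (differentiableAt_const _)
          (sg.contDiffAt.of_le two_le_infty)
        have hbr : brC (fun _ => K.b b) (fun _ => K.b a) x = 0 := by
          funext r; simp [brC, dV, dC_const]
        rw [hbr] at this
        have h0 : dC (0 : CV d) g x = 0 := map_zero _
        rw [h0] at this
        linear_combination - this
      -- Euler's identity for `P b` isolates `P b` itself; the remaining sum measures the failure of
      -- the mixed derivatives to agree, which `hcomp` controls.
      have hder : pderiv b Q = P b + C (((m : ℂ) + 1)⁻¹) *
          ∑ a, X a * (pderiv b (P a) - pderiv a (P b)) := by
        classical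
        have hE := (hP b).sum_X_mul_pderiv
        rw [nsmul_eq_mul] at hE
        have h1 : pderiv b (∑ a, X a * P a) = P b + ∑ a, X a * pderiv b (P a) := by
          rw [map_sum]
          simp only [pderiv_mul, pderiv_X, Pi.single_apply]
          rw [Finset.sum_add_distrib]
          congr 1
          rw [Finset.sum_eq_single b]
          · simp
          · intro c _ hc; simp [hc]
          · simp
        rw [hQ, pderiv_C_mul, h1]
        simp only [mul_sub, Finset.sum_sub_distrib, hE]
        have h2 : P b = C (((m : ℂ) + 1)⁻¹) * ((m : MvPolynomial ι ℂ) + 1) * P b := by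
          rw [show ((m : MvPolynomial ι ℂ) + 1) = C ((m : ℂ) + 1) by simp, ← C_mul,
            inv_mul_cancel₀ hm, C_1, one_mul]
        linear_combination (-1 : MvPolynomial ι ℂ) * h2
      have hp : ∀ x, DifferentiableAt ℝ (K.pev Q) x := fun x =>
        ((K.contDiff_pev Q).differentiable (by simp)).differentiableAt
      have hg' : ∀ x, DifferentiableAt ℝ g x := fun x =>
        (sg.differentiable (by simp)).differentiableAt
      simp only [dC_sub _ (hg' _) (hp _), K.dC_pev, hder]
      have e : ∀ x, K.pev (P b + C (((m : ℂ) + 1)⁻¹) *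
          ∑ a, X a * (pderiv b (P a) - pderiv a (P b))) x = K.pev (P b) x + ((m : ℂ) + 1)⁻¹ *
          ∑ a, K.y a x * K.pev (pderiv b (P a) - pderiv a (P b)) x := by
        intro x; simp [Coords.pev]
      simp only [e, ← sub_sub]
      refine (hPf b).sub (Flat.mul_left ?_ contDiff_const ?_) ((sD b).sub (K.contDiff_pev _)) ?_
      · refine Flat.sum _ (fun a _ => ?_) fun a _ => (K.y a).contDiff.mul (K.contDiff_pev _)
        have := (flat_one_iff.2 (map_zero (K.y a))).mul (hcomp a) (K.y a).contDiff
          (K.contDiff_pev _)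
        rwa [add_comm] at this
      · exact ContDiff.sum fun a _ => (K.y a).contDiff.mul (K.contDiff_pev _)
      · exact contDiff_const.mul (ContDiff.sum fun a _ => (K.y a).contDiff.mul (K.contDiff_pev _))

end Poly

variable {d : ℕ}

/-! ### Potentials of closed systems of polynomials -/

section Antiderivative

open MvPolynomial

variable {ι : Type*}

lemma pderiv_comm (i j : ι) (P : MvPolynomial ι ℂ) :
    pderiv i (pderiv j P) = pderiv j (pderiv i P) := by
  by_cases h : i = j
  · rw [h]
  ext m
  simp only [coeff_pderiv, Finsupp.add_apply, Finsupp.single_eq_of_ne h,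
    Finsupp.single_eq_of_ne (Ne.symm h)]
  rw [add_right_comm]
  simp only [add_zero]
  ring

/-- The antiderivative of a polynomial in the variable `j`. -/
def antiD (j : ι) (P : MvPolynomial ι ℂ) : MvPolynomial ι ℂ :=
  ∑ s ∈ P.support, monomial (s + Finsupp.single j 1) (coeff s P / ((s j : ℂ) + 1))

lemma pderiv_antiD_self (j : ι) (P : MvPolynomial ι ℂ) : pderiv j (antiD j P) = P := by
  conv_rhs => rw [← support_sum_monomial_coeff P]
  rw [antiD, map_sum]
  refine Finset.sum_congr rfl fun s _ => ?_
  rw [pderiv_monomial, add_tsub_cancel_right]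
  congr 1
  have : (s j : ℂ) + 1 ≠ 0 := Nat.cast_add_one_ne_zero _
  simp only [Finsupp.add_apply, Finsupp.single_eq_same]
  push_cast
  field_simp

/-- In characteristic zero a vanishing partial derivative means that the variable does not occur in
any monomial, and integrating in another variable does not introduce it. -/
lemma pderiv_antiD_of_ne {i j : ι} (h : i ≠ j) {P : MvPolynomial ι ℂ} (hP : pderiv i P = 0) :
    pderiv i (antiD j P) = 0 := by
  rw [antiD, map_sum]
  refine Finset.sum_eq_zero fun s hs => ?_
  have hsi : s i = 0 := by
    by_contra hne
    have h1 := congrArg (coeff (s - Finsupp.single i 1)) hP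
    rw [coeff_pderiv, coeff_zero] at h1
    have h2 : s - Finsupp.single i 1 + Finsupp.single i 1 = s :=
      tsub_add_cancel_of_le (Finsupp.single_le_iff.2 (Nat.one_le_iff_ne_zero.2 hne))
    rw [h2] at h1
    rcases mul_eq_zero.1 h1 with h3 | h3
    · exact (mem_support_iff.1 hs) h3
    · exact Nat.cast_add_one_ne_zero _ h3
  rw [pderiv_monomial]
  simp [hsi, Finsupp.single_apply, Ne.symm h]

lemma isHomogeneous_antiD (j : ι) {P : MvPolynomial ι ℂ} {m : ℕ} (hP : P.IsHomogeneous m) :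
    (antiD j P).IsHomogeneous (m + 1) := by
  refine IsHomogeneous.sum _ _ _ fun s hs => isHomogeneous_monomial _ ?_
  have := hP (mem_support_iff.1 hs)
  rw [map_add, Finsupp.degree_single]
  congr 1
  rw [← this, Finsupp.degree_eq_weight_one]; rfl

/-- The Poincaré lemma for polynomials, in a subset of the variables. -/
lemma exists_potential [DecidableEq ι] (S : Finset ι) {m : ℕ} (R : ι → MvPolynomial ι ℂ)
    (hR : ∀ j, (R j).IsHomogeneous m)
    (hc : ∀ i ∈ S, ∀ j ∈ S, pderiv i (R j) = pderiv j (R i)) :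
    ∃ P : MvPolynomial ι ℂ, P.IsHomogeneous (m + 1) ∧ ∀ j ∈ S, pderiv j P = R j := by
  induction S using Finset.induction_on with
  | empty => exact ⟨0, isHomogeneous_zero _ _ _, by simp⟩
  | insert j S hj ih =>
    obtain ⟨P, hP, hPS⟩ := ih fun i hi l hl => hc i (by simp [hi]) l (by simp [hl])
    have hP' : (pderiv j P).IsHomogeneous m := by simpa using hP.pderiv (i := j)
    -- The defect `R j - ∂_j P` does not involve the variables of `S`, by closedness; integrating it
    -- in the variable `j` therefore leaves the equations already solved intact.
    refine ⟨P + antiD j (R j - pderiv j P), hP.add (isHomogeneous_antiD j ((hR j).sub hP')), ?_⟩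
    intro i hi
    rcases Finset.mem_insert.1 hi with rfl | hi'
    · rw [map_add, pderiv_antiD_self]; ring
    · have hij : i ≠ j := fun h => hj (h ▸ hi')
      rw [map_add, hPS i hi', pderiv_antiD_of_ne hij, add_zero]
      rw [map_sub, pderiv_comm i j P, hPS i hi', hc i (by simp [hi']) j (by simp), sub_self]

end Antiderivative

/-! ### Formal solvability of involutive systems -/

section FormalSolve

open MvPolynomial

variable {ι : Type*} [Fintype ι] [DecidableEq ι] (K : Coords d ι)

/-- A gain of one order. As `L j` agrees with the constant field `b j` at the origin, the leading
part of the system is `∂_j P = R j`, where `R j` is the leading Taylor polynomial of `ρ j`. The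
compatibility of the `ρ j` makes the `R j` a closed system, solved by `exists_potential`. -/
lemma Coords.formal_step (S : Finset ι) {L : ι → RV d → CV d} (hL : ∀ j, ContDiff ℝ ∞ (L j))
    (hL0 : ∀ j ∈ S, L j 0 = K.b j) {m : ℕ} {ρ : ι → RV d → ℂ} (hρ : ∀ j, ContDiff ℝ ∞ (ρ j))
    (hρm : ∀ j ∈ S, Flat m (ρ j))
    (hc : ∀ i ∈ S, ∀ j ∈ S, ∀ᶠ x in 𝓝 0, dC (L i x) (ρ j) x = dC (L j x) (ρ i) x) :
    ∃ P : RV d → ℂ, ContDiff ℝ ∞ P ∧ Flat (m + 1) P ∧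
      ∀ j ∈ S, Flat (m + 1) (fun x => dC (L j x) P x - ρ j x) := by
  have hT : ∀ j, ∃ R : MvPolynomial ι ℂ, R.IsHomogeneous m ∧
      (j ∈ S → Flat (m + 1) (fun x => ρ j x - K.pev R x)) := by
    intro j
    by_cases hj : j ∈ S
    · obtain ⟨R, h1, h2⟩ := K.exists_taylor (hρ j) (hρm j hj)
      exact ⟨R, h1, fun _ => h2⟩
    · exact ⟨0, isHomogeneous_zero _ _ _, fun h => absurd h hj⟩
  choose R hR hRf using hT
  have hLd : ∀ j ∈ S, Flat 1 (fun x => L j x - K.b j) := fun j hj =>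
    flat_one_iff.2 (by rw [hL0 j hj, sub_self])
  have sLd : ∀ j, ContDiff ℝ ∞ (fun x => L j x - K.b j) := fun j => (hL j).sub contDiff_const
  -- The field `L j - b j` vanishes at the origin, which makes up for the order lost by
  -- differentiating.
  have key : ∀ j ∈ S, ∀ {g : RV d → ℂ}, ContDiff ℝ ∞ g → ∀ {a : ℕ}, Flat a g →
      Flat a (fun x => dC (L j x) g x - dC (K.b j) g x) := by
    intro j hj g sg a hg
    have := hg.along_of_zero (a := 0) (sLd j) (hLd j hj) sg
    rw [zero_add] at this
    refine this.congr (Eventually.of_forall fun x => ?_)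
    exact map_sub (cext (fderiv ℝ g x)) _ _
  have hcomp : ∀ i ∈ S, ∀ j ∈ S, pderiv i (R j) = pderiv j (R i) := by
    intro i hi j hj
    -- For degree zero the leading polynomials are constants and closedness is trivial; it also
    -- could not be read off from flatness.
    rcases m with _ | m
    · have : ∀ l, ∃ c, R l = C c := fun l => ⟨_, (totalDegree_eq_zero_iff_eq_C).1
        (Nat.le_zero.1 (hR l).totalDegree_le)⟩
      obtain ⟨c, hc⟩ := this i
      obtain ⟨c', hc'⟩ := this j
      simp [hc, hc']
    · rw [← sub_eq_zero]
      -- The difference of the mixed derivatives is homogeneous of degree m. It is shown to be flat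
      -- of order m + 1 by comparing with the compatible functions `ρ`, so it vanishes.
      refine K.eq_zero_of_flat (m := m) ((hR j).pderiv.sub (hR i).pderiv) ?_
      have sd : ∀ i j, ContDiff ℝ ∞ (fun x => dC (K.b i) (fun y => ρ j y - K.pev (R j) y) x) :=
        fun i j => contDiff_dC contDiff_const ((hρ j).sub (K.contDiff_pev _))
      have sb : ∀ i j, ContDiff ℝ ∞ (fun x => dC (L i x) (ρ j) x - dC (K.b i) (ρ j) x) := fun i j =>
        (contDiff_dC (hL i) (hρ j)).sub (contDiff_dC contDiff_const (hρ j))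
      have f1 : ∀ i ∈ S, ∀ j ∈ S, Flat (m + 1)
          (fun x => dC (K.b i) (fun y => ρ j y - K.pev (R j) y) x) := fun i hi j hj =>
        (hRf j hj).along contDiff_const ((hρ j).sub (K.contDiff_pev _))
      have f2 : ∀ i ∈ S, ∀ j ∈ S, Flat (m + 1)
          (fun x => dC (L i x) (ρ j) x - dC (K.b i) (ρ j) x) := fun i hi j hj =>
        key i hi (hρ j) (hρm j hj)
      have f3 := ((f1 j hj i hi).sub (f1 i hi j hj) (sd j i) (sd i j)).add
        ((f2 j hj i hi).sub (f2 i hi j hj) (sb j i) (sb i j)) ((sd j i).sub (sd i j))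
        ((sb j i).sub (sb i j))
      refine f3.congr ?_
      filter_upwards [hc i hi j hj] with x hx
      have hd : ∀ l, DifferentiableAt ℝ (ρ l) x := fun l =>
        ((hρ l).differentiable (by simp)).differentiableAt
      have hp : ∀ l, DifferentiableAt ℝ (K.pev (R l)) x := fun l =>
        ((K.contDiff_pev _).differentiable (by simp)).differentiableAt
      rw [dC_sub _ (hd _) (hp _), dC_sub _ (hd _) (hp _), K.dC_pev, K.dC_pev, K.pev_sub, hx]
      ring
  obtain ⟨P, hP, hPS⟩ := exists_potential S R hR hcomp
  refine ⟨K.pev P, K.contDiff_pev P, K.flat_pev hP, fun j hj => ?_⟩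
  have h1 := key j hj (K.contDiff_pev P) (K.flat_pev hP)
  have h2 := h1.sub (hRf j hj) ((contDiff_dC (hL j) (K.contDiff_pev P)).sub
    (contDiff_dC contDiff_const (K.contDiff_pev P))) ((hρ j).sub (K.contDiff_pev _))
  refine h2.congr (Eventually.of_forall fun x => ?_)
  dsimp only
  rw [K.dC_pev, hPS j hj]; ring

/-- Formal solvability of an involutive system: a solution up to order `m₀` can be corrected to a
solution up to any given order. -/
theorem Coords.formal_solve (S : Finset ι) {L : ι → RV d → CV d} (hL : ∀ j, ContDiff ℝ ∞ (L j))
    (hL0 : ∀ j ∈ S, L j 0 = K.b j)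
    (hcomm : ∀ i ∈ S, ∀ j ∈ S, ∀ᶠ x in 𝓝 0, brC (L i) (L j) x = 0)
    {r : ι → RV d → ℂ} (hr : ∀ j, ContDiff ℝ ∞ (r j))
    (hc : ∀ i ∈ S, ∀ j ∈ S, ∀ᶠ x in 𝓝 0, dC (L i x) (r j) x = dC (L j x) (r i) x)
    {φ : RV d → ℂ} (hφ : ContDiff ℝ ∞ φ) {m₀ : ℕ}
    (h0 : ∀ j ∈ S, Flat m₀ (fun x => dC (L j x) φ x - r j x)) (m : ℕ) :
    ∃ φ' : RV d → ℂ, ContDiff ℝ ∞ φ' ∧ Flat (m₀ + 1) (fun x => φ' x - φ x) ∧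
      ∀ j ∈ S, Flat (m₀ + m) (fun x => dC (L j x) φ' x - r j x) := by
  induction m with
  | zero => exact ⟨φ, hφ, by simpa using flat_fun_zero _, h0⟩
  | succ m ih =>
    obtain ⟨ψ, hψ, h1, h2⟩ := ih
    have sρ : ∀ j, ContDiff ℝ ∞ (fun x => r j x - dC (L j x) ψ x) := fun j =>
      (hr j).sub (contDiff_dC (hL j) hψ)
    -- The current residual is the new right-hand side. It is again compatible, because the
    -- right-hand sides are and the fields commute near the origin.
    obtain ⟨P, sP, hP, hPS⟩ := K.formal_step S hL hL0 (ρ := fun j x => r j x - dC (L j x) ψ x) sρ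
      (fun j hj => by
        have := (h2 j hj).neg ((contDiff_dC (hL j) hψ).sub (hr j))
        simpa only [neg_sub] using this)
      (fun i hi j hj => by
        filter_upwards [hcomm i hi j hj, hc i hi j hj] with x hx hx'
        have hd : ∀ {g : RV d → ℂ}, ContDiff ℝ ∞ g → DifferentiableAt ℝ g x := fun hg =>
          (hg.differentiable (by simp)).differentiableAt
        rw [dC_sub _ (hd (hr j)) (hd (contDiff_dC (hL j) hψ)),
          dC_sub _ (hd (hr i)) (hd (contDiff_dC (hL i) hψ)), hx']
        have := dC_dC_sub (V := L i) (W := L j) (g := ψ) (x := x)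
          ((hL i).differentiable (by simp)).differentiableAt
          ((hL j).differentiable (by simp)).differentiableAt (hψ.contDiffAt.of_le two_le_infty)
        rw [hx] at this
        have h0 : dC (0 : CV d) ψ x = 0 := map_zero _
        rw [h0] at this
        linear_combination - this)
    refine ⟨fun x => ψ x + P x, hψ.add sP, ?_, fun j hj => ?_⟩
    · have := h1.add (hP.mono (by omega : m₀ + 1 ≤ m₀ + m + 1)) (hψ.sub hφ) sP
      refine this.congr (Eventually.of_forall fun x => ?_)
      dsimp only; ring
    · refine (hPS j hj).congr (Eventually.of_forall fun x => ?_)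
      dsimp only
      rw [dC_add _ ((hψ.differentiable (by simp)).differentiableAt)
        ((sP.differentiable (by simp)).differentiableAt)]
      ring

end FormalSolve

variable {d n : ℕ}

/-! ### The filtration of forms defined by a space of complex vectors -/

/-- The span of a complex frame. -/
def T01 (L : Fin n → RV d → CV d) (x : RV d) : Submodule ℂ (CV d) :=
  Submodule.span ℂ (range fun j => L j x)

/-- The forms that vanish as soon as more than `m - p` of their arguments are in `T`. -/
def Filt (T : Submodule ℂ (CV d)) (p m : ℕ) : Submodule ℂ (Alt d m) where
  carrier := {α | ∀ (Z : Fin m → CV d) (s : Finset (Fin m)), m < p + s.card →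
    (∀ j ∈ s, Z j ∈ T) → altC α Z = 0}
  zero_mem' := fun Z s _ _ => by rw [altC_zero]; rfl
  add_mem' := fun {α β} hα hβ Z s h1 h2 => by
    rw [altC_add, ContinuousAlternatingMap.add_apply, hα Z s h1 h2, hβ Z s h1 h2, add_zero]
  smul_mem' := fun c α hα Z s h1 h2 => by
    rw [altC_smul, ContinuousAlternatingMap.smul_apply, hα Z s h1 h2, smul_zero]

lemma norm_altC_le {m : ℕ} (α : Alt d m) (Z : Fin m → CV d) :
    ‖altC α Z‖ ≤ (d : ℝ) ^ m * ‖α‖ * ∏ j, ‖Z j‖ := by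
  rw [altC_apply]
  refine (norm_sum_le _ _).trans ?_
  have : ∀ r : Fin m → Fin d, ‖(∏ j, Z j (r j)) * α (fun j => ev (r j))‖ ≤ ‖α‖ * ∏ j, ‖Z j‖ := by
    intro r
    rw [norm_mul, norm_prod, mul_comm]
    have h1 : ‖α (fun j => ev (r j))‖ ≤ ‖α‖ := by
      refine (α.le_opNorm _).trans (le_of_eq ?_)
      simp [ev]
    gcongr with j
    exact norm_le_pi_norm (Z j) (r j)
  refine (Finset.sum_le_sum fun r _ => this r).trans (le_of_eq ?_)
  simp [mul_assoc]

/-- Counting behind the filtration: deleting a slot loses at most one marked argument, and only if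
that slot was marked. -/
lemma card_le_removeNth {m : ℕ} (s : Finset (Fin (m + 1))) (i : Fin (m + 1)) :
    s.card ≤ (Finset.univ.filter fun l => i.succAbove l ∈ s).card + (if i ∈ s then 1 else 0) := by
  have h : s ⊆ ((Finset.univ.filter fun l => i.succAbove l ∈ s).image i.succAbove) ∪
      (if i ∈ s then {i} else ∅) := by
    intro x hx
    rcases Fin.eq_self_or_eq_succAbove i x with rfl | ⟨l, rfl⟩
    · simp [hx]
    · exact Finset.mem_union_left _ (Finset.mem_image.2 ⟨l, by simpa using hx, rfl⟩)
  refine (Finset.card_le_card h).trans ((Finset.card_union_le _ _).trans ?_)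
  gcongr
  · exact Finset.card_image_le
  · split_ifs <;> simp

lemma castSucc_succAbove_of_le {m : ℕ} {i j : Fin (m + 1)} (h : i ≤ j) :
    i.castSucc.succAbove j = j.succ :=
  Fin.succAbove_of_le_castSucc _ _ (by simpa using h)

lemma card_le_removeNth₂ {m : ℕ} (s : Finset (Fin (m + 2))) {i j : Fin (m + 1)} (h : i ≤ j) :
    s.card ≤ (Finset.univ.filter fun l => i.castSucc.succAbove (j.succAbove l) ∈ s).card +
      (if i.castSucc ∈ s then 1 else 0) + (if j.succ ∈ s then 1 else 0) := by
  have h1 := card_le_removeNth s i.castSucc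
  have h2 := card_le_removeNth (Finset.univ.filter fun l => i.castSucc.succAbove l ∈ s) j
  simp only [Finset.mem_filter, Finset.mem_univ, true_and, castSucc_succAbove_of_le h] at h2
  omega

/-- Handles the derivative terms in Cartan's formula: after removal of a slot there are still more
arguments in `T` than a form of level `p` tolerates. -/
lemma Filt.removeNth_eq_zero {T : Submodule ℂ (CV d)} {p m : ℕ} {α : Alt d m}
    (hα : α ∈ Filt T p m) {Z : Fin (m + 1) → CV d} {s : Finset (Fin (m + 1))}
    (hs : ∀ j ∈ s, Z j ∈ T) {i : Fin (m + 1)} (hc : m + (if i ∈ s then 1 else 0) < p + s.card) :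
    altC α (i.removeNth Z) = 0 := by
  refine hα _ (Finset.univ.filter fun l => i.succAbove l ∈ s) ?_ fun j hj => hs _ (by simpa using hj)
  have := card_le_removeNth s i
  omega

/-- Handles the bracket terms: the bracket itself is not assumed to lie in `T`, so two slots are
removed and the new one is not counted. -/
lemma Filt.bracket_eq_zero {T : Submodule ℂ (CV d)} {p m : ℕ} {α : Alt d (m + 1)}
    (hα : α ∈ Filt T p (m + 1)) {Z : Fin (m + 2) → CV d} {s : Finset (Fin (m + 2))}
    (hs : ∀ j ∈ s, Z j ∈ T) {i j : Fin (m + 1)} (hij : i ≤ j) (V : CV d)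
    (hc : m + 1 + (if i.castSucc ∈ s then 1 else 0) + (if j.succ ∈ s then 1 else 0) < p + s.card) :
    altC α (Matrix.vecCons V (j.removeNth (i.castSucc.removeNth Z))) = 0 := by
  set t := Finset.univ.filter fun l => i.castSucc.succAbove (j.succAbove l) ∈ s with ht
  refine hα _ (t.map (Fin.succEmb m)) ?_ ?_
  · have := card_le_removeNth₂ s hij
    rw [← ht] at this
    rw [Finset.card_map]; omega
  · intro l hl
    obtain ⟨l', hl', rfl⟩ := Finset.mem_map.1 hl
    simpa [Fin.removeNth] using hs _ (by simpa [ht] using hl')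

lemma brC_swap (V W : RV d → CV d) (x : RV d) : brC V W x = - brC W V x := by
  simp [brC]

lemma dV_sum_smul {L : Fin n → RV d → CV d} {x : RV d} (hL : ∀ j, DifferentiableAt ℝ (L j) x)
    (g : Fin n → ℂ) (V : CV d) :
    dV V (fun y => ∑ l, g l • L l y) x = ∑ l, g l • dV V (L l) x := by
  funext r
  have hc : ∀ l, DifferentiableAt ℝ (fun y => L l y r) x := fun l => differentiableAt_pi.1 (hL l) r
  simp only [dV, Finset.sum_apply, Pi.smul_apply, smul_eq_mul]
  rw [dC_sum _ _ fun l _ => (hc l).const_mul _]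
  exact Finset.sum_congr rfl fun l _ => dC_const_mul V _ (hc l)

lemma dV_vec_sum_smul {W : RV d → CV d} {x : RV d} (g : Fin n → ℂ) (V : Fin n → CV d) :
    dV (∑ l, g l • V l) W x = ∑ l, g l • dV (V l) W x := by
  funext r
  simp only [dV, dC, Finset.sum_apply, Pi.smul_apply, smul_eq_mul, map_sum, map_smul]

/-- With constant coefficients no derivative falls on them, so the bracket is a combination of the
vanishing brackets of the frame. -/
lemma brC_frame_eq_zero {L : Fin n → RV d → CV d} {x : RV d}
    (hL : ∀ j, DifferentiableAt ℝ (L j) x) (hcomm : ∀ i j, brC (L i) (L j) x = 0)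
    (g h : Fin n → ℂ) :
    brC (fun y => ∑ l, g l • L l y) (fun y => ∑ l, h l • L l y) x = 0 := by
  have hc : ∀ i j, dV (L i x) (L j) x = dV (L j x) (L i) x := fun i j => sub_eq_zero.1 (hcomm i j)
  simp only [brC]
  rw [dV_sum_smul hL, dV_sum_smul hL]
  simp_rw [dV_vec_sum_smul, Finset.smul_sum]
  rw [Finset.sum_comm, sub_eq_zero]
  exact Finset.sum_congr rfl fun i _ => Finset.sum_congr rfl fun j _ => by
    rw [hc i j, smul_comm]

/-- The exterior derivative preserves the filtration defined by an involutive frame. -/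
theorem filt_extDeriv {L : Fin n → RV d → CV d} {x : RV d} (hL : ∀ j, DifferentiableAt ℝ (L j) x)
    (hcomm : ∀ i j, brC (L i) (L j) x = 0) {p m : ℕ} {F : RV d → Alt d m}
    (hF : DifferentiableAt ℝ F x) (hFil : ∀ᶠ y in 𝓝 x, F y ∈ Filt (T01 L y) p m) :
    extDeriv F x ∈ Filt (T01 L x) p (m + 1) := by
  intro Z s hs hZ
  rcases m with _ | m
  · rw [altC_extDeriv_zero hF]
    have hp : 0 < p := by
      have : s.card ≤ 1 := by simpa using Finset.card_le_univ s
      omega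
    have : (fun y => altC (F y) ![]) =ᶠ[𝓝 x] fun _ => 0 := by
      filter_upwards [hFil] with y hy
      exact hy _ ∅ (by simpa using hp) (by simp)
    rw [dC_congr _ this, dC_const]
  have hg : ∀ j, ∃ g : Fin n → ℂ, j ∈ s → Z j = ∑ l, g l • L l x := by
    intro j
    by_cases hj : j ∈ s
    · obtain ⟨g, hg⟩ := (Submodule.mem_span_range_iff_exists_fun ℂ).1 (hZ j hj)
      exact ⟨g, fun _ => hg.symm⟩
    · exact ⟨0, fun h => absurd h hj⟩
  choose g hg using hg
  classical
  -- Arguments in the span of the frame are extended by combinations of the frame with constant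
  -- coefficients, the others as constants. Then the extensions stay in `T01` and those with index
  -- in `s` commute at `x`.
  set Zf : Fin (m + 2) → RV d → CV d := fun j y => if j ∈ s then ∑ l, g j l • L l y else Z j with hZf
  have hZx : (fun i => Zf i x) = Z := by
    funext j
    by_cases hj : j ∈ s
    · simp [hZf, hj, (hg j hj).symm]
    · simp [hZf, hj]
  have hmem : ∀ y, ∀ j ∈ s, Zf j y ∈ T01 L y := by
    intro y j hj
    simp only [hZf, hj, if_true]
    exact Submodule.sum_mem _ fun l _ => Submodule.smul_mem _ _ (Submodule.subset_span ⟨l, rfl⟩)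
  have hd : ∀ j, DifferentiableAt ℝ (Zf j) x := by
    intro j
    by_cases hj : j ∈ s
    · simp only [hZf, hj, if_true]
      exact DifferentiableAt.fun_sum fun l _ => (hL l).const_smul (g j l)
    · simp only [hZf, hj, if_false]; exact differentiableAt_const _
  have key := altC_extDeriv_fields hF hd
  rw [hZx] at key
  rw [key, Finset.sum_eq_zero, Finset.sum_eq_zero, sub_zero]
  · intro i _
    refine Finset.sum_eq_zero fun j hj => ?_
    have hij : i ≤ j := by simpa using hj
    -- If both bracketed slots are in `s` the bracket vanishes; otherwise at most one argument in
    -- `T01` is lost, and the remaining count still forces zero.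
    by_cases hb : i.castSucc ∈ s ∧ j.succ ∈ s
    · have : brC (Zf i.castSucc) (Zf j.succ) x = 0 := by
        simp only [hZf, hb.1, hb.2, if_true]
        exact brC_frame_eq_zero hL hcomm _ _
      rw [this, (altC (F x)).map_coord_zero 0 (by simp), mul_zero]
    · rw [Filt.bracket_eq_zero hFil.self_of_nhds hZ hij, mul_zero]
      have : (if i.castSucc ∈ s then 1 else 0) + (if j.succ ∈ s then 1 else 0) ≤ 1 := by
        by_cases h1 : i.castSucc ∈ s
        · have h2 : j.succ ∉ s := fun h2 => hb ⟨h1, h2⟩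
          simp [h2]; split_ifs <;> simp
        · simp [h1]; split_ifs <;> simp
      omega
  · intro i _
    have : (fun y => altC (F y) (i.removeNth fun l => Zf l y)) =ᶠ[𝓝 x] fun _ => 0 := by
      filter_upwards [hFil] with y hy
      refine Filt.removeNth_eq_zero hy (hmem y) ?_
      have : (if i ∈ s then 1 else 0) ≤ 1 := by split_ifs <;> simp
      omega
    rw [dC_congr _ this, dC_const, mul_zero]

/-- The value of `dF` on a family of vector fields, for `F` in the filtration: up to an error that is
controlled by the mixed brackets, only derivatives along the frame contribute. -/
theorem extDeriv_eval {L : Fin n → RV d → CV d} {x : RV d} {p m : ℕ} {F : RV d → Alt d m}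
    {Z : Fin (m + 1) → RV d → CV d} {s : Finset (Fin (m + 1))} (hs : p + s.card = m + 1)
    (hF : DifferentiableAt ℝ F x) (hZ : ∀ i, DifferentiableAt ℝ (Z i) x)
    (hmem : ∀ᶠ y in 𝓝 x, ∀ j ∈ s, Z j y ∈ T01 L y)
    (hFil : ∀ᶠ y in 𝓝 x, F y ∈ Filt (T01 L y) p m)
    (hcomm : ∀ i ∈ s, ∀ j ∈ s, brC (Z i) (Z j) x = 0) {A B : ℝ} (hA : ∀ i, ‖Z i x‖ ≤ A)
    (hA1 : 1 ≤ A) (hB0 : 0 ≤ B) (hB : ∀ i ∉ s, ∀ j ∈ s, ‖brC (Z i) (Z j) x‖ ≤ B) :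
    ‖altC (extDeriv F x) (fun i => Z i x) - ∑ i ∈ s, (-1 : ℂ) ^ (i : ℕ) *
      dC (Z i x) (fun y => altC (F y) (i.removeNth fun l => Z l y)) x‖ ≤
      (m : ℝ) ^ 2 * ((d : ℝ) ^ m * ‖F x‖ * (B * A ^ m)) := by
  rcases m with _ | m
  · have hx : altC (extDeriv F x) (fun i => Z i x) =
        dC (Z 0 x) (fun y => altC (F y) ![]) x := altC_extDeriv_zero hF
    have h0 : ∑ i ∈ s, (-1 : ℂ) ^ (i : ℕ) *
        dC (Z i x) (fun y => altC (F y) (i.removeNth fun l => Z l y)) x =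
        dC (Z 0 x) (fun y => altC (F y) ![]) x := by
      have e : ∀ y, altC (F y) (Fin.removeNth 0 fun l => Z l y) = altC (F y) ![] := fun y => by
        congr 1; exact Subsingleton.elim _ _
      have hsc : s.card ≤ 1 := by simpa using Finset.card_le_univ s
      by_cases hs1 : s.card = 1
      · obtain ⟨a, ha⟩ := Finset.card_eq_one.1 hs1
        have : a = 0 := Fin.fin_one_eq_zero a
        subst this
        rw [ha, Finset.sum_singleton, funext e, Fin.val_zero, pow_zero, one_mul]
      · have hs0 : s = ∅ := Finset.card_eq_zero.1 (by omega)
        rw [hs0, Finset.sum_empty]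
        have : (fun y => altC (F y) ![]) =ᶠ[𝓝 x] fun _ => 0 := by
          filter_upwards [hFil] with y hy
          refine hy _ ∅ ?_ (by simp)
          simp only [Finset.card_empty]
          simp only [hs0, Finset.card_empty] at hs
          omega
        rw [dC_congr _ this, dC_const]
    rw [hx, h0]; simp
  · have hmx := hmem.self_of_nhds
    have hFx := hFil.self_of_nhds
    rw [altC_extDeriv_fields hF hZ]
    -- Deleting a slot outside `s` keeps all the arguments in `T01`, one more than level `p` allows,
    -- so only derivatives along slots in `s` survive.
    have h1 : ∑ i : Fin (m + 2), (-1 : ℂ) ^ (i : ℕ) *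
        dC (Z i x) (fun y => altC (F y) (i.removeNth fun l => Z l y)) x =
        ∑ i ∈ s, (-1 : ℂ) ^ (i : ℕ) *
        dC (Z i x) (fun y => altC (F y) (i.removeNth fun l => Z l y)) x := by
      symm
      refine Finset.sum_subset (Finset.subset_univ s) fun i _ hi => ?_
      have : (fun y => altC (F y) (i.removeNth fun l => Z l y)) =ᶠ[𝓝 x] fun _ => 0 := by
        filter_upwards [hFil, hmem] with y hy hy'
        exact Filt.removeNth_eq_zero hy hy' (by simp only [hi, if_false]; omega)
      rw [dC_congr _ this, dC_const, mul_zero]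
    rw [h1, sub_sub_cancel_left, norm_neg]
    have hterm : ∀ i j : Fin (m + 1), i ≤ j → ‖(-1 : ℂ) ^ (i + j : ℕ) *
        altC (F x) (Matrix.vecCons (brC (Z i.castSucc) (Z j.succ) x)
          (j.removeNth (i.castSucc.removeNth fun l => Z l x)))‖ ≤
        (d : ℝ) ^ (m + 1) * ‖F x‖ * (B * A ^ (m + 1)) := by
      intro i j hij
      have hpos : 0 ≤ (d : ℝ) ^ (m + 1) * ‖F x‖ * (B * A ^ (m + 1)) := by positivity
      rw [norm_mul, norm_pow, norm_neg, norm_one, one_pow, one_mul]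
      have hbnd : ‖brC (Z i.castSucc) (Z j.succ) x‖ ≤ B →
          ‖altC (F x) (Matrix.vecCons (brC (Z i.castSucc) (Z j.succ) x)
            (j.removeNth (i.castSucc.removeNth fun l => Z l x)))‖ ≤
          (d : ℝ) ^ (m + 1) * ‖F x‖ * (B * A ^ (m + 1)) := by
        intro hb
        refine (norm_altC_le _ _).trans ?_
        gcongr
        rw [Fin.prod_univ_succ]
        simp only [Matrix.cons_val_zero, Matrix.cons_val_succ]
        have : ∏ l : Fin m, ‖j.removeNth (i.castSucc.removeNth fun l => Z l x) l‖ ≤ A ^ m := by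
          have := Finset.prod_le_prod (s := Finset.univ)
            (f := fun l => ‖j.removeNth (i.castSucc.removeNth fun l => Z l x) l‖)
            (g := fun _ : Fin m => A) (fun _ _ => norm_nonneg _) (fun l _ => hA _)
          simpa using this
        have hAm : A ^ m ≤ A ^ (m + 1) := pow_le_pow_right₀ hA1 (by omega)
        exact mul_le_mul hb (this.trans hAm) (Finset.prod_nonneg fun _ _ => norm_nonneg _) hB0
      -- Two slots of `s` commute; two slots outside `s` leave too many arguments in `T01`. Only the
      -- mixed brackets remain, and they are bounded by `B`.
      by_cases ha : i.castSucc ∈ s <;> by_cases hb : j.succ ∈ s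
      · rw [hcomm _ ha _ hb, (altC (F x)).map_coord_zero 0 (by simp), norm_zero]; exact hpos
      · refine hbnd ?_
        rw [brC_swap, norm_neg]; exact hB _ hb _ ha
      · exact hbnd (hB _ ha _ hb)
      · rw [Filt.bracket_eq_zero hFx hmx hij _ (by simp only [ha, hb, if_false]; omega), norm_zero]
        exact hpos
    refine (norm_sum_le _ _).trans ?_
    have : ∀ i : Fin (m + 1), ‖∑ j ≥ i, (-1 : ℂ) ^ (i + j : ℕ) *
        altC (F x) (Matrix.vecCons (brC (Z i.castSucc) (Z j.succ) x)
          (j.removeNth (i.castSucc.removeNth fun l => Z l x)))‖ ≤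
        ((m + 1 : ℕ) : ℝ) * ((d : ℝ) ^ (m + 1) * ‖F x‖ * (B * A ^ (m + 1))) := by
      intro i
      refine (norm_sum_le _ _).trans ?_
      refine (Finset.sum_le_sum fun j hj => hterm i j (by simpa using hj)).trans ?_
      rw [Finset.sum_const, nsmul_eq_mul]
      gcongr
      simpa using Finset.card_le_univ (Finset.Ici i)
    refine (Finset.sum_le_sum fun i _ => this i).trans (le_of_eq ?_)
    simp only [Finset.sum_const, Finset.card_univ, Fintype.card_fin, nsmul_eq_mul]
    ring

variable {d : ℕ}

/-! ### Components of forms -/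

/-- The components of a form with respect to the standard basis. -/
def comps (d m : ℕ) : Alt d m →ₗ[ℝ] ((Fin m → Fin d) → ℂ) where
  toFun α r := α fun j => ev (r j)
  map_add' _ _ := rfl
  map_smul' _ _ := rfl

lemma comps_injective (d m : ℕ) : Function.Injective (comps d m) := by
  intro α β h
  ext v
  rw [← altC_incl, ← altC_incl, altC_apply, altC_apply]
  exact Finset.sum_congr rfl fun r _ => by rw [show α (fun j => ev (r j)) = β fun j => ev (r j) from
    congrFun h r]

instance (d m : ℕ) : FiniteDimensional ℝ (Alt d m) :=
  Module.Finite.of_injective (comps d m) (comps_injective d m)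

/-- A left inverse, continuous by finite dimension, so that smoothness and flatness of fields of
forms can be checked on components. -/
lemma exists_comps_inverse (d m : ℕ) : ∃ A : ((Fin m → Fin d) → ℂ) →L[ℝ] Alt d m,
    ∀ α, A (comps d m α) = α := by
  obtain ⟨g, hg⟩ := (comps d m).exists_leftInverse_of_injective
    (LinearMap.ker_eq_bot.2 (comps_injective d m))
  exact ⟨LinearMap.toContinuousLinearMap g, fun α => LinearMap.congr_fun hg α⟩

lemma contDiff_of_comps {E : Type*} [NormedAddCommGroup E] [NormedSpace ℝ E] {m : ℕ}
    {F : E → Alt d m} {N : WithTop ℕ∞} (h : ∀ r : Fin m → Fin d, ContDiff ℝ N fun x => F x fun j => ev (r j)) :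
    ContDiff ℝ N F := by
  obtain ⟨A, hA⟩ := exists_comps_inverse d m
  have : F = fun x => A (fun r => F x fun j => ev (r j)) := funext fun x => (hA (F x)).symm
  rw [this]
  exact A.contDiff.comp (contDiff_pi.2 h)

lemma contDiff_comp_ev {E : Type*} [NormedAddCommGroup E] [NormedSpace ℝ E] {m : ℕ}
    {F : E → Alt d m} {N : WithTop ℕ∞} (h : ContDiff ℝ N F) (r : Fin m → Fin d) :
    ContDiff ℝ N fun x => F x fun j => ev (r j) :=
  contDiff_pi.1 ((LinearMap.toContinuousLinearMap (comps d m)).contDiff.comp h) r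

lemma flat_pi {E ι : Type} [NormedAddCommGroup E] [NormedSpace ℝ E] [Fintype ι] {m : ℕ}
    {f : E → ι → ℂ} (h : ∀ r, Flat m fun x => f x r) (sf : ∀ r, ContDiff ℝ ∞ fun x => f x r) :
    Flat m f := by
  classical
  have : f = fun x => ∑ r, ContinuousLinearMap.single ℝ (fun _ : ι => ℂ) r (f x r) := by
    funext x r
    simp [Finset.sum_apply, Pi.single_apply]
  rw [this]
  exact Flat.sum _ (fun r _ => (h r).clm (sf r) _) fun r _ =>
    (ContinuousLinearMap.contDiff _).comp (sf r)

lemma flat_of_comps {m N : ℕ} {F : RV d → Alt d m}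
    (h : ∀ r : Fin m → Fin d, Flat N fun x => F x fun j => ev (r j))
    (sF : ∀ r : Fin m → Fin d, ContDiff ℝ ∞ fun x => F x fun j => ev (r j)) : Flat N F := by
  obtain ⟨A, hA⟩ := exists_comps_inverse d m
  have : F = fun x => A (fun r => F x fun j => ev (r j)) := funext fun x => (hA (F x)).symm
  rw [this]
  exact (flat_pi h sF).clm (contDiff_pi.2 sF) A

lemma contDiff_extDeriv {m : ℕ} {F : RV d → Alt d m} (sF : ContDiff ℝ ∞ F) :
    ContDiff ℝ ∞ (extDeriv F) := by
  have h : ContDiff ℝ ∞ fun x =>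
      ContinuousAlternatingMap.alternatizeUncurryFinCLM ℝ (RV d) ℂ (fderiv ℝ F x) :=
    (ContinuousLinearMap.contDiff _).comp (contDiff_fderiv sF)
  exact h

lemma Flat.extDeriv {m N : ℕ} {F : RV d → Alt d m} (hF : Flat N F) (sF : ContDiff ℝ ∞ F) :
    Flat (N - 1) (extDeriv F) :=
  hF.deriv_flat.clm (contDiff_fderiv sF)
    (ContinuousAlternatingMap.alternatizeUncurryFinCLM ℝ (RV d) ℂ)

/-! ### Decomposable forms -/

/-- The determinant as a real multilinear form. -/
def detC (m : ℕ) : (Fin m → ℂ) [⋀^Fin m]→L[ℝ] ℂ where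
  toFun v := Matrix.detRowAlternating (R := ℂ) (n := Fin m) v
  map_update_add' v i x y := AlternatingMap.map_update_add _ v i x y
  map_update_smul' v i c x := by
    have := (Matrix.detRowAlternating (R := ℂ) (n := Fin m)).map_update_smul v i (c : ℂ) x
    rw [Complex.coe_smul, Complex.coe_smul] at this
    convert this
  map_eq_zero_of_eq' v i j h hij := AlternatingMap.map_eq_zero_of_eq _ v h hij
  cont := by
    show Continuous fun v : Fin m → Fin m → ℂ => Matrix.det (Matrix.of v)
    simp only [Matrix.det_apply, Matrix.of_apply]
    fun_prop

/-- The exterior product of one-forms. -/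
def detForm {m : ℕ} (l : Fin m → RV d →L[ℝ] ℂ) : Alt d m :=
  (detC m).compContinuousLinearMap (ContinuousLinearMap.pi l)

lemma detForm_apply {m : ℕ} (l : Fin m → RV d →L[ℝ] ℂ) (v : Fin m → RV d) :
    detForm l v = Matrix.det (Matrix.of fun j i => l i (v j)) := rfl

/-- The determinant is already complex multilinear, so the extension only complexifies the
covectors. -/
lemma altC_detForm {m : ℕ} (l : Fin m → RV d →L[ℝ] ℂ) (Z : Fin m → CV d) :
    altC (detForm l) Z = Matrix.det (Matrix.of fun j i => cext (l i) (Z j)) := by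
  have h := (Matrix.detRowAlternating (R := ℂ) (n := Fin m)).toMultilinearMap.map_sum
    (fun j (r : Fin d) => Z j r • fun i => l i (ev r))
  have h1 : Matrix.det (Matrix.of fun j i => cext (l i) (Z j)) =
      Matrix.detRowAlternating (R := ℂ) (n := Fin m)
        fun j => ∑ r, Z j r • fun i => l i (ev r) := by
    show Matrix.det _ = Matrix.det _
    congr 1
    ext j i
    simp [cext_apply, Finset.sum_apply]
  rw [h1, altC_apply]
  refine Eq.trans ?_ h.symm
  refine Finset.sum_congr rfl fun r _ => ?_
  exact ((Matrix.detRowAlternating (R := ℂ) (n := Fin m)).toMultilinearMap.map_smul_univ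
    (fun j => Z j (r j)) (fun j i => l i (ev (r j)))).symm

/-- Pigeonhole: with more than m - |R| arguments in `T`, every permutation pairs some covector of
`R` with an argument in `T`, and that factor is zero. -/
lemma detForm_mem_filt {T : Submodule ℂ (CV d)} {m : ℕ} {l : Fin m → RV d →L[ℝ] ℂ}
    (R : Finset (Fin m)) (h : ∀ i ∈ R, ∀ Z ∈ T, cext (l i) Z = 0) :
    detForm l ∈ Filt T R.card m := by
  intro Z s hs hZ
  rw [altC_detForm, Matrix.det_apply]
  refine Finset.sum_eq_zero fun σ _ => ?_
  have : ∃ i ∈ R, σ i ∈ s := by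
    by_contra hne
    push Not at hne
    have hd : Disjoint (R.map σ.toEmbedding) s := by
      rw [Finset.disjoint_left]
      intro a ha
      obtain ⟨i, hi, rfl⟩ := Finset.mem_map.1 ha
      exact hne i hi
    have := Finset.card_le_univ (R.map σ.toEmbedding ∪ s)
    rw [Finset.card_union_of_disjoint hd, Finset.card_map, Fintype.card_fin] at this
    omega
  obtain ⟨i, hi, hi'⟩ := this
  rw [Finset.prod_eq_zero (Finset.mem_univ i), smul_zero]
  exact h i hi _ (hZ _ hi')

lemma contDiff_detForm {m : ℕ} {l : Fin m → RV d → RV d →L[ℝ] ℂ} (hl : ∀ i, ContDiff ℝ ∞ (l i)) :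
    ContDiff ℝ ∞ fun x => detForm fun i => l i x := by
  refine contDiff_of_comps fun r => ?_
  simp only [detForm_apply, Matrix.det_apply, Matrix.of_apply]
  refine ContDiff.sum fun σ _ => ContDiff.const_smul _ (contDiff_prod fun i _ => ?_)
  exact (hl i).clm_apply contDiff_const

/-- Products of smooth functions that are close to each other to high order. -/
lemma flat_prod_sub {ι : Type*} {N : ℕ} (s : Finset ι) {f g : ι → RV d → ℂ}
    (h : ∀ i ∈ s, Flat N fun x => f i x - g i x) (sf : ∀ i, ContDiff ℝ ∞ (f i))
    (sg : ∀ i, ContDiff ℝ ∞ (g i)) : Flat N fun x => ∏ i ∈ s, f i x - ∏ i ∈ s, g i x := by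
  classical
  induction s using Finset.induction_on with
  | empty => simpa using flat_fun_zero N
  | insert a s ha ih =>
    have h1 := (h a (by simp)).mul_right ((sf a).sub (sg a)) (contDiff_prod fun i (_ : i ∈ s) => sf i)
    have h2 := (ih fun i hi => h i (by simp [hi])).mul_left (sg a)
      ((contDiff_prod fun i (_ : i ∈ s) => sf i).sub (contDiff_prod fun i (_ : i ∈ s) => sg i))
    refine (h1.add h2 (((sf a).sub (sg a)).mul (contDiff_prod fun i (_ : i ∈ s) => sf i))
      ((sg a).mul ((contDiff_prod fun i (_ : i ∈ s) => sf i).sub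
        (contDiff_prod fun i (_ : i ∈ s) => sg i)))).congr (Eventually.of_forall fun x => ?_)
    simp only [Finset.prod_insert ha]; ring

lemma flat_detForm_sub {m N : ℕ} {l l' : Fin m → RV d → RV d →L[ℝ] ℂ}
    (h : ∀ i, Flat N fun x => l i x - l' i x) (sl : ∀ i, ContDiff ℝ ∞ (l i))
    (sl' : ∀ i, ContDiff ℝ ∞ (l' i)) :
    Flat N fun x => detForm (fun i => l i x) - detForm fun i => l' i x := by
  have se : ∀ (k : Fin m → RV d → RV d →L[ℝ] ℂ) (_ : ∀ i, ContDiff ℝ ∞ (k i)) (i : Fin m) (v : RV d),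
      ContDiff ℝ ∞ fun x => k i x v := fun k hk i v => (hk i).clm_apply contDiff_const
  have sp : ∀ (k : Fin m → RV d → RV d →L[ℝ] ℂ) (_ : ∀ i, ContDiff ℝ ∞ (k i)) (v : Fin m → RV d),
      ContDiff ℝ ∞ fun x => ∏ i, k i x (v i) := fun k hk v => contDiff_prod fun i _ => se k hk i _
  refine flat_of_comps (fun r => ?_) fun r => ?_
  · simp only [ContinuousAlternatingMap.sub_apply, detForm_apply, Matrix.det_apply, Matrix.of_apply,
      ← Finset.sum_sub_distrib, ← smul_sub]
    refine Flat.sum _ (fun σ _ => ?_) fun σ _ => ((sp l sl _).sub (sp l' sl' _)).const_smul _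
    have := flat_prod_sub (N := N) Finset.univ (f := fun i x => l i x (ev (r (σ i))))
      (g := fun i x => l' i x (ev (r (σ i)))) (fun i _ => by
        have := (h i).clm ((sl i).sub (sl' i)) (ContinuousLinearMap.apply ℝ ℂ (ev (r (σ i))))
        simpa using this)
      (fun i => se l sl i _) fun i => se l' sl' i _
    have h2 := this.clm ((sp l sl _).sub (sp l' sl' _))
      ((((Equiv.Perm.sign σ : ℤˣ) : ℤ) : ℝ) • ContinuousLinearMap.id ℝ ℂ)
    refine h2.congr (Eventually.of_forall fun x => ?_)
    simp [Units.smul_def]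
  · exact contDiff_comp_ev ((contDiff_detForm sl).sub (contDiff_detForm sl')) r

/-- The form is the pull-back of a constant form by the map with components `z i`, and the exterior
derivative commutes with pull-back. -/
lemma extDeriv_detForm_fderiv {m : ℕ} {z : Fin m → RV d → ℂ} (hz : ∀ i, ContDiff ℝ ∞ (z i))
    (x : RV d) : extDeriv (fun y => detForm fun i => fderiv ℝ (z i) y) x = 0 := by
  have hp := extDeriv_pullback (𝕜 := ℝ) (f := fun y i => z i y) (x := x) (r := ∞)
    (differentiableAt_const (detC m)) (contDiff_pi.2 hz).contDiffAt
    (by simpa using two_le_infty)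
  have h1 : (fun y => (detC m).compContinuousLinearMap (fderiv ℝ (fun y i => z i y) y)) =
      fun y => detForm fun i => fderiv ℝ (z i) y := by
    funext y
    rw [fderiv_pi fun i => (hz i).differentiable (by simp) y]
    rfl
  rw [← h1, hp]
  have h0 : extDeriv (fun _ : Fin m → ℂ => detC m) (fun i => z i x) = 0 := by
    rw [extDeriv, fderiv_fun_const]
    exact map_zero (ContinuousAlternatingMap.alternatizeUncurryFinCLM ℝ (Fin m → ℂ) ℂ)
  rw [h0]; rfl

/-- The Leibniz rule; expanding the determinant along its first column is the alternating sum that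
defines the exterior derivative. -/
lemma extDeriv_smul_detForm {m : ℕ} {B : RV d → ℂ} {l : Fin m → RV d → RV d →L[ℝ] ℂ} {x : RV d}
    (hB : DifferentiableAt ℝ B x) (hD : DifferentiableAt ℝ (fun y => detForm fun i => l i y) x) :
    extDeriv (fun y => B y • detForm fun i => l i y) x =
      detForm (Fin.cons (fderiv ℝ B x) fun i => l i x) +
        B x • extDeriv (fun y => detForm fun i => l i y) x := by
  ext v
  rw [ContinuousAlternatingMap.add_apply, ContinuousAlternatingMap.smul_apply, detForm_apply,
    Matrix.det_succ_column_zero]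
  simp only [extDeriv, ContinuousAlternatingMap.alternatizeUncurryFin_apply]
  rw [fderiv_fun_smul hB hD, Finset.smul_sum, ← Finset.sum_add_distrib]
  refine Finset.sum_congr rfl fun i _ => ?_
  have hdet : ((Matrix.of fun j i => (Fin.cons (fderiv ℝ B x) (fun i => l i x) :
      Fin (m + 1) → RV d →L[ℝ] ℂ) i (v j)).submatrix i.succAbove Fin.succ).det =
      detForm (fun i => l i x) (i.removeNth v) := rfl
  rw [hdet]
  simp only [ContinuousLinearMap.add_apply, ContinuousLinearMap.smul_apply,
    ContinuousAlternatingMap.add_apply, ContinuousAlternatingMap.smul_apply,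
    ContinuousLinearMap.smulRight_apply, Matrix.of_apply, Fin.cons_zero, zsmul_eq_mul, smul_eq_mul]
  push_cast
  ring

lemma detForm_cons_sum {m : ℕ} {ι : Type*} (s : Finset ι) (c : ι → ℂ) (k : ι → RV d →L[ℝ] ℂ)
    (l : Fin m → RV d →L[ℝ] ℂ) (k₀ : RV d →L[ℝ] ℂ) :
    detForm (Fin.cons (k₀ + ∑ j ∈ s, c j • k j) l : Fin (m + 1) → RV d →L[ℝ] ℂ) =
      detForm (Fin.cons k₀ l : Fin (m + 1) → RV d →L[ℝ] ℂ) +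
      ∑ j ∈ s, c j • detForm (Fin.cons (k j) l : Fin (m + 1) → RV d →L[ℝ] ℂ) := by
  ext v
  have : ∀ k' : RV d →L[ℝ] ℂ, detForm (Fin.cons k' l : Fin (m + 1) → RV d →L[ℝ] ℂ) v =
      ∑ i : Fin (m + 1), (-1) ^ (i : ℕ) * k' (v i) * detForm l (i.removeNth v) := by
    intro k'
    rw [detForm_apply, Matrix.det_succ_column_zero]
    rfl
  rw [ContinuousAlternatingMap.add_apply, this, this, ContinuousAlternatingMap.sum_apply]
  simp only [ContinuousAlternatingMap.smul_apply, this, smul_eq_mul, ContinuousLinearMap.add_apply,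
    sum_smul_apply, Finset.mul_sum]
  rw [Finset.sum_comm, ← Finset.sum_add_distrib]
  refine Finset.sum_congr rfl fun i _ => ?_
  rw [mul_add, add_mul, Finset.mul_sum, Finset.sum_mul]
  congr 1
  exact Finset.sum_congr rfl fun j _ => by ring

lemma detForm_eq_zero {m : ℕ} {l : Fin m → RV d →L[ℝ] ℂ} {i j : Fin m} (hij : i ≠ j)
    (h : l i = l j) : detForm l = 0 := by
  ext v
  rw [detForm_apply]
  exact Matrix.det_zero_of_column_eq hij fun a => by simp [h]

variable {d : ℕ}

/-! ### Oscillating exponentials with flat amplitudes -/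

/-- From `exp u ≥ u ^ m / m!` with `u = c t²`, after replacing `t ^ m` by `1 + (t ^ 2) ^ m` so as to
reach an even power. -/
lemma exists_pow_mul_exp_bound (m : ℕ) {c : ℝ} (hc : 0 < c) :
    ∃ C : ℝ, 0 ≤ C ∧ ∀ t : ℝ, 0 ≤ t → t ^ m * Real.exp (-(c * t ^ 2)) ≤ C := by
  refine ⟨1 + m.factorial / c ^ m, by positivity, fun t ht => ?_⟩
  have h1 : (c * t ^ 2) ^ m / m.factorial ≤ Real.exp (c * t ^ 2) :=
    Real.pow_div_factorial_le_exp _ (by positivity) m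
  have h2 : t ^ m ≤ 1 + (t ^ 2) ^ m := by
    rw [← pow_mul, mul_comm, pow_mul]
    nlinarith [sq_nonneg (t ^ m - 1), sq_nonneg (t ^ m)]
  have h3 : (t ^ 2) ^ m ≤ m.factorial / c ^ m * Real.exp (c * t ^ 2) := by
    rw [div_le_iff₀ (by positivity), mul_pow] at h1
    rw [div_mul_eq_mul_div, le_div_iff₀ (by positivity)]
    linarith
  have h4 : 1 ≤ Real.exp (c * t ^ 2) := Real.one_le_exp (by positivity)
  rw [Real.exp_neg, ← div_eq_mul_inv, div_le_iff₀ (Real.exp_pos _)]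
  nlinarith

/-- The oscillating factor `exp (σ² φ)`. -/
def osc (σ : ℝ) (φ : RV d → ℂ) (x : RV d) : ℂ := Complex.exp ((σ : ℂ) ^ 2 * φ x)

lemma contDiff_osc (σ : ℝ) {φ : RV d → ℂ} (hφ : ContDiff ℝ ∞ φ) : ContDiff ℝ ∞ (osc σ φ) :=
  (contDiff_const.mul hφ).cexp

lemma hasFDerivAt_osc (σ : ℝ) {φ : RV d → ℂ} (hφ : ContDiff ℝ ∞ φ) (x : RV d) :
    HasFDerivAt (osc σ φ) ((osc σ φ x * (σ : ℂ) ^ 2) • fderiv ℝ φ x) x := by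
  have h := (((hφ.differentiable (by simp)) x).hasFDerivAt.const_mul ((σ : ℂ) ^ 2)).cexp
  rw [smul_smul] at h
  exact h

lemma norm_osc (σ : ℝ) (φ : RV d → ℂ) (x : RV d) :
    ‖osc σ φ x‖ = Real.exp (σ ^ 2 * (φ x).re) := by
  rw [osc, Complex.norm_exp, ← Complex.ofReal_pow, Complex.re_ofReal_mul]

/-- The bilinear map `(l, v) ↦ (u ↦ l u • v)`. -/
def tens (d : ℕ) (V : Type) [NormedAddCommGroup V] [NormedSpace ℝ V] [NormedSpace ℂ V]
    [IsScalarTower ℝ ℂ V] : (RV d →L[ℝ] ℂ) →L[ℝ] V →L[ℝ] (RV d →L[ℝ] V) :=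
  ((ContinuousLinearMap.compL ℝ (RV d) ℂ V).comp
    (ContinuousLinearMap.lsmul ℝ ℂ : ℂ →L[ℝ] V →L[ℝ] V).flip).flip

lemma tens_apply (V : Type) [NormedAddCommGroup V] [NormedSpace ℝ V] [NormedSpace ℂ V]
    [IsScalarTower ℝ ℂ V] (l : RV d →L[ℝ] ℂ) (v : V) (u : RV d) : tens d V l v u = l u • v := rfl

/-- Flatness gives a factor `‖x‖ ^ m` and the real part of the phase a Gaussian in `σ ‖x‖`; the
product is `σ ^ (-m)` times a bounded function of `σ ‖x‖`. -/
lemma exp_flat_bound_zero {V : Type} [NormedAddCommGroup V] [NormedSpace ℝ V] [NormedSpace ℂ V]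
    {φ : RV d → ℂ} {c : ℝ} (hc : 0 < c) {m : ℕ} {G : RV d → V}
    (sG : ContDiff ℝ ∞ G) (cG : HasCompactSupport G) (fG : Flat m G)
    (hre : ∀ x ∈ tsupport G, (φ x).re ≤ -(c * ‖x‖ ^ 2)) :
    ∃ C : ℝ, 0 ≤ C ∧ ∀ σ : ℝ, 1 ≤ σ → ∀ x, ‖osc σ φ x • G x‖ * σ ^ m ≤ C := by
  obtain ⟨R, hR⟩ := cG.isCompact.isBounded.exists_norm_le
  obtain ⟨C, hC0, hC⟩ := fG.bound sG R
  obtain ⟨C', hC'0, hC'⟩ := exists_pow_mul_exp_bound m hc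
  refine ⟨C * C', by positivity, fun σ hσ x => ?_⟩
  by_cases hx : x ∈ tsupport G
  · rw [norm_smul, norm_osc]
    have h1 := hC' (σ * ‖x‖) (by positivity)
    have h2 : Real.exp (σ ^ 2 * (φ x).re) ≤ Real.exp (-(c * (σ * ‖x‖) ^ 2)) := by
      apply Real.exp_le_exp.2
      have := mul_le_mul_of_nonneg_left (hre x hx) (sq_nonneg σ)
      linarith
    calc Real.exp (σ ^ 2 * (φ x).re) * ‖G x‖ * σ ^ m
        ≤ Real.exp (-(c * (σ * ‖x‖) ^ 2)) * (C * ‖x‖ ^ m) * σ ^ m := by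
          gcongr; exact hC x (hR x hx)
      _ = C * ((σ * ‖x‖) ^ m * Real.exp (-(c * (σ * ‖x‖) ^ 2))) := by ring
      _ ≤ C * C' := by gcongr
  · rw [image_eq_zero_of_notMem_tsupport hx]; simp; positivity

/-- A derivative either hits the exponential, which costs a factor `σ²` and keeps the flatness, or
hits `G`, which costs one order of flatness and hence a factor `σ`. The statement ranges over all
targets `V` and all orders `m`, because differentiation changes both. -/
theorem exp_flat_bound {φ : RV d → ℂ} (hφ : ContDiff ℝ ∞ φ) {c : ℝ} (hc : 0 < c) (i : ℕ) :
    ∀ {V : Type} [NormedAddCommGroup V] [NormedSpace ℝ V] [NormedSpace ℂ V] [IsScalarTower ℝ ℂ V]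
    {m : ℕ} {G : RV d → V}, ContDiff ℝ ∞ G → HasCompactSupport G → Flat m G →
    (∀ x ∈ tsupport G, (φ x).re ≤ -(c * ‖x‖ ^ 2)) →
    ∃ C : ℝ, 0 ≤ C ∧ ∀ σ : ℝ, 1 ≤ σ → ∀ x,
      ‖iteratedFDeriv ℝ i (fun y => osc σ φ y • G y) x‖ * σ ^ m ≤ C * σ ^ (2 * i) := by
  induction i with
  | zero =>
    intro V _ _ _ _ m G sG cG fG hre
    obtain ⟨C, hC0, hC⟩ := exp_flat_bound_zero hc sG cG fG hre
    exact ⟨C, hC0, fun σ hσ x => by simpa using hC σ hσ x⟩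
  | succ i ih =>
    intro V _ _ _ _ m G sG cG fG hre
    have sG1 := contDiff_fderiv sG
    have sG2 : ContDiff ℝ ∞ fun x => tens d V (fderiv ℝ φ x) (G x) :=
      (ContinuousLinearMap.isBoundedBilinearMap (tens d V)).contDiff.comp
        ((contDiff_fderiv hφ).prodMk sG)
    have hsub : tsupport (fun x => tens d V (fderiv ℝ φ x) (G x)) ⊆ tsupport G := by
      refine closure_mono fun x hx => ?_
      contrapose! hx
      simp only [Function.mem_support, not_not] at hx ⊢
      rw [hx, map_zero]
    have fG2 : Flat m fun x => tens d V (fderiv ℝ φ x) (G x) := by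
      have := (flat_zero (fderiv ℝ φ)).bilin (tens d V) fG (contDiff_fderiv hφ) sG
      rwa [zero_add] at this
    obtain ⟨C₁, hC₁0, hC₁⟩ := ih sG1 (cG.fderiv ℝ) fG.deriv_flat
      fun x hx => hre x (tsupport_fderiv_subset ℝ hx)
    obtain ⟨C₂, hC₂0, hC₂⟩ := ih sG2 (cG.of_isClosed_subset (isClosed_tsupport _) hsub) fG2
      fun x hx => hre x (hsub hx)
    refine ⟨C₁ + C₂, by positivity, fun σ hσ x => ?_⟩
    -- Both summands have the same shape as the original function, with amplitudes `fderiv ℝ G` and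
    -- `dφ ⊗ G`.
    have hd : fderiv ℝ (fun y => osc σ φ y • G y) = fun y => osc σ φ y • fderiv ℝ G y +
        (σ ^ 2) • (osc σ φ y • tens d V (fderiv ℝ φ y) (G y)) := by
      funext y
      have := (hasFDerivAt_osc σ hφ y).smul ((sG.differentiable (by simp)) y).hasFDerivAt
      rw [show (fun y => osc σ φ y • G y) = osc σ φ • G from rfl, this.fderiv]
      ext u
      simp only [ContinuousLinearMap.add_apply, ContinuousLinearMap.smul_apply,
        ContinuousLinearMap.smulRight_apply, tens_apply, smul_smul]
      congr 1
      rw [← smul_assoc]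
      congr 1
      simp only [smul_eq_mul, Complex.real_smul, Complex.ofReal_pow]; ring
    rw [← norm_iteratedFDeriv_fderiv, hd]
    have s1 : ContDiff ℝ ∞ fun y => osc σ φ y • fderiv ℝ G y := (contDiff_osc σ hφ).smul sG1
    have s2 : ContDiff ℝ ∞ fun y => osc σ φ y • tens d V (fderiv ℝ φ y) (G y) :=
      (contDiff_osc σ hφ).smul sG2
    have hi : ((i : ℕ) : WithTop ℕ∞) ≤ ∞ := by exact_mod_cast le_top
    rw [fun_iteratedFDeriv_add_apply (s1.of_le hi).contDiffAt ((s2.of_le hi).const_smul _).contDiffAt,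
      iteratedFDeriv_const_smul_apply' (s2.of_le hi).contDiffAt]
    have hσ0 : 0 ≤ σ := by linarith
    have e1 := hC₁ σ hσ x
    have e2 := hC₂ σ hσ x
    have e1' : ‖iteratedFDeriv ℝ i (fun y => osc σ φ y • fderiv ℝ G y) x‖ * σ ^ m ≤
        C₁ * σ ^ (2 * (i + 1)) := by
      -- The inequality also covers m = 0, where the subtraction truncates, since σ ≥ 1.
      have hm : σ ^ m ≤ σ ^ (m - 1) * σ := by
        rw [← pow_succ]; exact pow_le_pow_right₀ hσ (by omega)
      calc _ ≤ ‖iteratedFDeriv ℝ i (fun y => osc σ φ y • fderiv ℝ G y) x‖ * (σ ^ (m - 1) * σ) := by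
            gcongr
        _ ≤ C₁ * σ ^ (2 * i) * σ := by rw [← mul_assoc]; gcongr
        _ ≤ C₁ * σ ^ (2 * (i + 1)) := by
            rw [mul_assoc, ← pow_succ]
            gcongr
            omega
    have e2' : ‖σ ^ 2 • iteratedFDeriv ℝ i
        (fun y => osc σ φ y • tens d V (fderiv ℝ φ y) (G y)) x‖ * σ ^ m ≤
        C₂ * σ ^ (2 * (i + 1)) := by
      rw [norm_smul, Real.norm_of_nonneg (sq_nonneg σ), mul_assoc]
      calc _ ≤ σ ^ 2 * (C₂ * σ ^ (2 * i)) := by gcongr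
        _ = _ := by ring
    calc _ ≤ (‖iteratedFDeriv ℝ i (fun y => osc σ φ y • fderiv ℝ G y) x‖ + ‖σ ^ 2 • iteratedFDeriv ℝ i
        (fun y => osc σ φ y • tens d V (fderiv ℝ φ y) (G y)) x‖) * σ ^ m := by
          gcongr; exact norm_add_le _ _
      _ ≤ _ := by rw [add_mul, add_mul]; exact add_le_add e1' e2'

/-! ### The local model of a CR structure -/

variable {d n k : ℕ}

/-- The index set of the coordinates: `n` conjugate-holomorphic, `n` holomorphic and `k` real ones. -/
abbrev Idx (n k : ℕ) : Type := Fin n ⊕ (Fin n ⊕ Fin k)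

/-- A commuting frame of a CR structure near the origin, in adapted coordinates, together with a
conormal covector `ξ` for which the Levi form is diagonal with nonzero entries. -/
structure LocalCR (d n k : ℕ) where
  K : Coords d (Idx n k)
  L : Fin n → RV d → CV d
  smooth : ∀ j, ContDiff ℝ ∞ (L j)
  y_conj : ∀ j v, K.y (.inr (.inl j)) v = conj (K.y (.inl j) v)
  y_real : ∀ i v, conj (K.y (.inr (.inr i)) v) = K.y (.inr (.inr i)) v
  L_zero : ∀ j, L j 0 = K.b (.inl j)
  y_L : ∀ i j x, cext (K.y (.inl i)) (L j x) = if i = j then 1 else 0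
  R : ℝ
  R_pos : 0 < R
  comm : ∀ i j, ∀ x ∈ Metric.ball (0 : RV d) R, brC (L i) (L j) x = 0
  ξ : RV d →L[ℝ] ℝ
  ξ_b : ∀ j, cext (Complex.ofRealCLM.comp ξ) (K.b (.inl j)) = 0
  lam : Fin n → ℝ
  lam_ne : ∀ j, lam j ≠ 0
  levi : ∀ g : Fin n → ℂ, (∑ j, ∑ l, conj (g j) * g l *
    cext (Complex.ofRealCLM.comp ξ) (dV (K.b (.inr (.inl l))) (L j) 0)).im =
      -∑ j, lam j * ‖g j‖ ^ 2

/-! ### Quadratic functions -/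

section Quad

variable {ι : Type*} [Fintype ι] (K : Coords d ι)

/-- The quadratic function with coefficient matrix `B`. -/
def Coords.quad (B : ι → ι → ℂ) (x : RV d) : ℂ := ∑ a, ∑ c, B a c * (K.y a x * K.y c x)

lemma Coords.contDiff_quad (B : ι → ι → ℂ) : ContDiff ℝ ∞ (K.quad B) :=
  ContDiff.sum fun a _ => ContDiff.sum fun c _ =>
    contDiff_const.mul ((K.y a).contDiff.mul (K.y c).contDiff)

lemma Coords.quad_smul (B : ι → ι → ℂ) (s : ℝ) (x : RV d) :
    K.quad B (s • x) = (s : ℂ) ^ 2 * K.quad B x := by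
  simp only [Coords.quad, Finset.mul_sum, map_smul, Complex.real_smul]
  exact Finset.sum_congr rfl fun a _ => Finset.sum_congr rfl fun c _ => by ring

lemma dC_clm (V : CV d) (l : RV d →L[ℝ] ℂ) (x : RV d) : dC V l x = cext l V := by
  rw [dC, l.fderiv]

variable [DecidableEq ι]

lemma Coords.dual (a c : ι) : cext (K.y a) (K.b c) = if a = c then 1 else 0 := by
  split_ifs with h
  · rw [h, K.dual_self]
  · exact K.dual_ne a c h

lemma Coords.dC_quad (B : ι → ι → ℂ) (V : CV d) (x : RV d) :
    dC V (K.quad B) x = ∑ a, ∑ c, B a c * (cext (K.y a) V * K.y c x + K.y a x * cext (K.y c) V) := by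
  have hd : ∀ a, DifferentiableAt ℝ (fun y => K.y a y) x := fun a => (K.y a).differentiableAt
  have hdd : ∀ a c, DifferentiableAt ℝ (fun y => B a c * (K.y a y * K.y c y)) x := fun a c =>
    ((hd a).fun_mul (hd c)).const_mul _
  have : K.quad B = fun y => ∑ a, ∑ c, B a c * (K.y a y * K.y c y) := rfl
  rw [this, dC_sum _ _ fun a _ => DifferentiableAt.fun_sum fun c _ => hdd a c]
  refine Finset.sum_congr rfl fun a _ => ?_
  rw [dC_sum _ _ fun c _ => hdd a c]
  refine Finset.sum_congr rfl fun c _ => ?_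
  rw [dC_const_mul _ _ ((hd a).fun_mul (hd c)), dC_mul _ (hd a) (hd c)]
  have e : ∀ a, dC V (fun y => K.y a y) x = cext (K.y a) V := fun a => dC_clm V (K.y a) x
  rw [e, e]; ring

lemma Coords.dC_quad_b (B : ι → ι → ℂ) (e : ι) (x : RV d) :
    dC (K.b e) (K.quad B) x = ∑ c, (B e c + B c e) * K.y c x := by
  rw [K.dC_quad]
  simp only [K.dual, mul_add, Finset.sum_add_distrib, add_mul]
  congr 1
  · rw [Finset.sum_comm]
    exact Finset.sum_congr rfl fun c _ => by simp
  · exact Finset.sum_congr rfl fun c _ => by simp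

lemma Coords.flat_quad (B : ι → ι → ℂ) : Flat 2 (K.quad B) := by
  refine Flat.sum _ (fun a _ => Flat.sum _ (fun c _ => ?_) fun c _ =>
    contDiff_const.mul ((K.y a).contDiff.mul (K.y c).contDiff)) fun a _ => ContDiff.sum fun c _ =>
    contDiff_const.mul ((K.y a).contDiff.mul (K.y c).contDiff)
  have h1 : ∀ a, Flat 1 (fun y => K.y a y) := fun a => flat_one_iff.2 (map_zero _)
  exact ((h1 a).mul (h1 c) (K.y a).contDiff (K.y c).contDiff).mul_left contDiff_const
    ((K.y a).contDiff.mul (K.y c).contDiff)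

/-- By `expand` a vector on which all coordinates vanish is zero, and an injective linear map in
finite dimension is bounded below. -/
lemma Coords.antilipschitz : ∃ c : ℝ, 0 < c ∧ ∀ x : RV d, c * ‖x‖ ^ 2 ≤ ∑ a, ‖K.y a x‖ ^ 2 := by
  let Φ : RV d →ₗ[ℝ] (EuclideanSpace ℂ ι) :=
    (WithLp.linearEquiv 2 ℝ (ι → ℂ)).symm.toLinearMap ∘ₗ LinearMap.pi fun a => (K.y a : RV d →ₗ[ℝ] ℂ)
  have hker : LinearMap.ker Φ = ⊥ := by
    rw [LinearMap.ker_eq_bot']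
    intro x hx
    have hy : ∀ a, K.y a x = 0 := fun a => congrFun (congrArg WithLp.ofLp hx) a
    ext r
    have := DFunLike.congr_fun (K.expand (Complex.ofRealCLM.comp (EuclideanSpace.proj r))) x
    rw [sum_smul_apply] at this
    simp only [hy, mul_zero, Finset.sum_const_zero] at this
    simpa using this
  obtain ⟨C, hC0, hC⟩ := Φ.exists_antilipschitzWith hker
  have hC0' : (0 : ℝ) < C := by exact_mod_cast hC0
  refine ⟨((C : ℝ) ^ 2)⁻¹, by positivity, fun x => ?_⟩
  have h1 : ‖x‖ ≤ C * ‖Φ x‖ := hC.le_mul_norm (map_zero Φ) x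
  have h2 : ‖Φ x‖ ^ 2 = ∑ a, ‖K.y a x‖ ^ 2 := by
    rw [EuclideanSpace.norm_sq_eq]; rfl
  rw [← h2, inv_mul_le_iff₀ (by positivity), ← mul_pow]
  gcongr

end Quad

/-! ### The phase attached to a characteristic covector -/

namespace LocalCR

variable (X : LocalCR d n k)

/-- The covector `ξ` with complex values. -/
def ξC : RV d →L[ℝ] ℂ := Complex.ofRealCLM.comp X.ξ

/-- The derivative of `ξ(L_j)` at the origin. -/
def a (j : Fin n) (c : Idx n k) : ℂ := cext X.ξC (dV (X.K.b c) (X.L j) 0)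

/-- The coefficients of the quadratic part of the phase. -/
def phaseCoeff : Idx n k → Idx n k → ℂ
  | .inl j, .inl l => -(Complex.I / 2) * X.a j (.inl l)
  | .inl j, .inr c => -Complex.I * X.a j (.inr c)
  | .inr (.inl j), .inr (.inl l) => -(Complex.I / 2) * conj (X.a j (.inl l))
  | .inr (.inl j), .inr (.inr i) => -Complex.I * conj (X.a j (.inr (.inr i)))
  | _, _ => 0

/-- The phase: it satisfies the tangential Cauchy-Riemann equations to second order. -/
def W (x : RV d) : ℂ := Complex.I * X.ξC x + X.K.quad X.phaseCoeff x

lemma contDiff_W : ContDiff ℝ ∞ X.W :=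
  (contDiff_const.mul X.ξC.contDiff).add (X.K.contDiff_quad _)

/-- The frame commutes at the origin, where `L l` equals the basis vector. -/
lemma a_symm (j l : Fin n) : X.a j (.inl l) = X.a l (.inl j) := by
  have := X.comm l j 0 (by simpa using X.R_pos)
  rw [brC, X.L_zero, X.L_zero, sub_eq_zero] at this
  rw [a, a, this]

/-- This explains the shape of `phaseCoeff`: the block of pairs of conjugate coordinates carries a
factor 1/2 because each pair occurs in both orders, whereas the mixed blocks are stored in one order
only. -/
lemma dC_phase (j : Fin n) (x : RV d) :
    dC (X.K.b (.inl j)) (X.K.quad X.phaseCoeff) x = -Complex.I * ∑ c, X.a j c * X.K.y c x := by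
  rw [X.K.dC_quad_b, Finset.mul_sum]
  refine Finset.sum_congr rfl fun c _ => ?_
  rcases c with l | l | i
  · simp only [phaseCoeff, X.a_symm l j]; ring
  · simp only [phaseCoeff]; ring
  · simp only [phaseCoeff]; ring

lemma contDiff_ext_L (l : RV d →L[ℝ] ℂ) (j : Fin n) : ContDiff ℝ ∞ fun x => cext l (X.L j x) :=
  ((cext l).restrictScalars ℝ).contDiff.comp (X.smooth j)

lemma dC_cext (l : RV d →L[ℝ] ℂ) {V : RV d → CV d} {x : RV d} (hV : DifferentiableAt ℝ V x)
    (Z : CV d) : dC Z (fun y => cext l (V y)) x = cext l (dV Z V x) := by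
  have hc : ∀ r, DifferentiableAt ℝ (fun y => V y r) x := differentiableAt_pi.1 hV
  simp only [cext_apply]
  rw [dC_sum _ _ fun r _ => (hc r).mul_const _]
  refine Finset.sum_congr rfl fun r _ => ?_
  have := dC_mul Z (hc r) (differentiableAt_const (l (ev r)))
  rw [this, dC_const]; simp [dV]

/-- The frame minus its value at the origin vanishes there. -/
lemma flat_along {m : ℕ} {g : RV d → ℂ} (hg : Flat (m + 1) g) (sg : ContDiff ℝ ∞ g) (j : Fin n) :
    Flat (m + 1) fun x => dC (X.L j x) g x - dC (X.K.b (.inl j)) g x := by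
  have h : ∀ x, dC (X.L j x) g x - dC (X.K.b (.inl j)) g x = dC (X.L j x - X.L j 0) g x := by
    intro x; rw [dC, dC, dC, map_sub, X.L_zero]
  simp only [h]
  have := hg.along_of_zero (a := 0) ((X.smooth j).sub (contDiff_const (c := X.L j 0)))
    (flat_one_iff.2 (by simp)) sg
  rwa [zero_add] at this

/-- The function ξ(L_j) vanishes at the origin because ξ is characteristic, and the quadratic part
of `W` was chosen to cancel its linear part. Replacing `L j` by its value at the origin on the
quadratic part costs only a term flat of order two. -/
lemma flat_W (j : Fin n) : Flat 2 fun x => dC (X.L j x) X.W x := by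
  have hsplit : ∀ x, dC (X.L j x) X.W x = (Complex.I * cext X.ξC (X.L j x) -
      Complex.I * ∑ c, X.a j c * X.K.y c x) + (dC (X.L j x) (X.K.quad X.phaseCoeff) x -
      dC (X.K.b (.inl j)) (X.K.quad X.phaseCoeff) x) := by
    intro x
    rw [X.dC_phase]
    have : X.W = fun x => Complex.I * X.ξC x + X.K.quad X.phaseCoeff x := rfl
    rw [this, dC_add _ (X.ξC.differentiableAt.const_mul _)
      ((X.K.contDiff_quad _).differentiable (by simp) x), dC_const_mul _ _ X.ξC.differentiableAt]
    rw [show dC (X.L j x) (fun y => X.ξC y) x = cext X.ξC (X.L j x) from dC_clm _ _ _]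
    ring
  simp only [hsplit]
  have sy : ContDiff ℝ ∞ fun x => ∑ c, X.a j c * X.K.y c x :=
    ContDiff.sum fun c _ => contDiff_const.mul (X.K.y c).contDiff
  have s1 : ContDiff ℝ ∞ fun x => cext X.ξC (X.L j x) - ∑ c, X.a j c * X.K.y c x :=
    (X.contDiff_ext_L _ j).sub sy
  have f1 : Flat 2 fun x => cext X.ξC (X.L j x) - ∑ c, X.a j c * X.K.y c x := by
    rw [flat_succ_iff, flat_one_iff]
    refine ⟨by simp [X.L_zero, ξC, X.ξ_b], ?_⟩
    have hl : fderiv ℝ (fun x => cext X.ξC (X.L j x)) 0 = ∑ c, X.a j c • X.K.y c := by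
      rw [X.K.expand (fderiv ℝ (fun x => cext X.ξC (X.L j x)) 0)]
      refine Finset.sum_congr rfl fun c _ => ?_
      congr 1
      exact dC_cext X.ξC ((X.smooth j).differentiable (by simp) 0) (X.K.b c)
    have hr : HasFDerivAt (fun x => ∑ c, X.a j c * X.K.y c x) (∑ c, X.a j c • X.K.y c) 0 :=
      HasFDerivAt.fun_sum fun c _ => (X.K.y c).hasFDerivAt.const_mul _
    rw [fderiv_fun_sub ((X.contDiff_ext_L _ j).differentiable (by simp) 0) hr.differentiableAt, hl,
      hr.fderiv, sub_self]
  have := (f1.mul_left (contDiff_const (c := Complex.I)) s1).add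
    (X.flat_along (X.K.flat_quad X.phaseCoeff) (X.K.contDiff_quad _) j)
    (contDiff_const.mul s1) ((contDiff_dC (X.smooth j) (X.K.contDiff_quad _)).sub
      (contDiff_dC contDiff_const (X.K.contDiff_quad _)))
  simpa only [mul_sub] using this

/-- The term iξ is imaginary, and the blocks added freely occur as `P - conj P`, also imaginary.
Only the Hermitian block `-i A` has a real part, namely `Im A`, which `levi` evaluates. -/
lemma re_W (x : RV d) : (X.W x).re = -∑ j, X.lam j * ‖X.K.y (.inl j) x‖ ^ 2 := by
  have hl := X.levi fun j => X.K.y (.inr (.inl j)) x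
  set P : ℂ := ∑ j, ∑ l, -(Complex.I / 2) * X.a j (.inl l) * (X.K.y (.inl j) x * X.K.y (.inl l) x) +
    ∑ j, ∑ i, -Complex.I * X.a j (.inr (.inr i)) * (X.K.y (.inl j) x * X.K.y (.inr (.inr i)) x)
    with hP
  set A : ℂ := ∑ j, ∑ l, conj (X.K.y (.inr (.inl j)) x) * X.K.y (.inr (.inl l)) x *
    X.a j (.inr (.inl l)) with hA
  have hA' : ∑ j, ∑ l, conj (X.K.y (.inr (.inl j)) x) * X.K.y (.inr (.inl l)) x *
    cext (Complex.ofRealCLM.comp X.ξ) (dV (X.K.b (.inr (.inl l))) (X.L j) 0) = A := rfl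
  rw [hA'] at hl
  have hq : X.K.quad X.phaseCoeff x = P - conj P - Complex.I * A := by
    simp only [Coords.quad, Fintype.sum_sum_type, phaseCoeff, zero_mul, Finset.sum_const_zero,
      add_zero, zero_add, Finset.sum_add_distrib, hP, hA, map_add, map_sum, map_mul, map_neg,
      map_div₀, Complex.conj_I, X.y_conj, X.y_real, Complex.conj_conj, map_ofNat, Finset.mul_sum]
    have e1 : ∀ f g : Fin n → Fin n → ℂ, (∀ j l, f j l = -g j l) →
        ∑ j, ∑ l, f j l = -∑ j, ∑ l, g j l := by
      intro f g h; simp only [h, Finset.sum_neg_distrib]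
    have e2 : ∀ f g : Fin n → Fin k → ℂ, (∀ j l, f j l = -g j l) →
        ∑ j, ∑ l, f j l = -∑ j, ∑ l, g j l := by
      intro f g h; simp only [h, Finset.sum_neg_distrib]
    rw [e1 (fun j l => -Complex.I * X.a j (.inr (.inl l)) * (X.K.y (.inl j) x * conj (X.K.y (.inl l) x)))
      (fun j l => Complex.I * (X.K.y (.inl j) x * conj (X.K.y (.inl l) x) * X.a j (.inr (.inl l))))
      (fun j l => by ring),
      e1 (fun j l => -(Complex.I / 2) * conj (X.a j (.inl l)) *
        (conj (X.K.y (.inl j) x) * conj (X.K.y (.inl l) x)))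
      (fun j l => -(-Complex.I / 2) * conj (X.a j (.inl l)) *
        (conj (X.K.y (.inl j) x) * conj (X.K.y (.inl l) x))) (fun j l => by ring),
      e2 (fun j i => -Complex.I * conj (X.a j (.inr (.inr i))) *
        (conj (X.K.y (.inl j) x) * X.K.y (.inr (.inr i)) x))
      (fun j i => - -Complex.I * conj (X.a j (.inr (.inr i))) *
        (conj (X.K.y (.inl j) x) * X.K.y (.inr (.inr i)) x)) (fun j l => by ring)]
    ring
  rw [W, hq]
  have h1 : (X.ξC x).im = 0 := by simp [ξC]
  simp only [Complex.add_re, Complex.mul_re, Complex.I_re, Complex.I_im, h1, Complex.sub_re,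
    Complex.conj_re, hl]
  simp only [X.y_conj, RCLike.norm_conj]
  ring

end LocalCR

/-! ### Phases and approximate CR functions of high order -/

variable {d n k : ℕ}

namespace LocalCR

variable (X : LocalCR d n k)

/-- The frame, indexed by all coordinates. -/
def LL : Idx n k → RV d → CV d
  | .inl j => X.L j
  | .inr _ => fun _ => 0

lemma contDiff_LL (c : Idx n k) : ContDiff ℝ ∞ (X.LL c) := by
  rcases c with j | c
  · exact X.smooth j
  · exact contDiff_const

lemma comm_eventually (i j : Fin n) : ∀ᶠ x in 𝓝 0, brC (X.L i) (X.L j) x = 0 := by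
  filter_upwards [Metric.ball_mem_nhds (0 : RV d) X.R_pos] with x hx
  exact X.comm i j x hx

/-- Formal solvability of `L_j φ = r_j`, for `j` in a set of indices. -/
lemma formal_solve (S : Finset (Fin n)) {r : Fin n → RV d → ℂ} (hr : ∀ j, ContDiff ℝ ∞ (r j))
    (hc : ∀ i j, ∀ᶠ x in 𝓝 0, dC (X.L i x) (r j) x = dC (X.L j x) (r i) x)
    {φ : RV d → ℂ} (hφ : ContDiff ℝ ∞ φ) {m₀ : ℕ}
    (h0 : ∀ j ∈ S, Flat m₀ (fun x => dC (X.L j x) φ x - r j x)) (m : ℕ) :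
    ∃ φ' : RV d → ℂ, ContDiff ℝ ∞ φ' ∧ Flat (m₀ + 1) (fun x => φ' x - φ x) ∧
      ∀ j ∈ S, Flat m (fun x => dC (X.L j x) φ' x - r j x) := by
  obtain ⟨φ', h1, h2, h3⟩ := X.K.formal_solve (S.map ⟨Sum.inl, Sum.inl_injective⟩) X.contDiff_LL
    (by
      intro c hc
      obtain ⟨j, -, rfl⟩ := Finset.mem_map.1 hc
      exact X.L_zero j)
    (by
      intro c hc c' hc'
      obtain ⟨i, -, rfl⟩ := Finset.mem_map.1 hc
      obtain ⟨j, -, rfl⟩ := Finset.mem_map.1 hc'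
      exact X.comm_eventually i j)
    (r := fun c => Sum.elim r (fun _ _ => 0) c)
    (by rintro (j | c); exacts [hr j, contDiff_const])
    (by
      intro c hc₁ c' hc₁'
      obtain ⟨i, -, rfl⟩ := Finset.mem_map.1 hc₁
      obtain ⟨j, -, rfl⟩ := Finset.mem_map.1 hc₁'
      exact hc i j) hφ (m₀ := m₀)
    (by
      intro c hc
      obtain ⟨i, hi, rfl⟩ := Finset.mem_map.1 hc
      exact h0 i hi) m
  exact ⟨φ', h1, h2, fun j hj => (h3 (.inl j) (Finset.mem_map.2 ⟨j, hj, rfl⟩)).mono (by omega)⟩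

/-- The coefficients of `∑_{l ∈ S} |c_l|² + ∑ t_i²`. -/
def sqCoeff (S : Finset (Fin n)) : Idx n k → Idx n k → ℂ
  | .inl j, .inr (.inl l) => if j = l ∧ j ∈ S then 1 else 0
  | .inr (.inr i), .inr (.inr i') => if i = i' then 1 else 0
  | _, _ => 0

/-- The function `∑_{l ∈ S} |c_l|² + ∑ t_i²`. -/
def sq (S : Finset (Fin n)) (x : RV d) : ℂ := X.K.quad (sqCoeff S) x

lemma sq_eq (S : Finset (Fin n)) (x : RV d) : X.sq S x =
    ((∑ l ∈ S, ‖X.K.y (.inl l) x‖ ^ 2 + ∑ i, ‖X.K.y (.inr (.inr i)) x‖ ^ 2 : ℝ) : ℂ) := by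
  simp only [sq, Coords.quad, Fintype.sum_sum_type, sqCoeff, zero_mul, Finset.sum_const_zero,
    add_zero, zero_add]
  push_cast
  congr 1
  · rw [← Finset.sum_filter_add_sum_filter_not Finset.univ (· ∈ S)]
    have h0 : ∑ j with ¬ j ∈ S, ∑ l, (if j = l ∧ j ∈ S then (1 : ℂ) else 0) *
        (X.K.y (.inl j) x * X.K.y (.inr (.inl l)) x) = 0 := by
      refine Finset.sum_eq_zero fun j hj => Finset.sum_eq_zero fun l _ => ?_
      have : j ∉ S := by simpa using hj
      simp [this]
    rw [h0, add_zero, Finset.filter_univ_mem]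
    refine Finset.sum_congr rfl fun j hj => ?_
    rw [Finset.sum_eq_single j]
    · simp only [hj, and_self, if_true, one_mul, X.y_conj]
      exact Complex.mul_conj' _
    · intro l _ hl; simp [Ne.symm hl]
    · simp
  · refine Finset.sum_congr rfl fun i _ => ?_
    rw [Finset.sum_eq_single i]
    · simp only [if_true, one_mul]
      nth_rewrite 2 [← X.y_real i x]
      exact Complex.mul_conj' _
    · intro l _ hl; simp [Ne.symm hl]
    · simp

/-- For `j ∉ S` the quadratic function does not contain the conjugate coordinate `j`, so the
constant field `b j` annihilates it. -/
lemma flat_sq {S : Finset (Fin n)} {j : Fin n} (hj : j ∉ S) : Flat 2 fun x => dC (X.L j x) (X.sq S) x := by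
  have h := X.flat_along (X.K.flat_quad (sqCoeff S)) (X.K.contDiff_quad _) j
  refine h.congr (Eventually.of_forall fun x => ?_)
  have : dC (X.K.b (.inl j)) (X.K.quad (sqCoeff S)) x = 0 := by
    rw [X.K.dC_quad_b]
    refine Finset.sum_eq_zero fun c _ => ?_
    rcases c with l | l | i <;> simp [sqCoeff, hj]
  simp only [this, sub_zero]
  rfl

/-- The indices of the positive eigenvalues. -/
def pos : Finset (Fin n) := Finset.univ.filter fun j => 0 < X.lam j

/-- A constant that dominates the eigenvalues. -/
def C₀ : ℝ := 1 + ∑ j, |X.lam j|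

/-- The phase of the approximate cocycles, up to second order. -/
def φ₂ (x : RV d) : ℂ := X.W x - X.C₀ * X.sq X.posᶜ x

/-- The phase of the test forms, up to second order. -/
def ψ₂ (x : RV d) : ℂ := -X.W x - X.C₀ * X.sq X.pos x

lemma contDiff_sq (S : Finset (Fin n)) : ContDiff ℝ ∞ (X.sq S) := X.K.contDiff_quad _

lemma contDiff_φ₂ : ContDiff ℝ ∞ X.φ₂ := X.contDiff_W.sub (contDiff_const.mul (X.contDiff_sq _))

lemma contDiff_ψ₂ : ContDiff ℝ ∞ X.ψ₂ :=
  X.contDiff_W.neg.sub (contDiff_const.mul (X.contDiff_sq _))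

lemma flat_φ₂ {j : Fin n} (hj : j ∈ X.pos) : Flat 2 fun x => dC (X.L j x) X.φ₂ x := by
  have hj' : j ∉ X.posᶜ := by simpa using hj
  have s1 := contDiff_dC (X.smooth j) X.contDiff_W
  have s2 := contDiff_dC (X.smooth j) (X.contDiff_sq X.posᶜ)
  refine ((X.flat_W j).sub ((X.flat_sq hj').mul_left (contDiff_const (c := (X.C₀ : ℂ))) s2) s1
    (contDiff_const.mul s2)).congr (Eventually.of_forall fun x => ?_)
  have hd := (X.contDiff_sq X.posᶜ).differentiable (by simp) x
  show _ = dC (X.L j x) (fun y => X.W y - X.C₀ * X.sq X.posᶜ y) x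
  rw [dC_sub _ (X.contDiff_W.differentiable (by simp) x) (hd.const_mul _), dC_const_mul _ _ hd]

lemma flat_ψ₂ {j : Fin n} (hj : j ∉ X.pos) : Flat 2 fun x => dC (X.L j x) X.ψ₂ x := by
  have s1 := contDiff_dC (X.smooth j) X.contDiff_W
  have s2 := contDiff_dC (X.smooth j) (X.contDiff_sq X.pos)
  refine (((X.flat_W j).neg s1).sub ((X.flat_sq hj).mul_left (contDiff_const (c := (X.C₀ : ℂ))) s2) s1.neg
    (contDiff_const.mul s2)).congr (Eventually.of_forall fun x => ?_)
  have hd := (X.contDiff_sq X.pos).differentiable (by simp) x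
  have hW := X.contDiff_W.differentiable (by simp) x
  show _ = dC (X.L j x) (fun y => -X.W y - X.C₀ * X.sq X.pos y) x
  rw [dC_sub _ hW.fun_neg (hd.const_mul _), dC_const_mul _ _ hd]
  have : dC (X.L j x) (fun y => -X.W y) x = - dC (X.L j x) X.W x := by
    have := dC_const_mul (X.L j x) (-1) hW
    simpa using this
  rw [this]

lemma abs_lam_lt (j : Fin n) : 1 + |X.lam j| ≤ X.C₀ := by
  have := Finset.single_le_sum (f := fun j => |X.lam j|) (fun j _ => abs_nonneg _) (Finset.mem_univ j)
  simp only [C₀]; linarith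

lemma C₀_ge : 1 ≤ X.C₀ := by
  have : 0 ≤ ∑ j, |X.lam j| := Finset.sum_nonneg fun j _ => abs_nonneg _
  simp only [C₀]; linarith

/-- The real parts of the quadratic phases are negative definite. -/
lemma re_phase_le : ∃ c : ℝ, 0 < c ∧ ∀ x, (X.φ₂ x).re ≤ -(c * ‖x‖ ^ 2) ∧
    (X.ψ₂ x).re ≤ -(c * ‖x‖ ^ 2) := by
  obtain ⟨c₁, hc₁, h₁⟩ := X.K.antilipschitz
  obtain ⟨μ, hμ, hμ'⟩ : ∃ μ : ℝ, 0 < μ ∧ (μ ≤ 1 ∧ ∀ j, μ ≤ |X.lam j|) := by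
    by_cases hn : Nonempty (Fin n)
    · obtain ⟨j, hj⟩ := Finite.exists_min fun j => |X.lam j|
      exact ⟨min 1 |X.lam j|, lt_min one_pos (abs_pos.2 (X.lam_ne j)), min_le_left _ _,
        fun l => (min_le_right _ _).trans (hj l)⟩
    · exact ⟨1, one_pos, le_rfl, fun j => (hn ⟨j⟩).elim⟩
  refine ⟨μ / 2 * c₁, by positivity, fun x => ?_⟩
  have hsum : c₁ * ‖x‖ ^ 2 ≤ 2 * (∑ j, ‖X.K.y (.inl j) x‖ ^ 2 + ∑ i, ‖X.K.y (.inr (.inr i)) x‖ ^ 2) := by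
    refine (h₁ x).trans ?_
    simp only [Fintype.sum_sum_type, X.y_conj, RCLike.norm_conj]
    have : 0 ≤ ∑ i, ‖X.K.y (.inr (.inr i)) x‖ ^ 2 := Finset.sum_nonneg fun i _ => by positivity
    linarith
  set t := ∑ i, ‖X.K.y (.inr (.inr i)) x‖ ^ 2 with ht
  have ht0 : 0 ≤ t := Finset.sum_nonneg fun i _ => by positivity
  have hC := X.C₀_ge
  -- Both phases at once, ε being the sign in front of `W`: outside `S` the term ελ_j equals -|λ_j|,
  -- and on `S` the constant `C₀` exceeds |λ_j| by at least one.
  have key : ∀ (S : Finset (Fin n)) (ε : ℝ), (∀ j ∈ S, ε * X.lam j ≤ |X.lam j|) →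
      (∀ j ∉ S, ε * X.lam j = -|X.lam j|) →
      ε * ∑ j, X.lam j * ‖X.K.y (.inl j) x‖ ^ 2 - X.C₀ * (∑ l ∈ S, ‖X.K.y (.inl l) x‖ ^ 2 + t) ≤
        -(μ / 2 * c₁ * ‖x‖ ^ 2) := by
    intro S ε hS hS'
    have h2 : ∑ j, (ε * X.lam j - if j ∈ S then X.C₀ else 0) * ‖X.K.y (.inl j) x‖ ^ 2 ≤
        ∑ j, -(μ * ‖X.K.y (.inl j) x‖ ^ 2) := by
      refine Finset.sum_le_sum fun j _ => ?_
      rw [← neg_mul]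
      refine mul_le_mul_of_nonneg_right ?_ (by positivity)
      have := X.abs_lam_lt j
      by_cases hj : j ∈ S
      · simp only [hj, if_true]; linarith [hS j hj, hμ'.1]
      · simp only [hj, if_false]; rw [hS' j hj]; linarith [hμ'.2 j]
    have h3 : ∑ j, (ε * X.lam j - if j ∈ S then X.C₀ else 0) * ‖X.K.y (.inl j) x‖ ^ 2 =
        ε * ∑ j, X.lam j * ‖X.K.y (.inl j) x‖ ^ 2 - X.C₀ * ∑ l ∈ S, ‖X.K.y (.inl l) x‖ ^ 2 := by
      simp only [sub_mul, Finset.sum_sub_distrib, Finset.mul_sum, ite_mul, zero_mul,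
        Finset.sum_ite_mem, Finset.univ_inter]
      congr 1
      exact Finset.sum_congr rfl fun j _ => by ring
    rw [h3, Finset.sum_neg_distrib, ← Finset.mul_sum] at h2
    have h4 : μ * t ≤ X.C₀ * t := mul_le_mul_of_nonneg_right (by linarith [hμ'.1]) ht0
    have h5 := mul_le_mul_of_nonneg_left hsum hμ.le
    nlinarith
  have hφ : (X.φ₂ x).re = -∑ j, X.lam j * ‖X.K.y (.inl j) x‖ ^ 2 -
      X.C₀ * (∑ l ∈ X.posᶜ, ‖X.K.y (.inl l) x‖ ^ 2 + t) := by
    simp only [φ₂, X.sq_eq, Complex.sub_re, X.re_W, ← Complex.ofReal_mul, Complex.ofReal_re, ht]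
  have hψ : (X.ψ₂ x).re = ∑ j, X.lam j * ‖X.K.y (.inl j) x‖ ^ 2 -
      X.C₀ * (∑ l ∈ X.pos, ‖X.K.y (.inl l) x‖ ^ 2 + t) := by
    simp only [ψ₂, X.sq_eq, Complex.sub_re, Complex.neg_re, X.re_W, ← Complex.ofReal_mul,
      Complex.ofReal_re, neg_neg, ht]
  constructor
  · have := key X.posᶜ (-1) (fun j _ => by simpa using neg_le_abs (X.lam j)) (fun j hj => by
      have : 0 < X.lam j := by simpa [pos] using hj
      rw [abs_of_pos this]; ring)
    rw [hφ]; linarith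
  · have := key X.pos 1 (fun j _ => by simpa using le_abs_self (X.lam j)) (fun j hj => by
      have : X.lam j ≤ 0 := by simpa [pos] using hj
      rw [abs_of_nonpos this]; ring)
    rw [hψ]; linarith

/-- The quadratic phases solve their equations to order two, so the corrections are flat of order
three and leave the quadratic real parts unchanged. -/
lemma exists_phases (m : ℕ) : ∃ φ ψ : RV d → ℂ, ContDiff ℝ ∞ φ ∧ ContDiff ℝ ∞ ψ ∧
    Flat 3 (fun x => φ x - X.φ₂ x) ∧ Flat 3 (fun x => ψ x - X.ψ₂ x) ∧
    (∀ j ∈ X.pos, Flat m fun x => dC (X.L j x) φ x) ∧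
    (∀ j ∉ X.pos, Flat m fun x => dC (X.L j x) ψ x) := by
  have hz : ∀ i j, ∀ᶠ x in 𝓝 (0 : RV d), dC (X.L i x) (fun _ => 0) x = dC (X.L j x) (fun _ => 0) x :=
    fun i j => Eventually.of_forall fun x => by rw [dC_const, dC_const]
  obtain ⟨φ, h1, h2, h3⟩ := X.formal_solve X.pos (r := fun _ _ => 0) (fun _ => contDiff_const) hz
    X.contDiff_φ₂ (m₀ := 2) (fun j hj => by simpa using X.flat_φ₂ hj) m
  obtain ⟨ψ, h1', h2', h3'⟩ := X.formal_solve X.posᶜ (r := fun _ _ => 0) (fun _ => contDiff_const) hz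
    X.contDiff_ψ₂ (m₀ := 2) (fun j hj => by simpa using X.flat_ψ₂ (by simpa using hj)) m
  exact ⟨φ, ψ, h1, h1', h2, h2', fun j hj => by simpa using h3 j hj,
    fun j hj => by simpa using h3' j (by simpa using hj)⟩

/-- Approximate CR functions. -/
lemma exists_crFunctions (m : ℕ) : ∃ z : Fin n ⊕ Fin k → RV d → ℂ, (∀ a, ContDiff ℝ ∞ (z a)) ∧
    (∀ a, fderiv ℝ (z a) 0 = X.K.y (.inr a)) ∧ ∀ a j, Flat m fun x => dC (X.L j x) (z a) x := by
  have hz : ∀ i j, ∀ᶠ x in 𝓝 (0 : RV d), dC (X.L i x) (fun _ => 0) x = dC (X.L j x) (fun _ => 0) x :=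
    fun i j => Eventually.of_forall fun x => by rw [dC_const, dC_const]
  have : ∀ a : Fin n ⊕ Fin k, ∃ z : RV d → ℂ, ContDiff ℝ ∞ z ∧ fderiv ℝ z 0 = X.K.y (.inr a) ∧
      ∀ j, Flat m fun x => dC (X.L j x) z x := by
    intro a
    -- A coordinate dual to the complementary directions solves the equations to order one; the
    -- correction is flat of order two, so the differential at the origin is kept.
    obtain ⟨z, h1, h2, h3⟩ := X.formal_solve Finset.univ (r := fun _ _ => 0)
      (fun _ => contDiff_const) hz (X.K.y (.inr a)).contDiff (m₀ := 1) (fun j _ => by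
        rw [flat_one_iff, dC_clm, X.L_zero, X.K.dual]; simp) m
    refine ⟨z, h1, ?_, fun j => by simpa using h3 j (Finset.mem_univ j)⟩
    have := flat_one_iff.1 (flat_succ_iff.1 h2).2
    rw [fderiv_fun_sub (h1.differentiable (by simp) 0) (X.K.y (.inr a)).differentiableAt,
      (X.K.y (.inr a)).fderiv] at this
    exact sub_eq_zero.1 this
  choose z h1 h2 h3 using this
  exact ⟨z, h1, h2, h3⟩

end LocalCR

variable {d n k : ℕ}

/-- Cutting off lets germs be handled as globally defined functions of compact support, at the price
of halving the radius. -/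
lemma exists_contDiff_eqOn_ball {F : Type*} [NormedAddCommGroup F] [NormedSpace ℝ F] {f : RV d → F}
    {r : ℝ} (hr : 0 < r) (hf : ContDiffOn ℝ ∞ f (Metric.ball 0 r)) :
    ∃ g : RV d → F, ContDiff ℝ ∞ g ∧ EqOn g f (Metric.ball 0 (r / 2)) ∧ HasCompactSupport g := by
  let χ : ContDiffBump (0 : RV d) := ⟨r / 2, 3 * r / 4, by positivity, by linarith⟩
  refine ⟨fun x => χ x • f x, ?_, ?_, ?_⟩
  · rw [contDiff_iff_contDiffAt]
    intro x
    by_cases hx : x ∈ Metric.ball (0 : RV d) r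
    · exact χ.contDiff.contDiffAt.smul (hf.contDiffAt (Metric.isOpen_ball.mem_nhds hx))
    · have hx' : x ∈ (Metric.closedBall (0 : RV d) (3 * r / 4))ᶜ := by
        simp at hx ⊢; linarith
      refine (contDiffAt_const (c := (0 : F))).congr_of_eventuallyEq ?_
      filter_upwards [Metric.isClosed_closedBall.isOpen_compl.mem_nhds hx'] with y hy
      have : χ y = 0 := χ.zero_of_le_dist (by simp at hy; simp [χ]; linarith)
      rw [this, zero_smul]
  · intro x hx
    have : χ x = 1 := χ.one_of_mem_closedBall (Metric.ball_subset_closedBall hx)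
    simp [this]
  · exact χ.hasCompactSupport.smul_right

/-! ### Divergence -/

/-- The standard basis vectors as complex vectors. -/
def ec (r : Fin d) : CV d := incl (ev r)

lemma dC_ec (r : Fin d) (g : RV d → ℂ) (x : RV d) : dC (ec r) g x = fderiv ℝ g x (ev r) :=
  cext_incl _ _

lemma dC_eq_sum_ec (Z : CV d) (g : RV d → ℂ) (x : RV d) : dC Z g x = ∑ r, Z r * dC (ec r) g x := by
  rw [dC_eq_sum]; simp only [dC_ec]

/-- The divergence of a complex vector field. -/
def divC (V : RV d → CV d) (x : RV d) : ℂ := ∑ r, dC (ec r) (fun y => V y r) x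

lemma contDiff_divC {V : RV d → CV d} (hV : ContDiff ℝ ∞ V) : ContDiff ℝ ∞ (divC V) :=
  ContDiff.sum fun r _ => contDiff_dC contDiff_const (contDiff_pi.1 hV r)

/-- Commuting the coordinate derivative past `V` leaves a double sum that is symmetric in `V` and
`W`. -/
lemma sum_dC_ec_dC {V W : RV d → CV d} (hV : ContDiff ℝ ∞ V) (hW : ContDiff ℝ ∞ W) (x : RV d) :
    ∑ r, dC (ec r) (fun y => dC (V y) (fun y => W y r) y) x = dC (V x) (divC W) x +
      ∑ r, ∑ s, dC (ec r) (fun y => V y s) x * dC (ec s) (fun y => W y r) x := by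
  have hWr := contDiff_pi.1 hW
  have h1 : dC (V x) (divC W) x = ∑ r, dC (V x) (fun y => dC (ec r) (fun y => W y r) y) x :=
    dC_sum _ _ fun r _ => (contDiff_dC contDiff_const (hWr r)).differentiable (by simp) x
  rw [h1, ← Finset.sum_add_distrib]
  refine Finset.sum_congr rfl fun r _ => ?_
  have := dC_dC_sub (V := fun _ => ec r) (W := V) (g := fun y => W y r) (x := x)
    (differentiableAt_const _) (hV.differentiable (by simp) x) ((hWr r).contDiffAt.of_le two_le_infty)
  rw [sub_eq_iff_eq_add'] at this
  rw [this]
  congr 1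
  rw [dC_eq_sum_ec]
  refine Finset.sum_congr rfl fun s _ => ?_
  congr 1
  simp only [brC, dV, Pi.sub_apply, dC_const, sub_zero]

/-- The divergence of the vanishing bracket; the symmetric double sums cancel. This is the
compatibility condition for the amplitude. -/
lemma dC_divC_comm {V W : RV d → CV d} (hV : ContDiff ℝ ∞ V) (hW : ContDiff ℝ ∞ W) {x : RV d}
    (h : ∀ᶠ y in 𝓝 x, brC V W y = 0) : dC (V x) (divC W) x = dC (W x) (divC V) x := by
  have h1 := sum_dC_ec_dC hV hW x
  have h2 := sum_dC_ec_dC hW hV x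
  have h3 : ∑ r, dC (ec r) (fun y => dC (V y) (fun y => W y r) y) x =
      ∑ r, dC (ec r) (fun y => dC (W y) (fun y => V y r) y) x := by
    refine Finset.sum_congr rfl fun r _ => dC_congr _ ?_
    filter_upwards [h] with y hy
    exact sub_eq_zero.1 (congrFun hy r)
  rw [Finset.sum_comm] at h2
  have h4 : ∑ s, ∑ r, dC (ec r) (fun y => W y s) x * dC (ec s) (fun y => V y r) x =
    ∑ r, ∑ s, dC (ec r) (fun y => V y s) x * dC (ec s) (fun y => W y r) x :=
    Finset.sum_congr rfl fun r _ => Finset.sum_congr rfl fun s _ => mul_comm _ _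
  rw [h4] at h2
  linear_combination h3 - h1 + h2

/-! ### The amplitude and the normal frame -/

namespace LocalCR

variable (X : LocalCR d n k)

/-- The amplitude that corrects the divergence of the frame. -/
lemma exists_amplitude (m : ℕ) : ∃ β : RV d → ℂ, ContDiff ℝ ∞ β ∧
    ∀ j, Flat m fun x => dC (X.L j x) β x + divC (X.L j) x := by
  -- The system `L_j β = -div L_j` is compatible because the frame commutes; the zero function is a
  -- start of order zero.
  obtain ⟨β, h1, -, h3⟩ := X.formal_solve Finset.univ (r := fun j x => -divC (X.L j) x)
    (fun j => (contDiff_divC (X.smooth j)).neg) (fun i j => by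
      filter_upwards [(X.comm_eventually i j).eventually_nhds] with x hx
      have := dC_divC_comm (X.smooth i) (X.smooth j) hx
      have hd : ∀ j, DifferentiableAt ℝ (divC (X.L j)) x := fun j =>
        (contDiff_divC (X.smooth j)).differentiable (by simp) x
      have e : ∀ i j, dC (X.L i x) (fun y => -divC (X.L j) y) x = -dC (X.L i x) (divC (X.L j)) x := by
        intro i j
        simpa using dC_const_mul (X.L i x) (-1) (hd j)
      rw [e, e, this]) (φ := fun _ => 0) contDiff_const (m₀ := 0) (fun j _ => flat_zero _) m
  exact ⟨β, h1, fun j => by simpa using h3 j (Finset.mem_univ j)⟩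

lemma expand_vec (v : CV d) : v = ∑ c, cext (X.K.y c) v • X.K.b c := by
  funext r
  let l : RV d →L[ℝ] ℂ := Complex.ofRealCLM.comp (EuclideanSpace.proj r)
  have hl : ∀ w : CV d, cext l w = w r := by
    intro w
    rw [cext_apply, Finset.sum_eq_single r]
    · simp [l, ev]
    · intro s _ hs; simp [l, ev, Ne.symm hs]
    · simp
  have := congrArg (fun l => cext l v) (X.K.expand l)
  simp only [cext_sum, cext_smul, hl] at this
  rw [this, Finset.sum_apply]
  exact Finset.sum_congr rfl fun c _ => by simp [mul_comm]

/-- A frame complementary to `L`, dual to a given system of approximate CR functions. -/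
lemma exists_normalFrame {m : ℕ} {z : Fin n ⊕ Fin k → RV d → ℂ} (hz : ∀ a, ContDiff ℝ ∞ (z a))
    (hz0 : ∀ a, fderiv ℝ (z a) 0 = X.K.y (.inr a))
    (hzL : ∀ a j, Flat (m + 1) fun x => dC (X.L j x) (z a) x) :
    ∃ N : Fin n ⊕ Fin k → RV d → CV d, (∀ b, ContDiff ℝ ∞ (N b)) ∧
      (∀ᶠ x in 𝓝 0, ∀ b, (∀ a, dC (N b x) (z a) x = if a = b then 1 else 0) ∧
        ∀ j, cext (X.K.y (.inl j)) (N b x) = 0) ∧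
      ∀ b j, Flat m (brC (N b) (X.L j)) := by
  -- `Ψ x` replaces the last coordinates of a vector by its pairings with the `dz_a`. It is the
  -- identity at the origin, and the normal fields are the images of the basis vectors under its
  -- inverse.
  let Ψ : RV d → (CV d →L[ℂ] CV d) := fun x =>
    ∑ a, (cext (fderiv ℝ (z a) x)).smulRight (X.K.b (.inr a)) +
      ∑ j, (cext (X.K.y (.inl j))).smulRight (X.K.b (.inl j))
  have hΨ : ∀ x v, Ψ x v = ∑ a, dC v (z a) x • X.K.b (.inr a) +
      ∑ j, cext (X.K.y (.inl j)) v • X.K.b (.inl j) := by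
    intro x v
    simp [Ψ, ContinuousLinearMap.sum_apply, dC]
  have sΨ : ContDiff ℝ ∞ Ψ := by
    refine (ContDiff.sum fun a _ => ?_).add contDiff_const
    have : ∀ x, (cext (fderiv ℝ (z a) x)).smulRight (X.K.b (.inr a)) =
        ∑ r, fderiv ℝ (z a) x (ev r) •
          ((ContinuousLinearMap.proj r : CV d →L[ℂ] ℂ).smulRight (X.K.b (.inr a))) := by
      intro x; ext v; simp [cext_apply, ContinuousLinearMap.sum_apply, Finset.mul_sum, mul_comm, mul_left_comm, mul_assoc]
    simp only [this]
    exact ContDiff.sum fun r _ => ((contDiff_fderiv (hz a)).clm_apply contDiff_const).smul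
      contDiff_const
  have hΨ0 : Ψ 0 = 1 := by
    ext1 v
    rw [hΨ]
    simp only [dC, hz0]
    conv_rhs => rw [ContinuousLinearMap.one_apply, X.expand_vec v, Fintype.sum_sum_type]
    rw [add_comm]
  have hinv : ContDiffAt ℝ ∞ (fun x => Ring.inverse (Ψ x)) 0 := by
    have h1 : ContDiffAt ℝ ∞ Ring.inverse (((1 : (CV d →L[ℂ] CV d)ˣ)) : CV d →L[ℂ] CV d) :=
      contDiffAt_ringInverse ℝ 1
    rw [Units.val_one, ← hΨ0] at h1
    exact h1.comp (0 : RV d) sΨ.contDiffAt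
  have hunit : ∀ᶠ x in 𝓝 0, IsUnit (Ψ x) := by
    have : {u : CV d →L[ℂ] CV d | IsUnit u} ∈ 𝓝 (Ψ 0) := by
      rw [hΨ0]; exact Units.isOpen.mem_nhds isUnit_one
    exact sΨ.continuous.continuousAt this
  -- The inverse exists only near the origin; `I` is a globally smooth function that agrees with it
  -- there.
  obtain ⟨I, sI, hI⟩ : ∃ I : RV d → (CV d →L[ℂ] CV d), ContDiff ℝ ∞ I ∧
      I =ᶠ[𝓝 0] fun x => Ring.inverse (Ψ x) := by
    obtain ⟨r, hr, hr'⟩ : ∃ r > 0, ∀ x ∈ Metric.ball (0 : RV d) r, IsUnit (Ψ x) := by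
      simpa [Metric.eventually_nhds_iff_ball] using hunit
    have hon : ContDiffOn ℝ ∞ (fun x => Ring.inverse (Ψ x)) (Metric.ball 0 r) := by
      intro x hx
      obtain ⟨u, hu⟩ := hr' x hx
      have h1 : ContDiffAt ℝ ∞ Ring.inverse (u : CV d →L[ℂ] CV d) := contDiffAt_ringInverse ℝ u
      rw [hu] at h1
      exact (h1.comp x sΨ.contDiffAt).contDiffWithinAt
    obtain ⟨g, h1, h2, -⟩ := exists_contDiff_eqOn_ball hr hon
    exact ⟨g, h1, h2.eventuallyEq_of_mem (Metric.ball_mem_nhds _ (by positivity))⟩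
  have hinvL : ∀ᶠ x in 𝓝 0, ∀ v, I x (Ψ x v) = v ∧ Ψ x (I x v) = v := by
    filter_upwards [hunit, hI] with x hx hx' v
    rw [hx']
    constructor
    · exact DFunLike.congr_fun (Ring.inverse_mul_cancel _ hx) v
    · exact DFunLike.congr_fun (Ring.mul_inverse_cancel _ hx) v
  have sN : ∀ b, ContDiff ℝ ∞ fun x => I x (X.K.b (.inr b)) := fun b =>
    ((ContinuousLinearMap.apply ℂ (CV d) (X.K.b (.inr b))).restrictScalars ℝ).contDiff.comp sI
  have hy : ∀ (c : Idx n k) (v : CV d) (x : RV d), (∀ a, c = .inr a → cext (X.K.y c) (Ψ x v) = dC v (z a) x) ∧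
      ∀ j, c = .inl j → cext (X.K.y c) (Ψ x v) = cext (X.K.y (.inl j)) v := by
    intro c v x
    constructor
    · rintro a rfl
      rcases a with a | a <;> simp [hΨ, X.K.dual]
    · rintro j rfl
      simp [hΨ, X.K.dual]
  have hN : ∀ᶠ x in 𝓝 0, ∀ b, (∀ a, dC (I x (X.K.b (.inr b))) (z a) x = if a = b then 1 else 0) ∧
        ∀ j, cext (X.K.y (.inl j)) (I x (X.K.b (.inr b))) = 0 := by
    filter_upwards [hinvL] with x hx b
    refine ⟨fun a => ?_, fun j => ?_⟩
    · rw [← (hy (.inr a) _ x).1 a rfl, (hx _).2, X.K.dual]; simp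
    · rw [← (hy (.inl j) (I x (X.K.b (.inr b))) x).2 j rfl, (hx _).2, X.K.dual]; simp
  refine ⟨fun b x => I x (X.K.b (.inr b)), sN, hN, fun b j => ?_⟩
  have sU : ∀ a, ContDiff ℝ ∞ fun x => dC (I x (X.K.b (.inr b))) (fun y => dC (X.L j y) (z a) y) x :=
    fun a => contDiff_dC (sN b) (contDiff_dC (X.smooth j) (hz a))
  have fU : ∀ a, Flat m fun x => dC (I x (X.K.b (.inr b))) (fun y => dC (X.L j y) (z a) y) x :=
    fun a => (hzL a j).along (sN b) (contDiff_dC (X.smooth j) (hz a))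
  -- The pairing of the bracket with `dz_a` is `N_b (L_j z_a)`, since `N_b z_a` is constant, and
  -- this is flat of one order less than `L_j z_a`. The pairings with the `y (inl i)` vanish as they
  -- are constant on both fields. Inverting `Ψ` recovers the bracket.
  have hV : ∀ᶠ x in 𝓝 0, (fun r => ∑ a, dC (I x (X.K.b (.inr b))) (fun y => dC (X.L j y) (z a) y) x *
      I x (X.K.b (.inr a)) r) = brC (fun x => I x (X.K.b (.inr b))) (X.L j) x := by
    filter_upwards [hinvL, hN.eventually_nhds] with x hx hx'
    have hdz : ∀ a, dC (brC (fun x => I x (X.K.b (.inr b))) (X.L j) x) (z a) x =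
        dC (I x (X.K.b (.inr b))) (fun y => dC (X.L j y) (z a) y) x := by
      intro a
      rw [← dC_dC_sub ((sN b).differentiable (by simp) x) ((X.smooth j).differentiable (by simp) x)
        ((hz a).contDiffAt.of_le two_le_infty)]
      have : (fun y => dC (I y (X.K.b (.inr b))) (z a) y) =ᶠ[𝓝 x] fun _ => if a = b then 1 else 0 := by
        filter_upwards [hx'] with y hy
        exact (hy b).1 a
      rw [dC_congr _ this, dC_const, sub_zero]
    have hdc : ∀ i, cext (X.K.y (.inl i)) (brC (fun x => I x (X.K.b (.inr b))) (X.L j) x) = 0 := by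
      intro i
      have e := dC_dC_sub (g := X.K.y (.inl i)) ((sN b).differentiable (by simp) x)
        ((X.smooth j).differentiable (by simp) x) ((X.K.y (.inl i)).contDiff.contDiffAt)
      simp only [dC_clm] at e
      rw [← e]
      have h1 : (fun y => cext (X.K.y (.inl i)) (I y (X.K.b (.inr b)))) =ᶠ[𝓝 x] fun _ => 0 := by
        filter_upwards [hx'] with y hy
        exact (hy b).2 i
      rw [dC_congr _ h1, dC_const, sub_zero]
      simp only [X.y_L, dC_const]
    have h2 := (hx (brC (fun x => I x (X.K.b (.inr b))) (X.L j) x)).1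
    rw [hΨ] at h2
    simp only [hdz, hdc, zero_smul, Finset.sum_const_zero, add_zero, map_sum, map_smul] at h2
    rw [← h2]
    funext r
    simp [Finset.sum_apply]
  refine Flat.congr (flat_pi (fun r => Flat.sum _ (fun a _ => ?_) fun a _ => ?_) fun r => ContDiff.sum fun a _ => ?_) hV
  · exact (fU a).mul_right (sU a) (contDiff_pi.1 (sN a) r)
  · exact (sU a).mul (contDiff_pi.1 (sN a) r)
  · exact (sU a).mul (contDiff_pi.1 (sN a) r)

end LocalCR

/-! ### Stages: all the approximate data of one order -/

variable {d n k : ℕ}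

lemma zero_smul_alt {l : ℕ} (α : Alt d l) : (0 : ℂ) • α = 0 := by
  ext v; simp [ContinuousAlternatingMap.smul_apply]

lemma smul_zero_alt {l : ℕ} (c : ℂ) : c • (0 : Alt d l) = 0 := by
  ext v; simp [ContinuousAlternatingMap.smul_apply]

lemma add_smul_alt {l : ℕ} (b c : ℂ) (α : Alt d l) : (b + c) • α = b • α + c • α := by
  ext v; simp [ContinuousAlternatingMap.smul_apply, add_mul]

/-- Phases, approximate CR functions and cut-offs of a given order of accuracy `m`. -/
structure Stage (X : LocalCR d n k) (m : ℕ) (r : ℝ) where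
  φ : RV d → ℂ
  ψ : RV d → ℂ
  β : RV d → ℂ
  χ : RV d → ℂ
  z : Fin n ⊕ Fin k → RV d → ℂ
  N : Fin n ⊕ Fin k → RV d → CV d
  ρ : ℝ
  c : ℝ
  sφ : ContDiff ℝ ∞ φ
  sψ : ContDiff ℝ ∞ ψ
  sβ : ContDiff ℝ ∞ β
  sχ : ContDiff ℝ ∞ χ
  sz : ∀ a, ContDiff ℝ ∞ (z a)
  sN : ∀ b, ContDiff ℝ ∞ (N b)
  ρ_pos : 0 < ρ
  ρ_le : ρ ≤ r
  ρ_le_R : ρ ≤ X.R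
  c_pos : 0 < c
  φ_flat : Flat 3 fun x => φ x - X.φ₂ x
  ψ_flat : Flat 3 fun x => ψ x - X.ψ₂ x
  φ_L : ∀ j ∈ X.pos, Flat m fun x => dC (X.L j x) φ x
  ψ_L : ∀ j ∉ X.pos, Flat m fun x => dC (X.L j x) ψ x
  z_L : ∀ a j, Flat (m + 1) fun x => dC (X.L j x) (z a) x
  β_L : ∀ j, Flat m fun x => dC (X.L j x) β x + divC (X.L j) x
  N_L : ∀ b j, Flat m (brC (N b) (X.L j))
  N_z : ∀ x ∈ Metric.ball (0 : RV d) ρ, ∀ b a, dC (N b x) (z a) x = if a = b then 1 else 0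
  N_y : ∀ x ∈ Metric.ball (0 : RV d) ρ, ∀ b j, cext (X.K.y (.inl j)) (N b x) = 0
  φ_re : ∀ x ∈ Metric.ball (0 : RV d) ρ, (φ x).re ≤ -(c * ‖x‖ ^ 2)
  ψ_re : ∀ x ∈ Metric.ball (0 : RV d) ρ, (ψ x).re ≤ -(c * ‖x‖ ^ 2)
  φ₂_re : ∀ x, (X.φ₂ x).re ≤ -(c * ‖x‖ ^ 2)
  ψ₂_re : ∀ x, (X.ψ₂ x).re ≤ -(c * ‖x‖ ^ 2)
  χ_one : ∀ᶠ x in 𝓝 0, χ x = 1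
  χ_supp : tsupport χ ⊆ Metric.ball 0 ρ
  χ_compact : HasCompactSupport χ

/-- Near the origin the cubic error is absorbed by half of the quadratic term. -/
lemma re_le_of_flat {φ φ₂ : RV d → ℂ} (hφ : ContDiff ℝ ∞ φ) (hφ₂ : ContDiff ℝ ∞ φ₂)
    (h : Flat 3 fun x => φ x - φ₂ x) {c : ℝ} (hc : 0 < c) (hre : ∀ x, (φ₂ x).re ≤ -(c * ‖x‖ ^ 2)) :
    ∀ᶠ x in 𝓝 0, (φ x).re ≤ -(c / 2 * ‖x‖ ^ 2) := by
  obtain ⟨C, hC0, hC⟩ := h.bound (hφ.sub hφ₂) 1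
  have : ∀ᶠ x : RV d in 𝓝 0, ‖x‖ < min 1 (c / (2 * (C + 1))) := by
    have := Metric.ball_mem_nhds (0 : RV d) (ε := min 1 (c / (2 * (C + 1)))) (by positivity)
    filter_upwards [this] with x hx
    simpa using hx
  filter_upwards [this] with x hx
  have h1 := hC x (hx.le.trans (min_le_left _ _))
  have h2 : C * ‖x‖ ≤ c / 2 := by
    have h3 := hx.le.trans (min_le_right _ _)
    rw [le_div_iff₀ (by positivity)] at h3
    nlinarith [norm_nonneg x]
  have h4 : (φ x - φ₂ x).re ≤ C * ‖x‖ ^ 3 := (Complex.re_le_norm _).trans h1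
  rw [Complex.sub_re] at h4
  have h5 : C * ‖x‖ ^ 3 ≤ c / 2 * ‖x‖ ^ 2 := by
    have := mul_le_mul_of_nonneg_right h2 (sq_nonneg ‖x‖)
    linarith [this, (by ring : C * ‖x‖ ^ 3 = C * ‖x‖ * ‖x‖ ^ 2)]
  linarith [hre x]

/-- The CR functions are taken one order better than the rest, because the brackets of the normal
frame lose one order. The constant `c` is halved to accommodate the cubic error of the phases, and
the cut-off is supported where all the estimates hold. -/
lemma LocalCR.exists_stage (X : LocalCR d n k) (m : ℕ) {r : ℝ} (hr : 0 < r) :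
    Nonempty (Stage X m r) := by
  obtain ⟨φ, ψ, sφ, sψ, fφ, fψ, Lφ, Lψ⟩ := X.exists_phases m
  obtain ⟨z, sz, z0, zL⟩ := X.exists_crFunctions (m + 1)
  obtain ⟨β, sβ, βL⟩ := X.exists_amplitude m
  obtain ⟨N, sN, hN, NL⟩ := X.exists_normalFrame sz z0 zL
  obtain ⟨c, hc, hre⟩ := X.re_phase_le
  have h1 := re_le_of_flat sφ X.contDiff_φ₂ fφ hc fun x => (hre x).1
  have h2 := re_le_of_flat sψ X.contDiff_ψ₂ fψ hc fun x => (hre x).2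
  obtain ⟨ε, hε, hball⟩ := Metric.eventually_nhds_iff_ball.1 (h1.and (h2.and hN))
  set ρ := min ε (min r X.R) with hρ
  have hρ0 : 0 < ρ := lt_min hε (lt_min hr X.R_pos)
  let b : ContDiffBump (0 : RV d) := ⟨ρ / 3, ρ / 2, by positivity, by linarith⟩
  have hsub : ∀ x ∈ Metric.ball (0 : RV d) ρ, x ∈ Metric.ball (0 : RV d) ε := fun x hx =>
    Metric.ball_subset_ball (min_le_left _ _) hx
  have hts : tsupport (fun x => ((b x : ℝ) : ℂ)) ⊆ tsupport b := by
    refine closure_mono fun x hx => ?_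
    simpa using hx
  have hc2 : ∀ x : RV d, -(c * ‖x‖ ^ 2) ≤ -(c / 2 * ‖x‖ ^ 2) := fun x => by
    have : 0 ≤ c * ‖x‖ ^ 2 := by positivity
    linarith
  exact ⟨{
    φ := φ, ψ := ψ, β := β, χ := fun x => ((b x : ℝ) : ℂ), z := z, N := N, ρ := ρ, c := c / 2
    sφ := sφ, sψ := sψ, sβ := sβ, sz := sz, sN := sN
    sχ := Complex.ofRealCLM.contDiff.comp b.contDiff
    ρ_pos := hρ0
    ρ_le := (min_le_right _ _).trans (min_le_left _ _)
    ρ_le_R := (min_le_right _ _).trans (min_le_right _ _)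
    c_pos := by positivity
    φ_flat := fφ, ψ_flat := fψ, φ_L := Lφ, ψ_L := Lψ, z_L := zL, β_L := βL, N_L := NL
    N_z := fun x hx b a => ((hball x (hsub x hx)).2.2 b).1 a
    N_y := fun x hx b j => ((hball x (hsub x hx)).2.2 b).2 j
    φ_re := fun x hx => (hball x (hsub x hx)).1
    ψ_re := fun x hx => (hball x (hsub x hx)).2.1
    φ₂_re := fun x => (hre x).1.trans (hc2 x)
    ψ₂_re := fun x => (hre x).2.trans (hc2 x)
    χ_one := by
      filter_upwards [b.eventuallyEq_one] with x hx
      simp [hx]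
    χ_supp := by
      refine hts.trans ?_
      rw [b.tsupport_eq]
      exact Metric.closedBall_subset_ball (by simp [b]; linarith)
    χ_compact := b.hasCompactSupport.of_isClosed_subset (isClosed_tsupport _) hts }⟩

/-! ### The approximate cocycles -/

namespace Stage

variable {X : LocalCR d n k} {m : ℕ} {r : ℝ} (A : Stage X m r)

/-- The one-forms that annihilate the frame and approximate the differentials `dz_a`. -/
def θ (a : Fin n ⊕ Fin k) (x : RV d) : RV d →L[ℝ] ℂ :=
  fderiv ℝ (A.z a) x - ∑ j, dC (X.L j x) (A.z a) x • X.K.y (.inl j)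

lemma sθ (a : Fin n ⊕ Fin k) : ContDiff ℝ ∞ (A.θ a) :=
  (contDiff_fderiv (A.sz a)).sub (ContDiff.sum fun j _ =>
    (contDiff_dC (X.smooth j) (A.sz a)).smul contDiff_const)

/-- Since the `y (inl j)` are dual to the frame, subtracting the components `L_j B` leaves the part
of `dB` that annihilates T^{0,1}. -/
lemma cext_coframe (B : RV d → ℂ) (x : RV d) {Z : CV d} (hZ : Z ∈ T01 X.L x) :
    cext (fderiv ℝ B x - ∑ j, dC (X.L j x) B x • X.K.y (.inl j)) Z = 0 := by
  refine Submodule.span_induction (p := fun Z _ => cext (fderiv ℝ B x -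
    ∑ j, dC (X.L j x) B x • X.K.y (.inl j)) Z = 0) ?_ (map_zero _) ?_ ?_ hZ
  · rintro _ ⟨i, rfl⟩
    simp only [cext_sub, cext_sum, cext_smul, X.y_L]
    simp [dC]
  · intro u v _ _ hu hv; rw [map_add, hu, hv, add_zero]
  · intro c u _ hu; rw [map_smul, hu, smul_zero]

lemma cext_θ (a : Fin n ⊕ Fin k) (x : RV d) {Z : CV d} (hZ : Z ∈ T01 X.L x) :
    cext (A.θ a x) Z = 0 := cext_coframe (A.z a) x hZ

variable {p q : ℕ} (e : Fin p → Fin n ⊕ Fin k) (J : Fin q → Fin n)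

/-- The factors of the basic form. -/
def col (x : RV d) : Fin (p + q) → RV d →L[ℝ] ℂ :=
  Fin.append (fun i => A.θ (e i) x) fun j => X.K.y (.inl (J j))

/-- The basic form `θ_{e 1} ∧ … ∧ θ_{e p} ∧ c_{J 1} ∧ … ∧ c_{J q}`. -/
def D (x : RV d) : Alt d (p + q) := detForm (A.col e J x)

lemma scol (i : Fin (p + q)) : ContDiff ℝ ∞ fun x => A.col e J x i := by
  refine Fin.addCases (fun i => ?_) (fun j => ?_) i
  · simpa [col] using A.sθ (e i)
  · simpa [col] using contDiff_const

lemma sD : ContDiff ℝ ∞ (A.D e J) := contDiff_detForm (A.scol e J)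

lemma D_mem (x : RV d) : A.D e J x ∈ Filt (T01 X.L x) p (p + q) := by
  have := detForm_mem_filt (T := T01 X.L x) (l := A.col e J x)
    (Finset.univ.map (Fin.castAddEmb q)) (by
      intro i hi Z hZ
      obtain ⟨i, -, rfl⟩ := Finset.mem_map.1 hi
      simpa [col] using A.cext_θ (e i) x hZ)
  rw [Finset.card_map, Finset.card_univ, Fintype.card_fin] at this
  exact this

/-- The factors differ from exact differentials by terms flat of order m + 1, and a product of
differentials is closed; one order is lost in differentiating the difference. -/
lemma flat_extDeriv_D : Flat m (extDeriv (A.D e J)) := by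
  let z' : Fin (p + q) → RV d → ℂ := Fin.append (fun i => A.z (e i)) fun j => X.K.y (.inl (J j))
  have sz' : ∀ i, ContDiff ℝ ∞ (z' i) := by
    intro i
    refine Fin.addCases (fun i => ?_) (fun j => ?_) i
    · simpa [z'] using A.sz (e i)
    · simpa [z'] using (X.K.y (.inl (J j))).contDiff
  have sD' : ContDiff ℝ ∞ fun x => detForm fun i => fderiv ℝ (z' i) x :=
    contDiff_detForm fun i => contDiff_fderiv (sz' i)
  have hflat : Flat (m + 1) fun x => A.D e J x - detForm fun i => fderiv ℝ (z' i) x := by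
    refine flat_detForm_sub (fun i => ?_) (A.scol e J) fun i => contDiff_fderiv (sz' i)
    refine Fin.addCases (fun i => ?_) (fun j => ?_) i
    · simp only [col, z', Fin.append_left, θ]
      have h : Flat (m + 1) fun x => -∑ j, dC (X.L j x) (A.z (e i)) x • X.K.y (.inl j) := by
        have ss : ∀ j, ContDiff ℝ ∞ fun x => dC (X.L j x) (A.z (e i)) x • X.K.y (.inl j) := fun j =>
          (contDiff_dC (X.smooth j) (A.sz (e i))).smul contDiff_const
        refine Flat.neg (Flat.sum _ (fun j _ => ?_) fun j _ => ss j) (ContDiff.sum fun j _ => ss j)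
        exact (A.z_L (e i) j).clm (contDiff_dC (X.smooth j) (A.sz (e i)))
          ((ContinuousLinearMap.id ℝ ℂ).smulRight (X.K.y (.inl j)) : ℂ →L[ℝ] _)
      refine h.congr (Eventually.of_forall fun x => ?_)
      dsimp only; abel
    · simp only [col, z', Fin.append_right]
      refine flat_of_eventually_zero _ (Eventually.of_forall fun x => ?_)
      rw [ContinuousLinearMap.fderiv, sub_self]
  have hd : extDeriv (A.D e J) = extDeriv fun x => A.D e J x - detForm fun i => fderiv ℝ (z' i) x := by
    funext x
    have h1 := extDeriv_fun_add (x := x) (((A.sD e J).sub sD').differentiable (by simp) x)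
      (sD'.differentiable (by simp) x)
    rw [extDeriv_detForm_fderiv sz', add_zero] at h1
    rw [← h1]
    congr 1
    funext y; simp
  rw [hd]
  exact hflat.extDeriv ((A.sD e J).sub sD')

/-- The multiples of the phase. -/
def φs (a : ℕ) (x : RV d) : ℂ := ((a : ℂ) + 1) * A.φ x

lemma sφs (a : ℕ) : ContDiff ℝ ∞ (A.φs a) := contDiff_const.mul A.sφ

lemma φs_re (a : ℕ) {x : RV d} (hx : x ∈ Metric.ball (0 : RV d) A.ρ) :
    (A.φs a x).re ≤ -(A.c * ‖x‖ ^ 2) := by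
  have h := A.φ_re x hx
  have h0 : 0 ≤ A.c * ‖x‖ ^ 2 := mul_nonneg A.c_pos.le (sq_nonneg _)
  have : (A.φs a x).re = ((a : ℝ) + 1) * (A.φ x).re := by
    rw [φs, show ((a : ℂ) + 1) = (((a : ℝ) + 1 : ℝ) : ℂ) by push_cast; ring, Complex.re_ofReal_mul]
  rw [this]
  have ha : (0 : ℝ) ≤ a := Nat.cast_nonneg a
  nlinarith

lemma dC_φs (a : ℕ) (Z : CV d) (x : RV d) : dC Z (A.φs a) x = ((a : ℂ) + 1) * dC Z A.φ x :=
  dC_const_mul Z _ (A.sφ.differentiable (by simp) x)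

/-- The approximate cocycle. -/
def f (a : ℕ) (σ : ℝ) (x : RV d) : Alt d (p + q) := osc σ (A.φs a) x • (A.χ x • A.D e J x)

/-- The part of `g` without a factor `σ²`. -/
def G₀ (x : RV d) : Alt d (p + q + 1) :=
  ∑ j ∈ X.pos, dC (X.L j x) A.χ x •
      detForm (Fin.cons (X.K.y (.inl j)) (A.col e J x) : Fin (p + q + 1) → RV d →L[ℝ] ℂ) +
    A.χ x • extDeriv (A.D e J) x

/-- The coefficient of `σ²` in `g`. -/
def G₁ (a : ℕ) (x : RV d) : Alt d (p + q + 1) :=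
  ∑ j ∈ X.pos, (A.χ x * dC (X.L j x) (A.φs a) x) •
      detForm (Fin.cons (X.K.y (.inl j)) (A.col e J x) : Fin (p + q + 1) → RV d →L[ℝ] ℂ)

/-- The form that represents `∂̄ f`. -/
def g (a : ℕ) (σ : ℝ) (x : RV d) : Alt d (p + q + 1) :=
  osc σ (A.φs a) x • (A.G₀ e J x + (σ : ℂ) ^ 2 • A.G₁ e J a x)

lemma scons (j : Fin n) : ContDiff ℝ ∞ fun x =>
    detForm (Fin.cons (X.K.y (.inl j)) (A.col e J x) : Fin (p + q + 1) → RV d →L[ℝ] ℂ) := by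
  refine contDiff_detForm (l := fun i x => (Fin.cons (X.K.y (.inl j)) (A.col e J x) :
    Fin (p + q + 1) → RV d →L[ℝ] ℂ) i) fun i => ?_
  refine Fin.cases ?_ (fun i => ?_) i
  · simpa using contDiff_const
  · simpa using A.scol e J i

lemma sG₀ : ContDiff ℝ ∞ (A.G₀ e J) :=
  (ContDiff.sum fun j _ => (contDiff_dC (X.smooth j) A.sχ).smul (A.scons e J j)).add
    (A.sχ.smul (contDiff_extDeriv (A.sD e J)))

lemma sG₁ (a : ℕ) : ContDiff ℝ ∞ (A.G₁ e J a) :=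
  ContDiff.sum fun j _ => (A.sχ.mul (contDiff_dC (X.smooth j) (A.sφs a))).smul (A.scons e J j)

lemma dC_χ_eq_zero {x : RV d} (hx : x ∉ tsupport A.χ) (Z : CV d) : dC Z A.χ x = 0 := by
  have : A.χ =ᶠ[𝓝 x] fun _ => 0 := notMem_tsupport_iff_eventuallyEq.1 hx
  rw [dC_congr _ this, dC_const]

lemma G₀_eq_zero {x : RV d} (hx : x ∉ tsupport A.χ) : A.G₀ e J x = 0 := by
  simp only [G₀, A.dC_χ_eq_zero hx, image_eq_zero_of_notMem_tsupport hx, zero_smul_alt,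
    Finset.sum_const_zero, add_zero]

lemma G₁_eq_zero (a : ℕ) {x : RV d} (hx : x ∉ tsupport A.χ) : A.G₁ e J a x = 0 := by
  simp only [G₁, image_eq_zero_of_notMem_tsupport hx, zero_mul, zero_smul_alt,
    Finset.sum_const_zero]

lemma flat_smul_alt {N l : ℕ} {u : RV d → ℂ} {F : RV d → Alt d l} (hu : Flat N u)
    (su : ContDiff ℝ ∞ u) (sF : ContDiff ℝ ∞ F) : Flat N fun x => u x • F x := by
  have := hu.bilin (ContinuousLinearMap.lsmul ℝ ℂ : ℂ →L[ℝ] Alt d l →L[ℝ] Alt d l) (flat_zero F) su sF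
  simpa using this

lemma flat_smul_alt' {N l : ℕ} {u : RV d → ℂ} {F : RV d → Alt d l} (hF : Flat N F)
    (su : ContDiff ℝ ∞ u) (sF : ContDiff ℝ ∞ F) : Flat N fun x => u x • F x := by
  have := (flat_zero u).bilin (ContinuousLinearMap.lsmul ℝ ℂ : ℂ →L[ℝ] Alt d l →L[ℝ] Alt d l) hF su sF
  simpa using this

lemma flat_dC_χ (N : ℕ) (V : RV d → CV d) : Flat N fun x => dC (V x) A.χ x := by
  refine flat_of_eventually_zero _ ?_
  filter_upwards [A.χ_one.eventually_nhds] with x hx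
  rw [dC_congr (g := fun _ => 1) _ hx, dC_const]

lemma flat_G₀ : Flat m (A.G₀ e J) := by
  have s1 : ∀ j, ContDiff ℝ ∞ fun x => dC (X.L j x) A.χ x := fun j => contDiff_dC (X.smooth j) A.sχ
  refine Flat.add (Flat.sum _ (fun j _ => ?_) fun j _ => (s1 j).smul (A.scons e J j)) ?_
    (ContDiff.sum fun j _ => (s1 j).smul (A.scons e J j))
    (A.sχ.smul (contDiff_extDeriv (A.sD e J)))
  · exact flat_smul_alt (A.flat_dC_χ m _) (s1 j) (A.scons e J j)
  · exact flat_smul_alt' (A.flat_extDeriv_D e J) A.sχ (contDiff_extDeriv (A.sD e J))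

lemma flat_G₁ (a : ℕ) : Flat m (A.G₁ e J a) := by
  have s1 : ∀ j, ContDiff ℝ ∞ fun x => A.χ x * dC (X.L j x) (A.φs a) x := fun j =>
    A.sχ.mul (contDiff_dC (X.smooth j) (A.sφs a))
  refine Flat.sum _ (fun j hj => flat_smul_alt ?_ (s1 j) (A.scons e J j)) fun j _ =>
    (s1 j).smul (A.scons e J j)
  refine Flat.mul_left ?_ A.sχ (contDiff_dC (X.smooth j) (A.sφs a))
  simp only [A.dC_φs]
  exact (A.φ_L j hj).mul_left contDiff_const (contDiff_dC (X.smooth j) A.sφ)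

lemma tsupport_subset_of_eq_zero {F : Type*} [Zero F] {G : RV d → F}
    (h : ∀ x ∉ tsupport A.χ, G x = 0) : tsupport G ⊆ tsupport A.χ :=
  closure_minimal (fun x hx => by_contra fun h' => hx (h x h')) (isClosed_tsupport _)

lemma compact_of_eq_zero {F : Type*} [Zero F] {G : RV d → F}
    (h : ∀ x ∉ tsupport A.χ, G x = 0) : HasCompactSupport G :=
  A.χ_compact.of_isClosed_subset (isClosed_tsupport _) (A.tsupport_subset_of_eq_zero h)

lemma sf (a : ℕ) (σ : ℝ) : ContDiff ℝ ∞ (A.f e J a σ) :=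
  (contDiff_osc σ (A.sφs a)).smul (A.sχ.smul (A.sD e J))

lemma sg (a : ℕ) (σ : ℝ) : ContDiff ℝ ∞ (A.g e J a σ) :=
  (contDiff_osc σ (A.sφs a)).smul ((A.sG₀ e J).add ((A.sG₁ e J a).const_smul _))

lemma f_eq_zero (a : ℕ) (σ : ℝ) {x : RV d} (hx : x ∉ tsupport A.χ) : A.f e J a σ x = 0 := by
  rw [f, image_eq_zero_of_notMem_tsupport hx, zero_smul_alt, smul_zero_alt]

lemma g_eq_zero (a : ℕ) (σ : ℝ) {x : RV d} (hx : x ∉ tsupport A.χ) : A.g e J a σ x = 0 := by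
  rw [g, A.G₀_eq_zero e J hx, A.G₁_eq_zero e J a hx, smul_zero_alt, add_zero, smul_zero_alt]

lemma f_bound (a i : ℕ) : ∃ C : ℝ, 0 ≤ C ∧ ∀ σ : ℝ, 1 ≤ σ → ∀ x,
    ‖iteratedFDeriv ℝ i (A.f e J a σ) x‖ ≤ C * σ ^ (2 * i) := by
  have h0 : ∀ x ∉ tsupport A.χ, A.χ x • A.D e J x = 0 := fun x hx => by
    rw [image_eq_zero_of_notMem_tsupport hx, zero_smul_alt]
  obtain ⟨C, hC0, hC⟩ := exp_flat_bound (A.sφs a) A.c_pos i (A.sχ.smul (A.sD e J))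
    (A.compact_of_eq_zero h0) (flat_zero _)
    fun x hx => A.φs_re a (A.χ_supp (A.tsupport_subset_of_eq_zero h0 hx))
  exact ⟨C, hC0, fun σ hσ x => by have := hC σ hσ x; rwa [pow_zero, mul_one] at this⟩

/-- Both `G₀` and `G₁` are flat of order m: near the origin the cut-off is constant, the basic form
is almost closed, and the phase is almost annihilated by the `L j` with `j ∈ X.pos`. The coefficient
of `G₁` accounts for the additional σ². -/
lemma g_bound (a i : ℕ) : ∃ C : ℝ, 0 ≤ C ∧ ∀ σ : ℝ, 1 ≤ σ → ∀ x,
    ‖iteratedFDeriv ℝ i (A.g e J a σ) x‖ * σ ^ m ≤ C * σ ^ (2 * i + 2) := by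
  obtain ⟨C₀, hC₀0, hC₀⟩ := exp_flat_bound (A.sφs a) A.c_pos i (A.sG₀ e J)
    (A.compact_of_eq_zero fun x hx => A.G₀_eq_zero e J hx) (A.flat_G₀ e J)
    fun x hx => A.φs_re a (A.χ_supp (A.tsupport_subset_of_eq_zero (fun x hx => A.G₀_eq_zero e J hx) hx))
  obtain ⟨C₁, hC₁0, hC₁⟩ := exp_flat_bound (A.sφs a) A.c_pos i (A.sG₁ e J a)
    (A.compact_of_eq_zero fun x hx => A.G₁_eq_zero e J a hx) (A.flat_G₁ e J a)
    fun x hx => A.φs_re a (A.χ_supp (A.tsupport_subset_of_eq_zero (fun x hx => A.G₁_eq_zero e J a hx) hx))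
  refine ⟨C₀ + C₁, by positivity, fun σ hσ x => ?_⟩
  have s0 : ContDiff ℝ ∞ fun y => osc σ (A.φs a) y • A.G₀ e J y :=
    (contDiff_osc σ (A.sφs a)).smul (A.sG₀ e J)
  have s1 : ContDiff ℝ ∞ fun y => osc σ (A.φs a) y • A.G₁ e J a y :=
    (contDiff_osc σ (A.sφs a)).smul (A.sG₁ e J a)
  have hg : A.g e J a σ = fun y => osc σ (A.φs a) y • A.G₀ e J y +
      (σ ^ 2) • (osc σ (A.φs a) y • A.G₁ e J a y) := by
    funext y
    rw [g, smul_add]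
    congr 1
    rw [smul_comm]
    ext v
    simp [ContinuousAlternatingMap.smul_apply]
  have hi : ((i : ℕ) : WithTop ℕ∞) ≤ ∞ := by exact_mod_cast le_top
  rw [hg, fun_iteratedFDeriv_add_apply (s0.of_le hi).contDiffAt ((s1.of_le hi).const_smul _).contDiffAt,
      iteratedFDeriv_const_smul_apply' (s1.of_le hi).contDiffAt]
  have hσ0 : 0 ≤ σ := by linarith
  have e0 := hC₀ σ hσ x
  have e1 := hC₁ σ hσ x
  have hpow : σ ^ (2 * i) ≤ σ ^ (2 * i + 2) := pow_le_pow_right₀ hσ (by omega)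
  calc _ ≤ (‖iteratedFDeriv ℝ i (fun y => osc σ (A.φs a) y • A.G₀ e J y) x‖ +
      ‖σ ^ 2 • iteratedFDeriv ℝ i (fun y => osc σ (A.φs a) y • A.G₁ e J a y) x‖) * σ ^ m := by
        gcongr; exact norm_add_le _ _
    _ = ‖iteratedFDeriv ℝ i (fun y => osc σ (A.φs a) y • A.G₀ e J y) x‖ * σ ^ m + σ ^ 2 *
      (‖iteratedFDeriv ℝ i (fun y => osc σ (A.φs a) y • A.G₁ e J a y) x‖ * σ ^ m) := by
        rw [norm_smul, Real.norm_of_nonneg (sq_nonneg σ)]; ring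
    _ ≤ C₀ * σ ^ (2 * i + 2) + σ ^ 2 * (C₁ * σ ^ (2 * i)) := by
        exact add_le_add (e0.trans (by gcongr)) (by gcongr)
    _ = _ := by ring

lemma f_mem (a : ℕ) (σ : ℝ) (x : RV d) : A.f e J a σ x ∈ Filt (T01 X.L x) p (p + q) :=
  Submodule.smul_mem _ _ (Submodule.smul_mem _ _ (A.D_mem e J x))

lemma g_mem (a : ℕ) (σ : ℝ) {x : RV d} (hx : x ∈ Metric.ball (0 : RV d) X.R) :
    A.g e J a σ x ∈ Filt (T01 X.L x) p (p + q + 1) := by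
  have hD : ∀ j, detForm (Fin.cons (X.K.y (.inl j)) (A.col e J x) : Fin (p + q + 1) → RV d →L[ℝ] ℂ) ∈
      Filt (T01 X.L x) p (p + q + 1) := by
    intro j
    have := detForm_mem_filt (T := T01 X.L x)
      (l := (Fin.cons (X.K.y (.inl j)) (A.col e J x) : Fin (p + q + 1) → RV d →L[ℝ] ℂ))
      (Finset.univ.map ((Fin.castAddEmb q).trans (Fin.succEmb _))) (by
        intro i hi Z hZ
        obtain ⟨i, -, rfl⟩ := Finset.mem_map.1 hi
        simpa [col] using A.cext_θ (e i) x hZ)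
    simpa using this
  refine Submodule.smul_mem _ _ (Submodule.add_mem _ (Submodule.add_mem _
    (Submodule.sum_mem _ fun j _ => Submodule.smul_mem _ _ (hD j)) (Submodule.smul_mem _ _ ?_))
    (Submodule.smul_mem _ _ (Submodule.sum_mem _ fun j _ => Submodule.smul_mem _ _ (hD j))))
  -- The derivative of the basic form stays in level `p` only where the frame commutes, hence the
  -- restriction to the ball of radius `X.R`.
  exact filt_extDeriv (fun j => (X.smooth j).differentiable (by simp) x) (fun i j => X.comm i j x hx)
    ((A.sD e J).differentiable (by simp) x) (Eventually.of_forall fun y => A.D_mem e J y)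

/-- Write `f = B D`, so that `df = dB ∧ D + B dD`. The part of `dB` that annihilates T^{0,1} raises
the level to p + 1. What is left are the terms `L_j B · y_j ∧ D`, which vanish for `j ∉ X.pos`
because `J` exhausts these indices, and `g` collects the others together with `B dD`. -/
lemma extDeriv_f_sub (hJ : ∀ j ∉ X.pos, ∃ l, J l = j) (a : ℕ) (σ : ℝ) (x : RV d) :
    extDeriv (A.f e J a σ) x - A.g e J a σ x ∈ Filt (T01 X.L x) (p + 1) (p + q + 1) := by
  set B : RV d → ℂ := fun y => osc σ (A.φs a) y * A.χ y with hB
  have sB : ContDiff ℝ ∞ B := (contDiff_osc σ (A.sφs a)).mul A.sχ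
  have hf : A.f e J a σ = fun y => B y • detForm fun i => A.col e J y i := by
    funext y; rw [f, smul_smul]; rfl
  rw [hf, extDeriv_smul_detForm (l := fun i y => A.col e J y i) (sB.differentiable (by simp) x)
    ((A.sD e J).differentiable (by simp) x)]
  have hdec : fderiv ℝ B x = (fderiv ℝ B x - ∑ j, dC (X.L j x) B x • X.K.y (.inl j)) +
      ∑ j, dC (X.L j x) B x • X.K.y (.inl j) := by abel
  rw [hdec, detForm_cons_sum]
  have hdB : ∀ j, dC (X.L j x) B x = osc σ (A.φs a) x *
      (dC (X.L j x) A.χ x + (σ : ℂ) ^ 2 * (A.χ x * dC (X.L j x) (A.φs a) x)) := by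
    intro j
    rw [hB, dC_mul _ ((contDiff_osc σ (A.sφs a)).differentiable (by simp) x)
      (A.sχ.differentiable (by simp) x)]
    have : dC (X.L j x) (osc σ (A.φs a)) x = osc σ (A.φs a) x * (σ : ℂ) ^ 2 *
        dC (X.L j x) (A.φs a) x := by
      rw [dC, (hasFDerivAt_osc σ (A.sφs a) x).fderiv, cext_smul]; rfl
    have h2 : dC (X.L j x) (fun y => osc σ (A.φs a) y) x = dC (X.L j x) (osc σ (A.φs a)) x := rfl
    rw [h2, this]; ring
  -- The covector already occurs among the factors of `D`.
  have hzero : ∀ j ∉ X.pos,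
      detForm (Fin.cons (X.K.y (.inl j)) (A.col e J x) : Fin (p + q + 1) → RV d →L[ℝ] ℂ) = 0 := by
    intro j hj
    obtain ⟨l, rfl⟩ := hJ j hj
    exact detForm_eq_zero (i := 0) (j := (Fin.natAdd p l).succ) (Fin.succ_ne_zero _).symm (by simp [col])
  have hg : A.g e J a σ x = ∑ j, dC (X.L j x) B x •
      detForm (Fin.cons (X.K.y (.inl j)) (A.col e J x) : Fin (p + q + 1) → RV d →L[ℝ] ℂ) +
      B x • extDeriv (A.D e J) x := by
    have h1 : ∑ j, dC (X.L j x) B x •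
      detForm (Fin.cons (X.K.y (.inl j)) (A.col e J x) : Fin (p + q + 1) → RV d →L[ℝ] ℂ) =
      ∑ j ∈ X.pos, dC (X.L j x) B x •
      detForm (Fin.cons (X.K.y (.inl j)) (A.col e J x) : Fin (p + q + 1) → RV d →L[ℝ] ℂ) := by
      symm
      refine Finset.sum_subset (Finset.subset_univ _) fun j _ hj => ?_
      rw [hzero j hj, smul_zero_alt]
    rw [h1, g, G₀, G₁]
    simp only [hdB]
    simp only [smul_add, Finset.smul_sum, smul_smul, mul_add, add_smul_alt, Finset.sum_add_distrib, hB]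
    abel
  rw [hg]
  have hk := detForm_mem_filt (T := T01 X.L x)
      (l := (Fin.cons (fderiv ℝ B x - ∑ j, dC (X.L j x) B x • X.K.y (.inl j)) (A.col e J x) :
        Fin (p + q + 1) → RV d →L[ℝ] ℂ))
      (insert 0 (Finset.univ.map ((Fin.castAddEmb q).trans (Fin.succEmb _)))) (by
        intro i hi Z hZ
        rcases Finset.mem_insert.1 hi with rfl | hi
        · simpa using cext_coframe B x hZ
        obtain ⟨i, -, rfl⟩ := Finset.mem_map.1 hi
        simpa [col] using A.cext_θ (e i) x hZ)
  rw [Finset.card_insert_of_notMem (by simp [Fin.succ_ne_zero]), Finset.card_map, Finset.card_univ,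
    Fintype.card_fin] at hk
  convert hk using 1
  have hD : (fun y => detForm fun i => A.col e J y i) = A.D e J := rfl
  rw [hD]
  abel

end Stage

/-! ### The test functionals -/

variable {d n k : ℕ}

lemma contDiff_altC_apply {l : ℕ} {F : RV d → Alt d l} {Z : Fin l → RV d → CV d}
    (sF : ContDiff ℝ ∞ F) (sZ : ∀ i, ContDiff ℝ ∞ (Z i)) :
    ContDiff ℝ ∞ fun x => altC (F x) fun i => Z i x := by
  simp only [altC_apply]
  exact ContDiff.sum fun r _ => (contDiff_prod fun i _ => contDiff_pi.1 (sZ i) (r i)).mul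
    (contDiff_comp_ev sF r)

/-- Integration by parts in each coordinate; boundary terms are absent because `w` has compact
support, and the transpose of `V` is `-(V + div V)`. -/
lemma integral_dC_mul {V : RV d → CV d} {u w : RV d → ℂ} (sV : ContDiff ℝ ∞ V) (su : ContDiff ℝ ∞ u)
    (sw : ContDiff ℝ ∞ w) (cw : HasCompactSupport w) :
    ∫ x, dC (V x) u x * w x = -∫ x, u x * (dC (V x) w x + divC V x * w x) := by
  have sVr := contDiff_pi.1 sV
  have hmul : ∀ {a b : RV d → ℂ}, ContDiff ℝ ∞ a → ContDiff ℝ ∞ b → HasCompactSupport b →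
      Integrable fun x => a x * b x := fun ha hb hc =>
    (ha.mul hb).continuous.integrable_of_hasCompactSupport hc.mul_left
  have su' : ∀ r, ContDiff ℝ ∞ fun x => fderiv ℝ u x (ev r) := fun r =>
    (contDiff_fderiv su).clm_apply contDiff_const
  have sVw : ∀ r, ContDiff ℝ ∞ fun x => V x r * w x := fun r => (sVr r).mul sw
  have cVw : ∀ r, HasCompactSupport fun x => V x r * w x := fun r => cw.mul_left
  have sVw' : ∀ r, ContDiff ℝ ∞ fun x => fderiv ℝ (fun x => V x r * w x) x (ev r) := fun r =>
    (contDiff_fderiv (sVw r)).clm_apply contDiff_const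
  have cVw' : ∀ r, HasCompactSupport fun x => fderiv ℝ (fun x => V x r * w x) x (ev r) := fun r =>
    (cVw r).fderiv_apply ℝ (ev r)
  have key : ∀ r, ∫ x, (V x r * w x) * fderiv ℝ u x (ev r) =
      -∫ x, fderiv ℝ (fun x => V x r * w x) x (ev r) * u x := by
    intro r
    refine integral_mul_fderiv_eq_neg_fderiv_mul_of_integrable ?_ ?_ ?_
      (fun x _ => (sVw r).differentiable (by simp) x) fun x _ => su.differentiable (by simp) x
    · simp only [mul_comm _ (u _)]; exact hmul su (sVw' r) (cVw' r)
    · simp only [mul_comm _ (fderiv ℝ u _ _)]; exact hmul (su' r) (sVw r) (cVw r)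
    · simp only [mul_comm _ (u _)]; exact hmul su (sVw r) (cVw r)
  have h1 : ∀ x, dC (V x) u x * w x = ∑ r, (V x r * w x) * fderiv ℝ u x (ev r) := by
    intro x
    rw [dC_eq_sum, Finset.sum_mul]
    exact Finset.sum_congr rfl fun r _ => by ring
  have h2 : ∀ x, u x * (dC (V x) w x + divC V x * w x) =
      ∑ r, fderiv ℝ (fun x => V x r * w x) x (ev r) * u x := by
    intro x
    have : ∀ r, fderiv ℝ (fun x => V x r * w x) x (ev r) =
        V x r * fderiv ℝ w x (ev r) + dC (ec r) (fun y => V y r) x * w x := by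
      intro r
      rw [← dC_ec, dC_mul _ ((sVr r).differentiable (by simp) x) (sw.differentiable (by simp) x),
        dC_ec r w]
      try ring
    simp only [this, dC_eq_sum, divC]
    rw [← Finset.sum_mul, Finset.sum_add_distrib, Finset.sum_mul]; ring
  simp only [h1, h2]
  rw [integral_finsetSum _ fun r _ => ?_, integral_finsetSum _ fun r _ => ?_, ← Finset.sum_neg_distrib]
  · exact Finset.sum_congr rfl fun r _ => key r
  · simp only [mul_comm _ (u _)]; exact hmul su (sVw' r) (cVw' r)
  · simp only [mul_comm _ (fderiv ℝ u _ _)]; exact hmul (su' r) (sVw r) (cVw r)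

namespace Stage

variable {X : LocalCR d n k} {m : ℕ} {r : ℝ} (A : Stage X m r)
variable {p q : ℕ} (e : Fin p → Fin n ⊕ Fin k) (J : Fin q → Fin n)

/-- The vector fields in which forms are evaluated. -/
def Z : Fin (p + q) → RV d → CV d := Fin.append (fun i => A.N (e i)) fun j => X.L (J j)

lemma sZ (i : Fin (p + q)) : ContDiff ℝ ∞ (A.Z e J i) := by
  refine Fin.addCases (fun i => ?_) (fun j => ?_) i
  · simpa [Z] using A.sN (e i)
  · simpa [Z] using X.smooth (J j)

/-- The matrix of pairings is the identity: the normal fields are dual to the one-forms `θ`, the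
frame is dual to the conjugate covectors, and the cross terms vanish. -/
lemma altC_D (he : Function.Injective e) (hJ : Function.Injective J) {x : RV d}
    (hx : x ∈ Metric.ball (0 : RV d) A.ρ) : altC (A.D e J x) (fun i => A.Z e J i x) = 1 := by
  rw [D, altC_detForm, show (Matrix.of fun j i => cext (A.col e J x i) (A.Z e J j x)) =
    (1 : Matrix (Fin (p + q)) (Fin (p + q)) ℂ) from ?_, Matrix.det_one]
  ext j i
  rw [Matrix.of_apply, Matrix.one_apply]
  have hθN : ∀ a b, cext (A.θ a x) (A.N b x) = if a = b then 1 else 0 := by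
    intro a b
    have h1 := A.N_z x hx b a
    have h2 := A.N_y x hx b
    simp only [θ, cext_sub, cext_sum, cext_smul, h2, mul_zero, Finset.sum_const_zero, sub_zero]
    exact h1
  have hθL : ∀ a j, cext (A.θ a x) (X.L j x) = 0 := fun a j =>
    A.cext_θ a x (Submodule.subset_span ⟨j, rfl⟩)
  induction j using Fin.addCases with
  | left j =>
    induction i using Fin.addCases with
    | left i => simp [col, Z, hθN, he.eq_iff, eq_comm, Fin.ext_iff]
    | right i =>
      have : Fin.castAdd q j ≠ Fin.natAdd p i := by simp [Fin.ext_iff]; omega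
      simp [col, Z, A.N_y x hx, this]
  | right j =>
    induction i using Fin.addCases with
    | left i =>
      have : Fin.natAdd p j ≠ Fin.castAdd q i := by simp [Fin.ext_iff]; omega
      simp [col, Z, hθL, this]
    | right i => simp [col, Z, X.y_L, hJ.eq_iff, eq_comm, Fin.ext_iff]

/-- The multiples of the phase of the test forms. -/
def ψs (b : ℕ) (x : RV d) : ℂ := ((b : ℂ) + 1) * A.ψ x

lemma sψs (b : ℕ) : ContDiff ℝ ∞ (A.ψs b) := contDiff_const.mul A.sψ

lemma ψs_re (a : ℕ) {x : RV d} (hx : x ∈ Metric.ball (0 : RV d) A.ρ) :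
    (A.ψs a x).re ≤ -(A.c * ‖x‖ ^ 2) := by
  have h := A.ψ_re x hx
  have h0 : 0 ≤ A.c * ‖x‖ ^ 2 := mul_nonneg A.c_pos.le (sq_nonneg _)
  have : (A.ψs a x).re = ((a : ℝ) + 1) * (A.ψ x).re := by
    rw [ψs, show ((a : ℂ) + 1) = (((a : ℝ) + 1 : ℝ) : ℂ) by push_cast; ring, Complex.re_ofReal_mul]
  rw [this]
  have ha : (0 : ℝ) ≤ a := Nat.cast_nonneg a
  nlinarith

/-- The amplitude of the test form. -/
def amp (x : RV d) : ℂ := A.χ x * Complex.exp (A.β x)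

lemma samp : ContDiff ℝ ∞ A.amp := A.sχ.mul A.sβ.cexp

/-- The weight of the test functional. -/
def w (b : ℕ) (σ : ℝ) (x : RV d) : ℂ := osc σ (A.ψs b) x * A.amp x

lemma sw (b : ℕ) (σ : ℝ) : ContDiff ℝ ∞ (A.w b σ) := (contDiff_osc σ (A.sψs b)).mul A.samp

lemma amp_eq_zero {x : RV d} (hx : x ∉ tsupport A.χ) : A.amp x = 0 := by
  rw [amp, image_eq_zero_of_notMem_tsupport hx, zero_mul]

lemma w_eq_zero (b : ℕ) (σ : ℝ) {x : RV d} (hx : x ∉ tsupport A.χ) : A.w b σ x = 0 := by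
  rw [w, A.amp_eq_zero hx, mul_zero]

lemma cw (b : ℕ) (σ : ℝ) : HasCompactSupport (A.w b σ) :=
  A.compact_of_eq_zero fun _ hx => A.w_eq_zero b σ hx

lemma norm_integral_le {F : RV d → ℂ} (hF : ∀ x ∉ tsupport A.χ, F x = 0) {C : ℝ}
    (hC : ∀ x ∈ tsupport A.χ, ‖F x‖ ≤ C) : ‖∫ x, F x‖ ≤ C * volume.real (tsupport A.χ) := by
  rw [← setIntegral_eq_integral_of_forall_compl_eq_zero hF]
  exact norm_setIntegral_le_of_norm_le_const A.χ_compact.isCompact.measure_lt_top hC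

lemma exists_Z_bound : ∃ C : ℝ, 1 ≤ C ∧ ∀ i, ∀ x ∈ Metric.ball (0 : RV d) A.ρ, ‖A.Z e J i x‖ ≤ C := by
  have : ∀ i, ∃ C, ∀ x ∈ Metric.closedBall (0 : RV d) A.ρ, ‖A.Z e J i x‖ ≤ C := fun i =>
    (isCompact_closedBall _ _).exists_bound_of_continuousOn (A.sZ e J i).continuous.continuousOn
  choose C hC using this
  refine ⟨1 + ∑ i, |C i|, by
    have : 0 ≤ ∑ i, |C i| := Finset.sum_nonneg fun i _ => abs_nonneg _
    linarith, fun i x hx => ?_⟩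
  have h1 := hC i x (Metric.ball_subset_closedBall hx)
  have h2 := Finset.single_le_sum (f := fun i => |C i|) (fun i _ => abs_nonneg _) (Finset.mem_univ i)
  have h3 := le_abs_self (C i)
  linarith

/-- The test functional. -/
def T (b : ℕ) (σ : ℝ) (α : RV d → Alt d (p + q)) : ℂ :=
  ∫ x, altC (α x) (fun i => A.Z e J i x) * A.w b σ x

lemma T_bound (b : ℕ) : ∃ C : ℝ, 0 ≤ C ∧ ∀ σ : ℝ, 1 ≤ σ → ∀ (α : RV d → Alt d (p + q)) (K : ℝ), 0 ≤ K →
    (∀ x ∈ Metric.ball (0 : RV d) A.ρ, ‖α x‖ ≤ K) → ‖A.T e J b σ α‖ ≤ C * K := by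
  obtain ⟨C₁, hC₁, hZ⟩ := A.exists_Z_bound e J
  obtain ⟨C₂, hC₂0, hC₂⟩ := exp_flat_bound_zero (φ := A.ψs b) A.c_pos A.samp
    (A.compact_of_eq_zero fun _ hx => A.amp_eq_zero hx) (flat_zero _)
    fun x hx => A.ψs_re b (A.χ_supp (A.tsupport_subset_of_eq_zero (fun _ hx => A.amp_eq_zero hx) hx))
  refine ⟨(d : ℝ) ^ (p + q) * C₁ ^ (p + q) * C₂ * volume.real (tsupport A.χ), by positivity,
    fun σ hσ α K hK hα => ?_⟩
  refine (A.norm_integral_le (C := (d : ℝ) ^ (p + q) * K * C₁ ^ (p + q) * C₂)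
    (fun x hx => by rw [A.w_eq_zero b σ hx, mul_zero]) fun x hx => ?_).trans (le_of_eq (by ring))
  rw [norm_mul]
  have hx' := A.χ_supp hx
  have h1 : ‖altC (α x) (fun i => A.Z e J i x)‖ ≤ (d : ℝ) ^ (p + q) * K * C₁ ^ (p + q) := by
    refine (norm_altC_le _ _).trans ?_
    have : ∏ i, ‖A.Z e J i x‖ ≤ C₁ ^ (p + q) := by
      have := Finset.prod_le_prod (s := Finset.univ) (f := fun i => ‖A.Z e J i x‖) (g := fun _ => C₁)
        (fun _ _ => norm_nonneg _) fun i _ => hZ i x hx'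
      simpa using this
    have := hα x hx'
    gcongr
  have h2 : ‖A.w b σ x‖ ≤ C₂ := by
    have := hC₂ σ hσ x
    rwa [pow_zero, mul_one] at this
  gcongr

/-- Forms are evaluated with q of the arguments in T^{0,1}, one more than level p + 1 allows; so the
functional depends only on the class of a (p,q)-form. -/
lemma T_eq_zero (b : ℕ) (σ : ℝ) {α : RV d → Alt d (p + q)}
    (hα : ∀ x ∈ Metric.ball (0 : RV d) A.ρ, α x ∈ Filt (T01 X.L x) (p + 1) (p + q)) :
    A.T e J b σ α = 0 := by
  rw [T]
  refine integral_eq_zero_of_ae (Eventually.of_forall fun x => ?_)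
  by_cases hx : x ∈ tsupport A.χ
  · have : altC (α x) (fun i => A.Z e J i x) = 0 := by
      refine hα x (A.χ_supp hx) _ (Finset.univ.map (Fin.natAddEmb p)) (by simp) fun i hi => ?_
      obtain ⟨j, -, rfl⟩ := Finset.mem_map.1 hi
      simpa [Z, T01] using Submodule.subset_span (R := ℂ) (s := range fun j => X.L j x) ⟨J j, rfl⟩
    simp [this]
  · simp [A.w_eq_zero b σ hx]

lemma dC_w (b : ℕ) (σ : ℝ) (Z : CV d) (x : RV d) : dC Z (A.w b σ) x = osc σ (A.ψs b) x *
    (Complex.exp (A.β x) * (dC Z A.χ x + A.χ x * dC Z A.β x) +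
      (σ : ℂ) ^ 2 * (((b : ℂ) + 1) * (A.amp x * dC Z A.ψ x))) := by
  have h1 : dC Z (osc σ (A.ψs b)) x = osc σ (A.ψs b) x * (σ : ℂ) ^ 2 * (((b : ℂ) + 1) * dC Z A.ψ x) := by
    rw [dC, (hasFDerivAt_osc σ (A.sψs b) x).fderiv, cext_smul]
    congr 1
    exact dC_const_mul Z _ (A.sψ.differentiable (by simp) x)
  have h2 : dC Z (fun x => Complex.exp (A.β x)) x = Complex.exp (A.β x) * dC Z A.β x := by
    rw [dC, ((A.sβ.differentiable (by simp) x).hasFDerivAt.cexp).fderiv, cext_smul]; rfl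
  have h3 : dC Z A.amp x = Complex.exp (A.β x) * (dC Z A.χ x + A.χ x * dC Z A.β x) := by
    have := dC_mul Z (A.sχ.differentiable (by simp) x) (A.sβ.cexp.differentiable (by simp) x)
    rw [h2] at this
    rw [show A.amp = fun x => A.χ x * Complex.exp (A.β x) from rfl, this]
    try ring
  have h4 := dC_mul Z ((contDiff_osc σ (A.sψs b)).differentiable (by simp) x)
    (A.samp.differentiable (by simp) x)
  rw [show A.w b σ = fun x => osc σ (A.ψs b) x * A.amp x from rfl, h4, h3,
    show dC Z (fun y => osc σ (A.ψs b) y) x = dC Z (osc σ (A.ψs b)) x from rfl, h1]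
  ring

/-- The transposed frame applied to the weight is small. -/
lemma adjoint_w_bound (b : ℕ) {j : Fin n} (hj : j ∉ X.pos) : ∃ C : ℝ, 0 ≤ C ∧ ∀ σ : ℝ, 1 ≤ σ → ∀ x,
    ‖dC (X.L j x) (A.w b σ) x + divC (X.L j) x * A.w b σ x‖ * σ ^ m ≤ C * σ ^ 2 := by
  -- The transpose applied to the weight splits by powers of σ. The part `H₀` without σ² is flat
  -- since the cut-off is constant near the origin and β compensates the divergence; the coefficient
  -- `H₁` of σ² is flat since `j ∉ X.pos`.
  set H₀ : RV d → ℂ := fun x => Complex.exp (A.β x) *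
    (dC (X.L j x) A.χ x + A.χ x * (dC (X.L j x) A.β x + divC (X.L j) x)) with hH₀
  set H₁ : RV d → ℂ := fun x => ((b : ℂ) + 1) * (A.amp x * dC (X.L j x) A.ψ x) with hH₁
  have sdχ := contDiff_dC (X.smooth j) A.sχ
  have sdβ := (contDiff_dC (X.smooth j) A.sβ).add (contDiff_divC (X.smooth j))
  have sdψ := contDiff_dC (X.smooth j) A.sψ
  have sH₀ : ContDiff ℝ ∞ H₀ := A.sβ.cexp.mul (sdχ.add (A.sχ.mul sdβ))
  have sH₁ : ContDiff ℝ ∞ H₁ := contDiff_const.mul (A.samp.mul sdψ)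
  have z₀ : ∀ x ∉ tsupport A.χ, H₀ x = 0 := fun x hx => by
    simp [hH₀, A.dC_χ_eq_zero hx, image_eq_zero_of_notMem_tsupport hx]
  have z₁ : ∀ x ∉ tsupport A.χ, H₁ x = 0 := fun x hx => by simp [hH₁, A.amp_eq_zero hx]
  have f₀ : Flat m H₀ := ((A.flat_dC_χ m _).add ((A.β_L j).mul_left A.sχ sdβ) sdχ
    (A.sχ.mul sdβ)).mul_left A.sβ.cexp (sdχ.add (A.sχ.mul sdβ))
  have f₁ : Flat m H₁ := ((A.ψ_L j hj).mul_left A.samp sdψ).mul_left contDiff_const (A.samp.mul sdψ)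
  obtain ⟨C₀, hC₀0, hC₀⟩ := exp_flat_bound_zero (φ := A.ψs b) A.c_pos sH₀ (A.compact_of_eq_zero z₀) f₀
    fun x hx => A.ψs_re b (A.χ_supp (A.tsupport_subset_of_eq_zero z₀ hx))
  obtain ⟨C₁, hC₁0, hC₁⟩ := exp_flat_bound_zero (φ := A.ψs b) A.c_pos sH₁ (A.compact_of_eq_zero z₁) f₁
    fun x hx => A.ψs_re b (A.χ_supp (A.tsupport_subset_of_eq_zero z₁ hx))
  refine ⟨C₀ + C₁, by positivity, fun σ hσ x => ?_⟩
  have hx : dC (X.L j x) (A.w b σ) x + divC (X.L j) x * A.w b σ x =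
      osc σ (A.ψs b) x • H₀ x + (σ : ℂ) ^ 2 * (osc σ (A.ψs b) x • H₁ x) := by
    simp only [A.dC_w, w, hH₀, hH₁, amp, smul_eq_mul]; ring
  rw [hx]
  have e0 := hC₀ σ hσ x
  have e1 := hC₁ σ hσ x
  have hσ2 : 1 ≤ σ ^ 2 := one_le_pow₀ hσ
  have hσ0 : 0 ≤ σ := by linarith
  calc _ ≤ (‖osc σ (A.ψs b) x • H₀ x‖ + σ ^ 2 * ‖osc σ (A.ψs b) x • H₁ x‖) * σ ^ m := by
        gcongr
        refine (norm_add_le _ _).trans (le_of_eq ?_)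
        rw [norm_mul, norm_pow, Complex.norm_real, Real.norm_of_nonneg hσ0]
    _ = ‖osc σ (A.ψs b) x • H₀ x‖ * σ ^ m + σ ^ 2 * (‖osc σ (A.ψs b) x • H₁ x‖ * σ ^ m) := by ring
    _ ≤ C₀ * σ ^ 2 + σ ^ 2 * C₁ := by
        refine add_le_add (e0.trans ?_) (by gcongr)
        nlinarith
    _ = _ := by ring

end Stage

/-! ### Exact forms are almost annihilated -/

variable {d n k : ℕ}

namespace Stage

variable {X : LocalCR d n k} {m : ℕ} {r : ℝ} (A : Stage X m r)

lemma exists_bracket_bound : ∃ C : ℝ, 0 ≤ C ∧ ∀ b j, ∀ x ∈ Metric.ball (0 : RV d) A.ρ,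
    ‖brC (A.N b) (X.L j) x‖ ≤ C * ‖x‖ ^ m := by
  have hs : ∀ b j, ContDiff ℝ ∞ (brC (A.N b) (X.L j)) := fun b j => contDiff_pi.2 fun r =>
    (contDiff_dC (A.sN b) (contDiff_pi.1 (X.smooth j) r)).sub
      (contDiff_dC (X.smooth j) (contDiff_pi.1 (A.sN b) r))
  have : ∀ b j, ∃ C, 0 ≤ C ∧ ∀ x : RV d, ‖x‖ ≤ A.ρ → ‖brC (A.N b) (X.L j) x‖ ≤ C * ‖x‖ ^ m :=
    fun b j => (A.N_L b j).bound (hs b j) A.ρ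
  choose C hC0 hC using this
  refine ⟨∑ b, ∑ j, C b j, Finset.sum_nonneg fun b _ => Finset.sum_nonneg fun j _ => hC0 b j,
    fun b j x hx => (hC b j x (mem_ball_zero_iff.1 hx).le).trans ?_⟩
  have h1 := Finset.single_le_sum (f := fun j => C b j) (fun j _ => hC0 b j) (Finset.mem_univ j)
  have h2 := Finset.single_le_sum (f := fun b => ∑ j, C b j)
    (fun b _ => Finset.sum_nonneg fun j _ => hC0 b j) (Finset.mem_univ b)
  have : C b j ≤ ∑ b, ∑ j, C b j := h1.trans h2
  gcongr

variable {p q : ℕ} (e : Fin p → Fin n ⊕ Fin k) (J : Fin (q + 1) → Fin n)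

/-- Exact forms are almost annihilated by the test functional. -/
lemma T_exact (hJ : ∀ j, J j ∉ X.pos) (b : ℕ) : ∃ C : ℝ, 0 ≤ C ∧ ∀ σ : ℝ, 1 ≤ σ →
    ∀ (η : RV d → Alt d (p + q)) (K : ℝ), 0 ≤ K → ContDiff ℝ ∞ η →
    (∀ x ∈ Metric.ball (0 : RV d) A.ρ, η x ∈ Filt (T01 X.L x) p (p + q)) →
    (∀ x ∈ Metric.ball (0 : RV d) A.ρ, ‖η x‖ ≤ K) →
    ‖A.T e J b σ (extDeriv η)‖ * σ ^ m ≤ C * σ ^ 2 * K := by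
  obtain ⟨C₁, hC₁, hZ⟩ := A.exists_Z_bound e J
  obtain ⟨C₂, hC₂0, hbr⟩ := A.exists_bracket_bound
  have hadj : ∀ j : Fin (q + 1), ∃ C : ℝ, 0 ≤ C ∧ ∀ σ : ℝ, 1 ≤ σ → ∀ x,
    ‖dC (X.L (J j) x) (A.w b σ) x + divC (X.L (J j)) x * A.w b σ x‖ * σ ^ m ≤ C * σ ^ 2 := fun j =>
    A.adjoint_w_bound b (hJ j)
  choose C₃ hC₃0 hC₃ using hadj
  obtain ⟨C₄, hC₄0, hC₄⟩ := exists_pow_mul_exp_bound m A.c_pos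
  obtain ⟨C₅, hC₅⟩ := A.χ_compact.isCompact.exists_bound_of_continuousOn A.samp.continuous.continuousOn
  set l := p + q with hl
  set v := volume.real (tsupport A.χ) with hv
  have hv0 : 0 ≤ v := measureReal_nonneg
  refine ⟨((l : ℝ) ^ 2 * ((d : ℝ) ^ l * (C₂ * C₁ ^ l)) * (|C₅| * C₄)) * v +
    ∑ j, (d : ℝ) ^ l * C₁ ^ l * C₃ j * v, ?_, fun σ hσ η K hK sη hη hηK => ?_⟩
  · have := fun j => hC₃0 j
    have : 0 ≤ ∑ j, (d : ℝ) ^ l * C₁ ^ l * C₃ j * v := Finset.sum_nonneg fun j _ => by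
      have := hC₃0 j
      positivity
    positivity
  have hσ0 : 0 < σ := by linarith
  -- The last q + 1 slots, those filled with fields of the frame.
  set s : Finset (Fin (l + 1)) := Finset.univ.map (Fin.natAddEmb p : Fin (q + 1) ↪ Fin (p + (q + 1))) with hs
  have hscard : p + s.card = l + 1 := by rw [hs, Finset.card_map]; simp [hl]; omega
  have hZs : ∀ j, A.Z e J (Fin.natAdd p j) = X.L (J j) := fun j => by simp [Z]
  set u : Fin (l + 1) → RV d → ℂ := fun i y =>
    altC (η y) (i.removeNth fun t => A.Z e J t y) with hu
  have su : ∀ i, ContDiff ℝ ∞ (u i) := fun i =>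
    contDiff_altC_apply sη fun t => A.sZ e J (i.succAbove t)
  have hub : ∀ i, ∀ x ∈ Metric.ball (0 : RV d) A.ρ, ‖u i x‖ ≤ (d : ℝ) ^ l * K * C₁ ^ l := by
    intro i x hx
    refine (norm_altC_le _ _).trans ?_
    have h1 : ∏ t, ‖(i.removeNth fun t => A.Z e J t x : Fin l → CV d) t‖ ≤ C₁ ^ l := by
      have := Finset.prod_le_prod (s := Finset.univ)
        (f := fun t => ‖(i.removeNth fun t => A.Z e J t x : Fin l → CV d) t‖) (g := fun _ => C₁)
        (fun _ _ => norm_nonneg _) fun t _ => hZ _ x hx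
      simpa using this
    have := hηK x hx
    gcongr
  set S : RV d → ℂ := fun x => ∑ i ∈ s, (-1 : ℂ) ^ (i : ℕ) * dC (A.Z e J i x) (u i) x with hS
  have sS : ContDiff ℝ ∞ S := ContDiff.sum fun i _ =>
    contDiff_const.mul (contDiff_dC (A.sZ e J i) (su i))
  have seval : ContDiff ℝ ∞ fun x => altC (extDeriv η x) fun i => A.Z e J i x :=
    contDiff_altC_apply (contDiff_extDeriv sη) (A.sZ e J)
  -- Cartan's formula leaves derivatives along the frame and mixed brackets with the normal fields;
  -- the latter are flat of order m.
  have hpt : ∀ x ∈ Metric.ball (0 : RV d) A.ρ,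
      ‖altC (extDeriv η x) (fun i => A.Z e J i x) - S x‖ ≤
        (l : ℝ) ^ 2 * ((d : ℝ) ^ l * K * (C₂ * ‖x‖ ^ m * C₁ ^ l)) := by
    intro x hx
    have hnh := Metric.isOpen_ball.mem_nhds hx
    have := extDeriv_eval (m := l) (p := p) (F := η) (s := s) (L := X.L) (x := x) (Z := A.Z (p := p) (q := q + 1) e J) hscard (sη.differentiable (by simp) x)
      (fun i => (A.sZ e J i).differentiable (by simp) x)
      (Eventually.of_forall fun y i hi => by
        obtain ⟨j, -, rfl⟩ := Finset.mem_map.1 hi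
        rw [Fin.natAddEmb_apply, hZs]
        exact Submodule.subset_span ⟨J j, rfl⟩)
      (by filter_upwards [hnh] with y hy using hη y hy)
      (fun i hi j hj => by
        obtain ⟨i, -, rfl⟩ := Finset.mem_map.1 hi
        obtain ⟨j, -, rfl⟩ := Finset.mem_map.1 hj
        rw [Fin.natAddEmb_apply, Fin.natAddEmb_apply, hZs, hZs]
        exact X.comm _ _ x (Metric.ball_subset_ball A.ρ_le_R hx))
      (A := C₁) (B := C₂ * ‖x‖ ^ m) (fun i => hZ i x hx) hC₁ (by positivity)
      (fun i hi j hj => by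
        obtain ⟨j, -, rfl⟩ := Finset.mem_map.1 hj
        rw [Fin.natAddEmb_apply, hZs]
        revert hi
        exact Fin.addCases (m := p) (n := q + 1)
          (motive := fun i => i ∉ s → ‖brC (A.Z e J i) (X.L (J j)) x‖ ≤ C₂ * ‖x‖ ^ m)
          (fun i _ => by simpa [Z] using hbr (e i) (J j) x hx)
          (fun i hi => absurd (Finset.mem_map.2 ⟨i, Finset.mem_univ _, rfl⟩) hi) i)
    refine this.trans ?_
    have := hηK x hx
    gcongr
  have hint : ∀ {F : RV d → ℂ}, ContDiff ℝ ∞ F → Integrable fun x => F x * A.w b σ x := fun sF =>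
    (sF.mul (A.sw b σ)).continuous.integrable_of_hasCompactSupport (A.cw b σ).mul_left
  -- The first term is the bracket error; the others come from moving the frame derivatives onto the
  -- weight.
  have hsplit : A.T e J b σ (extDeriv η) =
      (∫ x, (altC (extDeriv η x) (fun i => A.Z e J i x) - S x) * A.w b σ x) +
      ∑ j : Fin (q + 1), -((-1 : ℂ) ^ (Fin.natAdd p j : ℕ) * ∫ x, u (Fin.natAdd p j) x *
        (dC (X.L (J j) x) (A.w b σ) x + divC (X.L (J j)) x * A.w b σ x)) := by
    have h1 : ∑ j : Fin (q + 1), -((-1 : ℂ) ^ (Fin.natAdd p j : ℕ) * ∫ x, u (Fin.natAdd p j) x *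
        (dC (X.L (J j) x) (A.w b σ) x + divC (X.L (J j)) x * A.w b σ x)) = ∫ x, S x * A.w b σ x := by
      have h2 : ∀ x, S x * A.w b σ x = ∑ j : Fin (q + 1), (-1 : ℂ) ^ (Fin.natAdd p j : ℕ) *
          (dC (X.L (J j) x) (u (Fin.natAdd p j)) x * A.w b σ x) := by
        intro x
        simp only [hS]
        rw [hs]
        refine (congrArg (· * A.w b σ x) (Finset.sum_map _ _ _)).trans ?_
        rw [Finset.sum_mul]
        refine Finset.sum_congr rfl fun j _ => ?_
        rw [Fin.natAddEmb_apply, hZs]; ring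
      simp only [h2]
      rw [integral_finsetSum _ fun j _ => (hint (contDiff_dC (X.smooth (J j)) (su _))).const_mul _]
      refine Finset.sum_congr rfl fun j _ => ?_
      rw [integral_const_mul, integral_dC_mul (X.smooth (J j)) (su _) (A.sw b σ) (A.cw b σ)]
      ring
    rw [h1, T]
    refine Eq.trans ?_ (integral_add (hint (seval.sub sS)) (hint sS))
    have hr : ∀ u v w : ℂ, u * w = (u - v) * w + v * w := fun u v w => by ring
    exact integral_congr_ae (Eventually.of_forall fun x => hr _ _ _)
  -- The factor `‖x‖ ^ m` of the bracket bound is traded for `σ ^ (-m)` by means of the Gaussian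
  -- decay of the weight.
  have hw : ∀ x ∈ tsupport A.χ, ‖x‖ ^ m * ‖A.w b σ x‖ * σ ^ m ≤ |C₅| * C₄ := by
    intro x hx
    have h1 := hC₄ (σ * ‖x‖) (by positivity)
    have h2 : ‖osc σ (A.ψs b) x‖ ≤ Real.exp (-(A.c * (σ * ‖x‖) ^ 2)) := by
      rw [norm_osc]
      apply Real.exp_le_exp.2
      have := mul_le_mul_of_nonneg_left (A.ψs_re b (A.χ_supp hx)) (sq_nonneg σ)
      linarith
    have h3 : ‖A.amp x‖ ≤ |C₅| := (hC₅ x hx).trans (le_abs_self _)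
    rw [w, norm_mul]
    calc ‖x‖ ^ m * (‖osc σ (A.ψs b) x‖ * ‖A.amp x‖) * σ ^ m
        ≤ ‖x‖ ^ m * (Real.exp (-(A.c * (σ * ‖x‖) ^ 2)) * |C₅|) * σ ^ m := by gcongr
      _ = |C₅| * ((σ * ‖x‖) ^ m * Real.exp (-(A.c * (σ * ‖x‖) ^ 2))) := by ring
      _ ≤ |C₅| * C₄ := by gcongr
  have e1 : ‖∫ x, (altC (extDeriv η x) (fun i => A.Z e J i x) - S x) * A.w b σ x‖ * σ ^ m ≤
      ((l : ℝ) ^ 2 * ((d : ℝ) ^ l * (C₂ * C₁ ^ l)) * (|C₅| * C₄)) * v * K := by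
    have := A.norm_integral_le
      (F := fun x => (altC (extDeriv η x) (fun i => A.Z e J i x) - S x) * A.w b σ x)
      (C := (l : ℝ) ^ 2 * ((d : ℝ) ^ l * (C₂ * C₁ ^ l)) * (|C₅| * C₄) * K / σ ^ m)
      (fun x hx => by simp only [A.w_eq_zero b σ hx, mul_zero]) fun x hx => by
        rw [norm_mul, le_div_iff₀ (by positivity)]
        calc _ ≤ (l : ℝ) ^ 2 * ((d : ℝ) ^ l * K * (C₂ * ‖x‖ ^ m * C₁ ^ l)) * ‖A.w b σ x‖ * σ ^ m := by
              gcongr; exact hpt x (A.χ_supp hx)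
          _ = (l : ℝ) ^ 2 * ((d : ℝ) ^ l * (C₂ * C₁ ^ l)) * K *
              (‖x‖ ^ m * ‖A.w b σ x‖ * σ ^ m) := by ring
          _ ≤ (l : ℝ) ^ 2 * ((d : ℝ) ^ l * (C₂ * C₁ ^ l)) * K * (|C₅| * C₄) := by
              exact mul_le_mul_of_nonneg_left (hw x hx) (by positivity)
          _ = _ := by ring
    rw [← hv, div_mul_eq_mul_div, le_div_iff₀ (by positivity)] at this
    exact this.trans (le_of_eq (by ring))
  have e2 : ∀ j, ‖-((-1 : ℂ) ^ (Fin.natAdd p j : ℕ) * ∫ x, u (Fin.natAdd p j) x *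
        (dC (X.L (J j) x) (A.w b σ) x + divC (X.L (J j)) x * A.w b σ x))‖ * σ ^ m ≤
      (d : ℝ) ^ l * C₁ ^ l * C₃ j * v * (σ ^ 2 * K) := by
    intro j
    rw [norm_neg, norm_mul, norm_pow, norm_neg, norm_one, one_pow, one_mul]
    have := A.norm_integral_le (F := fun x => u (Fin.natAdd p j) x *
        (dC (X.L (J j) x) (A.w b σ) x + divC (X.L (J j)) x * A.w b σ x))
      (C := (d : ℝ) ^ l * K * C₁ ^ l * (C₃ j * σ ^ 2) / σ ^ m)
      (fun x hx => by
        have : A.w b σ =ᶠ[𝓝 x] fun _ => 0 := by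
          filter_upwards [(isClosed_tsupport A.χ).isOpen_compl.mem_nhds hx] with y hy
          exact A.w_eq_zero b σ hy
        simp only [dC_congr _ this, dC_const, A.w_eq_zero b σ hx, mul_zero, add_zero]) fun x hx => by
        rw [norm_mul, le_div_iff₀ (by positivity), mul_assoc]
        have h1 := hub (Fin.natAdd p j) x (A.χ_supp hx)
        have h2 := hC₃ j σ hσ x
        gcongr
    rw [← hv, div_mul_eq_mul_div, le_div_iff₀ (by positivity)] at this
    exact this.trans (le_of_eq (by ring))
  rw [hsplit]
  have hσ2 : 1 ≤ σ ^ 2 := one_le_pow₀ hσ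
  calc _ ≤ (‖∫ x, (altC (extDeriv η x) (fun i => A.Z e J i x) - S x) * A.w b σ x‖ +
      ∑ j : Fin (q + 1), ‖-((-1 : ℂ) ^ (Fin.natAdd p j : ℕ) * ∫ x, u (Fin.natAdd p j) x *
        (dC (X.L (J j) x) (A.w b σ) x + divC (X.L (J j)) x * A.w b σ x))‖) * σ ^ m := by
        refine mul_le_mul_of_nonneg_right ((norm_add_le _ _).trans ?_) (by positivity)
        gcongr
        exact norm_sum_le _ _
    _ ≤ ((l : ℝ) ^ 2 * ((d : ℝ) ^ l * (C₂ * C₁ ^ l)) * (|C₅| * C₄)) * v * K * σ ^ 2 +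
        ∑ j, (d : ℝ) ^ l * C₁ ^ l * C₃ j * v * (σ ^ 2 * K) := by
        rw [add_mul, Finset.sum_mul]
        refine add_le_add (e1.trans ?_) (Finset.sum_le_sum fun j _ => e2 j)
        exact le_mul_of_one_le_right (by positivity) hσ2
    _ = _ := by rw [← Finset.sum_mul]; ring

end Stage

/-! ### Asymptotics of Gaussian integrals -/

lemma integrable_gaussian {c : ℝ} (hc : 0 < c) : Integrable fun x : RV d => Real.exp (-(c * ‖x‖ ^ 2)) := by
  have := (GaussianFourier.integrable_cexp_neg_mul_sq_norm_add (V := RV d) (b := (c : ℂ))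
    (by simpa using hc) 0 0).norm
  refine this.congr (Eventually.of_forall fun x => ?_)
  simp only [Complex.norm_exp]
  congr 1
  simp [← Complex.ofReal_pow]

lemma integrable_cexp_of_re_le {Q : RV d → ℂ} (hQ : Continuous Q) {c : ℝ} (hc : 0 < c)
    (hre : ∀ x, (Q x).re ≤ -(c * ‖x‖ ^ 2)) : Integrable fun x => Complex.exp (Q x) := by
  refine (integrable_gaussian hc).mono' (by fun_prop) (Eventually.of_forall fun x => ?_)
  rw [Complex.norm_exp]
  exact Real.exp_le_exp.2 (hre x)

/-- Substitute `x = y / σ`. The quadratic part of the phase is scale invariant, the linear part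
becomes the oscillation `σ ξ(y)`, and the cubic remainder is of size `‖y‖³ / σ`. Gaussian domination
gives the limit. -/
lemma tendsto_rescaled_integral {a Θ Q : RV d → ℂ} (ha : Continuous a) (ca : HasCompactSupport a)
    (hΘ : Continuous Θ) (hQ : Continuous Q) (ξ : RV d →L[ℝ] ℝ) {c C : ℝ} (hc : 0 < c)
    (hre : ∀ x ∈ tsupport a, (Θ x).re ≤ -(c * ‖x‖ ^ 2)) (hQre : ∀ x, (Q x).re ≤ -(c * ‖x‖ ^ 2))
    (hQs : ∀ (s : ℝ) x, Q (s • x) = (s : ℂ) ^ 2 * Q x)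
    (hdiff : ∀ x, ‖x‖ ≤ 1 → ‖Θ x - (Complex.I * (ξ x : ℂ) + Q x)‖ ≤ C * ‖x‖ ^ 3) :
    Tendsto (fun σ : ℝ => ((σ : ℂ) ^ d * ∫ x, a x * Complex.exp ((σ : ℂ) ^ 2 * Θ x)) -
      a 0 * ∫ x, Complex.exp (Complex.I * ((σ * ξ x : ℝ) : ℂ)) * Complex.exp (Q x)) atTop (𝓝 0) := by
  obtain ⟨M, hM⟩ := ha.bounded_above_of_compact_support ca
  have hM0 : 0 ≤ M := (norm_nonneg _).trans (hM 0)
  have hosc : ∀ t : ℝ, ‖Complex.exp (Complex.I * (t : ℂ))‖ = 1 := fun t => by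
    rw [mul_comm]; exact Complex.norm_exp_ofReal_mul_I t
  -- Because of the oscillating factor neither integrand need converge pointwise. Their difference
  -- does, since the factor is common to both and has modulus one.
  set F : ℝ → RV d → ℂ := fun σ y => a (σ⁻¹ • y) * Complex.exp ((σ : ℂ) ^ 2 * Θ (σ⁻¹ • y)) -
    a 0 * (Complex.exp (Complex.I * ((σ * ξ y : ℝ) : ℂ)) * Complex.exp (Q y)) with hF
  have hlim : Tendsto (fun σ => ∫ y, F σ y) atTop (𝓝 (∫ _ : RV d, (0 : ℂ))) := by
    refine tendsto_integral_filter_of_dominated_convergence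
      (fun y => (M + ‖a 0‖) * Real.exp (-(c * ‖y‖ ^ 2))) ?_ ?_
      ((integrable_gaussian hc).const_mul _) ?_
    · refine Eventually.of_forall fun σ => Continuous.aestronglyMeasurable ?_
      simp only [hF]; fun_prop
    · filter_upwards [eventually_gt_atTop 0] with σ hσ
      refine Eventually.of_forall fun y => (norm_sub_le _ _).trans ?_
      rw [add_mul]
      refine add_le_add ?_ ?_
      · by_cases hy : σ⁻¹ • y ∈ tsupport a
        · rw [norm_mul]
          refine mul_le_mul (hM _) ?_ (norm_nonneg _) hM0
          rw [Complex.norm_exp, ← Complex.ofReal_pow, Complex.re_ofReal_mul]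
          apply Real.exp_le_exp.2
          have := mul_le_mul_of_nonneg_left (hre _ hy) (sq_nonneg σ)
          rw [norm_smul, norm_inv, Real.norm_of_nonneg hσ.le] at this
          refine this.trans (le_of_eq ?_)
          field_simp
        · rw [image_eq_zero_of_notMem_tsupport hy]; simp; positivity
      · rw [norm_mul, norm_mul, hosc, one_mul, Complex.norm_exp]
        gcongr
        exact hQre y
    · refine Eventually.of_forall fun y => ?_
      have hsmall : Tendsto (fun σ : ℝ => σ⁻¹ • y) atTop (𝓝 0) := by
        have := (tendsto_inv_atTop_zero (𝕜 := ℝ)).smul_const y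
        rwa [zero_smul] at this
      set R : ℝ → ℂ := fun σ => (σ : ℂ) ^ 2 * (Θ (σ⁻¹ • y) - (Complex.I * (ξ (σ⁻¹ • y) : ℂ) + Q (σ⁻¹ • y)))
        with hR
      have hR0 : Tendsto R atTop (𝓝 0) := by
        have hb : Tendsto (fun σ : ℝ => C * ‖y‖ ^ 3 * σ⁻¹) atTop (𝓝 0) := by
          have := (tendsto_inv_atTop_zero (𝕜 := ℝ)).const_mul (C * ‖y‖ ^ 3)
          rwa [mul_zero] at this
        refine squeeze_zero_norm' ?_ hb
        have hn : ∀ᶠ σ : ℝ in atTop, ‖σ⁻¹ • y‖ ≤ 1 := by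
          have := hsmall.norm
          rw [norm_zero] at this
          exact (this.eventually (gt_mem_nhds one_pos)).mono fun σ h => h.le
        filter_upwards [hn, eventually_gt_atTop 0] with σ h1 hσ
        rw [hR]
        simp only [norm_mul, norm_pow, Complex.norm_real, Real.norm_of_nonneg hσ.le]
        calc _ ≤ σ ^ 2 * (C * ‖σ⁻¹ • y‖ ^ 3) := by gcongr; exact hdiff _ h1
          _ = _ := by
            rw [norm_smul, norm_inv, Real.norm_of_nonneg hσ.le]
            field_simp
      have hlim2 : Tendsto (fun σ : ℝ => a (σ⁻¹ • y) * Complex.exp (Q y + R σ) - a 0 * Complex.exp (Q y))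
          atTop (𝓝 0) := by
        have h1 : Tendsto (fun σ : ℝ => a (σ⁻¹ • y)) atTop (𝓝 (a 0)) :=
          (ha.tendsto 0).comp hsmall
        have h2 : Tendsto (fun σ : ℝ => Complex.exp (Q y + R σ)) atTop (𝓝 (Complex.exp (Q y + 0))) :=
          (Complex.continuous_exp.tendsto _).comp (tendsto_const_nhds.add hR0)
        have := (h1.mul h2).sub_const (a 0 * Complex.exp (Q y))
        rwa [add_zero, sub_self] at this
      refine squeeze_zero_norm' ?_ (tendsto_zero_iff_norm_tendsto_zero.1 hlim2)
      filter_upwards [eventually_gt_atTop 0] with σ hσ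
      have hσ' : (σ : ℂ) ≠ 0 := by exact_mod_cast hσ.ne'
      have hex : (σ : ℂ) ^ 2 * Θ (σ⁻¹ • y) = Complex.I * ((σ * ξ y : ℝ) : ℂ) + (Q y + R σ) := by
        rw [hR]
        simp only [hQs, map_smul, smul_eq_mul]
        push_cast
        field_simp
        ring
      rw [hF]
      simp only [hex, Complex.exp_add (Complex.I * _)]
      rw [show a (σ⁻¹ • y) * (Complex.exp (Complex.I * ((σ * ξ y : ℝ) : ℂ)) * Complex.exp (Q y + R σ)) -
        a 0 * (Complex.exp (Complex.I * ((σ * ξ y : ℝ) : ℂ)) * Complex.exp (Q y)) =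
        Complex.exp (Complex.I * ((σ * ξ y : ℝ) : ℂ)) *
          (a (σ⁻¹ • y) * Complex.exp (Q y + R σ) - a 0 * Complex.exp (Q y)) by ring, norm_mul, hosc,
        one_mul]
  rw [integral_zero] at hlim
  refine hlim.congr' ?_
  filter_upwards [eventually_gt_atTop 0] with σ hσ
  have hi1 : Integrable fun y : RV d => a (σ⁻¹ • y) * Complex.exp ((σ : ℂ) ^ 2 * Θ (σ⁻¹ • y)) := by
    have h0 : Integrable fun y : RV d => a y * Complex.exp ((σ : ℂ) ^ 2 * Θ y) :=
      Continuous.integrable_of_hasCompactSupport (by fun_prop) ca.mul_right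
    exact h0.comp_smul (inv_ne_zero hσ.ne')
  have hi2 : Integrable fun y : RV d => a 0 * (Complex.exp (Complex.I * ((σ * ξ y : ℝ) : ℂ)) * Complex.exp (Q y)) := by
    refine Integrable.const_mul ?_ _
    refine (integrable_cexp_of_re_le hQ hc hQre).bdd_mul (c := 1) (Continuous.aestronglyMeasurable (by fun_prop)) ?_
    exact Eventually.of_forall fun y => (hosc _).le
  rw [hF]
  simp only
  rw [integral_sub hi1 hi2, integral_const_mul]
  congr 1
  have := Measure.integral_comp_smul (volume : Measure (RV d))
    (fun x => a x * Complex.exp ((σ : ℂ) ^ 2 * Θ x)) σ⁻¹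
  rw [this, finrank_euclideanSpace_fin, inv_pow, inv_inv, abs_of_pos (by positivity), Complex.real_smul]
  push_cast; rfl

/-- The Riemann-Lebesgue lemma: the covectors `-(σ / 2π) ξ` leave every compact set. -/
lemma tendsto_oscillating_integral {Q : RV d → ℂ} {ξ : RV d →L[ℝ] ℝ} (hξ : ξ ≠ 0) :
    Tendsto (fun σ : ℝ => ∫ x, Complex.exp (Complex.I * ((σ * ξ x : ℝ) : ℂ)) * Complex.exp (Q x)) atTop
      (𝓝 0) := by
  have h := tendsto_integral_exp_smul_cocompact (fun x : RV d => Complex.exp (Q x)) volume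
  have h2 : Tendsto (fun σ : ℝ => (-(σ / (2 * Real.pi))) • ξ) atTop (cocompact (StrongDual ℝ (RV d))) := by
    rw [← Metric.cobounded_eq_cocompact, ← tendsto_norm_atTop_iff_cobounded]
    simp only [norm_smul, norm_neg, norm_div]
    have h3 : Tendsto (fun σ : ℝ => ‖σ‖ * (‖ξ‖ / ‖2 * Real.pi‖)) atTop atTop :=
      tendsto_norm_atTop_atTop.atTop_mul_const (by
        have := Real.pi_pos
        exact div_pos (norm_pos_iff.2 hξ) (norm_pos_iff.2 (by positivity)))
    refine h3.congr fun σ => by ring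
  refine (h.comp h2).congr fun σ => ?_
  refine integral_congr_ae (Eventually.of_forall fun x => ?_)
  simp only [Circle.smul_def, Real.fourierChar_apply, smul_eq_mul, ContinuousLinearMap.smul_apply]
  congr 2
  push_cast
  have : (Real.pi : ℂ) ≠ 0 := by exact_mod_cast Real.pi_ne_zero
  field_simp

/-! ### Pairings of approximate cocycles with test functionals -/

variable {d n k : ℕ}

namespace LocalCR

variable (X : LocalCR d n k)

/-- Otherwise the Levi form would vanish, while its diagonal entries are nonzero and there is at
least one. -/
lemma ξ_ne_zero (hn : 0 < n) : X.ξ ≠ 0 := by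
  intro h
  have := X.levi (Pi.single ⟨0, hn⟩ 1)
  have h0 : Complex.ofRealCLM.comp X.ξ = 0 := by rw [h]; ext; simp
  have hc : ∀ v, cext (Complex.ofRealCLM.comp X.ξ) v = 0 := fun v => by rw [h0]; simp [cext]
  simp only [hc, mul_zero, Finset.sum_const_zero, Complex.zero_im] at this
  rw [Finset.sum_eq_single ⟨0, hn⟩ (fun j _ hj => by simp [hj]) (by simp)] at this
  simp at this
  exact X.lam_ne _ this

/-- The quadratic part of a sum of phases. -/
def Q (a b : ℝ) (x : RV d) : ℂ :=
  (a : ℂ) * (X.φ₂ x - Complex.I * X.ξC x) + (b : ℂ) * (X.ψ₂ x + Complex.I * X.ξC x)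

lemma contDiff_Q (a b : ℝ) : ContDiff ℝ ∞ (X.Q a b) :=
  (contDiff_const.mul (X.contDiff_φ₂.sub (contDiff_const.mul X.ξC.contDiff))).add
    (contDiff_const.mul (X.contDiff_ψ₂.add (contDiff_const.mul X.ξC.contDiff)))

lemma Q_smul (a b s : ℝ) (x : RV d) : X.Q a b (s • x) = (s : ℂ) ^ 2 * X.Q a b x := by
  simp only [Q, φ₂, ψ₂, W, sq, Coords.quad_smul]
  ring

lemma re_Q (a b : ℝ) (x : RV d) : (X.Q a b x).re = a * (X.φ₂ x).re + b * (X.ψ₂ x).re := by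
  simp [Q, ξC]

/-- For equal weights the contributions of `W` cancel and only a real multiple of sums of squares
remains. -/
lemma Q_self (a : ℝ) (x : RV d) : X.Q a a x = ((X.Q a a x).re : ℂ) := by
  have : X.Q a a x = -((a * X.C₀ : ℝ) : ℂ) * (X.sq X.posᶜ x + X.sq X.pos x) := by
    simp only [Q, φ₂, ψ₂]; push_cast; ring
  rw [this, sq_eq, sq_eq]
  norm_cast

end LocalCR

namespace Stage

variable {X : LocalCR d n k} {m : ℕ} {r : ℝ} (A : Stage X m r)
variable {p q : ℕ} (e : Fin p → Fin n ⊕ Fin k) (J : Fin q → Fin n)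

lemma T_f (he : Function.Injective e) (hJ : Function.Injective J) (a b : ℕ) (σ : ℝ) :
    A.T e J b σ (A.f e J a σ) =
      ∫ x, (A.χ x * A.amp x) * Complex.exp ((σ : ℂ) ^ 2 * (A.φs a x + A.ψs b x)) := by
  rw [T]
  refine integral_congr_ae (Eventually.of_forall fun x => ?_)
  simp only
  by_cases hx : x ∈ tsupport A.χ
  · have h1 : altC (A.f e J a σ x) (fun i => A.Z e J i x) = osc σ (A.φs a) x * A.χ x := by
      have := A.altC_D e J he hJ (A.χ_supp hx)
      rw [f, altC_smul, altC_smul, ContinuousAlternatingMap.smul_apply, ContinuousAlternatingMap.smul_apply, this, smul_eq_mul,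
        smul_eq_mul, mul_one]
    rw [h1, w, osc, osc, mul_add, Complex.exp_add]
    ring
  · rw [A.w_eq_zero b σ hx, A.amp_eq_zero hx]; simp

/-- The constant in the leading term of the pairings. -/
def κ (b : ℕ) : ℂ := A.χ 0 * A.amp 0 * ∫ x, Complex.exp (X.Q (b + 1) (b + 1) x)

lemma re_Q_le (a b : ℕ) (x : RV d) : (X.Q (a + 1) (b + 1) x).re ≤ -(A.c * ‖x‖ ^ 2) := by
  rw [X.re_Q]
  have h1 := A.φ₂_re x
  have h2 := A.ψ₂_re x
  have h0 : 0 ≤ A.c * ‖x‖ ^ 2 := mul_nonneg A.c_pos.le (sq_nonneg _)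
  have ha : (0 : ℝ) ≤ a := Nat.cast_nonneg a
  have hb : (0 : ℝ) ≤ b := Nat.cast_nonneg b
  nlinarith

/-- The integrand is a positive real exponential and both cut-offs equal one at the origin, so no
cancellation can occur. -/
lemma κ_ne_zero (b : ℕ) : A.κ b ≠ 0 := by
  have h1 : A.χ 0 = 1 := A.χ_one.self_of_nhds
  have hint := integrable_cexp_of_re_le (X.contDiff_Q (b + 1) (b + 1)).continuous A.c_pos (A.re_Q_le b b)
  have h2 : ∫ x, Complex.exp (X.Q (b + 1) (b + 1) x) =
      ((∫ x, Real.exp (X.Q (b + 1) (b + 1) x).re : ℝ) : ℂ) := by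
    rw [← integral_complex_ofReal]
    refine integral_congr_ae (Eventually.of_forall fun x => ?_)
    simp only
    rw [X.Q_self, Complex.ofReal_re, Complex.ofReal_exp]
  have h3 : 0 < ∫ x, Real.exp (X.Q (b + 1) (b + 1) x).re := by
    refine integral_exp_pos ?_
    refine hint.norm.congr (Eventually.of_forall fun x => ?_)
    simp [Complex.norm_exp]
  rw [κ, amp, h1, h2]
  have : ((∫ x, Real.exp (X.Q (b + 1) (b + 1) x).re : ℝ) : ℂ) ≠ 0 := by exact_mod_cast h3.ne'
  simpa using this

/-- The sum of phases is `i (a - b) ξ` plus the quadratic form `Q` plus a cubic error. On the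
diagonal the oscillation disappears and the limit is the Gaussian constant; off the diagonal it
sends the integral to zero. -/
lemma tendsto_T_f (hn : 0 < n) (he : Function.Injective e) (hJ : Function.Injective J) (a b : ℕ) :
    Tendsto (fun σ : ℝ => (σ : ℂ) ^ d * A.T e J b σ (A.f e J a σ)) atTop
      (𝓝 (if a = b then A.κ b else 0)) := by
  obtain ⟨C₁, hC₁, h₁⟩ := A.φ_flat.bound (A.sφ.sub X.contDiff_φ₂) 1
  obtain ⟨C₂, hC₂, h₂⟩ := A.ψ_flat.bound (A.sψ.sub X.contDiff_ψ₂) 1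
  have hnn : ∀ a : ℕ, ‖(a : ℂ) + 1‖ = a + 1 := fun a => by
    rw [show ((a : ℂ) + 1) = (((a : ℝ) + 1 : ℝ) : ℂ) by push_cast; ring, Complex.norm_real,
      Real.norm_of_nonneg (by positivity)]
  have key := tendsto_rescaled_integral (a := fun x => A.χ x * A.amp x)
    (Θ := fun x => A.φs a x + A.ψs b x) (Q := X.Q (a + 1) (b + 1)) (A.sχ.mul A.samp).continuous
    (A.compact_of_eq_zero fun x hx => by rw [A.amp_eq_zero hx, mul_zero])
    ((A.sφs a).add (A.sψs b)).continuous (X.contDiff_Q _ _).continuous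
    (((a : ℝ) - b) • X.ξ) (c := A.c) (C := (a + 1) * C₁ + (b + 1) * C₂) A.c_pos
    (fun x hx => by
      have hx' := A.χ_supp (A.tsupport_subset_of_eq_zero (fun x hx => by rw [A.amp_eq_zero hx, mul_zero]) hx)
      have h1 := A.φs_re a hx'
      have h2 := A.ψs_re b hx'
      have h0 : 0 ≤ A.c * ‖x‖ ^ 2 := mul_nonneg A.c_pos.le (sq_nonneg _)
      rw [Complex.add_re]; linarith)
    (A.re_Q_le a b) (fun s x => X.Q_smul _ _ s x) (fun x hx => by
      have h3 : A.φs a x + A.ψs b x - (Complex.I * (((((a : ℝ) - b) • X.ξ) x : ℝ) : ℂ) +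
          X.Q (a + 1) (b + 1) x) = ((a : ℂ) + 1) * (A.φ x - X.φ₂ x) +
          ((b : ℂ) + 1) * (A.ψ x - X.ψ₂ x) := by
        simp only [φs, ψs, LocalCR.Q, LocalCR.ξC, ContinuousLinearMap.smul_apply, smul_eq_mul,
          ContinuousLinearMap.comp_apply, Complex.ofRealCLM_apply]
        push_cast; ring
      rw [h3]
      refine (norm_add_le _ _).trans ?_
      rw [norm_mul, norm_mul, hnn, hnn]
      have e1 := h₁ x hx
      have e2 := h₂ x hx
      calc _ ≤ ((a : ℝ) + 1) * (C₁ * ‖x‖ ^ 3) + ((b : ℝ) + 1) * (C₂ * ‖x‖ ^ 3) := by gcongr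
        _ = _ := by ring)
  have hlim : Tendsto (fun σ : ℝ => A.χ 0 * A.amp 0 * ∫ x,
      Complex.exp (Complex.I * ((σ * (((a : ℝ) - b) • X.ξ) x : ℝ) : ℂ)) *
        Complex.exp (X.Q (a + 1) (b + 1) x)) atTop (𝓝 (if a = b then A.κ b else 0)) := by
    split_ifs with hab
    · subst hab
      simp only [sub_self, zero_smul, ContinuousLinearMap.zero_apply, mul_zero, Complex.ofReal_zero,
        Complex.exp_zero, one_mul]
      exact tendsto_const_nhds
    · have hne : ((a : ℝ) - b) • X.ξ ≠ 0 :=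
        smul_ne_zero (sub_ne_zero.2 (by exact_mod_cast hab)) (X.ξ_ne_zero hn)
      have := (tendsto_oscillating_integral (Q := X.Q (a + 1) (b + 1)) hne).const_mul (A.χ 0 * A.amp 0)
      rwa [mul_zero] at this
  have := key.add hlim
  rw [zero_add] at this
  refine this.congr fun σ => ?_
  rw [A.T_f e J he hJ, sub_add_cancel]

lemma T_add (b : ℕ) (σ : ℝ) {α α' : RV d → Alt d (p + q)} (hα : ContDiff ℝ ∞ α) (hα' : ContDiff ℝ ∞ α') :
    A.T e J b σ (fun x => α x + α' x) = A.T e J b σ α + A.T e J b σ α' := by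
  have hint : ∀ {F : RV d → Alt d (p + q)}, ContDiff ℝ ∞ F →
      Integrable fun x => altC (F x) (fun i => A.Z e J i x) * A.w b σ x := fun sF =>
    ((contDiff_altC_apply sF (A.sZ e J)).mul (A.sw b σ)).continuous.integrable_of_hasCompactSupport
      (A.cw b σ).mul_left
  rw [T, T, T, ← integral_add (hint hα) (hint hα')]
  refine integral_congr_ae (Eventually.of_forall fun x => ?_)
  simp only [altC_add, ContinuousAlternatingMap.add_apply]; ring

lemma T_smul (b : ℕ) (σ : ℝ) (c : ℂ) (α : RV d → Alt d (p + q)) :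
    A.T e J b σ (fun x => c • α x) = c * A.T e J b σ α := by
  rw [T, T, ← integral_const_mul]
  refine integral_congr_ae (Eventually.of_forall fun x => ?_)
  simp only [altC_smul, ContinuousAlternatingMap.smul_apply, smul_eq_mul]; ring

end Stage

/-! ### Almost dual families of cocycles and functionals -/

/-- On the ball of radius `r`, `α` represents an exact form with a primitive of size at most `C`. -/
def ExactBound (L : Fin n → RV d → CV d) (p : ℕ) : (q : ℕ) → (RV d → Alt d (p + q)) → ℝ → ℝ → Prop
  | 0, α, r, _ => ∀ x ∈ Metric.ball (0 : RV d) r, α x ∈ Filt (T01 L x) (p + 1) (p + 0)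
  | q + 1, α, r, C => ∃ η : RV d → Alt d (p + q), ContDiff ℝ ∞ η ∧
      ∀ x ∈ Metric.ball (0 : RV d) r, η x ∈ Filt (T01 L x) p (p + q) ∧ ‖η x‖ ≤ C ∧
        α x - extDeriv η x ∈ Filt (T01 L x) (p + 1) (p + q + 1)

/-- Approximate cocycles `f` with small differentials modulo the filtration, and functionals that nearly
annihilate the exact forms and are nearly dual to the approximate cocycles. -/
structure TestFamily (X : LocalCR d n k) (p q ν M : ℕ) (r Λ₀ : ℝ) where
  Λ : ℝ
  Λ_ge : Λ₀ ≤ Λ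
  f : Fin ν → RV d → Alt d (p + q)
  g : Fin ν → RV d → Alt d (p + q + 1)
  T : Fin ν → (RV d → Alt d (p + q)) → ℂ
  sf : ∀ a, ContDiff ℝ ∞ (f a)
  sg : ∀ a, ContDiff ℝ ∞ (g a)
  cf : ∀ a, HasCompactSupport (f a)
  cg : ∀ a, HasCompactSupport (g a)
  f_bound : ∀ a, ∀ i ≤ M, ∀ x, ‖iteratedFDeriv ℝ i (f a) x‖ ≤ Λ
  g_bound : ∀ a, ∀ i ≤ M, ∀ x, ‖iteratedFDeriv ℝ i (g a) x‖ * Λ ^ 4 ≤ 1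
  f_mem : ∀ a x, f a x ∈ Filt (T01 X.L x) p (p + q)
  g_mem : ∀ a, ∀ x ∈ Metric.ball (0 : RV d) X.R, g a x ∈ Filt (T01 X.L x) p (p + q + 1)
  df_sub : ∀ a x, extDeriv (f a) x - g a x ∈ Filt (T01 X.L x) (p + 1) (p + q + 1)
  T_add : ∀ b α α', ContDiff ℝ ∞ α → ContDiff ℝ ∞ α' → T b (fun x => α x + α' x) = T b α + T b α'
  T_smul : ∀ b (c : ℂ) α, T b (fun x => c • α x) = c * T b α
  T_bound : ∀ b α K, 0 ≤ K → (∀ x ∈ Metric.ball (0 : RV d) r, ‖α x‖ ≤ K) → ‖T b α‖ ≤ Λ * K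
  T_exact : ∀ b α C, 0 ≤ C → ContDiff ℝ ∞ α → ExactBound X.L p q α r C → ‖T b α‖ * Λ ^ 4 ≤ C
  T_f : ∀ a b, ‖T b (f a) - if a = b then 1 else 0‖ ≤ 1 / (4 * ν)

/-- For q = 0 an exact form has level p + 1 and the functional is exactly zero on it; for q > 0 the
form is replaced by the differential of its primitive, which changes nothing modulo level p + 1. -/
lemma Stage.T_exactBound {X : LocalCR d n k} {m : ℕ} {r : ℝ} (A : Stage X m r) {p q : ℕ}
    (e : Fin p → Fin n ⊕ Fin k) (J : Fin q → Fin n) (hJ : ∀ j, J j ∉ X.pos) (b : ℕ) :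
    ∃ C : ℝ, 0 ≤ C ∧ ∀ σ : ℝ, 1 ≤ σ → ∀ (α : RV d → Alt d (p + q)) (K : ℝ), 0 ≤ K → ContDiff ℝ ∞ α →
    ExactBound X.L p q α r K → ‖A.T e J b σ α‖ * σ ^ m ≤ C * σ ^ 2 * K := by
  have hsub := Metric.ball_subset_ball (x := (0 : RV d)) A.ρ_le
  cases q with
  | zero =>
    refine ⟨0, le_rfl, fun σ hσ α K hK sα hα => ?_⟩
    rw [A.T_eq_zero e J b σ fun x hx => hα x (hsub hx)]
    simp
  | succ q =>
    obtain ⟨C, hC0, hC⟩ := A.T_exact e J hJ b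
    refine ⟨C, hC0, fun σ hσ α K hK sα ⟨η, sη, hη⟩ => ?_⟩
    have sd : ContDiff ℝ ∞ (extDeriv η) := contDiff_extDeriv sη
    have h1 : A.T e J b σ α = A.T e J b σ (extDeriv η) := by
      have h2 : α = fun x => (α x - extDeriv η x) + extDeriv η x := by funext x; abel
      conv_lhs => rw [h2]
      rw [A.T_add e J b σ (sα.sub sd) sd, A.T_eq_zero e J b σ fun x hx => (hη x (hsub hx)).2.2, zero_add]
    rw [h1]
    exact hC σ hσ η K hK sη (fun x hx => (hη x (hsub hx)).1) fun x hx => (hη x (hsub hx)).2.1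

/-- All quantities are powers of σ times constants, apart from the pairings, which converge. A
sufficiently large order of flatness beats every fixed power, and σ is then chosen large. -/
theorem LocalCR.exists_testFamily (X : LocalCR d n k) (hn : 0 < n) {p : ℕ} (hp : p ≤ n + k) (ν M : ℕ)
    {r : ℝ} (hr : 0 < r) (Λ₀ : ℝ) : Nonempty (TestFamily X p X.posᶜ.card ν M r Λ₀) := by
  set q := X.posᶜ.card with hq
  -- The exponent `E` makes `Λ = σ ^ E` dominate M derivatives of `f`, the normalisation `σ ^ d` of
  -- the functionals, and one more factor σ that absorbs constants. The order of flatness below pays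
  -- for `Λ ^ 4`; its remainder `2 * M + d + 3` covers the powers lost in `g_bound` and `T_exact`.
  set E := 2 * M + d + 1 with hE
  obtain ⟨A⟩ := X.exists_stage (4 * E + 2 * M + d + 3) hr
  -- There are n + k covectors `θ`, enough for p distinct ones.
  set e : Fin p → Fin n ⊕ Fin k := fun i => finSumFinEquiv.symm (Fin.castLE hp i) with he
  have hei : Function.Injective e := finSumFinEquiv.symm.injective.comp (Fin.castLE_injective hp)
  set J : Fin q → Fin n := fun i => X.posᶜ.orderEmbOfFin hq.symm i with hJ
  have hJi : Function.Injective J := (X.posᶜ.orderEmbOfFin hq.symm).injective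
  have hJm : ∀ j, J j ∉ X.pos := fun j => Finset.mem_compl.1 (Finset.orderEmbOfFin_mem _ hq.symm j)
  have hJs : ∀ j ∉ X.pos, ∃ l, J l = j := fun j hj => by
    have : j ∈ Set.range (X.posᶜ.orderEmbOfFin hq.symm) := by
      rw [Finset.range_orderEmbOfFin]; exact Finset.mem_coe.2 (Finset.mem_compl.2 hj)
    exact this
  choose Cf hCf0 hCf using fun a i => A.f_bound e J a i
  choose Cg hCg0 hCg using fun a i => A.g_bound e J a i
  choose CT hCT0 hCT using fun b => A.T_bound e J b
  choose Ce hCe0 hCe using fun b => A.T_exactBound e J hJm b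
  -- Finitely many conditions, each valid for all large σ: one factor σ absorbs each constant, and
  -- the pairings are close to their limits.
  have hev : ∀ᶠ σ : ℝ in atTop, 1 ≤ σ ∧ Λ₀ ≤ σ ∧
      (∀ a : Fin ν, ∀ i : Fin (M + 1), Cf a i ≤ σ ∧ Cg a i ≤ σ) ∧
      (∀ b : Fin ν, ‖A.κ b‖⁻¹ * CT b ≤ σ ∧ ‖A.κ b‖⁻¹ * Ce b ≤ σ) ∧
      ∀ a b : Fin ν, ‖(A.κ b)⁻¹ * ((σ : ℂ) ^ d * A.T e J b σ (A.f e J a σ)) -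
        if a = b then 1 else 0‖ ≤ 1 / (4 * ν) := by
    refine (eventually_ge_atTop 1).and ((eventually_ge_atTop Λ₀).and (Eventually.and ?_ (Eventually.and ?_ ?_)))
    · exact eventually_all.2 fun a => eventually_all.2 fun i =>
        (eventually_ge_atTop _).and (eventually_ge_atTop _)
    · exact eventually_all.2 fun a => (eventually_ge_atTop _).and (eventually_ge_atTop _)
    · refine eventually_all.2 fun a => eventually_all.2 fun b => ?_
      have hν : 0 < (ν : ℝ) := by exact_mod_cast (Fin.pos a)
      have h1 := (A.tendsto_T_f e J hn hei hJi a b).const_mul (A.κ b)⁻¹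
      have h2 : (A.κ b)⁻¹ * (if (a : ℕ) = b then A.κ b else 0) = if a = b then 1 else 0 := by
        by_cases hab : a = b
        · subst hab; simp [A.κ_ne_zero]
        · simp [hab, Fin.ext_iff.not.1 hab]
      rw [h2] at h1
      exact (tendsto_iff_norm_sub_tendsto_zero.1 h1).eventually_le_const (by positivity)
  obtain ⟨σ, h1σ, hΛσ, hfg, hT, hpair⟩ := hev.exists
  have hσ0 : 0 < σ := by linarith
  have hκ : ∀ b : ℕ, ‖(A.κ b)⁻¹ * (σ : ℂ) ^ d‖ = ‖A.κ b‖⁻¹ * σ ^ d := fun b => by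
    rw [norm_mul, norm_inv, norm_pow, Complex.norm_real, Real.norm_of_nonneg hσ0.le]
  have hpow : ∀ {i j : ℕ}, i ≤ j → σ ^ i ≤ σ ^ j := fun h => pow_le_pow_right₀ h1σ h
  exact ⟨{
    Λ := σ ^ E
    Λ_ge := hΛσ.trans (by simpa using hpow (i := 1) (j := E) (by omega))
    f := fun a => A.f e J a σ
    g := fun a => A.g e J a σ
    -- Division by the leading term of the diagonal pairing makes the limiting matrix of pairings
    -- the identity.
    T := fun b α => (A.κ b)⁻¹ * (σ : ℂ) ^ d * A.T e J b σ α
    sf := fun a => A.sf e J a σ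
    sg := fun a => A.sg e J a σ
    cf := fun a => A.compact_of_eq_zero fun x hx => A.f_eq_zero e J a σ hx
    cg := fun a => A.compact_of_eq_zero fun x hx => A.g_eq_zero e J a σ hx
    f_bound := fun a i hi x => by
      have h1 := hCf a i σ h1σ x
      have h2 := (hfg a ⟨i, by omega⟩).1
      calc _ ≤ Cf a i * σ ^ (2 * i) := h1
        _ ≤ σ * σ ^ (2 * i) := by gcongr
        _ = σ ^ (2 * i + 1) := by ring
        _ ≤ σ ^ E := hpow (by omega)
    g_bound := fun a i hi x => by
      have h1 := hCg a i σ h1σ x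
      have h2 := (hfg a ⟨i, by omega⟩).2
      have h3 : ‖iteratedFDeriv ℝ i (A.g e J a σ) x‖ * (σ ^ E) ^ 4 * σ ^ (2 * M + d + 3) ≤
          1 * σ ^ (2 * M + d + 3) := by
        calc _ = ‖iteratedFDeriv ℝ i (A.g e J a σ) x‖ * σ ^ (4 * E + 2 * M + d + 3) := by ring
          _ ≤ Cg a i * σ ^ (2 * i + 2) := h1
          _ ≤ σ * σ ^ (2 * i + 2) := by gcongr
          _ = σ ^ (2 * i + 3) := by ring
          _ ≤ σ ^ (2 * M + d + 3) := hpow (by omega)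
          _ = _ := by ring
      exact le_of_mul_le_mul_right h3 (by positivity)
    f_mem := fun a x => A.f_mem e J a σ x
    g_mem := fun a x hx => A.g_mem e J a σ hx
    df_sub := fun a x => A.extDeriv_f_sub e J hJs a σ x
    T_add := fun b α α' hα hα' => by simp only [A.T_add e J b σ hα hα', mul_add]
    T_smul := fun b c α => by simp only [A.T_smul e J b σ c α]; ring
    T_bound := fun b α K hK hα => by
      rw [norm_mul, hκ]
      have h1 := hCT b σ h1σ α K hK fun x hx => hα x (Metric.ball_subset_ball A.ρ_le hx)
      have h2 := (hT b).1
      calc _ ≤ ‖A.κ b‖⁻¹ * σ ^ d * (CT b * K) := by gcongr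
        _ = (‖A.κ b‖⁻¹ * CT b) * σ ^ d * K := by ring
        _ ≤ σ * σ ^ d * K := by gcongr
        _ = σ ^ (d + 1) * K := by ring
        _ ≤ σ ^ E * K := mul_le_mul_of_nonneg_right (hpow (by omega)) hK
    T_exact := fun b α C hC sα hα => by
      rw [norm_mul, hκ]
      have h1 := hCe b σ h1σ α C hC sα hα
      have h2 := (hT b).2
      have h3 : ‖A.κ b‖⁻¹ * σ ^ d * ‖A.T e J b σ α‖ * (σ ^ E) ^ 4 * σ ^ (2 * M + d + 3) ≤
          C * σ ^ (2 * M + d + 3) := by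
        calc _ = ‖A.κ b‖⁻¹ * σ ^ d * (‖A.T e J b σ α‖ * σ ^ (4 * E + 2 * M + d + 3)) := by ring
          _ ≤ ‖A.κ b‖⁻¹ * σ ^ d * (Ce b * σ ^ 2 * C) := by gcongr
          _ = (‖A.κ b‖⁻¹ * Ce b) * (σ ^ d * σ ^ 2 * C) := by ring
          _ ≤ σ * (σ ^ d * σ ^ 2 * C) := by gcongr
          _ = σ ^ (d + 3) * C := by ring
          _ ≤ σ ^ (2 * M + d + 3) * C := mul_le_mul_of_nonneg_right (hpow (by omega)) hC
          _ = _ := by ring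
      exact le_of_mul_le_mul_right h3 (by positivity)
    T_f := fun a b => by simpa only [mul_assoc] using hpair a b }⟩

variable {d n k : ℕ}

/-! ### Series of smooth functions with bounded derivatives -/

section Series

variable {F : Type*} [NormedAddCommGroup F] [NormedSpace ℝ F]

/-- Smooth functions all of whose derivatives are bounded. -/
def SBdd (u : RV d → F) : Prop :=
  ContDiff ℝ ∞ u ∧ ∀ i : ℕ, ∃ B : ℝ, ∀ x, ‖iteratedFDeriv ℝ i u x‖ ≤ B

lemma SBdd.of_compact {u : RV d → F} (hu : ContDiff ℝ ∞ u) (hc : HasCompactSupport u) : SBdd u :=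
  ⟨hu, fun i => (hu.continuous_iteratedFDeriv (m := i)
    (by exact_mod_cast le_top)).bounded_above_of_compact_support (hc.iteratedFDeriv i)⟩

lemma SBdd.zero : SBdd (fun _ : RV d => (0 : F)) :=
  ⟨contDiff_const, fun i => ⟨0, fun x => by
    have : iteratedFDeriv ℝ i (fun _ : RV d => (0 : F)) = 0 := iteratedFDeriv_zero_fun
    simp [this]⟩⟩

lemma nat_le_infty (i : ℕ) : ((i : ℕ) : WithTop ℕ∞) ≤ ∞ := by exact_mod_cast le_top

lemma norm_iteratedFDeriv_sub_le {u v : RV d → F} (hu : ContDiff ℝ ∞ u) (hv : ContDiff ℝ ∞ v) (i : ℕ)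
    (x : RV d) : ‖iteratedFDeriv ℝ i (fun y => u y - v y) x‖ ≤
      ‖iteratedFDeriv ℝ i u x‖ + ‖iteratedFDeriv ℝ i v x‖ := by
  have : iteratedFDeriv ℝ i (fun y => u y - v y) x = iteratedFDeriv ℝ i u x - iteratedFDeriv ℝ i v x :=
    fun_iteratedFDeriv_sub_apply (hu.of_le (nat_le_infty i)).contDiffAt (hv.of_le (nat_le_infty i)).contDiffAt
  rw [this]
  exact norm_sub_le _ _

lemma norm_iteratedFDeriv_smul {u : RV d → F} (hu : ContDiff ℝ ∞ u) (c : ℝ) (i : ℕ)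
    (x : RV d) : ‖iteratedFDeriv ℝ i (fun y => c • u y) x‖ = |c| * ‖iteratedFDeriv ℝ i u x‖ := by
  rw [iteratedFDeriv_const_smul_apply' (hu.of_le (nat_le_infty i)).contDiffAt, norm_smul, Real.norm_eq_abs]

lemma SBdd.sub {u v : RV d → F} (hu : SBdd u) (hv : SBdd v) : SBdd fun x => u x - v x := by
  refine ⟨hu.1.sub hv.1, fun i => ?_⟩
  obtain ⟨B, hB⟩ := hu.2 i
  obtain ⟨C, hC⟩ := hv.2 i
  exact ⟨B + C, fun x => (norm_iteratedFDeriv_sub_le hu.1 hv.1 i x).trans (add_le_add (hB x) (hC x))⟩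

lemma SBdd.smul {u : RV d → F} (hu : SBdd u) (c : ℝ) : SBdd fun x => c • u x := by
  refine ⟨hu.1.const_smul c, fun i => ?_⟩
  obtain ⟨B, hB⟩ := hu.2 i
  refine ⟨|c| * B, fun x => ?_⟩
  rw [norm_iteratedFDeriv_smul hu.1]
  exact mul_le_mul_of_nonneg_left (hB x) (abs_nonneg _)

/-- The derivatives of the functions `u j` are dominated by summable sequences. -/
structure Dominated (u : ℕ → RV d → F) (v : ℕ → ℕ → ℝ) : Prop where
  smooth : ∀ j, ContDiff ℝ ∞ (u j)
  summable : ∀ i, Summable (v i)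
  bound : ∀ i j x, ‖iteratedFDeriv ℝ i (u j) x‖ ≤ v i j

/-- For each order of derivative only finitely many terms escape the given bound; for these their
own bounds are used. -/
lemma exists_dominated {u : ℕ → RV d → F} (hu : ∀ j, SBdd (u j)) {v : ℕ → ℕ → ℝ}
    (hv : ∀ i, Summable (v i)) (h : ∀ i, ∀ᶠ j in atTop, ∀ x, ‖iteratedFDeriv ℝ i (u j) x‖ ≤ v i j) :
    ∃ v', Dominated u v' := by
  choose B hB using fun j => (hu j).2
  choose N hN using fun i => eventually_atTop.1 (h i)
  refine ⟨fun i j => if j < N i then B j i else v i j, fun j => (hu j).1, fun i => ?_, fun i j x => ?_⟩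
  · refine (summable_nat_add_iff (N i)).1 (((summable_nat_add_iff (N i)).2 (hv i)).congr fun j => ?_)
    simp
  · split_ifs with hj
    · exact hB j i x
    · exact hN i j (not_lt.1 hj) x

namespace Dominated

variable {u : ℕ → RV d → F} {v : ℕ → ℕ → ℝ} (h : Dominated u v)

include h

lemma norm_le (j : ℕ) (x : RV d) : ‖u j x‖ ≤ v 0 j := by simpa using h.bound 0 j x

variable [CompleteSpace F]

lemma contDiff_tsum : ContDiff ℝ ∞ fun x => ∑' j, u j x :=
  _root_.contDiff_tsum (N := ⊤) h.smooth (fun i _ => h.summable i) fun i j x _ => h.bound i j x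

lemma iteratedFDeriv_tsum (i : ℕ) (x : RV d) :
    iteratedFDeriv ℝ i (fun y => ∑' j, u j y) x = ∑' j, iteratedFDeriv ℝ i (u j) x :=
  iteratedFDeriv_tsum_apply (N := ⊤) h.smooth (fun i _ => h.summable i) (fun i j x _ => h.bound i j x)
    le_top x

lemma norm_iteratedFDeriv_tsum_le (i : ℕ) (x : RV d) :
    ‖iteratedFDeriv ℝ i (fun y => ∑' j, u j y) x‖ ≤ ∑' j, v i j := by
  rw [h.iteratedFDeriv_tsum]
  exact tsum_of_norm_bounded (h.summable i).hasSum (h.bound i · x)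

lemma sBdd : SBdd fun x => ∑' j, u j x :=
  ⟨h.contDiff_tsum, fun i => ⟨_, h.norm_iteratedFDeriv_tsum_le i⟩⟩

lemma hasSum (x : RV d) : HasSum (u · x) (∑' j, u j x) :=
  (Summable.of_norm_bounded (h.summable 0) (h.norm_le · x)).hasSum

lemma hasSum_fderiv (x : RV d) :
    HasSum (fun j => fderiv ℝ (u j) x) (fderiv ℝ (fun y => ∑' j, u j y) x) := by
  have hb : ∀ j x, ‖fderiv ℝ (u j) x‖ ≤ v 1 j := fun j x => by
    rw [← norm_iteratedFDeriv_one]; exact h.bound 1 j x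
  have hd : ∀ j, Differentiable ℝ (u j) := fun j => (h.smooth j).differentiable (by simp)
  rw [fderiv_tsum_apply (h.summable 1) hd hb (h.hasSum (0 : RV d)).summable x]
  exact (Summable.of_norm_bounded (h.summable 1) (hb · x)).hasSum

omit h in
lemma hasSum_extDeriv {m : ℕ} {u : ℕ → RV d → Alt d m} (h : Dominated u v) (x : RV d) :
    HasSum (fun j => extDeriv (u j) x) (extDeriv (fun y => ∑' j, u j y) x) :=
  (ContinuousAlternatingMap.alternatizeUncurryFinCLM ℝ (RV d) ℂ).hasSum (h.hasSum_fderiv x)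

lemma iteratedFDeriv_sum_sub (i N : ℕ) (x : RV d) :
    ‖iteratedFDeriv ℝ i (fun y => (∑ j ∈ Finset.range N, u j y) - ∑' j, u j y) x‖ ≤
      ∑' j, v i (j + N) := by
  have h1 : (fun y => (∑ j ∈ Finset.range N, u j y) - ∑' j, u j y) = fun y => (-1 : ℝ) • ∑' j, u (j + N) y := by
    funext y
    rw [← (h.hasSum y).summable.sum_add_tsum_nat_add N]; simp
  have h2 : Dominated (fun j => u (j + N)) fun i j => v i (j + N) :=
    ⟨fun j => h.smooth _, fun i => (summable_nat_add_iff N).2 (h.summable i), fun i j x => h.bound _ _ _⟩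
  rw [h1, norm_iteratedFDeriv_smul h2.contDiff_tsum]
  simpa using h2.norm_iteratedFDeriv_tsum_le i x

end Dominated

end Series

/-! ### Primitives -/

/-- On the ball of radius `r`, `η` is a primitive of `α` modulo the next step of the filtration. -/
def Prim (L : Fin n → RV d → CV d) (p m : ℕ) (r : ℝ) (α : RV d → Alt d (m + 1)) (η : RV d → Alt d m) : Prop :=
  ∀ x ∈ Metric.ball (0 : RV d) r, η x ∈ Filt (T01 L x) p m ∧
    α x - extDeriv η x ∈ Filt (T01 L x) (p + 1) (m + 1)

lemma extDeriv_fun_sub' {m : ℕ} {u v : RV d → Alt d m} (hu : ContDiff ℝ ∞ u) (hv : ContDiff ℝ ∞ v)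
    (x : RV d) : extDeriv (fun y => u y - v y) x = extDeriv u x - extDeriv v x := by
  simp only [extDeriv]
  rw [fderiv_fun_sub (hu.differentiable (by simp) x) (hv.differentiable (by simp) x)]
  exact map_sub (ContinuousAlternatingMap.alternatizeUncurryFinCLM ℝ (RV d) ℂ) _ _

lemma extDeriv_const_smul' {m : ℕ} (u : RV d → Alt d m) (c : ℝ)
    (x : RV d) : extDeriv (fun y => c • u y) x = c • extDeriv u x := extDeriv_fun_smul c u

lemma extDeriv_zero_fun {m : ℕ} : extDeriv (fun _ : RV d => (0 : Alt d m)) = 0 := by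
  funext x
  simp only [extDeriv, fderiv_fun_const]
  exact map_zero (ContinuousAlternatingMap.alternatizeUncurryFinCLM ℝ (RV d) ℂ)

lemma real_smul_mem {m : ℕ} (P : Submodule ℂ (Alt d m)) (c : ℝ) {α : Alt d m} (h : α ∈ P) : c • α ∈ P := by
  have : c • α = (c : ℂ) • α := by ext v; simp [ContinuousAlternatingMap.smul_apply]
  rw [this]; exact P.smul_mem _ h

lemma isClosed_submodule {m : ℕ} (P : Submodule ℂ (Alt d m)) : IsClosed (P : Set (Alt d m)) := by
  have h : IsClosed ((P.restrictScalars ℝ : Submodule ℝ (Alt d m)) : Set (Alt d m)) :=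
    Submodule.closed_of_finiteDimensional _
  exact h

/-! ### Uniform primitives by a category argument -/

section Baire

variable {L : Fin n → RV d → CV d} {p m : ℕ} {V : Type*} [NormedAddCommGroup V] [NormedSpace ℝ V]
  (S : V →ₗ[ℝ] (RV d → Alt d (m + 1)))

lemma Prim.sub {r : ℝ} {a b : V} {u v : RV d → Alt d m} (hu : ContDiff ℝ ∞ u) (hv : ContDiff ℝ ∞ v)
    (h : Prim L p m r (S a) u) (h' : Prim L p m r (S b) v) :
    Prim L p m r (S (a - b)) fun x => u x - v x := fun x hx => by
  refine ⟨Submodule.sub_mem _ (h x hx).1 (h' x hx).1, ?_⟩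
  rw [extDeriv_fun_sub' hu hv, map_sub, Pi.sub_apply, sub_sub_sub_comm]
  exact Submodule.sub_mem _ (h x hx).2 (h' x hx).2

lemma Prim.smul {r : ℝ} {a : V} {u : RV d → Alt d m} (h : Prim L p m r (S a) u) (c : ℝ) :
    Prim L p m r (S (c • a)) fun x => c • u x := fun x hx => by
  refine ⟨real_smul_mem _ c (h x hx).1, ?_⟩
  have h1 : c • S a x - c • extDeriv u x = c • (S a x - extDeriv u x) := (smul_sub c _ _).symm
  rw [extDeriv_const_smul', map_smul, Pi.smul_apply, h1]
  exact real_smul_mem _ c (h x hx).2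

/-- The data that have a primitive on the ball of radius `1 / (N + 1)` with `C^i` norm at most `K`. -/
def primSet (L : Fin n → RV d → CV d) (p : ℕ) (N i K : ℕ) : Set V :=
  {a | ∃ η : RV d → Alt d m, SBdd η ∧ Prim L p m (1 / (N + 1)) (S a) η ∧
    ∀ l ≤ i, ∀ x, ‖iteratedFDeriv ℝ l η x‖ ≤ K}

variable [CompleteSpace V]

/-- A single radius for all orders `i`. If every radius 1 / (N + 1) failed at some order `i N`, the
closed sets for the pairs (N, K), taken at order `i N`, would have empty interior although they
cover `V`, because every datum has a primitive on some ball, bounded to every order after cutting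
off. -/
lemma exists_radius (hS : ∀ a, ∃ r > 0, ∃ η : RV d → Alt d m, ContDiff ℝ ∞ η ∧ Prim L p m r (S a) η) :
    ∃ N, ∀ i, ∃ K, (interior (closure (primSet S L p N i K))).Nonempty := by
  by_contra! hcon
  choose i hi using hcon
  have hU : ⋃ NK : ℕ × ℕ, closure (primSet S L p NK.1 (i NK.1) NK.2) = univ := by
    refine eq_univ_of_forall fun a => ?_
    obtain ⟨r, hr, η, sη, hη⟩ := hS a
    obtain ⟨η', sη', heq, hc⟩ := exists_contDiff_eqOn_ball hr sη.contDiffOn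
    obtain ⟨N, hN⟩ := exists_nat_one_div_lt (show (0 : ℝ) < r / 2 by positivity)
    have hb := SBdd.of_compact sη' hc
    choose B hB using hb.2
    obtain ⟨K, hK⟩ := exists_nat_ge (∑ l ∈ Finset.range (i N + 1), |B l|)
    refine mem_iUnion.2 ⟨(N, K), subset_closure ⟨η', hb, fun x hx => ?_, fun l hl x => ?_⟩⟩
    · have hx1 : x ∈ Metric.ball (0 : RV d) (r / 2) := Metric.ball_subset_ball hN.le hx
      have hx2 : x ∈ Metric.ball (0 : RV d) r := Metric.ball_subset_ball (by linarith) hx1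
      have he : η' =ᶠ[𝓝 x] η := heq.eventuallyEq_of_mem (Metric.isOpen_ball.mem_nhds hx1)
      rw [heq hx1, he.extDeriv_eq]
      exact hη x hx2
    · have := Finset.single_le_sum (f := fun l => |B l|) (fun l _ => abs_nonneg _)
        (Finset.mem_range.2 (Nat.lt_succ_of_le hl))
      exact ((hB l x).trans (le_abs_self _)).trans (this.trans hK)
  obtain ⟨NK, hNK⟩ := nonempty_interior_of_iUnion_of_closed (fun _ => isClosed_closure) hU
  rw [hi] at hNK
  exact Set.not_nonempty_empty hNK

omit [CompleteSpace V] in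
-- Differences of two data near an interior point of the closure, rescaled, approximate any given
-- datum, with primitives bounded linearly in its norm. The error is arbitrary but not zero, since
-- only the closure is known to have interior.
lemma exists_approx {N i K : ℕ} (hK : (interior (closure (primSet S L p N i K))).Nonempty) :
    ∃ C : ℝ, 0 ≤ C ∧ ∀ (a : V) (δ : ℝ), 0 < δ → ∃ (a' : V) (η : RV d → Alt d m), ‖a - a'‖ ≤ δ ∧ SBdd η ∧
      Prim L p m (1 / (N + 1)) (S a') η ∧ ∀ l ≤ i, ∀ x, ‖iteratedFDeriv ℝ l η x‖ ≤ C * ‖a‖ := by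
  obtain ⟨c, hc⟩ := hK
  obtain ⟨ε, hε, hball⟩ := Metric.isOpen_iff.1 isOpen_interior c hc
  have hcl := hball.trans interior_subset
  refine ⟨4 * K / ε, by positivity, fun a δ hδ => ?_⟩
  by_cases ha : a = 0
  · subst ha
    refine ⟨0, fun _ => 0, by simpa using hδ.le, SBdd.zero, fun x _ => ⟨zero_mem _, ?_⟩, fun l _ x => ?_⟩
    · rw [extDeriv_zero_fun, map_zero]; simp
    · have : iteratedFDeriv ℝ l (fun _ : RV d => (0 : Alt d m)) = 0 := iteratedFDeriv_zero_fun
      simp [this]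
  have hna : 0 < ‖a‖ := norm_pos_iff.2 ha
  -- The scale keeps `c + t • a` in the ball; dividing the bound `2 K` by `t` gives the constant `4
  -- * K / ε`.
  set t : ℝ := ε / (2 * ‖a‖) with ht
  have ht0 : 0 < t := by positivity
  have h1 : c + t • a ∈ Metric.ball c ε := by
    rw [mem_ball_iff_norm, add_sub_cancel_left, norm_smul, Real.norm_of_nonneg ht0.le, ht]
    field_simp; linarith
  obtain ⟨e₁, ⟨η₁, hb₁, hp₁, hn₁⟩, hd₁⟩ := Metric.mem_closure_iff.1 (hcl h1) (t * δ / 2) (by positivity)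
  obtain ⟨e₂, ⟨η₂, hb₂, hp₂, hn₂⟩, hd₂⟩ :=
    Metric.mem_closure_iff.1 (hcl (Metric.mem_ball_self hε)) (t * δ / 2) (by positivity)
  refine ⟨t⁻¹ • (e₁ - e₂), fun x => t⁻¹ • (η₁ x - η₂ x), ?_, (hb₁.sub hb₂).smul _,
    (hp₁.sub S hb₁.1 hb₂.1 hp₂).smul S _, fun l hl x => ?_⟩
  · have : a - t⁻¹ • (e₁ - e₂) = t⁻¹ • ((c + t • a - e₁) - (c - e₂)) := by
      rw [show c + t • a - e₁ - (c - e₂) = t • a - (e₁ - e₂) by abel, smul_sub t⁻¹ (t • a), smul_smul,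
        inv_mul_cancel₀ ht0.ne', one_smul]
    rw [this, norm_smul, norm_inv, Real.norm_of_nonneg ht0.le, inv_mul_le_iff₀ ht0]
    rw [dist_eq_norm] at hd₁ hd₂
    have := norm_sub_le (c + t • a - e₁) (c - e₂)
    linarith
  · rw [norm_iteratedFDeriv_smul (hb₁.1.sub hb₂.1), abs_of_pos (by positivity)]
    have h2 := norm_iteratedFDeriv_sub_le hb₁.1 hb₂.1 l x
    have h3 := hn₁ l hl x
    have h4 := hn₂ l hl x
    calc _ ≤ t⁻¹ * (K + K) := by gcongr; linarith
      _ = _ := by rw [ht]; field_simp; ring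

/-- The successive approximation of the open mapping theorem: the error of each stage is the datum
of the next. The order of differentiability increases with the stage, so the series of primitives
converges with all derivatives. The radius does not depend on `i`, but the primitive may. -/
theorem exists_uniform_primitive (hc : ∀ x, Continuous fun a => S a x)
    (hS : ∀ a, ∃ r > 0, ∃ η : RV d → Alt d m, ContDiff ℝ ∞ η ∧ Prim L p m r (S a) η) :
    ∃ r > 0, ∃ K : ℕ → ℝ, ∀ (a : V) (i : ℕ), ∃ η : RV d → Alt d m, SBdd η ∧ Prim L p m r (S a) η ∧
      ∀ l ≤ i, ∀ x, ‖iteratedFDeriv ℝ l η x‖ ≤ K i * ‖a‖ := by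
  obtain ⟨N, hN⟩ := exists_radius S hS
  choose K hK using hN
  have happ := fun i => exists_approx S (hK i)
  choose C hC0 happ using happ
  choose! A' H hA hH hP hB using happ
  refine ⟨1 / (N + 1), by positivity, fun i => C i + 1, fun a i => ?_⟩
  by_cases ha : a = 0
  · subst ha
    refine ⟨fun _ => 0, SBdd.zero, fun x _ => ⟨zero_mem _, ?_⟩, fun l _ x => ?_⟩
    · rw [extDeriv_zero_fun, map_zero]; simp
    · have : iteratedFDeriv ℝ l (fun _ : RV d => (0 : Alt d m)) = 0 := iteratedFDeriv_zero_fun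
      simp [this]
  have hna : 0 < ‖a‖ := norm_pos_iff.2 ha
  -- The tolerance at stage j is divided by the constant of order i + j in advance, so that the
  -- primitive chosen at that stage is bounded by `‖a‖ / 2 ^ j` up to order i + j.
  set δ : ℕ → ℝ := fun j => ‖a‖ * (1 / 2) ^ j / (1 + C (i + j)) with hδ
  have hδ0 : ∀ j, 0 < δ j := fun j => by have := hC0 (i + j); positivity
  let r : ℕ → V := fun j => Nat.rec a (fun j r => r - A' (i + j) r (δ (j + 1))) j
  have hr : ∀ j, r (j + 1) = r j - A' (i + j) (r j) (δ (j + 1)) := fun j => rfl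
  have hrn : ∀ j, ‖r (j + 1)‖ ≤ δ (j + 1) := fun j => by rw [hr]; exact hA _ _ _ (hδ0 _)
  set u : ℕ → RV d → Alt d m := fun j => H (i + j) (r j) (δ (j + 1)) with hu
  have hub : ∀ j, SBdd (u j) := fun j => hH _ _ _ (hδ0 _)
  have hun : ∀ j l, l ≤ i + (j + 1) → ∀ x, ‖iteratedFDeriv ℝ l (u (j + 1)) x‖ ≤ ‖a‖ * (1 / 2) ^ (j + 1) := by
    intro j l hl x
    have h1 := hB (i + (j + 1)) (r (j + 1)) (δ (j + 2)) (hδ0 _) l hl x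
    refine h1.trans ?_
    have hC := hC0 (i + (j + 1))
    calc C (i + (j + 1)) * ‖r (j + 1)‖ ≤ C (i + (j + 1)) * δ (j + 1) := by gcongr; exact hrn j
      _ ≤ (1 + C (i + (j + 1))) * δ (j + 1) :=
        mul_le_mul_of_nonneg_right (by linarith) (hδ0 _).le
      _ = _ := by simp only [hδ]; field_simp
  have hun0 : ∀ l ≤ i, ∀ x, ‖iteratedFDeriv ℝ l (u 0) x‖ ≤ C i * ‖a‖ := fun l hl x =>
    hB i a (δ 1) (hδ0 _) l hl x
  have hgeo : HasSum (fun j : ℕ => ‖a‖ * (1 / 2 : ℝ) ^ j) (‖a‖ * 2) := hasSum_geometric_two.mul_left ‖a‖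
  obtain ⟨v, hv⟩ := exists_dominated hub (v := fun _ j => ‖a‖ * (1 / 2 : ℝ) ^ j) (fun _ => hgeo.summable)
    fun l => by
      filter_upwards [eventually_ge_atTop (l + 1)] with j hj x
      obtain ⟨j, rfl⟩ : ∃ j', j = j' + 1 := ⟨j - 1, by omega⟩
      exact hun j l (by omega) x
  refine ⟨fun x => ∑' j, u j x, hv.sBdd, fun x hx => ⟨?_, ?_⟩, fun l hl x => ?_⟩
  · refine (isClosed_submodule (Filt (T01 L x) p m)).mem_of_tendsto (hv.hasSum x) (Eventually.of_forall fun s => ?_)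
    exact Submodule.sum_mem _ fun j _ => (hP _ _ _ (hδ0 _) x hx).1
  · have h1 : Tendsto r atTop (𝓝 0) := by
      refine (tendsto_add_atTop_iff_nat 1).1 (squeeze_zero_norm (a := fun j => ‖a‖ * (1 / 2) ^ (j + 1))
        (fun j => (hrn j).trans ?_) ((tendsto_add_atTop_iff_nat 1).2 hgeo.summable.tendsto_atTop_zero))
      have := hC0 (i + (j + 1))
      exact div_le_self (by positivity) (by linarith)
    have h2 : Tendsto (fun J => S a x - S (r J) x) atTop (𝓝 (S a x)) := by
      have := ((hc x).tendsto 0).comp h1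
      simp only [map_zero, Pi.zero_apply] at this
      simpa using tendsto_const_nhds.sub this
    have h3 : ∀ J, ∑ j ∈ Finset.range J, S (A' (i + j) (r j) (δ (j + 1))) x = S a x - S (r J) x := by
      intro J
      induction J with
      | zero => simp [r]
      | succ J ih => rw [Finset.sum_range_succ, ih, hr, map_sub, Pi.sub_apply]; abel
    have h4 := h2.sub (hv.hasSum_extDeriv x).tendsto_sum_nat
    refine (isClosed_submodule (Filt (T01 L x) (p + 1) (m + 1))).mem_of_tendsto h4
      (Eventually.of_forall fun J => ?_)
    rw [← h3, ← Finset.sum_sub_distrib]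
    exact Submodule.sum_mem _ fun j _ => (hP _ _ _ (hδ0 _) x hx).2
  · rw [hv.iteratedFDeriv_tsum]
    -- Only the first primitive is controlled by `C i`; the rest form a geometric series of sum
    -- `‖a‖`, whence the constant `C i + 1`.
    have hs : HasSum (fun j : ℕ => if j = 0 then C i * ‖a‖ else ‖a‖ * (1 / 2 : ℝ) ^ j)
        ((C i + 1) * ‖a‖) := by
      rw [← hasSum_nat_add_iff' 1]
      have := (hasSum_nat_add_iff' 1).2 hgeo
      simp only [Finset.range_one, Finset.sum_singleton, pow_zero] at this ⊢
      simpa [show (C i + 1) * ‖a‖ - C i * ‖a‖ = ‖a‖ * 2 - ‖a‖ * 1 by ring] using this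
    refine tsum_of_norm_bounded hs fun j => ?_
    rcases j with _ | j
    · simpa using hun0 l hl x
    · simpa using hun j l (by omega) x

end Baire

variable {d n k : ℕ}

/-! ### Superpositions with bounded coefficients -/

section Superposition

variable {F : Type*} [NormedAddCommGroup F] [NormedSpace ℝ F] {ν : ℕ}

lemma coeff_le (a : ℕ →ᵇ (Fin ν → ℝ)) (s : ℕ) (b : Fin ν) : |a s b| ≤ ‖a‖ :=
  (norm_le_pi_norm (a s) b).trans (a.norm_coe_le_norm s)

/-- The unit vectors. -/
def unitVec (s : ℕ) (b : Fin ν) : ℕ →ᵇ (Fin ν → ℝ) :=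
  BoundedContinuousFunction.ofNormedAddCommGroupDiscrete
    (fun t => if t = s then Pi.single b 1 else 0) 1 fun t => by
      split_ifs
      · exact (pi_norm_le_iff_of_nonneg zero_le_one).2 fun c => by
          by_cases h : c = b
          · subst h; simp
          · simp [h]
      · simp

lemma unitVec_apply (s t : ℕ) (b c : Fin ν) : unitVec s b t c = if t = s ∧ c = b then 1 else 0 := by
  change (if t = s then (Pi.single b 1 : Fin ν → ℝ) else 0) c = _
  by_cases h : t = s
  · by_cases h' : c = b
    · subst h'; simp [h]
    · simp [h, h']
  · simp [h]

lemma norm_unitVec_le (s : ℕ) (b : Fin ν) : ‖unitVec s b‖ ≤ 1 := by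
  refine (BoundedContinuousFunction.norm_le zero_le_one).2 fun t =>
    (pi_norm_le_iff_of_nonneg zero_le_one).2 fun c => ?_
  rw [unitVec_apply]; split_ifs <;> simp

variable {G : ℕ → Fin ν → RV d → F} {v : Fin ν → ℕ → ℕ → ℝ}

lemma norm_iteratedFDeriv_finset_sum_le {ι : Type*} (t : Finset ι) {u : ι → RV d → F}
    (hu : ∀ j, ContDiff ℝ ∞ (u j)) (i : ℕ) (x : RV d) :
    ‖iteratedFDeriv ℝ i (fun y => ∑ j ∈ t, u j y) x‖ ≤ ∑ j ∈ t, ‖iteratedFDeriv ℝ i (u j) x‖ := by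
  have : iteratedFDeriv ℝ i (fun y => ∑ j ∈ t, u j y) = ∑ j ∈ t, iteratedFDeriv ℝ i (u j) :=
    iteratedFDeriv_sum fun j _ => (hu j).of_le (nat_le_infty i)
  rw [this, Finset.sum_apply]
  exact norm_sum_le _ _

lemma dominated_combination (hG : ∀ b, Dominated (fun s => G s b) (v b)) (a : ℕ →ᵇ (Fin ν → ℝ)) :
    Dominated (fun s x => ∑ b, a s b • G s b x) fun i s => ‖a‖ * ∑ b, v b i s where
  smooth s := ContDiff.sum fun b _ => ((hG b).smooth s).const_smul _
  summable i := (summable_sum fun b _ => (hG b).summable i).mul_left _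
  bound i s x := by
    refine (norm_iteratedFDeriv_finset_sum_le _ (fun b => ((hG b).smooth s).const_smul _) i x).trans ?_
    rw [Finset.mul_sum]
    refine Finset.sum_le_sum fun b _ => ?_
    rw [norm_iteratedFDeriv_smul ((hG b).smooth s)]
    exact mul_le_mul (coeff_le a s b) ((hG b).bound i s x) (norm_nonneg _) (norm_nonneg _)

variable [CompleteSpace F]

/-- The superposition of a dominated family with bounded coefficients. -/
def superpose (hG : ∀ b, Dominated (fun s => G s b) (v b)) : (ℕ →ᵇ (Fin ν → ℝ)) →ₗ[ℝ] (RV d → F) where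
  toFun a x := ∑' s, ∑ b, a s b • G s b x
  map_add' a a' := by
    funext x
    rw [Pi.add_apply, ← ((dominated_combination hG a).hasSum x).summable.tsum_add
      ((dominated_combination hG a').hasSum x).summable]
    simp [add_smul, Finset.sum_add_distrib]
  map_smul' c a := by
    funext x
    rw [RingHom.id_apply, Pi.smul_apply, ← ((dominated_combination hG a).hasSum x).summable.tsum_const_smul]
    simp [mul_smul, Finset.smul_sum]

lemma superpose_apply (hG : ∀ b, Dominated (fun s => G s b) (v b)) (a : ℕ →ᵇ (Fin ν → ℝ)) :
    superpose hG a = fun x => ∑' s, ∑ b, a s b • G s b x := rfl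

lemma norm_superpose_le (hG : ∀ b, Dominated (fun s => G s b) (v b)) (a : ℕ →ᵇ (Fin ν → ℝ)) (x : RV d) :
    ‖superpose hG a x‖ ≤ (∑' s, ∑ b, v b 0 s) * ‖a‖ := by
  have := (dominated_combination hG a).norm_iteratedFDeriv_tsum_le 0 x
  rw [norm_iteratedFDeriv_zero, tsum_mul_left, mul_comm] at this
  exact this

/-- The continuity of the data in the coefficients that `exists_uniform_primitive` requires. -/
lemma continuous_superpose (hG : ∀ b, Dominated (fun s => G s b) (v b)) (x : RV d) :
    Continuous fun a => superpose hG a x :=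
  ((LinearMap.proj x).comp (superpose hG)).mkContinuous _ (norm_superpose_le hG · x) |>.continuous

lemma superpose_unitVec (hG : ∀ b, Dominated (fun s => G s b) (v b)) (s : ℕ) (b : Fin ν) :
    superpose hG (unitVec s b) = G s b := by
  funext x
  rw [superpose_apply]
  simp only
  rw [tsum_eq_single s fun t ht => ?_]
  · rw [Finset.sum_eq_single b (fun c _ hc => by simp [unitVec_apply, hc]) (by simp)]
    simp [unitVec_apply]
  · exact Finset.sum_eq_zero fun c _ => by simp [unitVec_apply, ht]

end Superposition

/-! ### Cocycles -/

/-- On the ball of radius `r`, `α` represents a cocycle. -/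
def Cocyc (L : Fin n → RV d → CV d) (p m : ℕ) (r : ℝ) (α : RV d → Alt d m) : Prop :=
  ∀ x ∈ Metric.ball (0 : RV d) r, α x ∈ Filt (T01 L x) p m ∧
    extDeriv α x ∈ Filt (T01 L x) (p + 1) (m + 1)

section Cocyc

variable {L : Fin n → RV d → CV d} {p m : ℕ} {r : ℝ}

lemma Cocyc.smul {α : RV d → Alt d m} (h : Cocyc L p m r α) (c : ℝ) : Cocyc L p m r fun x => c • α x :=
  fun x hx => ⟨real_smul_mem _ c (h x hx).1, by
    rw [extDeriv_const_smul']; exact real_smul_mem _ c (h x hx).2⟩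

lemma extDeriv_finset_sum {ι : Type*} (t : Finset ι) {u : ι → RV d → Alt d m} (hu : ∀ j, ContDiff ℝ ∞ (u j))
    (x : RV d) : extDeriv (fun y => ∑ j ∈ t, u j y) x = ∑ j ∈ t, extDeriv (u j) x := by
  simp only [extDeriv]
  rw [fderiv_fun_sum fun j _ => (hu j).differentiable (by simp) x]
  exact map_sum (ContinuousAlternatingMap.alternatizeUncurryFinCLM ℝ (RV d) ℂ) _ _

lemma Cocyc.sum {ι : Type*} (t : Finset ι) {u : ι → RV d → Alt d m} (hu : ∀ j, ContDiff ℝ ∞ (u j))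
    (h : ∀ j, Cocyc L p m r (u j)) : Cocyc L p m r fun x => ∑ j ∈ t, u j x := fun x hx =>
  ⟨Submodule.sum_mem _ fun j _ => (h j x hx).1, by
    rw [extDeriv_finset_sum t hu]; exact Submodule.sum_mem _ fun j _ => (h j x hx).2⟩

/-- The filtration is a closed condition at each point, and the series converges together with its
exterior derivative. -/
lemma Cocyc.tsum {u : ℕ → RV d → Alt d m} {v : ℕ → ℕ → ℝ} (hu : Dominated u v)
    (h : ∀ j, Cocyc L p m r (u j)) : Cocyc L p m r fun x => ∑' j, u j x := fun x hx =>
  ⟨(isClosed_submodule _).mem_of_tendsto (hu.hasSum x) (Eventually.of_forall fun s =>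
      Submodule.sum_mem _ fun j _ => (h j x hx).1),
    (isClosed_submodule _).mem_of_tendsto (hu.hasSum_extDeriv x) (Eventually.of_forall fun s =>
      Submodule.sum_mem _ fun j _ => (h j x hx).2)⟩

lemma Prim.sum {ι : Type*} (t : Finset ι) {α : ι → RV d → Alt d (m + 1)} {u : ι → RV d → Alt d m}
    (hu : ∀ j, ContDiff ℝ ∞ (u j)) (h : ∀ j, Prim L p m r (α j) (u j)) :
    Prim L p m r (fun x => ∑ j ∈ t, α j x) fun x => ∑ j ∈ t, u j x := fun x hx =>
  ⟨Submodule.sum_mem _ fun j _ => (h j x hx).1, by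
    rw [extDeriv_finset_sum t hu, ← Finset.sum_sub_distrib]
    exact Submodule.sum_mem _ fun j _ => (h j x hx).2⟩

lemma Prim.smul' {α : RV d → Alt d (m + 1)} {u : RV d → Alt d m} (h : Prim L p m r α u) (c : ℝ) :
    Prim L p m r (fun x => c • α x) fun x => c • u x := fun x hx => by
  refine ⟨real_smul_mem _ c (h x hx).1, ?_⟩
  have h1 : c • α x - c • extDeriv u x = c • (α x - extDeriv u x) := (smul_sub c _ _).symm
  rw [extDeriv_const_smul', h1]
  exact real_smul_mem _ c (h x hx).2

end Cocyc

lemma contDiff_const_smul_alt {m : ℕ} (c : ℂ) {α : RV d → Alt d m} (h : ContDiff ℝ ∞ α) :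
    ContDiff ℝ ∞ fun x => c • α x := (contDiff_const (c := c)).smul h

namespace TestFamily

variable {X : LocalCR d n k} {p q ν M : ℕ} {r Λ₀ : ℝ} (A : TestFamily X p q ν M r Λ₀)

/-- By `df_sub`, `g` differs from an exact form by a form of level p + 1, and the exterior
derivative preserves that level where the frame commutes. -/
lemma cocyc_g (a : Fin ν) : Cocyc X.L p (p + q + 1) X.R (A.g a) := fun x hx => by
  refine ⟨A.g_mem a x hx, ?_⟩
  set κ : RV d → Alt d (p + q + 1) := fun y => extDeriv (A.f a) y - A.g a y with hκ
  have sd := contDiff_extDeriv (A.sf a)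
  have sκ : ContDiff ℝ ∞ κ := sd.sub (A.sg a)
  have h1 : extDeriv κ x ∈ Filt (T01 X.L x) (p + 1) (p + q + 1 + 1) :=
    filt_extDeriv (fun j => (X.smooth j).differentiable (by simp) x) (fun i j => X.comm i j x hx)
      (sκ.differentiable (by simp) x) (Eventually.of_forall fun y => A.df_sub a y)
  have h2 : extDeriv (extDeriv (A.f a)) x = 0 :=
    extDeriv_extDeriv_apply ((A.sf a).contDiffAt (x := x)) (by simp; exact two_le_infty)
  have h3 : extDeriv (A.g a) x = -extDeriv κ x := by
    rw [hκ, extDeriv_fun_sub' sd (A.sg a), h2, zero_sub, neg_neg]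
  rw [h3]
  exact Submodule.neg_mem _ h1

lemma prim_g (a : Fin ν) (ρ : ℝ) : Prim X.L p (p + q) ρ (A.g a) (A.f a) := fun x _ => by
  refine ⟨A.f_mem a x, ?_⟩
  have := Submodule.neg_mem _ (A.df_sub a x)
  rwa [neg_sub] at this

lemma T_sub (b : Fin ν) {α α' : RV d → Alt d (p + q)} (h : ContDiff ℝ ∞ α) (h' : ContDiff ℝ ∞ α') :
    A.T b (fun x => α x - α' x) = A.T b α - A.T b α' := by
  have h1 := A.T_add b α (fun x => (-1 : ℂ) • α' x) h (contDiff_const_smul_alt _ h')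
  rw [A.T_smul] at h1
  have h2 : (fun x => α x + (-1 : ℂ) • α' x) = fun x => α x - α' x := by
    funext x; ext v; simp [ContinuousAlternatingMap.smul_apply, sub_eq_add_neg]
  rw [h2] at h1
  rw [h1]; ring

lemma T_real_smul (b : Fin ν) (c : ℝ) (α : RV d → Alt d (p + q)) :
    A.T b (fun x => c • α x) = c * A.T b α := by
  rw [← A.T_smul]
  exact congrArg (A.T b) (by funext x; ext v; simp [ContinuousAlternatingMap.smul_apply])

lemma T_sum {N : ℕ} (b : Fin ν) (c : Fin N → ℂ) {α : Fin N → RV d → Alt d (p + q)}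
    (h : ∀ j, ContDiff ℝ ∞ (α j)) (t : Finset (Fin N)) :
    A.T b (fun x => ∑ j ∈ t, c j • α j x) = ∑ j ∈ t, c j * A.T b (α j) := by
  classical
  induction t using Finset.induction_on with
  | empty =>
    have := A.T_smul b 0 fun _ => 0
    simpa [zero_smul_alt] using this
  | insert a t ha ih =>
    simp only [Finset.sum_insert ha]
    rw [A.T_add b _ _ (contDiff_const_smul_alt _ (h a))
      (ContDiff.sum fun j _ => contDiff_const_smul_alt _ (h j)),
      A.T_smul, ih]

end TestFamily

/-- N linear conditions on N + 1 unknowns have a nonzero solution, normalised by an entry of largest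
modulus. -/
lemma exists_annihilator {N : ℕ} (B : Fin N → Fin (N + 1) → ℂ) : ∃ β : Fin (N + 1) → ℂ,
    (∀ b, ‖β b‖ ≤ 1) ∧ (∃ b, β b = 1) ∧ ∀ i, ∑ b, β b * B i b = 0 := by
  let Φ : (Fin (N + 1) → ℂ) →ₗ[ℂ] (Fin N → ℂ) :=
    { toFun := fun β i => ∑ b, β b * B i b
      map_add' := fun β β' => by funext i; simp [add_mul, Finset.sum_add_distrib]
      map_smul' := fun c β => by funext i; simp [mul_assoc, Finset.mul_sum] }
  have hker : LinearMap.ker Φ ≠ ⊥ := LinearMap.ker_ne_bot_of_finrank_lt (by simp)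
  obtain ⟨β, hβ, hne⟩ := Submodule.exists_mem_ne_zero_of_ne_bot hker
  obtain ⟨b₀, hb₀⟩ := Finite.exists_max fun b => ‖β b‖
  have h0 : β b₀ ≠ 0 := by
    intro h
    apply hne
    funext b
    have := hb₀ b
    rw [h, norm_zero] at this
    exact norm_le_zero_iff.1 this
  refine ⟨fun b => (β b₀)⁻¹ * β b, fun b => ?_, ⟨b₀, inv_mul_cancel₀ h0⟩, fun i => ?_⟩
  · rw [norm_mul, norm_inv, inv_mul_le_iff₀ (norm_pos_iff.2 h0), mul_one]; exact hb₀ b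
  · have := congrFun (LinearMap.mem_ker.1 hβ) i
    simp only [mul_assoc, ← Finset.mul_sum]
    change (β b₀)⁻¹ * Φ β i = 0
    rw [this]; simp

/-- A diagonal choice: the order of differentiability tends to infinity so slowly that the
corresponding constant stays below Λ. -/
lemma exists_slow_index (K : ℕ → ℝ) {Λ : ℕ → ℝ} (hΛ : Tendsto Λ atTop atTop) :
    ∃ i : ℕ → ℕ, Tendsto i atTop atTop ∧ ∀ᶠ s in atTop, K (i s) ≤ Λ s := by
  classical
  refine ⟨fun s => Nat.findGreatest (fun j => K j ≤ Λ s) s, tendsto_atTop.2 fun j => ?_, ?_⟩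
  · filter_upwards [hΛ.eventually_ge_atTop (K j), eventually_ge_atTop j] with s h1 h2
    exact Nat.le_findGreatest h2 h1
  · filter_upwards [hΛ.eventually_ge_atTop (K 0)] with s h1
    exact Nat.findGreatest_spec (P := fun j => K j ≤ Λ s) (Nat.zero_le s) h1

/-! ### The contradiction -/

variable {d n k : ℕ}

/-- Limits of germs of exact forms are germs of exact forms. -/
def ClosedExact (X : LocalCR d n k) (p m : ℕ) : Prop :=
  ∀ (α : RV d → Alt d (m + 1)) (u : ℕ → RV d → Alt d (m + 1)), ContDiff ℝ ∞ α → (∀ j, ContDiff ℝ ∞ (u j)) →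
    Cocyc X.L p (m + 1) X.R α → (∀ j, Cocyc X.L p (m + 1) X.R (u j)) →
    (∀ j, ∃ r > 0, ∃ η : RV d → Alt d m, ContDiff ℝ ∞ η ∧ Prim X.L p m r (u j) η) →
    (∀ i : ℕ, ∃ v : ℕ → ℝ, Tendsto v atTop (𝓝 0) ∧
      ∀ j x, ‖iteratedFDeriv ℝ i (fun y => u j y - α y) x‖ ≤ v j) →
    ∃ r > 0, ∃ η : RV d → Alt d m, ContDiff ℝ ∞ η ∧ Prim X.L p m r α η

/-- The germs of cocycles modulo exact forms are spanned by finitely many forms. -/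
def FiniteCohomology (X : LocalCR d n k) (p q : ℕ) : Prop :=
  ∃ (N : ℕ) (h : Fin N → RV d → Alt d (p + q)), (∀ j, ContDiff ℝ ∞ (h j)) ∧
    ∀ (α : RV d → Alt d (p + q)) (r : ℝ), 0 < r → ContDiff ℝ ∞ α → Cocyc X.L p (p + q) r α →
      ∃ (c : Fin N → ℂ) (r' C : ℝ), 0 < r' ∧ 0 ≤ C ∧
        ExactBound X.L p q (fun x => α x - ∑ j, c j • h j x) r' C

lemma ExactBound.mono {L : Fin n → RV d → CV d} {p q : ℕ} {α : RV d → Alt d (p + q)} {r r' C : ℝ}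
    (h : ExactBound L p q α r C) (hr : r' ≤ r) : ExactBound L p q α r' C := by
  have hsub := Metric.ball_subset_ball (x := (0 : RV d)) hr
  cases q with
  | zero => exact fun x hx => h x (hsub hx)
  | succ q =>
    obtain ⟨η, h1, h2⟩ := h
    exact ⟨η, h1, fun x hx => h2 x (hsub hx)⟩

/-- If exactness is a closed condition, the approximate cocycles can be corrected to cocycles on a fixed
ball. -/
theorem exists_corrections (X : LocalCR d n k) {p q ν : ℕ} (hν1 : (1 : ℝ) ≤ ν) (H1 : ClosedExact X p (p + q))
    (A : ∀ s : ℕ, TestFamily X p q ν s (1 / (s + 1)) (4 * ν * 2 ^ s)) :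
    ∃ ρ > 0, ∃ κ : ℕ → Fin ν → RV d → Alt d (p + q), (∀ s b, SBdd (κ s b)) ∧
      (∀ s b, Cocyc X.L p (p + q) ρ fun x => (A s).f b x - κ s b x) ∧
      ∀ i, ∀ᶠ s in atTop, ∀ b x, ‖iteratedFDeriv ℝ i (κ s b) x‖ ≤ ((A s).Λ ^ 2)⁻¹ := by
  have hΛ2 : ∀ s, (2 : ℝ) ^ s ≤ (A s).Λ := fun s => le_trans (by
    have : (0 : ℝ) < 2 ^ s := by positivity
    nlinarith) (A s).Λ_ge
  have hΛν : ∀ s, 4 * (ν : ℝ) ≤ (A s).Λ := fun s => le_trans (by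
    have : (1 : ℝ) ≤ 2 ^ s := one_le_pow₀ (by norm_num)
    nlinarith) (A s).Λ_ge
  have hΛ1 : ∀ s, 1 ≤ (A s).Λ := fun s => (one_le_pow₀ (by norm_num)).trans (hΛ2 s)
  have hΛ0 : ∀ s, 0 < (A s).Λ := fun s => zero_lt_one.trans_le (hΛ1 s)
  have hgeo : Summable fun s : ℕ => (1 / 2 : ℝ) ^ s := summable_geometric_two
  have hinv : ∀ s, ((A s).Λ)⁻¹ ≤ (1 / 2 : ℝ) ^ s := fun s => by
    refine (inv_anti₀ (by positivity) (hΛ2 s)).trans (le_of_eq ?_)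
    exact (inv_pow (2 : ℝ) s).symm.trans (by rw [inv_eq_one_div])
  -- the superpositions of the differentials are exact
  set G : ℕ → Fin ν → RV d → Alt d (p + q + 1) := fun s b x => ((A s).Λ ^ 3) • (A s).g b x with hG
  have hGb : ∀ s b, SBdd (G s b) := fun s b => (SBdd.of_compact ((A s).sg b) ((A s).cg b)).smul _
  have hGd : ∀ b, ∃ v, Dominated (fun s => G s b) v := fun b =>
    exists_dominated (fun s => hGb s b) (v := fun _ s => (1 / 2 : ℝ) ^ s) (fun _ => hgeo) fun i => by
      -- With the weight `Λ ^ 3` the bound `Λ ^ (-4)` on `g` still leaves `1 / Λ ≤ 2 ^ (-s)`, valid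
      -- for derivatives of order `i` as soon as `s ≥ i`.
      filter_upwards [eventually_ge_atTop i] with s hs x
      rw [hG, norm_iteratedFDeriv_smul ((A s).sg b), abs_of_pos (pow_pos (hΛ0 s) 3)]
      refine le_trans ?_ (hinv s)
      have h0 := hΛ0 s
      rw [← one_div, le_div_iff₀ h0]
      calc _ = ‖iteratedFDeriv ℝ i ((A s).g b) x‖ * (A s).Λ ^ 4 := by ring
        _ ≤ 1 := (A s).g_bound b i hs x
  choose v hv using hGd
  have hexact : ∀ a, ∃ r > 0, ∃ η : RV d → Alt d (p + q), ContDiff ℝ ∞ η ∧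
      Prim X.L p (p + q) r (superpose hv a) η := by
    intro a
    have hdom := dominated_combination hv a
    have hco : ∀ s, Cocyc X.L p (p + q + 1) X.R fun x => ∑ b, a s b • G s b x := fun s =>
      Cocyc.sum _ (fun b => (hGb s b).1.const_smul _) fun b => (((A s).cocyc_g b).smul _).smul _
    -- The partial sums have the combinations of the `f` as primitives on every ball, so the radius
    -- 1 is arbitrary; exactness of the limit is what the hypothesis supplies.
    refine H1 (superpose hv a) (fun j x => ∑ s ∈ Finset.range j, ∑ b, a s b • G s b x) hdom.contDiff_tsum
      (fun j => ContDiff.sum fun s _ => hdom.smooth s) (Cocyc.tsum hdom hco)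
      (fun j => Cocyc.sum _ hdom.smooth hco) (fun j => ⟨1, one_pos,
        fun x => ∑ s ∈ Finset.range j, ∑ b, a s b • ((A s).Λ ^ 3) • (A s).f b x, ?_, ?_⟩) fun i => ?_
    · exact ContDiff.sum fun s _ => ContDiff.sum fun b _ => (((A s).sf b).const_smul _).const_smul _
    · refine Prim.sum _ (fun s => ContDiff.sum fun b _ => (((A s).sf b).const_smul _).const_smul _)
        fun s => Prim.sum _ (fun b => (((A s).sf b).const_smul _).const_smul _) fun b => ?_
      exact (((A s).prim_g b 1).smul' _).smul' _
    · exact ⟨_, tendsto_sum_nat_add (fun s => ‖a‖ * ∑ b, v b i s), fun j x =>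
        hdom.iteratedFDeriv_sum_sub i j x⟩
  obtain ⟨ρ, hρ, K, hK⟩ := exists_uniform_primitive (superpose hv) (continuous_superpose hv) hexact
  -- corrections of the approximate cocycles
  have hΛt : Tendsto (fun s => (A s).Λ) atTop atTop :=
    tendsto_atTop_mono hΛ2 (tendsto_pow_atTop_atTop_of_one_lt (by norm_num))
  obtain ⟨ι, hι, hKι⟩ := exists_slow_index (fun j => |K j|) hΛt
  -- The uniform primitives are applied to unit vectors, whose superposition is the single form `G s
  -- b`, at the slowly growing order `ι s`.
  have hη : ∀ s b, ∃ η : RV d → Alt d (p + q), SBdd η ∧ Prim X.L p (p + q) ρ (G s b) η ∧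
      ∀ l ≤ ι s, ∀ x, ‖iteratedFDeriv ℝ l η x‖ ≤ |K (ι s)| := fun s b => by
    obtain ⟨η, h1, h2, h3⟩ := hK (unitVec s b) (ι s)
    rw [superpose_unitVec] at h2
    refine ⟨η, h1, h2, fun l hl x => (h3 l hl x).trans ?_⟩
    calc K (ι s) * ‖unitVec s b‖ ≤ |K (ι s)| * 1 :=
          mul_le_mul (le_abs_self _) (norm_unitVec_le s b) (norm_nonneg _) (abs_nonneg _)
      _ = _ := mul_one _
  choose η hηb hηp hηn using hη
  refine ⟨ρ, hρ, fun s b x => (((A s).Λ ^ 3)⁻¹) • η s b x, fun s b => (hηb s b).smul _, fun s b x hx => ?_,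
    fun l => ?_⟩
  · obtain ⟨h1, h2⟩ := hηp s b x hx
    refine ⟨Submodule.sub_mem _ ((A s).f_mem b x) (real_smul_mem _ _ h1), ?_⟩
    rw [extDeriv_fun_sub' ((A s).sf b) ((hηb s b).1.const_smul _), extDeriv_const_smul']
    have h3 := real_smul_mem _ (((A s).Λ ^ 3)⁻¹) h2
    have h4 : (((A s).Λ ^ 3)⁻¹) • (G s b x - extDeriv (η s b) x) =
        (A s).g b x - (((A s).Λ ^ 3)⁻¹) • extDeriv (η s b) x := by
      have := hΛ0 s
      refine (smul_sub (((A s).Λ ^ 3)⁻¹) (G s b x) _).trans ?_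
      rw [hG]
      simp only
      rw [smul_smul, inv_mul_cancel₀ (by positivity), one_smul]
    rw [h4] at h3
    have h5 := Submodule.add_mem _ ((A s).df_sub b x) h3
    rwa [sub_add_sub_cancel] at h5
  · filter_upwards [hι.eventually_ge_atTop l, hKι] with s hl hs b x
    have h0 := hΛ0 s
    rw [norm_iteratedFDeriv_smul (hηb s b).1, abs_of_pos (by positivity)]
    -- Undoing the weight gives `Λ ^ (-3)`; the constant of order `ι s` is at most Λ by the choice
    -- of the slow index.
    calc _ ≤ ((A s).Λ ^ 3)⁻¹ * (A s).Λ := by gcongr; exact (hηn s b l hl x).trans hs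
      _ = _ := by field_simp

set_option maxHeartbeats 1000000 in
-- A uniform boundedness argument on bounded coefficient sequences: exactness modulo finitely many
-- generators bounds the functionals pointwise, while near duality makes them large on unit vectors.
theorem LocalCR.false_of_closedExact_of_finiteCohomology (X : LocalCR d n k) (hn : 0 < n) {p : ℕ} (hp : p ≤ n + k)
    (H1 : ClosedExact X p (p + X.posᶜ.card)) (H2 : FiniteCohomology X p X.posᶜ.card) : False := by
  have hex := fun (ν s : ℕ) (r Λ₀ : ℝ) (hr : 0 < r) => X.exists_testFamily hn hp ν s hr Λ₀
  -- From here on the eigenvalues enter only through the existence of test families.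
  generalize X.posᶜ.card = q at H1 H2 hex
  obtain ⟨N, h, sh, H2⟩ := H2
  set ν := N + 1 with hν
  have hνpos : (0 : ℝ) < ν := by positivity
  have hfam : ∀ s : ℕ, Nonempty (TestFamily X p q ν s (1 / (s + 1)) (4 * ν * 2 ^ s)) := fun s =>
    hex ν s _ _ (by positivity)
  let A := fun s => (hfam s).some
  have hν1 : (1 : ℝ) ≤ ν := by rw [hν]; push_cast; linarith [(Nat.cast_nonneg N : (0 : ℝ) ≤ N)]
  obtain ⟨ρ, hρ, κ, hκb, hκc, hκn⟩ := exists_corrections X hν1 H1 A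
  clear_value A
  have hΛ2 : ∀ s, (2 : ℝ) ^ s ≤ (A s).Λ := fun s => le_trans (by
    have : (0 : ℝ) < 2 ^ s := by positivity
    nlinarith) (A s).Λ_ge
  have hΛν : ∀ s, 4 * (ν : ℝ) ≤ (A s).Λ := fun s => le_trans (by
    have : (1 : ℝ) ≤ 2 ^ s := one_le_pow₀ (by norm_num)
    nlinarith) (A s).Λ_ge
  have hΛ1 : ∀ s, 1 ≤ (A s).Λ := fun s => (one_le_pow₀ (by norm_num)).trans (hΛ2 s)
  have hΛ0 : ∀ s, 0 < (A s).Λ := fun s => zero_lt_one.trans_le (hΛ1 s)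
  have hgeo : Summable fun s : ℕ => (1 / 2 : ℝ) ^ s := summable_geometric_two
  have hinv : ∀ s, ((A s).Λ)⁻¹ ≤ (1 / 2 : ℝ) ^ s := fun s => by
    refine (inv_anti₀ (by positivity) (hΛ2 s)).trans (le_of_eq ?_)
    exact (inv_pow (2 : ℝ) s).symm.trans (by rw [inv_eq_one_div])
  have hΛt : Tendsto (fun s => (A s).Λ) atTop atTop :=
    tendsto_atTop_mono hΛ2 (tendsto_pow_atTop_atTop_of_one_lt (by norm_num))
  set U : ℕ → Fin ν → RV d → Alt d (p + q) := fun s b x =>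
    (((A s).Λ ^ 2)⁻¹) • ((A s).f b x - κ s b x) with hU
  have hfb : ∀ s b, SBdd ((A s).f b) := fun s b => SBdd.of_compact ((A s).sf b) ((A s).cf b)
  have hUb : ∀ s b, SBdd (U s b) := fun s b => ((hfb s b).sub (hκb s b)).smul _
  have hUd : ∀ b, ∃ v, Dominated (fun s => U s b) v := fun b =>
    -- The weight `Λ ^ (-2)` against a bound Λ for each of `f` and its correction leaves `2 / Λ`,
    -- which is summable.
    exists_dominated (fun s => hUb s b) (v := fun _ s => 2 * (1 / 2 : ℝ) ^ s) (fun _ => hgeo.mul_left 2)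
      fun i => by
        filter_upwards [eventually_ge_atTop i, hκn i] with s hs hκs x
        have h0 := hΛ0 s
        have h1 := (A s).f_bound b i hs x
        have h2 := hκs b x
        have h3 := norm_iteratedFDeriv_sub_le ((A s).sf b) (hκb s b).1 i x
        rw [hU, norm_iteratedFDeriv_smul (((A s).sf b).sub (hκb s b).1),
          abs_of_pos (by positivity)]
        have h4 : ((A s).Λ ^ 2)⁻¹ ≤ (A s).Λ := by
          rw [inv_le_comm₀ (by positivity) h0]
          exact (inv_le_one_of_one_le₀ (hΛ1 s)).trans (one_le_pow₀ (hΛ1 s))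
        calc _ ≤ ((A s).Λ ^ 2)⁻¹ * ((A s).Λ + (A s).Λ) := by
              gcongr; exact h3.trans (add_le_add h1 (h2.trans h4))
          _ = 2 * ((A s).Λ)⁻¹ := by field_simp; ring
          _ ≤ _ := by gcongr; exact hinv s
  choose w hw using hUd
  have hUc : ∀ s b, Cocyc X.L p (p + q) ρ (U s b) := fun s b => (hκc s b).smul _
  -- functionals that annihilate the generators
  have hβ : ∀ s, ∃ β : Fin ν → ℂ, (∀ b, ‖β b‖ ≤ 1) ∧ (∃ b, β b = 1) ∧
      ∀ i, ∑ b, β b * (A s).T b (h i) = 0 := fun s => exists_annihilator fun i b => (A s).T b (h i)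
  choose β hβ1 hbs hβ0 using hβ
  choose bs hbs using hbs
  have hsm : ∀ a, ContDiff ℝ ∞ (superpose hw a) := fun a => (dominated_combination hw a).contDiff_tsum
  set B := ∑' s, ∑ b, w b 0 s with hB
  have hBa : ∀ a, 0 ≤ B * ‖a‖ := fun a => (norm_nonneg _).trans (norm_superpose_le hw a 0)
  -- The factor `Λ ^ 3` lies between two requirements: it is beaten by the `Λ ^ (-4)` of exact
  -- forms, and it exceeds the weight `Λ ^ (-2)` of the cocycles by one power.
  let ℓ₀ : ℕ → (ℕ →ᵇ (Fin ν → ℝ)) →ₗ[ℝ] ℂ := fun s =>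
    { toFun := fun a => ((A s).Λ : ℂ) ^ 3 * ∑ b, β s b * (A s).T b (superpose hw a)
      map_add' := fun a a' => by
        have : ∀ b, (A s).T b (superpose hw (a + a')) =
            (A s).T b (superpose hw a) + (A s).T b (superpose hw a') := fun b => by
          rw [map_add]; exact (A s).T_add b _ _ (hsm a) (hsm a')
        simp only [this, mul_add, Finset.sum_add_distrib]
      map_smul' := fun c a => by
        have : ∀ b, (A s).T b (superpose hw (c • a)) = c * (A s).T b (superpose hw a) := fun b => by
          rw [map_smul]; exact (A s).T_real_smul b c _
        simp only [this, RingHom.id_apply, Complex.real_smul, Finset.mul_sum]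
        exact Finset.sum_congr rfl fun b _ => by ring }
  have hnΛ : ∀ s, ‖((A s).Λ : ℂ) ^ 3‖ = (A s).Λ ^ 3 := fun s => by
    rw [norm_pow, Complex.norm_real, Real.norm_of_nonneg (hΛ0 s).le]
  have hsumT : ∀ s (t : Fin ν → ℂ) (C : ℝ), (∀ b, ‖t b‖ ≤ C) → ‖∑ b, β s b * t b‖ ≤ ν * C := by
    intro s t C ht
    refine (norm_sum_le _ _).trans ((Finset.sum_le_card_nsmul _ _ C fun b _ => ?_).trans (by simp))
    rw [norm_mul]
    calc _ ≤ 1 * C := mul_le_mul (hβ1 s b) (ht b) (norm_nonneg _) zero_le_one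
      _ = C := one_mul C
  have hℓb : ∀ s a, ‖ℓ₀ s a‖ ≤ (A s).Λ ^ 3 * (ν * ((A s).Λ * B)) * ‖a‖ := by
    intro s a
    change ‖((A s).Λ : ℂ) ^ 3 * ∑ b, β s b * (A s).T b (superpose hw a)‖ ≤ _
    rw [norm_mul, hnΛ]
    have := hsumT s (fun b => (A s).T b (superpose hw a)) ((A s).Λ * (B * ‖a‖)) fun b =>
      (A s).T_bound b _ _ (hBa a) fun x _ => norm_superpose_le hw a x
    calc _ ≤ (A s).Λ ^ 3 * (ν * ((A s).Λ * (B * ‖a‖))) :=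
          mul_le_mul_of_nonneg_left this (pow_pos (hΛ0 s) 3).le
      _ = _ := by ring
  let ℓ : ℕ → (ℕ →ᵇ (Fin ν → ℝ)) →L[ℝ] ℂ := fun s => (ℓ₀ s).mkContinuous _ (hℓb s)
  have hℓ : ∀ s a, ℓ s a = ((A s).Λ : ℂ) ^ 3 * ∑ b, β s b * (A s).T b (superpose hw a) := fun s a => rfl
  have hpt : ∀ a, ∃ C, ∀ s, ‖ℓ s a‖ ≤ C := by
    intro a
    have hco : Cocyc X.L p (p + q) ρ (superpose hw a) := Cocyc.tsum (dominated_combination hw a) fun s =>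
      Cocyc.sum _ (fun b => (hUb s b).1.const_smul _) fun b => (hUc s b).smul _
    obtain ⟨c, r', C, hr', hC, hex⟩ := H2 _ ρ hρ (hsm a) hco
    -- The ball on which the superposition is exact modulo generators depends on the coefficients.
    -- For large `s` it contains the ball of radius 1 / (s + 1) that the functionals of the s-th
    -- family see; finitely many `s` are left over.
    obtain ⟨s₀, hs₀⟩ := exists_nat_one_div_lt hr'
    refine ⟨∑ s ∈ Finset.range s₀, ‖ℓ s a‖ + ν * C, fun s => ?_⟩
    have hsum0 : 0 ≤ ∑ s ∈ Finset.range s₀, ‖ℓ s a‖ := Finset.sum_nonneg fun _ _ => norm_nonneg _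
    rcases lt_or_ge s s₀ with hs | hs
    · have := Finset.single_le_sum (f := fun s => ‖ℓ s a‖) (fun _ _ => norm_nonneg _) (Finset.mem_range.2 hs)
      have : 0 ≤ ν * C := by positivity
      linarith
    · have hr : 1 / ((s : ℝ) + 1) ≤ r' := (one_div_le_one_div_of_le (by positivity) (by gcongr)).trans hs₀.le
      have sα : ContDiff ℝ ∞ fun x => ∑ j, c j • h j x :=
        ContDiff.sum fun j _ => contDiff_const_smul_alt _ (sh j)
      have h1 : ∀ b, ‖(A s).T b (fun x => superpose hw a x - ∑ j, c j • h j x)‖ ≤ C / (A s).Λ ^ 4 := fun b => by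
        rw [le_div_iff₀ (pow_pos (hΛ0 s) 4)]
        exact (A s).T_exact b _ C hC ((hsm a).sub sα) (hex.mono hr)
      have h2 : ∑ b, β s b * (A s).T b (superpose hw a) =
          ∑ b, β s b * (A s).T b (fun x => superpose hw a x - ∑ j, c j • h j x) := by
        have h3 : ∀ b, (A s).T b (fun x => superpose hw a x - ∑ j, c j • h j x) =
            (A s).T b (superpose hw a) - ∑ j, c j * (A s).T b (h j) := fun b => by
          rw [(A s).T_sub b (hsm a) sα, (A s).T_sum b c sh]
        simp only [h3, mul_sub, Finset.sum_sub_distrib]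
        have h4 : ∑ b, β s b * ∑ j, c j * (A s).T b (h j) = 0 := by
          simp only [Finset.mul_sum]
          rw [Finset.sum_comm]
          refine Finset.sum_eq_zero fun j _ => ?_
          have := hβ0 s j
          calc _ = c j * ∑ b, β s b * (A s).T b (h j) := by
                rw [Finset.mul_sum]; exact Finset.sum_congr rfl fun b _ => by ring
            _ = 0 := by rw [this, mul_zero]
        rw [h4, sub_zero]
      have h5 := hsumT s _ _ h1
      rw [hℓ, h2, norm_mul, hnΛ]
      have h0 := hΛ0 s
      calc _ ≤ (A s).Λ ^ 3 * (ν * (C / (A s).Λ ^ 4)) := by gcongr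
        _ = ν * C * ((A s).Λ)⁻¹ := by field_simp
        _ ≤ ν * C * 1 := by gcongr; exact inv_le_one_of_one_le₀ (hΛ1 s)
        _ ≤ _ := by linarith
  obtain ⟨C, hC⟩ := banach_steinhaus hpt
  -- the functionals are unbounded on the unit vectors
  have hlow : ∀ᶠ s in atTop, (A s).Λ / 2 ≤ C := by
    filter_upwards [hκn 0] with s hs
    have h0 := hΛ0 s
    have hup : ‖ℓ s (unitVec s (bs s))‖ ≤ C := by
      have h1 := (ℓ s).le_opNorm (unitVec s (bs s))
      have h2 := mul_le_mul (hC s) (norm_unitVec_le s (bs s)) (norm_nonneg _) ((norm_nonneg _).trans (hC s))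
      linarith
    refine le_trans ?_ hup
    rw [hℓ, superpose_unitVec]
    have hT : ∀ b, (A s).T b (U s (bs s)) = (((A s).Λ ^ 2)⁻¹ : ℝ) * ((A s).T b ((A s).f (bs s)) -
        (A s).T b (κ s (bs s))) := fun b => by
      rw [hU, (A s).T_real_smul, (A s).T_sub b ((A s).sf _) (hκb s _).1]
    set t₁ : Fin ν → ℂ := fun b => (A s).T b ((A s).f (bs s)) - if bs s = b then 1 else 0 with ht₁
    set t₂ : Fin ν → ℂ := fun b => (A s).T b (κ s (bs s)) with ht₂
    have h1 : ∑ b, β s b * (A s).T b (U s (bs s)) =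
        (((A s).Λ ^ 2)⁻¹ : ℝ) * (1 + ∑ b, β s b * t₁ b - ∑ b, β s b * t₂ b) := by
      have : (1 : ℂ) = ∑ b, β s b * (if bs s = b then 1 else 0) := by simp [hbs]
      rw [this, ← Finset.sum_add_distrib, ← Finset.sum_sub_distrib, Finset.mul_sum]
      refine Finset.sum_congr rfl fun b _ => ?_
      rw [hT]; simp only [ht₁, ht₂]; ring
    -- The three contributions: the entry of β equal to one gives 1, the deviation from duality at
    -- most `ν / (4 ν) = 1/4`, and the correction at most `ν / Λ ≤ 1/4`, since `Λ ≥ 4 ν`.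
    have e1 := hsumT s t₁ (1 / (4 * ν)) fun b => (A s).T_f (bs s) b
    have e2 := hsumT s t₂ ((A s).Λ * ((A s).Λ ^ 2)⁻¹) fun b =>
      (A s).T_bound b _ _ (by positivity) fun x _ => by
        simpa using hs (bs s) x
    have e1' : ‖∑ b, β s b * t₁ b‖ ≤ 1 / 4 := e1.trans (le_of_eq (by field_simp))
    have e2' : ‖∑ b, β s b * t₂ b‖ ≤ 1 / 4 := by
      refine e2.trans ?_
      rw [show (ν : ℝ) * ((A s).Λ * ((A s).Λ ^ 2)⁻¹) = ν / (A s).Λ by field_simp, div_le_iff₀ h0]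
      linarith [hΛν s]
    have e3 : (1 / 2 : ℝ) ≤ ‖1 + ∑ b, β s b * t₁ b - ∑ b, β s b * t₂ b‖ := by
      have : (1 : ℂ) = (1 + ∑ b, β s b * t₁ b - ∑ b, β s b * t₂ b) - ∑ b, β s b * t₁ b +
        ∑ b, β s b * t₂ b := by ring
      have h3 := norm_add_le ((1 + ∑ b, β s b * t₁ b - ∑ b, β s b * t₂ b) - ∑ b, β s b * t₁ b)
        (∑ b, β s b * t₂ b)
      rw [← this, norm_one] at h3
      have h4 := norm_sub_le (1 + ∑ b, β s b * t₁ b - ∑ b, β s b * t₂ b) (∑ b, β s b * t₁ b)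
      linarith
    rw [h1, norm_mul, norm_mul, hnΛ, Complex.norm_real, Real.norm_of_nonneg (by positivity)]
    calc (A s).Λ / 2 = (A s).Λ ^ 3 * (((A s).Λ ^ 2)⁻¹ * (1 / 2)) := by field_simp
      _ ≤ _ := by gcongr
  obtain ⟨s, hs1, hs2⟩ := (hlow.and (hΛt.eventually_gt_atTop (2 * C))).exists
  linarith

/-! ### Forms in different charts -/

section Charts

variable {E : Type*} [NormedAddCommGroup E] [NormedSpace ℝ E]
  {M : Type*} [TopologicalSpace M] [ChartedSpace E M]

/-- The derivative at `x` of the preferred chart at `x₀`. -/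
def chartD (x₀ x : M) : E →L[ℝ] E := mfderiv 𝓘(ℝ, E) 𝓘(ℝ, E) (extChartAt 𝓘(ℝ, E) x₀) x

/-- The derivative at `y` of the inverse of the preferred chart at `x₀`. -/
def chartDsymm (x₀ : M) (y : E) : E →L[ℝ] E := mfderiv 𝓘(ℝ, E) 𝓘(ℝ, E) (extChartAt 𝓘(ℝ, E) x₀).symm y

/-- The coordinate change between the preferred charts at `x₁` and `x₀`. -/
def transition (x₁ x₀ : M) (y : E) : E := extChartAt 𝓘(ℝ, E) x₀ ((extChartAt 𝓘(ℝ, E) x₁).symm y)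

/-- An element of the fibre as a form on the model space. -/
def CForm.toModel {m : ℕ} {x : M} (α : CForm E m x) : E [⋀^Fin m]→L[ℝ] ℂ := α

/-- A form on the model space as an element of the fibre. -/
def CForm.ofModel {m : ℕ} (x : M) (α : E [⋀^Fin m]→L[ℝ] ℂ) : CForm E m x := α

lemma formInChart_eq {m : ℕ} (α : ∀ x : M, CForm E m x) (x₀ : M) (y : E) :
    formInChart α x₀ y = (CForm.toModel (α ((extChartAt 𝓘(ℝ, E) x₀).symm y))).compContinuousLinearMap
      (chartDsymm x₀ y) := rfl

lemma mextDeriv_eq_self {m : ℕ} (α : ∀ x : M, CForm E m x) (x : M) :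
    mextDeriv α x = CForm.ofModel x ((extDeriv (formInChart α x)
      (extChartAt 𝓘(ℝ, E) x x)).compContinuousLinearMap (chartD x x)) := rfl

variable [IsManifold 𝓘(ℝ, E) ∞ M]

lemma chartD_comp_symm {x₀ : M} {y : E} (hy : y ∈ (extChartAt 𝓘(ℝ, E) x₀).target) :
    (chartD x₀ ((extChartAt 𝓘(ℝ, E) x₀).symm y)).comp (chartDsymm x₀ y) = ContinuousLinearMap.id ℝ E := by
  have : IsManifold 𝓘(ℝ, E) 1 M := IsManifold.of_le (n := ∞) (by simp)
  have := mfderiv_extChartAt_comp_mfderivWithin_extChartAt_symm (I := 𝓘(ℝ, E)) hy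
  rw [modelWithCornersSelf_coe, range_id, mfderivWithin_univ] at this
  exact this

lemma chartDsymm_comp {x₀ x : M} (hx : x ∈ (extChartAt 𝓘(ℝ, E) x₀).source) :
    (chartDsymm x₀ (extChartAt 𝓘(ℝ, E) x₀ x)).comp (chartD x₀ x) = ContinuousLinearMap.id ℝ E := by
  have : IsManifold 𝓘(ℝ, E) 1 M := IsManifold.of_le (n := ∞) (by simp)
  have := mfderivWithin_extChartAt_symm_comp_mfderiv_extChartAt' (I := 𝓘(ℝ, E)) hx
  rw [modelWithCornersSelf_coe, range_id, mfderivWithin_univ] at this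
  exact this

lemma mdifferentiableAt_chart_symm {x₀ : M} {y : E} (hy : y ∈ (extChartAt 𝓘(ℝ, E) x₀).target) :
    MDifferentiableAt 𝓘(ℝ, E) 𝓘(ℝ, E) (extChartAt 𝓘(ℝ, E) x₀).symm y := by
  have : IsManifold 𝓘(ℝ, E) 1 M := IsManifold.of_le (n := ∞) (by simp)
  have := mdifferentiableWithinAt_extChartAt_symm (I := 𝓘(ℝ, E)) hy
  rwa [modelWithCornersSelf_coe, range_id, mdifferentiableWithinAt_univ] at this

/-- The domain of the coordinate change. -/
def transitionDomain (x₁ x₀ : M) : Set E :=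
  (extChartAt 𝓘(ℝ, E) x₁).target ∩ (extChartAt 𝓘(ℝ, E) x₁).symm ⁻¹' (extChartAt 𝓘(ℝ, E) x₀).source

omit [IsManifold 𝓘(ℝ, E) ∞ M] in
lemma isOpen_transitionDomain (x₁ x₀ : M) : IsOpen (transitionDomain (E := E) x₁ x₀) :=
  (continuousOn_extChartAt_symm (I := 𝓘(ℝ, E)) x₁).isOpen_inter_preimage
    (isOpen_extChartAt_target x₁) (isOpen_extChartAt_source x₀)

lemma contDiffOn_transition (x₁ x₀ : M) :
    ContDiffOn ℝ ∞ (transition (E := E) x₁ x₀) (transitionDomain x₁ x₀) := by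
  have h1 : ContMDiffOn 𝓘(ℝ, E) 𝓘(ℝ, E) ∞ (extChartAt 𝓘(ℝ, E) x₁).symm (extChartAt 𝓘(ℝ, E) x₁).target :=
    contMDiffOn_extChartAt_symm x₁
  have h2 : ContMDiffOn 𝓘(ℝ, E) 𝓘(ℝ, E) ∞ (extChartAt 𝓘(ℝ, E) x₀) (extChartAt 𝓘(ℝ, E) x₀).source := by
    rw [extChartAt_source]; exact contMDiffOn_extChartAt
  exact (h2.comp' h1).contDiffOn

lemma mem_transitionDomain_self {x₁ x₀ : M} {x : M} (h₁ : x ∈ (extChartAt 𝓘(ℝ, E) x₁).source)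
    (h₀ : x ∈ (extChartAt 𝓘(ℝ, E) x₀).source) : extChartAt 𝓘(ℝ, E) x₁ x ∈ transitionDomain (E := E) x₁ x₀ :=
  ⟨(extChartAt 𝓘(ℝ, E) x₁).map_source h₁, by
    rw [mem_preimage, (extChartAt 𝓘(ℝ, E) x₁).left_inv h₁]; exact h₀⟩

lemma transition_mem_target {x₁ x₀ : M} {z : E} (hz : z ∈ transitionDomain (E := E) x₁ x₀) :
    transition x₁ x₀ z ∈ (extChartAt 𝓘(ℝ, E) x₀).target := (extChartAt 𝓘(ℝ, E) x₀).map_source hz.2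

lemma symm_transition {x₁ x₀ : M} {z : E} (hz : z ∈ transitionDomain (E := E) x₁ x₀) :
    (extChartAt 𝓘(ℝ, E) x₀).symm (transition x₁ x₀ z) = (extChartAt 𝓘(ℝ, E) x₁).symm z :=
  (extChartAt 𝓘(ℝ, E) x₀).left_inv hz.2

lemma chartDsymm_transition {x₁ x₀ : M} {z : E} (hz : z ∈ transitionDomain (E := E) x₁ x₀) :
    chartDsymm x₁ z = (chartDsymm x₀ (transition x₁ x₀ z)).comp (fderiv ℝ (transition x₁ x₀) z) := by
  have hnh := (isOpen_transitionDomain (E := E) x₁ x₀).mem_nhds hz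
  have h1 : (extChartAt 𝓘(ℝ, E) x₁).symm =ᶠ[𝓝 z]
      (extChartAt 𝓘(ℝ, E) x₀).symm ∘ (transition x₁ x₀) := by
    filter_upwards [hnh] with y hy
    exact (symm_transition hy).symm
  have hτ : MDifferentiableAt 𝓘(ℝ, E) 𝓘(ℝ, E) (transition (E := E) x₁ x₀) z :=
    (((contDiffOn_transition x₁ x₀).contDiffAt hnh).differentiableAt (by simp)).mdifferentiableAt
  have h2 := mfderiv_comp z (mdifferentiableAt_chart_symm (transition_mem_target hz)) hτ
  rw [← h1.mfderiv_eq, mfderiv_eq_fderiv] at h2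
  exact h2

lemma formInChart_transition {m : ℕ} (α : ∀ x : M, CForm E m x) {x₁ x₀ : M} {z : E}
    (hz : z ∈ transitionDomain (E := E) x₁ x₀) :
    formInChart α x₁ z = (formInChart α x₀ (transition x₁ x₀ z)).compContinuousLinearMap
      (fderiv ℝ (transition x₁ x₀) z) := by
  rw [formInChart_eq, formInChart_eq, symm_transition hz, chartDsymm_transition hz]
  rfl

lemma chartD_transition {x₁ x₀ x : M} (h₁ : x ∈ (extChartAt 𝓘(ℝ, E) x₁).source)
    (h₀ : x ∈ (extChartAt 𝓘(ℝ, E) x₀).source) :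
    (fderiv ℝ (transition x₁ x₀) (extChartAt 𝓘(ℝ, E) x₁ x)).comp (chartD x₁ x) = chartD (E := E) x₀ x := by
  have hz := mem_transitionDomain_self h₁ h₀
  have h2 := chartDsymm_transition hz
  have h3 : transition x₁ x₀ (extChartAt 𝓘(ℝ, E) x₁ x) = extChartAt 𝓘(ℝ, E) x₀ x := by
    rw [transition, (extChartAt 𝓘(ℝ, E) x₁).left_inv h₁]
  rw [h3] at h2
  have h4 := chartDsymm_comp h₁
  rw [h2] at h4
  have h5 := chartD_comp_symm ((extChartAt 𝓘(ℝ, E) x₀).map_source h₀)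
  rw [(extChartAt 𝓘(ℝ, E) x₀).left_inv h₀] at h5
  have h6 := congrArg (fun L => (chartD (E := E) x₀ x).comp L) h4
  simp only [ContinuousLinearMap.comp_id] at h6
  rw [← h6, ContinuousLinearMap.comp_assoc, ← ContinuousLinearMap.comp_assoc, h5,
    ContinuousLinearMap.id_comp]

/-- The exterior derivative can be computed in any chart. -/
lemma mextDeriv_eq {m : ℕ} (α : ∀ x : M, CForm E m x) {x₀ x : M}
    (hx : x ∈ (extChartAt 𝓘(ℝ, E) x₀).source)
    (hα : DifferentiableAt ℝ (formInChart α x₀) (extChartAt 𝓘(ℝ, E) x₀ x)) :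
    mextDeriv α x = CForm.ofModel x ((extDeriv (formInChart α x₀)
      (extChartAt 𝓘(ℝ, E) x₀ x)).compContinuousLinearMap (chartD x₀ x)) := by
  have h₁ := mem_extChartAt_source (I := 𝓘(ℝ, E)) x
  have hz := mem_transitionDomain_self h₁ hx
  have hnh := (isOpen_transitionDomain (E := E) x x₀).mem_nhds hz
  have h3 : transition x x₀ (extChartAt 𝓘(ℝ, E) x x) = extChartAt 𝓘(ℝ, E) x₀ x := by
    rw [transition, (extChartAt 𝓘(ℝ, E) x).left_inv h₁]
  -- Near `x` the expressions in two charts differ by pull-back under the coordinate change, and the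
  -- exterior derivative commutes with pull-back.
  have he : formInChart α x =ᶠ[𝓝 (extChartAt 𝓘(ℝ, E) x x)] fun z =>
      (formInChart α x₀ (transition x x₀ z)).compContinuousLinearMap (fderiv ℝ (transition x x₀) z) := by
    filter_upwards [hnh] with z hz using formInChart_transition α hz
  rw [mextDeriv_eq_self, he.extDeriv_eq, extDeriv_pullback (r := ∞) (by rw [h3]; exact hα)
    ((contDiffOn_transition x x₀).contDiffAt hnh) (by simp; exact two_le_infty), h3]
  congr 1
  rw [← chartD_transition h₁ hx]
  rfl

lemma formInChart_mextDeriv {m : ℕ} (α : ∀ x : M, CForm E m x) {x₀ : M} {y : E}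
    (hy : y ∈ (extChartAt 𝓘(ℝ, E) x₀).target) (hα : DifferentiableAt ℝ (formInChart α x₀) y) :
    formInChart (mextDeriv α) x₀ y = extDeriv (formInChart α x₀) y := by
  have hr := (extChartAt 𝓘(ℝ, E) x₀).right_inv hy
  rw [formInChart_eq, mextDeriv_eq α ((extChartAt 𝓘(ℝ, E) x₀).map_target hy) (by rw [hr]; exact hα), hr]
  have h := chartD_comp_symm hy
  ext v
  change extDeriv (formInChart α x₀) y (fun j => (chartD x₀ _).comp (chartDsymm x₀ y) (v j)) = _
  rw [h]; rfl

end Charts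

/-! ### Pull-back of forms on the model space -/

section Pullback

variable {d m : ℕ}

/-- The components of the pull-back are a multilinear form evaluated on the images of basis vectors,
hence polynomial in the linear map. -/
lemma contDiff_compContinuousLinearMapCLM : ContDiff ℝ ∞ (fun A : RV d →L[ℝ] RV d =>
    (ContinuousAlternatingMap.compContinuousLinearMapCLM A : Alt d m →L[ℝ] Alt d m)) := by
  rw [contDiff_clm_apply_iff]
  intro a
  refine contDiff_of_comps fun r => ?_
  change ContDiff ℝ ∞ fun A : RV d →L[ℝ] RV d => a.toContinuousMultilinearMap fun j => A (ev (r j))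
  exact a.toContinuousMultilinearMap.contDiff.comp
    (contDiff_pi.2 fun j => (ContinuousLinearMap.apply ℝ (RV d) (ev (r j))).contDiff)

/-- The pull-back of a field of forms. -/
def pullForm (τ : RV d → RV d) (β : RV d → Alt d m) (z : RV d) : Alt d m :=
  (β (τ z)).compContinuousLinearMap (fderiv ℝ τ z)

lemma contDiffOn_pullClm {τ : RV d → RV d} {s : Set (RV d)} (hs : IsOpen s) (hτ : ContDiffOn ℝ ∞ τ s) :
    ContDiffOn ℝ ∞ (fun z => (ContinuousAlternatingMap.compContinuousLinearMapCLM (fderiv ℝ τ z) :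
      Alt d m →L[ℝ] Alt d m)) s :=
  contDiff_compContinuousLinearMapCLM.comp_contDiffOn (hτ.fderiv_of_isOpen hs (by simp))

lemma contDiffOn_pullForm {τ : RV d → RV d} {s : Set (RV d)} (hs : IsOpen s) (hτ : ContDiffOn ℝ ∞ τ s)
    {β : RV d → Alt d m} (hβ : ContDiff ℝ ∞ β) : ContDiffOn ℝ ∞ (pullForm τ β) s :=
  (contDiffOn_pullClm hs hτ).clm_apply (hβ.comp_contDiffOn hτ)

lemma exists_bound_iteratedFDerivWithin {F : Type*} [NormedAddCommGroup F] [NormedSpace ℝ F]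
    {f : RV d → F} {s K : Set (RV d)} (hs : IsOpen s) (hf : ContDiffOn ℝ ∞ f s) (hK : IsCompact K)
    (hKs : K ⊆ s) (N : ℕ) : ∃ D : ℝ, 1 ≤ D ∧ ∀ i ≤ N, ∀ z ∈ K, ‖iteratedFDerivWithin ℝ i f s z‖ ≤ D := by
  have h : ∀ i : ℕ, ∃ D : ℝ, ∀ z ∈ K, ‖iteratedFDerivWithin ℝ i f s z‖ ≤ D := fun i =>
    hK.exists_bound_of_continuousOn
      ((hf.continuousOn_iteratedFDerivWithin (nat_le_infty i) hs.uniqueDiffOn).mono hKs)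
  choose D hD using h
  refine ⟨1 + ∑ i ∈ Finset.range (N + 1), |D i|, le_add_of_nonneg_right (Finset.sum_nonneg fun i _ => abs_nonneg _),
    fun i hi z hz => (hD i z hz).trans ?_⟩
  have h2 := Finset.single_le_sum (f := fun i => |D i|) (fun i _ => abs_nonneg (D i))
    (Finset.mem_range.2 (Nat.lt_succ_of_le hi))
  have := le_abs_self (D i)
  linarith

/-- The derivatives of a pull-back are controlled by the derivatives of the form. -/
lemma exists_bound_pullForm {τ : RV d → RV d} {s K : Set (RV d)} (hs : IsOpen s) (hτ : ContDiffOn ℝ ∞ τ s)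
    (hK : IsCompact K) (hKs : K ⊆ s) (N : ℕ) :
    ∃ C : ℝ, ∀ (β : RV d → Alt d m) (ε : ℝ), ContDiff ℝ ∞ β → 0 ≤ ε →
      (∀ i ≤ N, ∀ x, ‖iteratedFDeriv ℝ i β x‖ ≤ ε) →
      ∀ z ∈ K, ‖iteratedFDeriv ℝ N (pullForm τ β) z‖ ≤ C * ε := by
  obtain ⟨D, hD1, hD⟩ := exists_bound_iteratedFDerivWithin hs hτ hK hKs N
  obtain ⟨D', hD1', hD'⟩ := exists_bound_iteratedFDerivWithin hs (contDiffOn_pullClm (m := m) hs hτ) hK hKs N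
  refine ⟨∑ i ∈ Finset.range (N + 1), (N.choose i : ℝ) * D' * ((N - i).factorial * D ^ (N - i)),
    fun β ε hβ hε hb z hz => ?_⟩
  rw [← iteratedFDerivWithin_of_isOpen N hs (hKs hz)]
  -- Leibniz for the operator-valued factor, then the estimate for derivatives of a composition; `D
  -- ≥ 1` allows a bound by `D ^ l` for each derivative of order l.
  have h := norm_iteratedFDerivWithin_clm_apply (n := N) (contDiffOn_pullClm (m := m) hs hτ)
    (hβ.comp_contDiffOn hτ) hs.uniqueDiffOn (hKs hz) (nat_le_infty N)
  refine h.trans ?_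
  rw [Finset.sum_mul]
  refine Finset.sum_le_sum fun i hi => ?_
  have hi : i ≤ N := Nat.lt_succ_iff.1 (Finset.mem_range.1 hi)
  have h2 : ‖iteratedFDerivWithin ℝ (N - i) (β ∘ τ) s z‖ ≤ (N - i).factorial * ε * D ^ (N - i) := by
    refine norm_iteratedFDerivWithin_comp_le (t := univ) hβ.contDiffOn hτ (nat_le_infty _) uniqueDiffOn_univ
      hs.uniqueDiffOn (fun _ _ => mem_univ _) (hKs hz) (fun l hl => ?_) (fun l hl hl' => ?_)
    · rw [iteratedFDerivWithin_univ]; exact hb l (by omega) _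
    · exact (hD l (by omega) z hz).trans (le_self_pow₀ hD1 (by omega))
  calc _ ≤ (N.choose i : ℝ) * D' * ((N - i).factorial * ε * D ^ (N - i)) := by
        gcongr
        exact hD' i hi z hz
    _ = _ := by ring

end Pullback

/-! ### Forms in the chart centred at a point -/

section Centred

variable {d m : ℕ} {M : Type*} [TopologicalSpace M] [ChartedSpace (RV d) M]

/-- The coordinate expression of a field of forms in the preferred chart at `p₀`, moved so that `p₀`
has coordinate zero. -/
def loc (p₀ : M) (α : ∀ x : M, CForm (RV d) m x) (y : RV d) : Alt d m :=
  formInChart α p₀ (extChartAt 𝓘(ℝ, RV d) p₀ p₀ + y)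

/-- The point with coordinate `y` in the chart centred at `p₀`. -/
def pt (p₀ : M) (y : RV d) : M := (extChartAt 𝓘(ℝ, RV d) p₀).symm (extChartAt 𝓘(ℝ, RV d) p₀ p₀ + y)

/-- The coordinate of a point in the chart centred at `p₀`. -/
def crd (p₀ x : M) : RV d := extChartAt 𝓘(ℝ, RV d) p₀ x - extChartAt 𝓘(ℝ, RV d) p₀ p₀

/-- The derivative of the inverse of the chart centred at `p₀`. -/
def ptD (p₀ : M) (y : RV d) : RV d →L[ℝ] RV d := chartDsymm p₀ (extChartAt 𝓘(ℝ, RV d) p₀ p₀ + y)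

/-- The range of the chart centred at `p₀`. -/
def chartRange (p₀ : M) : Set (RV d) := {y | extChartAt 𝓘(ℝ, RV d) p₀ p₀ + y ∈ (extChartAt 𝓘(ℝ, RV d) p₀).target}

lemma loc_eq (p₀ : M) (α : ∀ x : M, CForm (RV d) m x) (y : RV d) :
    loc p₀ α y = (CForm.toModel (α (pt p₀ y))).compContinuousLinearMap (ptD p₀ y) := rfl

lemma pt_crd {p₀ x : M} (hx : x ∈ (extChartAt 𝓘(ℝ, RV d) p₀).source) : pt p₀ (crd (d := d) p₀ x) = x := by
  rw [pt, crd, add_sub_cancel, (extChartAt 𝓘(ℝ, RV d) p₀).left_inv hx]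

lemma crd_pt {p₀ : M} {y : RV d} (hy : y ∈ chartRange p₀) : crd p₀ (pt p₀ y) = y := by
  rw [pt, crd, (extChartAt 𝓘(ℝ, RV d) p₀).right_inv hy, add_sub_cancel_left]

lemma pt_mem_source {p₀ : M} {y : RV d} (hy : y ∈ chartRange p₀) :
    pt p₀ y ∈ (extChartAt 𝓘(ℝ, RV d) p₀).source := (extChartAt 𝓘(ℝ, RV d) p₀).map_target hy

lemma crd_mem_chartRange {p₀ x : M} (hx : x ∈ (extChartAt 𝓘(ℝ, RV d) p₀).source) :
    crd (d := d) p₀ x ∈ chartRange p₀ := by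
  rw [chartRange, mem_setOf_eq, crd, add_sub_cancel]; exact (extChartAt 𝓘(ℝ, RV d) p₀).map_source hx

lemma pt_zero (p₀ : M) : pt p₀ (0 : RV d) = p₀ := by
  rw [pt, add_zero, extChartAt_to_inv]

/-- The points whose coordinate in the chart centred at `p₀` is in the ball of radius `r`. -/
def ballNhd (d : ℕ) {M : Type*} [TopologicalSpace M] [ChartedSpace (RV d) M] (p₀ : M) {r : ℝ} (hr : 0 < r) :
    OpenNhdsOf p₀ where
  carrier := (extChartAt 𝓘(ℝ, RV d) p₀).source ∩
    extChartAt 𝓘(ℝ, RV d) p₀ ⁻¹' Metric.ball (extChartAt 𝓘(ℝ, RV d) p₀ p₀) r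
  is_open' := (continuousOn_extChartAt p₀).isOpen_inter_preimage (isOpen_extChartAt_source p₀) Metric.isOpen_ball
  mem' := ⟨mem_extChartAt_source p₀, Metric.mem_ball_self hr⟩

lemma mem_ballNhd {p₀ x : M} {r : ℝ} {hr : 0 < r} : x ∈ (ballNhd d p₀ hr).toOpens ↔
    x ∈ (extChartAt 𝓘(ℝ, RV d) p₀).source ∧ crd p₀ x ∈ Metric.ball (0 : RV d) r := by
  rw [mem_ball_zero_iff, crd, ← mem_ball_iff_norm]; rfl

lemma pt_mem_ballNhd {p₀ : M} {r : ℝ} {hr : 0 < r} {y : RV d} (hy : y ∈ chartRange p₀)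
    (hyr : y ∈ Metric.ball (0 : RV d) r) : pt p₀ y ∈ (ballNhd d p₀ hr).toOpens :=
  mem_ballNhd.2 ⟨pt_mem_source hy, by rwa [crd_pt hy]⟩

lemma ballNhd_le {p₀ : M} {r r' : ℝ} {hr : 0 < r} {hr' : 0 < r'} (h : r ≤ r') :
    (ballNhd d p₀ hr).toOpens ≤ (ballNhd d p₀ hr').toOpens :=
  fun _ hx => mem_ballNhd.2 ⟨(mem_ballNhd.1 hx).1, Metric.ball_subset_ball h (mem_ballNhd.1 hx).2⟩

lemma exists_ball_chartDomain (p₀ : M) (U : OpenNhdsOf p₀) : ∃ r > 0, Metric.ball (0 : RV d) r ⊆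
    {y | y ∈ chartRange p₀ ∧ pt p₀ y ∈ U.toOpens} := by
  have h : IsOpen {y : RV d | y ∈ chartRange p₀ ∧ pt p₀ y ∈ U.toOpens} :=
    (isOpen_chartDomain (E := RV d) U.toOpens p₀).preimage (f := fun y => extChartAt 𝓘(ℝ, RV d) p₀ p₀ + y)
      (by fun_prop)
  refine Metric.isOpen_iff.1 h 0 ⟨?_, ?_⟩
  · rw [chartRange, mem_setOf_eq, add_zero]; exact mem_extChartAt_target p₀
  · rw [pt_zero]; exact U.mem

lemma ballNhd_le_of_subset {p₀ : M} {U : OpenNhdsOf p₀} {r : ℝ} (hr : 0 < r)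
    (h : Metric.ball (0 : RV d) r ⊆ {y | y ∈ chartRange p₀ ∧ pt p₀ y ∈ U.toOpens}) :
    (ballNhd d p₀ hr).toOpens ≤ U.toOpens := fun x hx => by
  have := (h (mem_ballNhd.1 hx).2).2
  rwa [pt_crd (mem_ballNhd.1 hx).1] at this

lemma contDiffOn_loc {p₀ : M} {U : Opens M} (α : SmoothForm (RV d) m U) {s : Set (RV d)}
    (h : s ⊆ {y | y ∈ chartRange p₀ ∧ pt p₀ y ∈ U}) : ContDiffOn ℝ ∞ (loc p₀ α.field) s :=
  (α.2.1 p₀).comp (by fun_prop) fun _ hy => h hy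

lemma loc_restrictField {p₀ : M} {V : Opens M} (α : ∀ x : M, CForm (RV d) m x) {y : RV d}
    (hy : y ∈ chartRange p₀) (hV : pt p₀ y ∈ V) : loc p₀ (restrictField V α) y = loc p₀ α y :=
  formInChart_restrictField V α p₀ ⟨hy, hV⟩

variable [IsManifold 𝓘(ℝ, RV d) ∞ M]

lemma loc_mextDeriv {p₀ : M} {α : ∀ x : M, CForm (RV d) m x} {y : RV d} (hy : y ∈ chartRange p₀)
    (h : DifferentiableAt ℝ (loc p₀ α) y) : loc p₀ (mextDeriv α) y = extDeriv (loc p₀ α) y := by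
  have h' : DifferentiableAt ℝ (formInChart α p₀) (extChartAt 𝓘(ℝ, RV d) p₀ p₀ + y) := by
    have h2 : formInChart α p₀ = fun z => loc p₀ α (z - extChartAt 𝓘(ℝ, RV d) p₀ p₀) := by
      funext z; rw [loc, add_sub_cancel]
    rw [h2]
    refine DifferentiableAt.comp (g := loc p₀ α) _ ?_ (by fun_prop)
    rwa [add_sub_cancel_left]
  rw [loc, formInChart_mextDeriv α hy h', extDeriv, extDeriv]
  congr 1
  exact (fderiv_comp_add_left (f := formInChart α p₀) (extChartAt 𝓘(ℝ, RV d) p₀ p₀)).symm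

open Classical in
/-- The field of forms on a coordinate ball with a given coordinate expression. -/
def globField (p₀ : M) {r : ℝ} (hr : 0 < r) (β : RV d → Alt d m) (x : M) : CForm (RV d) m x :=
  if x ∈ (ballNhd d p₀ hr).toOpens then
    CForm.ofModel x ((β (crd p₀ x)).compContinuousLinearMap (chartD p₀ x)) else 0

lemma loc_globField {p₀ : M} {r : ℝ} {hr : 0 < r} (β : RV d → Alt d m) {y : RV d} (hy : y ∈ chartRange p₀)
    (hyr : y ∈ Metric.ball (0 : RV d) r) : loc p₀ (globField p₀ hr β) y = β y := by
  rw [loc_eq, globField, if_pos (pt_mem_ballNhd hy hyr), crd_pt hy]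
  have h := chartD_comp_symm (E := RV d) hy
  ext v
  change β y (fun j => (chartD p₀ (pt p₀ y)).comp (chartDsymm p₀ _) (v j)) = _
  rw [pt, h]; rfl

/-- In every chart the form is a pull-back of `β` under the coordinate change, which gives both its
smoothness and, through `exists_bound_pullForm`, its continuous dependence on `β`. -/
lemma formInChart_globField {p₀ : M} {r : ℝ} {hr : 0 < r} (β : RV d → Alt d m) (x₁ : M) :
    EqOn (formInChart (globField p₀ hr β) x₁)
      (pullForm (fun z => transition x₁ p₀ z - extChartAt 𝓘(ℝ, RV d) p₀ p₀) β)
      (chartDomain (RV d) (ballNhd d p₀ hr).toOpens x₁) := by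
  intro z hz
  have hm := mem_ballNhd.1 hz.2
  have hz' : z ∈ transitionDomain x₁ p₀ := ⟨hz.1, hm.1⟩
  rw [formInChart_transition _ hz', pullForm, fderiv_sub_const]
  congr 1
  have h1 : transition x₁ p₀ z = extChartAt 𝓘(ℝ, RV d) p₀ p₀ + crd p₀ ((extChartAt 𝓘(ℝ, RV d) x₁).symm z) := by
    rw [crd, add_sub_cancel]; rfl
  have h2 := loc_globField (hr := hr) β (crd_mem_chartRange hm.1) hm.2
  rw [loc, ← h1] at h2
  rw [h2, h1, add_sub_cancel_left]

omit [IsManifold 𝓘(ℝ, RV d) ∞ M] in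
lemma chartDomain_ballNhd_subset {p₀ : M} {r : ℝ} {hr : 0 < r} (x₁ : M) :
    chartDomain (RV d) (ballNhd d p₀ hr).toOpens x₁ ⊆ transitionDomain x₁ p₀ :=
  fun _ hz => ⟨hz.1, (mem_ballNhd.1 hz.2).1⟩

lemma contDiffOn_transition_sub {p₀ : M} {r : ℝ} {hr : 0 < r} (x₁ : M) :
    ContDiffOn ℝ ∞ (fun z => transition x₁ p₀ z - extChartAt 𝓘(ℝ, RV d) p₀ p₀)
      (chartDomain (RV d) (ballNhd d p₀ hr).toOpens x₁) :=
  ((contDiffOn_transition x₁ p₀).mono (chartDomain_ballNhd_subset x₁)).sub contDiffOn_const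

/-- The smooth form on a coordinate ball with a given coordinate expression. -/
def glob (p₀ : M) {r : ℝ} (hr : 0 < r) {β : RV d → Alt d m} (hβ : ContDiff ℝ ∞ β) :
    SmoothForm (RV d) m (ballNhd d p₀ hr).toOpens :=
  ⟨globField p₀ hr β, fun x₁ => (contDiffOn_pullForm (isOpen_chartDomain _ _)
    (contDiffOn_transition_sub x₁) hβ).congr (formInChart_globField β x₁), fun _ hx => if_neg hx⟩

lemma loc_glob {p₀ : M} {r : ℝ} {hr : 0 < r} {β : RV d → Alt d m} (hβ : ContDiff ℝ ∞ β) {y : RV d}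
    (hy : y ∈ chartRange p₀) (hyr : y ∈ Metric.ball (0 : RV d) r) : loc p₀ (glob p₀ hr hβ).field y = β y :=
  loc_globField β hy hyr

/-- Uniform convergence of all derivatives implies convergence of the corresponding forms. -/
lemma tendsto_glob {p₀ : M} {r : ℝ} {hr : 0 < r} {β : RV d → Alt d m} (hβ : ContDiff ℝ ∞ β)
    {u : ℕ → RV d → Alt d m} (hu : ∀ j, ContDiff ℝ ∞ (u j))
    (h : ∀ i : ℕ, ∃ v : ℕ → ℝ, Tendsto v atTop (𝓝 0) ∧
      ∀ j x, ‖iteratedFDeriv ℝ i (fun y => u j y - β y) x‖ ≤ v j) :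
    Tendsto (fun j => glob p₀ hr (hu j)) atTop (𝓝 (glob p₀ hr hβ)) := by
  -- The topology is an infimum of induced ones, so convergence is tested chart by chart, for one
  -- order of derivative and on one compact set at a time.
  refine (nhds_iInf (a := glob p₀ hr hβ)).symm ▸ tendsto_iInf.2 fun x₁ => ?_
  refine (nhds_iInf (a := glob p₀ hr hβ)).symm ▸ tendsto_iInf.2 fun N => ?_
  rw [nhds_induced, tendsto_comap_iff, UniformOnFun.tendsto_iff_tendstoUniformlyOn]
  rintro K ⟨hK, hKs⟩
  have hs := isOpen_chartDomain (E := RV d) (ballNhd d p₀ hr).toOpens x₁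
  have hτ := contDiffOn_transition_sub (d := d) (p₀ := p₀) (hr := hr) x₁
  obtain ⟨C, hC⟩ := exists_bound_pullForm (m := m) hs hτ hK hKs N
  choose v hv0 hv using h
  let ε : ℕ → ℝ := fun j => ∑ i ∈ Finset.range (N + 1), |v i j|
  have hε : Tendsto (fun j => C * ε j) atTop (𝓝 0) := by
    have : Tendsto ε atTop (𝓝 (∑ i ∈ Finset.range (N + 1), |(0 : ℝ)|)) :=
      tendsto_finset_sum _ fun i _ => (hv0 i).abs
    simpa using this.const_mul C
  rw [Metric.tendstoUniformlyOn_iff]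
  intro δ hδ
  filter_upwards [hε.eventually (gt_mem_nhds hδ)] with j hj z hz
  refine lt_of_le_of_lt ?_ hj
  have hb := hC (fun y => u j y - β y) (ε j) ((hu j).sub hβ) (Finset.sum_nonneg fun _ _ => abs_nonneg _)
    (fun i hi x => (hv i j x).trans ((le_abs_self _).trans (Finset.single_le_sum (f := fun i => |v i j|)
      (fun _ _ => abs_nonneg _) (Finset.mem_range.2 (Nat.lt_succ_of_le hi))))) z hz
  have e1 : ∀ {γ : RV d → Alt d m} (_ : ContDiff ℝ ∞ γ),
      iteratedFDeriv ℝ N (formInChart (globField p₀ hr γ) x₁) z = iteratedFDeriv ℝ N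
        (pullForm (fun z => transition x₁ p₀ z - extChartAt 𝓘(ℝ, RV d) p₀ p₀) γ) z := fun {γ} _ =>
    (((formInChart_globField (hr := hr) γ x₁).eventuallyEq_of_mem (hs.mem_nhds (hKs hz))).iteratedFDeriv
      (𝕜 := ℝ) N).eq_of_nhds
  have e2 : pullForm (fun z => transition x₁ p₀ z - extChartAt 𝓘(ℝ, RV d) p₀ p₀) (fun y => u j y - β y) =
      pullForm (fun z => transition x₁ p₀ z - extChartAt 𝓘(ℝ, RV d) p₀ p₀) (u j) -
        pullForm (fun z => transition x₁ p₀ z - extChartAt 𝓘(ℝ, RV d) p₀ p₀) β := rfl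
  have hz' := hs.mem_nhds (hKs hz)
  rw [e2, iteratedFDeriv_sub_apply
    (((contDiffOn_pullForm hs hτ (hu j)).contDiffAt hz').of_le (nat_le_infty N))
    (((contDiffOn_pullForm hs hτ hβ).contDiffAt hz').of_le (nat_le_infty N)),
    ← e1 (hu j), ← e1 hβ] at hb
  rw [dist_comm, dist_eq_norm]
  exact hb

end Centred

/-! ### The local cohomology groups -/

section LocalCohomology

variable {n k : ℕ} {M : Type*} [TopologicalSpace M]
  [ChartedSpace (EuclideanSpace ℝ (Fin (2 * n + k))) M] [IsManifold (𝓡 (2 * n + k)) ∞ M]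
  (S : CRStructure n k M) {p q : ℕ} {p₀ : M}

omit [IsManifold (𝓡 (2 * n + k)) ∞ M] in
lemma restrict_self {m : ℕ} {U : Opens M} (α : SmoothForm (RV (2 * n + k)) m U) (h : U ≤ U) :
    SmoothForm.restrict h α = α := Subtype.ext <| funext fun x => by
  change restrictField U α.field x = α.field x
  by_cases hx : x ∈ U
  · exact restrictField_apply _ hx
  · exact (if_neg hx).trans (α.2.2 x hx).symm

omit [IsManifold (𝓡 (2 * n + k)) ∞ M] in
lemma restrict_restrict {m : ℕ} {U V W : Opens M} (α : SmoothForm (RV (2 * n + k)) m U) (h : V ≤ U)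
    (h' : W ≤ V) : SmoothForm.restrict h' (SmoothForm.restrict h α) = SmoothForm.restrict (h'.trans h) α :=
  Subtype.ext <| funext fun x => by
  change restrictField W (restrictField V α.field) x = restrictField W α.field x
  by_cases hx : x ∈ W
  · rw [restrictField_apply _ hx, restrictField_apply _ hx, restrictField_apply _ (h' hx)]
  · exact (if_neg hx).trans (if_neg hx).symm

lemma directedSystem_cohomology : DirectedSystem (fun U : (OpenNhdsOf p₀)ᵒᵈ => S.Cohomology p q (OrderDual.ofDual U).toOpens)
    (fun _ _ h => S.restrictCohomology p q h) where
  map_self U z := by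
    obtain ⟨α, rfl⟩ := Submodule.Quotient.mk_surjective _ z
    exact congrArg _ (Subtype.ext (restrict_self α.1 le_rfl))
  map_map U V W h h' z := by
    obtain ⟨α, rfl⟩ := Submodule.Quotient.mk_surjective _ z
    exact congrArg _ (Subtype.ext (restrict_restrict α.1 h h'))

/-- The class of a closed form in the local cohomology group. -/
def germClass (U : OpenNhdsOf p₀) (α : S.cocycles p q U.toOpens) : S.LocalCohomology p q p₀ :=
  S.toLocalCohomology p q U (Submodule.Quotient.mk α)

lemma exists_germClass (z : S.LocalCohomology p q p₀) :
    ∃ (U : OpenNhdsOf p₀) (α : S.cocycles p q U.toOpens), germClass S U α = z := by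
  classical
  obtain ⟨U, x, hx⟩ := Module.DirectLimit.exists_of z
  obtain ⟨α, rfl⟩ := Submodule.Quotient.mk_surjective _ x
  exact ⟨OrderDual.ofDual U, α, hx⟩

/-- In a directed system an element of the limit is zero exactly when it already becomes zero at
some later stage. -/
lemma germClass_eq_zero {U : OpenNhdsOf p₀} {α : S.cocycles p q U.toOpens} :
    germClass S U α = 0 ↔ ∃ (V : OpenNhdsOf p₀) (h : V.toOpens ≤ U.toOpens),
      S.IsExact p q (SmoothForm.restrict h α.1) := by
  classical
  constructor
  · intro h
    obtain ⟨V, hV, h0⟩ := @Module.DirectLimit.of.zero_exact _ _ _ _ _ _ _ _ _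
      (directedSystem_cohomology (p := p) (q := q) (p₀ := p₀) S) _ _ _ h
    exact ⟨OrderDual.ofDual V, hV, (Submodule.Quotient.mk_eq_zero _).1 h0⟩
  · rintro ⟨V, h, hV⟩
    have h1 : S.restrictCohomology p q h (Submodule.Quotient.mk α) = 0 :=
      (Submodule.Quotient.mk_eq_zero _).2 (show S.restrictCocycles p q h α ∈ S.coboundaries p q V.toOpens from hV)
    have h2 := Module.DirectLimit.of_f (R := ℂ) (ι := (OpenNhdsOf p₀)ᵒᵈ)
      (G := fun U => S.Cohomology p q (OrderDual.ofDual U).toOpens)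
      (f := fun _ _ h => S.restrictCohomology p q h) (i := OrderDual.toDual U) (j := OrderDual.toDual V)
      (hij := h) (x := Submodule.Quotient.mk α)
    have h3 : germClass S U α = _ := h2.symm
    rw [h3]
    exact (congrArg _ h1).trans (map_zero _)

lemma continuous_germClass (U : OpenNhdsOf p₀) :
    Continuous (germClass (p := p) (q := q) S U) := by
  have h1 : Continuous (S.toLocalCohomology p q U) := continuous_iSup_rng (i := U) continuous_coinduced_rng
  exact h1.comp continuous_quot_mk

/-- Every element of the limit is the class of a closed form on some neighbourhood, exact on a
smaller one. -/
lemma subsingleton_of_poincareLemma (h : S.PoincareLemma p q p₀) : Subsingleton (S.LocalCohomology p q p₀) := by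
  refine subsingleton_of_forall_eq 0 fun z => ?_
  obtain ⟨U, α, rfl⟩ := exists_germClass S z
  exact (germClass_eq_zero S).2 (h U α.1 α.2)

lemma germClass_sub {U : OpenNhdsOf p₀} (α β : S.cocycles p q U.toOpens) :
    germClass S U (α - β) = germClass S U α - germClass S U β := 
  map_sub ((S.toLocalCohomology p q U).comp (Submodule.mkQ _)) α β

lemma germClass_restrict {U V : OpenNhdsOf p₀} (h : V.toOpens ≤ U.toOpens) (α : S.cocycles p q U.toOpens) :
    germClass S V (S.restrictCocycles p q h α) = germClass S U α := by
  classical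
  exact Module.DirectLimit.of_f (R := ℂ) (ι := (OpenNhdsOf p₀)ᵒᵈ)
      (G := fun U => S.Cohomology p q (OrderDual.ofDual U).toOpens)
      (f := fun _ _ h => S.restrictCohomology p q h) (i := OrderDual.toDual U) (j := OrderDual.toDual V)
      (hij := h) (x := Submodule.Quotient.mk α)

end LocalCohomology

/-! ### Comparison of the local model with the manifold -/

section LocalModel

variable {n k : ℕ} {M : Type*} [TopologicalSpace M]
  [ChartedSpace (EuclideanSpace ℝ (Fin (2 * n + k))) M] [IsManifold (𝓡 (2 * n + k)) ∞ M]

/-- The complex tangent vector with the given real and imaginary parts. -/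
def tangentPair {d : ℕ} {M : Type*} [TopologicalSpace M] [ChartedSpace (RV d) M] (x : M) (v w : RV d) :
    CTangent (RV d) x := (v, w)

/-- The frame of the local model spans `T^{0,1}` in the chart centred at `p₀`. -/
structure IsLocalModel (S : CRStructure n k M) (p₀ : M) (X : LocalCR (2 * n + k) n k) : Prop where
  range : Metric.ball (0 : RV (2 * n + k)) X.R ⊆ chartRange p₀
  mem_T01 : ∀ y ∈ Metric.ball (0 : RV (2 * n + k)) X.R, ∀ v w : RV (2 * n + k),
    mkC v w ∈ T01 X.L y ↔ tangentPair (pt p₀ y) (ptD p₀ y v) (ptD p₀ y w) ∈ S.T01 (pt p₀ y)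

lemma mkC_reV_imV {d : ℕ} (Z : CV d) : mkC (reV Z) (imV Z) = Z := by
  funext r
  simp only [mkC, reV, imV]
  rw [mul_comm]; exact Complex.re_add_im _

variable {S : CRStructure n k M} {p₀ : M} {X : LocalCR (2 * n + k) n k} (hX : IsLocalModel S p₀ X) {p q m : ℕ}

omit [IsManifold (𝓡 (2 * n + k)) ∞ M] in
lemma altC_loc (α : ∀ x : M, CForm (RV (2 * n + k)) m x) (y : RV (2 * n + k)) (v w : Fin m → RV (2 * n + k)) :
    altC (loc p₀ α y) (fun j => mkC (v j) (w j)) = CForm.complexEval (α (pt p₀ y))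
      (fun j => tangentPair (pt p₀ y) (ptD p₀ y (v j)) (ptD p₀ y (w j))) := by
  rw [altC_mkC, CForm.complexEval]
  refine Finset.sum_congr rfl fun s _ => ?_
  congr 1
  rw [loc_eq]
  change α (pt p₀ y) (fun j => ptD p₀ y (if j ∈ s then w j else v j)) = _
  congr 1
  funext j
  split_ifs <;> rfl

include hX

/-- The inverse chart maps the span of the model frame onto T^{0,1}, so the vanishing conditions
correspond argument by argument. -/
lemma mem_filtration_iff (α : ∀ x : M, CForm (RV (2 * n + k)) m x) {y : RV (2 * n + k)}
    (hy : y ∈ Metric.ball 0 X.R) :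
    α (pt p₀ y) ∈ S.filtration p m (pt p₀ y) ↔ loc p₀ α y ∈ Filt (T01 X.L y) p m := by
  constructor
  · intro h Z s hs hZ
    have h1 : Z = fun j => mkC (reV (Z j)) (imV (Z j)) := funext fun j => (mkC_reV_imV _).symm
    rw [h1, altC_loc]
    refine h _ s hs fun j hj => ?_
    rw [← hX.mem_T01 y hy, mkC_reV_imV]
    exact hZ j hj
  · intro h Z s hs hZ
    have h2 := chartDsymm_comp (E := RV (2 * n + k)) (pt_mem_source (hX.range hy))
    rw [pt, (extChartAt 𝓘(ℝ, RV (2 * n + k)) p₀).right_inv (hX.range hy)] at h2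
    have h3 : ∀ v : RV (2 * n + k), ptD p₀ y (chartD p₀ (pt p₀ y) v) = v := fun v =>
      DFunLike.congr_fun h2 v
    -- The chart derivative is invertible, hence every family of tangent vectors comes from the
    -- model space.
    have h4 : Z = fun j => tangentPair (pt p₀ y) (ptD p₀ y (chartD p₀ (pt p₀ y) (Z j).1))
        (ptD p₀ y (chartD p₀ (pt p₀ y) (Z j).2)) :=
      funext fun j => Prod.ext (h3 _).symm (h3 _).symm
    have h5 := altC_loc (p₀ := p₀) α y (fun j => chartD p₀ (pt p₀ y) (Z j).1) (fun j => chartD p₀ (pt p₀ y) (Z j).2)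
    have h6 := h5.symm.trans (h _ s hs fun j hj => by
      rw [hX.mem_T01 y hy]; have := hZ j hj; rw [congrFun h4 j] at this; exact this)
    rw [h4]; exact h6

lemma forall_mem_filtration_iff (α : ∀ x : M, CForm (RV (2 * n + k)) m x) {r : ℝ} (hr : 0 < r) (hrR : r ≤ X.R) :
    (∀ x ∈ (ballNhd (2 * n + k) p₀ hr).toOpens, α x ∈ S.filtration p m x) ↔
      ∀ y ∈ Metric.ball 0 r, loc p₀ α y ∈ Filt (T01 X.L y) p m := by
  have hb := Metric.ball_subset_ball (x := (0 : RV (2 * n + k))) hrR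
  constructor
  · intro h y hy
    exact (mem_filtration_iff hX α (hb hy)).1 (h _ (pt_mem_ballNhd (hX.range (hb hy)) hy))
  · intro h x hx
    have hx' := mem_ballNhd.1 hx
    have := (mem_filtration_iff hX α (hb hx'.2)).2 (h _ hx'.2)
    rwa [pt_crd hx'.1] at this

lemma IsLocalModel.loc_mextDeriv {U : Opens M} (α : SmoothForm (RV (2 * n + k)) m U) {r : ℝ} (hrR : r ≤ X.R)
    (hU : ∀ y ∈ Metric.ball (0 : RV (2 * n + k)) r, pt p₀ y ∈ U) {y : RV (2 * n + k)} (hy : y ∈ Metric.ball 0 r) :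
    loc p₀ (mextDeriv α.field) y = extDeriv (loc p₀ α.field) y := by
  have hb := Metric.ball_subset_ball (x := (0 : RV (2 * n + k))) hrR
  exact CRLocal.loc_mextDeriv (hX.range (hb hy)) (((contDiffOn_loc α fun z hz =>
    ⟨hX.range (hb hz), hU z hz⟩).contDiffAt (Metric.isOpen_ball.mem_nhds hy)).differentiableAt (by simp))

lemma IsLocalModel.pt_mem {r : ℝ} (hr : 0 < r) (hrR : r ≤ X.R) :
    ∀ y ∈ Metric.ball (0 : RV (2 * n + k)) r, pt p₀ y ∈ (ballNhd (2 * n + k) p₀ hr).toOpens := fun _ hy =>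
  pt_mem_ballNhd (hX.range (Metric.ball_subset_ball hrR hy)) hy

omit hX in
lemma extDeriv_congr_ball {d : ℕ} {f g : RV d → Alt d m} {r : ℝ} (h : EqOn f g (Metric.ball 0 r)) {y : RV d}
    (hy : y ∈ Metric.ball 0 r) : extDeriv f y = extDeriv g y :=
  (h.eventuallyEq_of_mem (Metric.isOpen_ball.mem_nhds hy)).extDeriv_eq

lemma glob_mem_cocycles {r : ℝ} (hr : 0 < r) (hrR : r ≤ X.R) {β : RV (2 * n + k) → Alt (2 * n + k) (p + q)}
    (hβ : ContDiff ℝ ∞ β) (h : Cocyc X.L p (p + q) r β) :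
    glob p₀ hr hβ ∈ S.cocycles p q (ballNhd (2 * n + k) p₀ hr).toOpens := by
  have hb := Metric.ball_subset_ball (x := (0 : RV (2 * n + k))) hrR
  have he : EqOn (loc p₀ (glob p₀ hr hβ).field) β (Metric.ball 0 r) := fun y hy =>
    loc_glob hβ (hX.range (hb hy)) hy
  refine ⟨(forall_mem_filtration_iff hX _ hr hrR).2 fun y hy => ?_,
    (forall_mem_filtration_iff hX _ hr hrR).2 fun y hy => ?_⟩
  · rw [he hy]; exact (h y hy).1
  · rw [hX.loc_mextDeriv _ hrR (hX.pt_mem hr hrR) hy, extDeriv_congr_ball he hy]; exact (h y hy).2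

/-- A form with a primitive on a coordinate ball in the local model is exact there. -/
lemma isExact_of_prim {r : ℝ} (hr : 0 < r) (hrR : r ≤ X.R)
    (α : SmoothForm (RV (2 * n + k)) (p + (q + 1)) (ballNhd (2 * n + k) p₀ hr).toOpens)
    {η : RV (2 * n + k) → Alt (2 * n + k) (p + q)} (hη : ContDiff ℝ ∞ η)
    (h : Prim X.L p (p + q) r (loc p₀ α.field) η) : S.IsExact p (q + 1) α := by
  have hb := Metric.ball_subset_ball (x := (0 : RV (2 * n + k))) hrR
  have he : EqOn (loc p₀ (glob p₀ hr hη).field) η (Metric.ball 0 r) := fun y hy =>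
    loc_glob hη (hX.range (hb hy)) hy
  refine ⟨glob p₀ hr hη, (forall_mem_filtration_iff hX _ hr hrR).2 fun y hy => ?_,
    (forall_mem_filtration_iff hX (fun x => α.field x - mextDeriv (glob p₀ hr hη).field x) hr hrR).2
      fun y hy => ?_⟩
  · rw [he hy]; exact (h y hy).1
  · have h1 : loc p₀ (fun x => α.field x - mextDeriv (glob p₀ hr hη).field x) y =
        loc p₀ α.field y - loc p₀ (mextDeriv (glob p₀ hr hη).field) y := rfl
    rw [h1, hX.loc_mextDeriv _ hrR (hX.pt_mem hr hrR) hy, extDeriv_congr_ball he hy]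
    exact (h y hy).2

/-- An exact form near `p₀` is exact with bounds in the local model. -/
lemma exactBound_of_isExact {V : OpenNhdsOf p₀} {α : SmoothForm (RV (2 * n + k)) (p + q) V.toOpens}
    (h : S.IsExact p q α) : ∃ r C : ℝ, 0 < r ∧ 0 ≤ C ∧ ExactBound X.L p q (loc p₀ α.field) r C := by
  obtain ⟨r₀, hr₀, hsub₀⟩ := exists_ball_chartDomain (d := 2 * n + k) p₀ V
  set r := min r₀ X.R
  have hr : 0 < r := lt_min hr₀ X.R_pos
  have hrR : r ≤ X.R := min_le_right _ _
  have hb := Metric.ball_subset_ball (x := (0 : RV (2 * n + k))) hrR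
  have hsub : Metric.ball (0 : RV (2 * n + k)) r ⊆ {y | y ∈ chartRange p₀ ∧ pt p₀ y ∈ V.toOpens} :=
    (Metric.ball_subset_ball (min_le_left _ _)).trans hsub₀
  cases q with
  | zero =>
    exact ⟨r, 0, hr, le_rfl, fun y hy =>
      (mem_filtration_iff hX α.field (hb hy)).1 (h _ (hsub hy).2)⟩
  | succ q =>
    obtain ⟨η, h1, h2⟩ := h
    obtain ⟨g, hg, hge, hgc⟩ := exists_contDiff_eqOn_ball hr (contDiffOn_loc η hsub)
    obtain ⟨C, hC⟩ := hg.continuous.bounded_above_of_compact_support hgc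
    have hb2 : Metric.ball (0 : RV (2 * n + k)) (r / 2) ⊆ Metric.ball 0 r :=
      Metric.ball_subset_ball (by linarith)
    refine ⟨r / 2, C, by positivity, (norm_nonneg _).trans (hC 0), g, hg, fun y hy => ⟨?_, hC y, ?_⟩⟩
    · rw [hge hy]; exact (mem_filtration_iff hX η.field (hb (hb2 hy))).1 (h1 _ (hsub (hb2 hy)).2)
    · have := (mem_filtration_iff hX (fun x => α.field x - mextDeriv η.field x) (hb (hb2 hy))).1
        (h2 _ (hsub (hb2 hy)).2)
      have h3 : loc p₀ (fun x => α.field x - mextDeriv η.field x) y =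
        loc p₀ α.field y - loc p₀ (mextDeriv η.field) y := rfl
      rw [h3, hX.loc_mextDeriv η hrR (fun z hz => (hsub hz).2) (hb2 hy)] at this
      rw [extDeriv_congr_ball hge hy]
      exact this

omit hX in
lemma ExactBound.congr {d : ℕ} {L : Fin n → RV d → CV d} {α β : RV d → Alt d (p + q)} {r C : ℝ}
    (h : ExactBound L p q α r C) (he : EqOn α β (Metric.ball 0 r)) : ExactBound L p q β r C := by
  cases q with
  | zero => exact fun x hx => by rw [← he hx]; exact h x hx
  | succ q =>
    obtain ⟨η, hη, h⟩ := h
    exact ⟨η, hη, fun x hx => ⟨(h x hx).1, (h x hx).2.1, by rw [← he hx]; exact (h x hx).2.2⟩⟩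

/-- If the germs of two closed forms are cohomologous, their difference is exact in the local model. -/
lemma exactBound_of_germClass_eq_zero {U : OpenNhdsOf p₀} {α : S.cocycles p q U.toOpens}
    (h : germClass S U α = 0) :
    ∃ r C : ℝ, 0 < r ∧ 0 ≤ C ∧ ExactBound X.L p q (loc p₀ α.1.field) r C := by
  obtain ⟨V, hV, hex⟩ := (germClass_eq_zero S).1 h
  obtain ⟨r, C, hr, hC, hb⟩ := exactBound_of_isExact hX hex
  obtain ⟨r₀, hr₀, hsub₀⟩ := exists_ball_chartDomain (d := 2 * n + k) p₀ V
  refine ⟨min r r₀, C, lt_min hr hr₀, hC, (hb.mono (min_le_left _ _)).congr fun y hy => ?_⟩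
  have := hsub₀ (Metric.ball_subset_ball (min_le_right _ _) hy)
  exact loc_restrictField _ this.1 this.2

/-- Convergence of forms implies convergence of their classes. The classes of the approximating
forms are zero, so uniqueness of limits makes the class of the limit zero. -/
lemma closedExact_of_t2Space [T2Space (S.LocalCohomology p (q + 1) p₀)] : ClosedExact X p (p + q) := by
  intro α u hα hu cα cu hex hlim
  let a : S.cocycles p (q + 1) (ballNhd (2 * n + k) p₀ X.R_pos).toOpens :=
    ⟨glob p₀ X.R_pos hα, glob_mem_cocycles hX (q := q + 1) X.R_pos le_rfl hα cα⟩
  let b : ℕ → S.cocycles p (q + 1) (ballNhd (2 * n + k) p₀ X.R_pos).toOpens := fun j =>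
    ⟨glob p₀ X.R_pos (hu j), glob_mem_cocycles hX (q := q + 1) X.R_pos le_rfl (hu j) (cu j)⟩
  have hba : Tendsto b atTop (𝓝 a) := tendsto_subtype_rng.2 (tendsto_glob hα hu hlim)
  have hlim := ((continuous_germClass S _).tendsto a).comp hba
  have hb0 : ∀ j, germClass S _ (b j) = 0 := by
    intro j
    obtain ⟨r, hr, η, hη, hP⟩ := hex j
    have hr' : 0 < min r X.R := lt_min hr X.R_pos
    refine (germClass_eq_zero S).2 ⟨ballNhd (2 * n + k) p₀ hr', ballNhd_le (min_le_right _ _), ?_⟩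
    refine isExact_of_prim hX hr' (min_le_right _ _) _ hη fun y hy => ?_
    have hyR := Metric.ball_subset_ball (min_le_right _ _) hy
    have h1 := hP y (Metric.ball_subset_ball (min_le_left _ _) hy)
    refine ⟨h1.1, ?_⟩
    rw [SmoothForm.restrict_field, loc_restrictField _ (hX.range hyR) (pt_mem_ballNhd (hX.range hyR) hy)]
    have h2 : loc p₀ (b j).1.field y = u j y := loc_glob (hu j) (hX.range hyR) hyR
    rw [h2]; exact h1.2
  have h0 : germClass S _ a = 0 := by
    refine tendsto_nhds_unique hlim (tendsto_const_nhds.congr fun j => (hb0 j).symm)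
  obtain ⟨r, C, hr, -, η, hη, hE⟩ := exactBound_of_germClass_eq_zero hX h0
  refine ⟨min r X.R, lt_min hr X.R_pos, η, hη, fun y hy => ?_⟩
  have hyR := Metric.ball_subset_ball (min_le_right _ _) hy
  have h1 := hE y (Metric.ball_subset_ball (min_le_left _ _) hy)
  refine ⟨h1.1, ?_⟩
  have h2 : loc p₀ a.1.field y = α y := loc_glob hα (hX.range hyR) hyR
  rw [← h2]; exact h1.2.2

/-- Generators of the limit are represented by closed forms on neighbourhoods; the model expressions
are cut off, which does not change them near the origin. -/
lemma finiteCohomology_of_finiteDimensional [FiniteDimensional ℂ (S.LocalCohomology p q p₀)] :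
    FiniteCohomology X p q := by
  obtain ⟨N, s, hs⟩ := Module.Finite.exists_fin (R := ℂ) (M := S.LocalCohomology p q p₀)
  choose U a ha using fun j => exists_germClass S (s j)
  choose ρ hρ hsub using fun j => exists_ball_chartDomain (d := 2 * n + k) p₀ (U j)
  choose g hg hge hgc using fun j => exists_contDiff_eqOn_ball (hρ j) (contDiffOn_loc (a j).1 (hsub j))
  refine ⟨N, g, hg, fun α r hr hα cα => ?_⟩
  have hr' : 0 < min r X.R := lt_min hr X.R_pos
  let A : S.cocycles p q (ballNhd (2 * n + k) p₀ hr').toOpens :=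
    ⟨glob p₀ hr' hα, glob_mem_cocycles hX hr' (min_le_right _ _) hα fun y hy =>
      cα y (Metric.ball_subset_ball (min_le_left _ _) hy)⟩
  have hA : germClass S _ A ∈ Submodule.span ℂ (range s) := by rw [hs]; trivial
  obtain ⟨c, hc⟩ := (Submodule.mem_span_range_iff_exists_fun ℂ).1 hA
  -- a common radius
  obtain ⟨ρ', hρ', hρle⟩ : ∃ ρ' > 0, ρ' ≤ min r X.R ∧ ∀ j, ρ' ≤ ρ j / 2 := by
    by_cases hN : Nonempty (Fin N)
    · obtain ⟨j₀, -, hj₀⟩ := Finset.exists_min_image Finset.univ ρ Finset.univ_nonempty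
      exact ⟨min (min r X.R) (ρ j₀ / 2), lt_min hr' (by linarith [hρ j₀]), min_le_left _ _, fun j =>
        (min_le_right _ _).trans (by linarith [hj₀ j (Finset.mem_univ j)])⟩
    · exact ⟨min r X.R, hr', le_rfl, fun j => (hN ⟨j⟩).elim⟩
  have hle1 : (ballNhd (2 * n + k) p₀ hρ').toOpens ≤ (ballNhd (2 * n + k) p₀ hr').toOpens := ballNhd_le hρle.1
  have hbj : ∀ j, Metric.ball (0 : RV (2 * n + k)) ρ' ⊆ Metric.ball 0 (ρ j) := fun j =>
    Metric.ball_subset_ball (by linarith [hρle.2 j, hρ j])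
  have hlej : ∀ j, (ballNhd (2 * n + k) p₀ hρ').toOpens ≤ (U j).toOpens := fun j =>
    ballNhd_le_of_subset hρ' ((hbj j).trans (hsub j))
  -- On a ball common to all representatives, the form minus the combination given by its class; the
  -- class of `D` is zero, so it is exact on a smaller ball.
  let D : S.cocycles p q (ballNhd (2 * n + k) p₀ hρ').toOpens :=
    S.restrictCocycles p q hle1 A - ∑ j, c j • S.restrictCocycles p q (hlej j) (a j)
  have hD : germClass S _ D = 0 := by
    rw [germClass_sub, germClass_restrict]
    have : germClass S _ (∑ j, c j • S.restrictCocycles p q (hlej j) (a j)) =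
        ∑ j, c j • germClass S _ (S.restrictCocycles p q (hlej j) (a j)) := by
      have h := map_sum ((S.toLocalCohomology p q (ballNhd (2 * n + k) p₀ hρ')).comp (Submodule.mkQ _))
        (fun j => c j • S.restrictCocycles p q (hlej j) (a j)) Finset.univ
      simp only [map_smul] at h
      exact h
    rw [this, ← hc, sub_eq_zero]
    exact Finset.sum_congr rfl fun j _ => by rw [germClass_restrict, ha]
  obtain ⟨r₁, C, hr₁, hC, hE⟩ := exactBound_of_germClass_eq_zero hX hD
  refine ⟨c, min r₁ ρ', C, lt_min hr₁ hρ', hC, (hE.mono (min_le_left _ _)).congr fun y hy => ?_⟩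
  have hy' := Metric.ball_subset_ball (min_le_right r₁ ρ') hy
  have hyr := Metric.ball_subset_ball hρle.1 hy'
  have hyR := hX.range (Metric.ball_subset_ball (min_le_right _ _) hyr)
  have hV := pt_mem_ballNhd (hr := hρ') hyR hy'
  have e1 : D.1.field = restrictField (ballNhd (2 * n + k) p₀ hρ').toOpens A.1.field -
      ∑ j, c j • restrictField (ballNhd (2 * n + k) p₀ hρ').toOpens (a j).1.field := by
    have h1 : D.1 = SmoothForm.restrict hle1 A.1 - ∑ j, c j • SmoothForm.restrict (hlej j) (a j).1 := by
      change (S.cocycles p q (ballNhd (2 * n + k) p₀ hρ').toOpens).subtype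
        (S.restrictCocycles p q hle1 A - ∑ j, c j • S.restrictCocycles p q (hlej j) (a j)) = _
      rw [map_sub, map_sum]
      simp only [map_smul]
      rfl
    rw [h1, map_sub, map_sum]
    simp only [map_smul]
    rfl
  have e2 : loc p₀ D.1.field y = loc p₀ (restrictField (ballNhd (2 * n + k) p₀ hρ').toOpens A.1.field) y -
      ∑ j, c j • loc p₀ (restrictField (ballNhd (2 * n + k) p₀ hρ').toOpens (a j).1.field) y := by
    let Φ : (∀ x : M, CForm (RV (2 * n + k)) (p + q) x) →ₗ[ℂ] Alt (2 * n + k) (p + q) :=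
      { toFun := fun f => loc p₀ f y
        map_add' := fun _ _ => rfl
        map_smul' := fun _ _ => rfl }
    rw [e1]
    change Φ (_ - ∑ j, _) = Φ _ - ∑ j, c j • Φ (restrictField _ (a j).1.field)
    rw [map_sub, map_sum]
    simp only [map_smul]
  have e3 : ∀ j, loc p₀ (a j).1.field y = g j y := fun j =>
    (hge j (Metric.ball_subset_ball (hρle.2 j) hy')).symm
  have e4 : loc p₀ A.1.field y = α y := loc_glob hα hyR hyr
  rw [e2, loc_restrictField _ hyR hV, e4]
  congr 1
  exact Finset.sum_congr rfl fun j _ => by rw [loc_restrictField _ hyR hV, e3]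

end LocalModel

/-! ### Vector fields in the chart centred at a point -/

section VectorFields

variable {d : ℕ} {M : Type*} [TopologicalSpace M] [ChartedSpace (RV d) M]

/-- The coordinate expression of a vector field in the chart centred at `p₀`. -/
def vf (p₀ : M) (Y : ∀ x : M, TangentSpace 𝓘(ℝ, RV d) x) (y : RV d) : RV d :=
  VectorField.mpullback 𝓘(ℝ, RV d) 𝓘(ℝ, RV d) (pt p₀) Y y

variable [IsManifold 𝓘(ℝ, RV d) ∞ M] {p₀ : M} {y : RV d}

lemma contMDiffAt_pt (hy : y ∈ chartRange p₀) : ContMDiffAt 𝓘(ℝ, RV d) 𝓘(ℝ, RV d) ∞ (pt p₀) y := by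
  have h1 := (contMDiffOn_extChartAt_symm (I := 𝓘(ℝ, RV d)) (n := ∞) p₀).contMDiffAt
    ((isOpen_extChartAt_target p₀).mem_nhds hy)
  have h2 : ContMDiffAt 𝓘(ℝ, RV d) 𝓘(ℝ, RV d) ∞ (fun y => extChartAt 𝓘(ℝ, RV d) p₀ p₀ + y) y :=
    ContDiffAt.contMDiffAt (by fun_prop)
  exact h1.comp y h2

lemma mfderiv_pt (hy : y ∈ chartRange p₀) : mfderiv 𝓘(ℝ, RV d) 𝓘(ℝ, RV d) (pt p₀) y = ptD p₀ y := by
  have h2 : HasMFDerivAt 𝓘(ℝ, RV d) 𝓘(ℝ, RV d) (fun y => extChartAt 𝓘(ℝ, RV d) p₀ p₀ + y) y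
      (ContinuousLinearMap.id ℝ (RV d)) := ((hasFDerivAt_id y).const_add _).hasMFDerivAt
  exact ((mdifferentiableAt_chart_symm hy).hasMFDerivAt.comp y h2).mfderiv

lemma ptD_comp_chartD (hy : y ∈ chartRange p₀) (v : RV d) : ptD p₀ y (chartD p₀ (pt p₀ y) v) = v := by
  have h2 := chartDsymm_comp (E := RV d) (pt_mem_source hy)
  rw [pt, (extChartAt 𝓘(ℝ, RV d) p₀).right_inv hy] at h2
  exact DFunLike.congr_fun h2 v

lemma chartD_comp_ptD (hy : y ∈ chartRange p₀) (v : RV d) : chartD p₀ (pt p₀ y) (ptD p₀ y v) = v :=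
  DFunLike.congr_fun (chartD_comp_symm (E := RV d) hy) v

/-- The derivative of the inverse of the chart, as an equivalence. -/
def ptEquiv (hy : y ∈ chartRange p₀) : RV d ≃L[ℝ] RV d :=
  ContinuousLinearEquiv.equivOfInverse (ptD p₀ y) (chartD p₀ (pt p₀ y)) (chartD_comp_ptD hy) (ptD_comp_chartD hy)

lemma isInvertible_mfderiv_pt (hy : y ∈ chartRange p₀) :
    (mfderiv 𝓘(ℝ, RV d) 𝓘(ℝ, RV d) (pt p₀) y).IsInvertible := by
  rw [mfderiv_pt hy]; exact ⟨ptEquiv hy, rfl⟩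

lemma ptD_mpullback (hy : y ∈ chartRange p₀) (Y : ∀ x : M, TangentSpace 𝓘(ℝ, RV d) x) :
    ptD p₀ y (vf p₀ Y y) = Y (pt p₀ y) := by
  have h := (isInvertible_mfderiv_pt hy).self_apply_inverse (Y (pt p₀ y))
  have h2 : mfderiv 𝓘(ℝ, RV d) 𝓘(ℝ, RV d) (pt p₀) y (vf p₀ Y y) = Y (pt p₀ y) := h
  rw [mfderiv_pt hy] at h2
  exact h2

lemma contDiffAt_vf {Y : ∀ x : M, TangentSpace 𝓘(ℝ, RV d) x} {U : Opens M} (hY : SmoothVectorFieldOn Y U)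
    (hy : y ∈ chartRange p₀) (hU : pt p₀ y ∈ U) : ContDiffAt ℝ ∞ (vf p₀ Y) y := by
  have : IsManifold 𝓘(ℝ, RV d) 1 M := IsManifold.of_le (n := ∞) (by simp)
  have h := ContMDiffAt.mpullback_vectorField_preimage (m := ∞) (n := ∞)
    (ContMDiffOn.contMDiffAt hY (U.isOpen.mem_nhds hU)) (contMDiffAt_pt hy) (isInvertible_mfderiv_pt hy) (by simp)
  exact contMDiffAt_vectorSpace_iff_contDiffAt.1 h

lemma ptD_lieBracket {Y Z : ∀ x : M, TangentSpace 𝓘(ℝ, RV d) x} {U : Opens M} (hY : SmoothVectorFieldOn Y U)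
    (hZ : SmoothVectorFieldOn Z U) (hy : y ∈ chartRange p₀) (hU : pt p₀ y ∈ U) :
    ptD p₀ y (VectorField.lieBracket ℝ (vf p₀ Y) (vf p₀ Z) y) =
      VectorField.mlieBracket 𝓘(ℝ, RV d) Y Z (pt p₀ y) := by
  have : IsManifold 𝓘(ℝ, RV d) (minSmoothness ℝ 2) M := IsManifold.of_le (n := ∞) (by simp; exact two_le_infty)
  have h := VectorField.mpullback_mlieBracket (n := ∞) (f := pt p₀) (x₀ := y)
    ((ContMDiffOn.contMDiffAt hY (U.isOpen.mem_nhds hU)).mdifferentiableAt (by simp))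
    ((ContMDiffOn.contMDiffAt hZ (U.isOpen.mem_nhds hU)).mdifferentiableAt (by simp))
    (contMDiffAt_pt hy) (by simp; exact two_le_infty)
  have h2 := ptD_mpullback hy (VectorField.mlieBracket 𝓘(ℝ, RV d) Y Z)
  rw [← h2]
  congr 1
  refine Eq.trans ?_ h.symm
  rw [← VectorField.lieBracketWithin_univ, ← VectorField.mlieBracketWithin_univ]
  exact (congrFun VectorField.mlieBracketWithin_eq_lieBracketWithin y).symm

end VectorFields

/-! ### Complex vector fields with given real and imaginary parts -/

section Complexified

variable {d : ℕ}

lemma reV_mkC (v w : RV d) : reV (mkC v w) = v := by ext r; simp [reV, mkC]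

lemma imV_mkC (v w : RV d) : imV (mkC v w) = w := by ext r; simp [imV, mkC]

lemma reV_add (Z W : CV d) : reV (Z + W) = reV Z + reV W := by ext r; simp [reV]

lemma imV_add (Z W : CV d) : imV (Z + W) = imV Z + imV W := by ext r; simp [imV]

lemma reV_smul (c : ℂ) (Z : CV d) : reV (c • Z) = c.re • reV Z - c.im • imV Z := by ext r; simp [reV, imV]

lemma imV_smul (c : ℂ) (Z : CV d) : imV (c • Z) = c.im • reV Z + c.re • imV Z := by
  ext r; simp [reV, imV]; ring

lemma contDiffAt_mkC {A B : RV d → RV d} {y : RV d} (hA : ContDiffAt ℝ ∞ A y) (hB : ContDiffAt ℝ ∞ B y) :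
    ContDiffAt ℝ ∞ (fun z => mkC (A z) (B z)) y := by
  rw [contDiffAt_pi]
  intro r
  have h : ∀ {A : RV d → RV d}, ContDiffAt ℝ ∞ A y → ContDiffAt ℝ ∞ (fun z => ((A z r : ℝ) : ℂ)) y :=
    fun h => Complex.ofRealCLM.contDiff.contDiffAt.comp y
      ((EuclideanSpace.proj r : RV d →L[ℝ] ℝ).contDiff.contDiffAt.comp y h)
  exact (h hA).add (contDiffAt_const.mul (h hB))

lemma dV_mkC {A B : RV d → RV d} {y : RV d} (hA : DifferentiableAt ℝ A y) (hB : DifferentiableAt ℝ B y)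
    (v w : RV d) : dV (mkC v w) (fun z => mkC (A z) (B z)) y =
      mkC (fderiv ℝ A y v - fderiv ℝ B y w) (fderiv ℝ B y v + fderiv ℝ A y w) := by
  funext r
  have h : ∀ {A : RV d → RV d}, DifferentiableAt ℝ A y → HasFDerivAt (fun z => ((A z r : ℝ) : ℂ))
      (Complex.ofRealCLM.comp ((EuclideanSpace.proj r : RV d →L[ℝ] ℝ).comp (fderiv ℝ A y))) y := fun h =>
    Complex.ofRealCLM.hasFDerivAt.comp y ((EuclideanSpace.proj r : RV d →L[ℝ] ℝ).hasFDerivAt.comp y h.hasFDerivAt)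
  have h1 : fderiv ℝ (fun z => mkC (A z) (B z) r) y = _ := ((h hA).add ((h hB).const_mul Complex.I)).fderiv
  rw [dV, dC, h1, cext_mkC]
  simp [mkC]
  ring_nf
  rw [Complex.I_sq]
  ring

/-- The real and imaginary parts are those of `complexLieBracket`, which links the integrability
condition to the model. -/
lemma brC_mkC {A B C D : RV d → RV d} {y : RV d} (hA : DifferentiableAt ℝ A y) (hB : DifferentiableAt ℝ B y)
    (hC : DifferentiableAt ℝ C y) (hD : DifferentiableAt ℝ D y) :
    brC (fun z => mkC (A z) (B z)) (fun z => mkC (C z) (D z)) y =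
      mkC (VectorField.lieBracket ℝ A C y - VectorField.lieBracket ℝ B D y)
        (VectorField.lieBracket ℝ A D y + VectorField.lieBracket ℝ B C y) := by
  rw [brC, dV_mkC hA hB, dV_mkC hC hD]
  funext r
  simp [mkC, VectorField.lieBracket]
  ring

end Complexified

/-! ### The coordinate expression of `T^{0,1}` -/

section ModelT01

variable {n k : ℕ} {M : Type*} [TopologicalSpace M]
  [ChartedSpace (EuclideanSpace ℝ (Fin (2 * n + k))) M] [IsManifold (𝓡 (2 * n + k)) ∞ M]
  (S : CRStructure n k M) {p₀ : M} {y : RV (2 * n + k)}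

/-- A vector of `H` as a vector of the model space. -/
def hVec {x : M} : S.H x →ₗ[ℝ] RV (2 * n + k) := (S.H x).subtype

/-- The vector `Jv` as a vector of the model space. -/
def hJ {x : M} : S.H x →ₗ[ℝ] RV (2 * n + k) := (S.H x).subtype ∘ₗ S.J x

lemma hVec_injective {x : M} : Function.Injective (hVec S (x := x)) := Subtype.val_injective

lemma hVec_J {x : M} (h : S.H x) : hVec S (S.J x h) = hJ S h := rfl

lemma hJ_J {x : M} (h : S.H x) : hJ S (S.J x h) = - hVec S h := by
  rw [← hVec_J, S.J_sq, map_neg]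

/-- The coordinate expression of `T^{0,1}` in the chart centred at `p₀`. -/
def modelT01 (p₀ : M) (y : RV (2 * n + k)) : Submodule ℂ (CV (2 * n + k)) where
  carrier := {Z | ∃ h : S.H (pt p₀ y), hVec S h = ptD p₀ y (reV Z) ∧ hJ S h = ptD p₀ y (imV Z)}
  zero_mem' := ⟨0, by
    have h1 : reV (0 : CV (2 * n + k)) = 0 := by ext; simp [reV]
    have h2 : imV (0 : CV (2 * n + k)) = 0 := by ext; simp [imV]
    rw [h1, h2, map_zero, map_zero, map_zero]; exact ⟨rfl, rfl⟩⟩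
  add_mem' := by
    rintro Z W ⟨h, h1, h2⟩ ⟨h', h1', h2'⟩
    exact ⟨h + h', by rw [map_add, h1, h1', reV_add, map_add], by rw [map_add, h2, h2', imV_add, map_add]⟩
  smul_mem' := by
    rintro c Z ⟨h, h1, h2⟩
    -- As Jh + iJ(Jh) = -i (h + iJh), a scalar acts on T^{0,1} as its conjugate acts on H.
    refine ⟨c.re • h - c.im • S.J _ h, ?_, ?_⟩
    · rw [map_sub, map_smul, map_smul, hVec_J, h1, h2, reV_smul, map_sub, map_smul, map_smul]
    · rw [map_sub, map_smul, map_smul, hJ_J, h1, h2, imV_smul, map_add, map_smul, map_smul, smul_neg,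
        sub_neg_eq_add]
      exact add_comm _ _

lemma mem_modelT01 {v w : RV (2 * n + k)} : mkC v w ∈ modelT01 S p₀ y ↔
    tangentPair (pt p₀ y) (ptD p₀ y v) (ptD p₀ y w) ∈ S.T01 (pt p₀ y) := by
  constructor
  · rintro ⟨h, h1, h2⟩
    rw [reV_mkC] at h1; rw [imV_mkC] at h2
    exact ⟨h, Prod.ext h1 h2⟩
  · rintro ⟨h, hh⟩
    exact ⟨h, by rw [reV_mkC]; exact congrArg Prod.fst hh, by rw [imV_mkC]; exact congrArg Prod.snd hh⟩

/-- The complex vector field `X + iJX` in the chart centred at `p₀`. -/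
def cvf (p₀ : M) (X : ∀ x : M, S.H x) (y : RV (2 * n + k)) : CV (2 * n + k) :=
  mkC (vf p₀ (fun x => (X x : TangentSpace (𝓡 (2 * n + k)) x)) y)
    (vf p₀ (fun x => (S.J x (X x) : TangentSpace (𝓡 (2 * n + k)) x)) y)

lemma cvf_mem (hy : y ∈ chartRange p₀) (X : ∀ x : M, S.H x) : cvf S p₀ X y ∈ modelT01 S p₀ y :=
  ⟨X (pt p₀ y), by rw [cvf, reV_mkC, ptD_mpullback hy]; rfl, by rw [cvf, imV_mkC, ptD_mpullback hy]; rfl⟩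

lemma contDiffAt_cvf {X : ∀ x : M, S.H x} {U : Opens M}
    (hX : SmoothVectorFieldOn (fun x => (X x : TangentSpace (𝓡 (2 * n + k)) x)) U)
    (hy : y ∈ chartRange p₀) (hU : pt p₀ y ∈ U) : ContDiffAt ℝ ∞ (cvf S p₀ X) y :=
  contDiffAt_mkC (contDiffAt_vf hX hy hU) (contDiffAt_vf (S.J_smooth U X hX) hy hU)

/-- Formal integrability, transported by the naturality of the Lie bracket under the inverse chart.
-/
lemma brC_cvf_mem {X Y : ∀ x : M, S.H x} {U : Opens M}
    (hX : SmoothVectorFieldOn (fun x => (X x : TangentSpace (𝓡 (2 * n + k)) x)) U)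
    (hY : SmoothVectorFieldOn (fun x => (Y x : TangentSpace (𝓡 (2 * n + k)) x)) U)
    (hy : y ∈ chartRange p₀) (hU : pt p₀ y ∈ U) : brC (cvf S p₀ X) (cvf S p₀ Y) y ∈ modelT01 S p₀ y := by
  have hJX := S.J_smooth U X hX
  have hJY := S.J_smooth U Y hY
  have dif : ∀ {Z : ∀ x : M, TangentSpace (𝓡 (2 * n + k)) x}, SmoothVectorFieldOn Z U →
      DifferentiableAt ℝ (vf p₀ Z) y := fun h => (contDiffAt_vf h hy hU).differentiableAt (by simp)
  have h1 := brC_mkC (dif hX) (dif hJX) (dif hY) (dif hJY)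
  obtain ⟨v, hv⟩ := S.integrable U X Y hX hY _ hU
  have h2 : brC (cvf S p₀ X) (cvf S p₀ Y) y = _ := h1
  rw [h2, mem_modelT01, map_sub, map_add]
  simp only [ptD_lieBracket hX hY hy hU, ptD_lieBracket hJX hJY hy hU, ptD_lieBracket hX hJY hy hU,
    ptD_lieBracket hJX hY hy hU]
  exact ⟨v, hv.symm⟩

/-- `T^{0,1}` is isomorphic to `H`. -/
def modelT01Equiv (hy : y ∈ chartRange p₀) : modelT01 S p₀ y ≃ₗ[ℝ] S.H (pt p₀ y) :=
  LinearEquiv.symm <| LinearEquiv.ofBijective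
    ({ toFun := fun h => ⟨mkC (chartD p₀ (pt p₀ y) (hVec S h)) (chartD p₀ (pt p₀ y) (hJ S h)), h, by
          rw [reV_mkC, ptD_comp_chartD hy], by rw [imV_mkC, ptD_comp_chartD hy]⟩
       map_add' := fun h h' => Subtype.ext <| by
        funext r
        simp [mkC]; ring
       map_smul' := fun c h => Subtype.ext <| by
        funext r
        simp [mkC]; ring } : S.H (pt p₀ y) →ₗ[ℝ] modelT01 S p₀ y)
    ⟨fun h h' hh => hVec_injective S <| by
        have h1 := congrArg (fun Z => ptD p₀ y (reV Z.1)) hh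
        simpa [reV_mkC, ptD_comp_chartD hy] using h1,
      fun ⟨Z, h, h1, h2⟩ => ⟨h, Subtype.ext <| by
        change mkC _ _ = Z
        rw [h1, h2, chartD_comp_ptD hy, chartD_comp_ptD hy, mkC_reV_imV]⟩⟩

lemma finrank_modelT01 (hy : y ∈ chartRange p₀) (hH : Module.finrank ℝ (S.H (pt p₀ y)) = 2 * n) :
    Module.finrank ℂ (modelT01 S p₀ y) = n := by
  have h1 := (modelT01Equiv S hy).finrank_eq
  rw [hH, finrank_real_of_complex] at h1
  omega

end ModelT01

/-! ### Normalisation of an involutive frame -/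

section Frame

variable {d n : ℕ}

lemma contDiffAt_det {A : RV d → Matrix (Fin n) (Fin n) ℂ} {x : RV d}
    (h : ∀ i j, ContDiffAt ℝ ∞ (fun y => A y i j) x) : ContDiffAt ℝ ∞ (fun y => (A y).det) x := by
  simp only [Matrix.det_apply]
  exact ContDiffAt.sum fun σ _ => ContDiffAt.const_smul _ (contDiffAt_prod fun i _ => h _ _)

lemma contDiffAt_matrix_inv {A : RV d → Matrix (Fin n) (Fin n) ℂ} {x : RV d}
    (h : ∀ i j, ContDiffAt ℝ ∞ (fun y => A y i j) x) (hdet : (A x).det ≠ 0) (i j : Fin n) :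
    ContDiffAt ℝ ∞ (fun y => (A y)⁻¹ i j) x := by
  simp only [Matrix.inv_def, Ring.inverse_eq_inv', Matrix.smul_apply, Matrix.adjugate_apply, smul_eq_mul]
  refine (ContDiffAt.inv (contDiffAt_det h) hdet).mul (contDiffAt_det fun l m => ?_)
  by_cases hl : l = j
  · subst hl; simp only [Matrix.updateRow_self]; exact contDiffAt_const
  · simp only [Matrix.updateRow_ne hl]; exact h l m

lemma dV_sum_fun_smul {V : Fin n → RV d → CV d} {a : Fin n → RV d → ℂ} {x : RV d}
    (hV : ∀ j, DifferentiableAt ℝ (V j) x) (ha : ∀ j, DifferentiableAt ℝ (a j) x) (Z : CV d) :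
    dV Z (fun y => ∑ l, a l y • V l y) x = ∑ l, (dC Z (a l) x • V l x + a l x • dV Z (V l) x) := by
  funext r
  have hc : ∀ l, DifferentiableAt ℝ (fun y => V l y r) x := fun l => differentiableAt_pi.1 (hV l) r
  simp only [dV, Finset.sum_apply, Pi.smul_apply, smul_eq_mul, Pi.add_apply]
  rw [dC_sum (f := fun l y => a l y * V l y r) _ _ fun l _ => (ha l).mul (hc l)]
  refine Finset.sum_congr rfl fun l _ => ?_
  rw [dC_mul Z (ha l) (hc l)]
  ring

/-- Combinations of the fields of an involutive family with smooth coefficients. -/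
lemma brC_sum_fun_smul_mem {V : Fin n → RV d → CV d} {a c : Fin n → RV d → ℂ} {x : RV d}
    (hV : ∀ j, DifferentiableAt ℝ (V j) x) (ha : ∀ j, DifferentiableAt ℝ (a j) x)
    (hc : ∀ j, DifferentiableAt ℝ (c j) x) {T : Submodule ℂ (CV d)} (hT : ∀ j, V j x ∈ T)
    (hbr : ∀ i j, brC (V i) (V j) x ∈ T) :
    brC (fun y => ∑ l, a l y • V l y) (fun y => ∑ l, c l y • V l y) x ∈ T := by
  have h1 : brC (fun y => ∑ l, a l y • V l y) (fun y => ∑ l, c l y • V l y) x =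
      ((∑ l, dC (∑ l, a l x • V l x) (c l) x • V l x) - ∑ l, dC (∑ l, c l x • V l x) (a l) x • V l x) +
        ∑ l, ∑ m, (c l x * a m x) • brC (V m) (V l) x := by
    rw [brC, dV_sum_fun_smul hV ha, dV_sum_fun_smul hV hc]
    simp_rw [dV_vec_sum_smul, Finset.sum_add_distrib, brC, smul_sub, Finset.sum_sub_distrib, Finset.smul_sum, smul_smul]
    have h2 : ∑ l, ∑ m, (a l x * c m x) • dV (V m x) (V l) x =
        ∑ l, ∑ m, (c l x * a m x) • dV (V l x) (V m) x := by
      rw [Finset.sum_comm]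
      exact Finset.sum_congr rfl fun l _ => Finset.sum_congr rfl fun m _ => by rw [mul_comm]
    rw [h2]; abel
  rw [h1]
  refine add_mem (sub_mem (Submodule.sum_mem _ fun l _ => Submodule.smul_mem _ _ (hT l))
    (Submodule.sum_mem _ fun l _ => Submodule.smul_mem _ _ (hT l)))
    (Submodule.sum_mem _ fun l _ => Submodule.sum_mem _ fun m _ => Submodule.smul_mem _ _ (hbr m l))

lemma brC_congr {V W V' W' : RV d → CV d} {x : RV d} (h : V =ᶠ[𝓝 x] V') (h' : W =ᶠ[𝓝 x] W') :
    brC V W x = brC V' W' x := by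
  funext r
  have e : ∀ {A B : RV d → CV d}, A =ᶠ[𝓝 x] B → (fun y => A y r) =ᶠ[𝓝 x] fun y => B y r := fun h =>
    h.mono fun y hy => congrFun hy r
  simp only [brC, dV, Pi.sub_apply]
  rw [dC_congr _ (e h), dC_congr _ (e h'), h.eq_of_nhds, h'.eq_of_nhds]

/-- A frame dual to constant covectors of an involutive family of spaces commutes. -/
lemma brC_eq_zero_of_dual {L : Fin n → RV d → CV d} {y : Fin n → RV d →L[ℝ] ℂ}
    (hL : ∀ j, ContDiff ℝ ∞ (L j)) (hy : ∀ i j x, cext (y i) (L j x) = if i = j then 1 else 0)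
    {x : RV d} {i j : Fin n} (hbr : brC (L i) (L j) x ∈ T01 L x) : brC (L i) (L j) x = 0 := by
  obtain ⟨g, hg⟩ := (Submodule.mem_span_range_iff_exists_fun ℂ).1 hbr
  have h0 : ∀ l, cext (y l) (brC (L i) (L j) x) = 0 := by
    intro l
    rw [brC, map_sub, ← LocalCR.dC_cext _ ((hL j).differentiable (by simp) x), ← LocalCR.dC_cext _ ((hL i).differentiable (by simp) x)]
    simp_rw [hy]
    rw [dC_const, dC_const, sub_zero]
  have hg0 : ∀ l, g l = 0 := fun l => by
    have := h0 l
    rw [← hg, map_sum] at this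
    simpa [map_smul, hy] using this
  rw [← hg]
  simp [hg0]

/-- Duality forces linear independence, and the dimensions agree. -/
lemma span_eq_of_dual {b : Fin n → CV d} {y : Fin n → RV d →L[ℝ] ℂ}
    (hy : ∀ i j, cext (y i) (b j) = if i = j then 1 else 0) {T : Submodule ℂ (CV d)} (hb : ∀ j, b j ∈ T)
    (hT : Module.finrank ℂ T = n) : Submodule.span ℂ (range b) = T := by
  have hli : LinearIndependent ℂ b := by
    rw [Fintype.linearIndependent_iff]
    intro g hg i
    have := congrArg (cext (y i)) hg
    simpa [map_sum, map_smul, hy] using this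
  refine Submodule.eq_of_le_of_finrank_eq (Submodule.span_le.2 (range_subset_iff.2 hb)) ?_
  rw [finrank_span_eq_card hli, hT, Fintype.card_fin]

/-- Normalising the pairings with constant covectors makes them constant, so brackets pair to zero
with these covectors. By involutivity the brackets lie in the span, where this forces them to
vanish: the normalised frame commutes. -/
theorem exists_normal_frame {T : RV d → Submodule ℂ (CV d)} {V : Fin n → RV d → CV d}
    {y : Fin n → RV d →L[ℝ] ℂ} {ρ : ℝ} (hρ : 0 < ρ)
    (hV : ∀ j, ∀ x ∈ Metric.ball (0 : RV d) ρ, ContDiffAt ℝ ∞ (V j) x)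
    (hVT : ∀ j, ∀ x ∈ Metric.ball (0 : RV d) ρ, V j x ∈ T x)
    (hbr : ∀ i j, ∀ x ∈ Metric.ball (0 : RV d) ρ, brC (V i) (V j) x ∈ T x)
    (hT : ∀ x ∈ Metric.ball (0 : RV d) ρ, Module.finrank ℂ (T x) = n)
    (hy : ∀ i j, cext (y i) (V j 0) = if i = j then 1 else 0) :
    ∃ L : Fin n → RV d → CV d, (∀ j, ContDiff ℝ ∞ (L j)) ∧ (∀ j, L j 0 = V j 0) ∧
      (∀ i j x, cext (y i) (L j x) = if i = j then 1 else 0) ∧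
      ∃ R > 0, R ≤ ρ ∧ ∀ x ∈ Metric.ball (0 : RV d) R, T01 L x = T x ∧ ∀ i j, brC (L i) (L j) x = 0 := by
  let A : RV d → Matrix (Fin n) (Fin n) ℂ := fun x => Matrix.of fun i j => cext (y i) (V j x)
  have hA : ∀ x ∈ Metric.ball (0 : RV d) ρ, ∀ i j, ContDiffAt ℝ ∞ (fun z => A z i j) x := fun x hx i j =>
    ((cext (y i)).restrictScalars ℝ).contDiff.contDiffAt.comp x (hV j x hx)
  have hA0 : A 0 = 1 := by
    ext i j; simp [A, hy, Matrix.one_apply]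
  have h0 := Metric.mem_ball_self (x := (0 : RV d)) hρ
  have hdet : ∀ᶠ x in 𝓝 (0 : RV d), (A x).det ≠ 0 :=
    (contDiffAt_det (hA 0 h0)).continuousAt.eventually_ne (by rw [hA0]; simp)
  obtain ⟨ρ₁, hρ₁, hsub⟩ := Metric.eventually_nhds_iff_ball.1 hdet
  set ρ₂ := min ρ ρ₁
  have hρ₂ : 0 < ρ₂ := lt_min hρ hρ₁
  have b1 : Metric.ball (0 : RV d) ρ₂ ⊆ Metric.ball 0 ρ := Metric.ball_subset_ball (min_le_left _ _)
  have b2 : Metric.ball (0 : RV d) ρ₂ ⊆ Metric.ball 0 ρ₁ := Metric.ball_subset_ball (min_le_right _ _)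
  have hN : ∀ x ∈ Metric.ball (0 : RV d) ρ₂, ∀ i j, ContDiffAt ℝ ∞ (fun z => (A z)⁻¹ i j) x := fun x hx i j =>
    contDiffAt_matrix_inv (hA x (b1 hx)) (hsub x (b2 hx)) i j
  let W : Fin n → RV d → CV d := fun j x => ∑ l, (A x)⁻¹ l j • V l x
  have hW : ∀ j, ∀ x ∈ Metric.ball (0 : RV d) ρ₂, ContDiffAt ℝ ∞ (W j) x := fun j x hx =>
    ContDiffAt.sum fun l _ => (hN x hx l j).smul (hV l x (b1 hx))
  have hW0 : ∀ j, W j 0 = V j 0 := fun j => by simp [W, hA0, Matrix.one_apply]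
  have hWT : ∀ j, ∀ x ∈ Metric.ball (0 : RV d) ρ₂, W j x ∈ T x := fun j x hx =>
    Submodule.sum_mem _ fun l _ => Submodule.smul_mem _ _ (hVT l x (b1 hx))
  have hWy : ∀ i j, ∀ x ∈ Metric.ball (0 : RV d) ρ₂, cext (y i) (W j x) = if i = j then 1 else 0 := by
    intro i j x hx
    have h1 : (A x * (A x)⁻¹) i j = (1 : Matrix (Fin n) (Fin n) ℂ) i j := by
      rw [Matrix.mul_nonsing_inv _ (isUnit_iff_ne_zero.2 (hsub x (b2 hx)))]
    rw [Matrix.mul_apply, Matrix.one_apply] at h1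
    rw [← h1, map_sum]
    exact Finset.sum_congr rfl fun l _ => by rw [map_smul, smul_eq_mul, mul_comm]; rfl
  have hex := fun j => exists_contDiff_eqOn_ball hρ₂ (f := fun x => W j x - V j 0)
    (fun x hx => ((hW j x hx).sub contDiffAt_const).contDiffWithinAt)
  choose g hg hge _ using hex
  -- The projection along the values at the origin makes duality hold everywhere, not only near the
  -- origin; on the small ball it changes nothing.
  let L : Fin n → RV d → CV d := fun j x => V j 0 + (g j x - ∑ i, cext (y i) (g j x) • V i 0)
  have hLs : ∀ j, ContDiff ℝ ∞ (L j) := fun j => contDiff_const.add ((hg j).sub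
    (ContDiff.sum fun i _ => (((cext (y i)).restrictScalars ℝ).contDiff.comp (hg j)).smul contDiff_const))
  have hLy : ∀ i j x, cext (y i) (L j x) = if i = j then 1 else 0 := fun i j x => by
    simp only [L, map_add, map_sub, map_sum, map_smul, hy, smul_eq_mul]
    simp
  have b3 : Metric.ball (0 : RV d) (ρ₂ / 2) ⊆ Metric.ball 0 ρ₂ := Metric.ball_subset_ball (by linarith)
  have hLW : ∀ j, EqOn (L j) (W j) (Metric.ball 0 (ρ₂ / 2)) := fun j x hx => by
    have h1 : ∀ i, cext (y i) (W j x - V j 0) = 0 := fun i => by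
      rw [map_sub, hWy i j x (b3 hx), hy, sub_self]
    simp only [L]
    rw [hge j hx]
    simp [h1]
  refine ⟨L, hLs, fun j => ?_, hLy, ρ₂ / 2, by positivity, by linarith [min_le_left ρ ρ₁], fun x hx => ?_⟩
  · rw [hLW j (Metric.mem_ball_self (by positivity)), hW0]
  have hTx : T01 L x = T x := span_eq_of_dual (fun i j => hLy i j x)
    (fun j => by rw [hLW j hx]; exact hWT j x (b3 hx)) (hT x (b1 (b3 hx)))
  refine ⟨hTx, fun i j => brC_eq_zero_of_dual hLs hLy ?_⟩
  have he : ∀ j, L j =ᶠ[𝓝 x] W j := fun j => (hLW j).eventuallyEq_of_mem (Metric.isOpen_ball.mem_nhds hx)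
  rw [hTx, brC_congr (he i) (he j)]
  exact brC_sum_fun_smul_mem (fun l => (hV l x (b1 (b3 hx))).differentiableAt (by simp))
    (fun l => (hN x (b3 hx) l i).differentiableAt (by simp)) (fun l => (hN x (b3 hx) l j).differentiableAt (by simp))
    (fun l => hVT l x (b1 (b3 hx))) (fun l m => hbr l m x (b1 (b3 hx)))

end Frame

/-! ### Complex coordinates from a real basis -/

section CoordsOfBasis

variable {d n k : ℕ}

/-- The complex coordinates defined by a real basis `e_j, f_j, t_i`, where `b_j = e_j + i f_j`. -/
def coordsOfBasis (B : Module.Basis (Idx n k) ℝ (RV d)) : Coords d (Idx n k) where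
  y := fun
    | .inl j => (2⁻¹ : ℂ) • (Complex.ofRealCLM.comp (B.coord (.inl j)).toContinuousLinearMap -
        Complex.I • Complex.ofRealCLM.comp (B.coord (.inr (.inl j))).toContinuousLinearMap)
    | .inr (.inl j) => (2⁻¹ : ℂ) • (Complex.ofRealCLM.comp (B.coord (.inl j)).toContinuousLinearMap +
        Complex.I • Complex.ofRealCLM.comp (B.coord (.inr (.inl j))).toContinuousLinearMap)
    | .inr (.inr i) => Complex.ofRealCLM.comp (B.coord (.inr (.inr i))).toContinuousLinearMap
  b := fun
    | .inl j => mkC (B (.inl j)) (B (.inr (.inl j)))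
    | .inr (.inl j) => mkC (B (.inl j)) (- B (.inr (.inl j)))
    | .inr (.inr i) => mkC (B (.inr (.inr i))) 0
  dual_self := by
    rintro (j | j | i) <;> simp only [cext_mkC] <;> simp [← mul_assoc, mul_comm] <;> ring_nf <;>
      simp [Complex.I_sq] <;> norm_num
  dual_ne := by
    rintro (j | j | i) (j' | j' | i') h <;> simp only [cext_mkC] <;> simp [Finsupp.single_apply] <;>
      first
        | (split_ifs <;> simp_all <;> linear_combination (1 / 2 : ℂ) * Complex.I_sq)
        | exact fun h' => h (by rw [h'])
  expand := by
    intro l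
    refine ContinuousLinearMap.coe_injective (B.ext ?_)
    rintro (j | j | i)
    all_goals
      simp only [Fintype.sum_sum_type, cext_mkC, ContinuousLinearMap.coe_coe, ContinuousLinearMap.add_apply,
        sum_smul_apply]
      simp [Finsupp.single_apply, apply_ite Complex.ofReal, mul_ite]
    · ring
    · linear_combination (l (B (.inr (.inl j)))) * Complex.I_sq

end CoordsOfBasis

lemma exists_basis_extending {d n k : ℕ} (hd : d = 2 * n + k) {e f : Fin n → RV d}
    (h : LinearIndependent ℝ (Sum.elim e f)) : ∃ B : Module.Basis (Idx n k) ℝ (RV d),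
      (∀ j, B (.inl j) = e j) ∧ ∀ j, B (.inr (.inl j)) = f j := by
  obtain ⟨C, hC⟩ := exists_isCompl (Submodule.span ℝ (range (Sum.elim e f)))
  have h1 := Submodule.finrank_add_eq_of_isCompl hC
  rw [finrank_span_eq_card h, finrank_euclideanSpace_fin] at h1
  have h2 : Module.finrank ℝ C = k := by simp at h1; omega
  let B := (((Module.Basis.span h).prod (Module.finBasisOfFinrankEq ℝ C h2)).map
    (Submodule.prodEquivOfIsCompl _ _ hC)).reindex (Equiv.sumAssoc (Fin n) (Fin n) (Fin k))
  refine ⟨B, fun j => ?_, fun j => ?_⟩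
  · simp [B, Module.Basis.span_apply]
  · simp [B, Module.Basis.span_apply]

/-! ### Diagonalisation of the Levi form -/

section Diagonal

variable {n k : ℕ} {M : Type*} [TopologicalSpace M]
  [ChartedSpace (EuclideanSpace ℝ (Fin (2 * n + k))) M] [IsManifold (𝓡 (2 * n + k)) ∞ M]
  (S : CRStructure n k M)

/-- The complex structure of `H x`. -/
def cmul (x : M) : ℂ →ₐ[ℝ] Module.End ℝ (S.H x) :=
  Complex.liftAux (S.J x) (LinearMap.ext fun v => S.J_sq x v)

lemma cmul_apply {x : M} (z : ℂ) (v : S.H x) : cmul S x z v = z.re • v + z.im • S.J x v := by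
  simp [cmul, Complex.liftAux_apply]

lemma sum_cmul_mulVec {x : M} (e : Fin n → S.H x) (U : Matrix (Fin n) (Fin n) ℂ) (c : Fin n → ℂ) :
    ∑ j, cmul S x (c j) (∑ i, cmul S x (U i j) (e i)) = ∑ i, cmul S x (U.mulVec c i) (e i) := by
  simp_rw [map_sum, ← Module.End.mul_apply, ← map_mul]
  rw [Finset.sum_comm]
  refine Finset.sum_congr rfl fun i _ => ?_
  rw [Matrix.mulVec, dotProduct, map_sum, LinearMap.sum_apply]
  exact Finset.sum_congr rfl fun j _ => by rw [mul_comm (c j)]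

lemma linearIndependent_iff_cmul {x : M} (e : Fin n → S.H x) :
    LinearIndependent ℝ (Sum.elim e fun j => S.J x (e j)) ↔
      ∀ c : Fin n → ℂ, ∑ j, cmul S x (c j) (e j) = 0 → c = 0 := by
  rw [Fintype.linearIndependent_iff]
  simp only [Fintype.sum_sum_type, Sum.elim_inl, Sum.elim_inr, cmul_apply]
  constructor
  · intro h c hc
    have := h (Sum.elim (fun j => (c j).re) fun j => (c j).im) (by
      rw [← hc, Finset.sum_add_distrib]; rfl)
    funext j
    exact Complex.ext (this (.inl j)) (this (.inr j))
  · intro h g hg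
    have := h (fun j => ⟨g (.inl j), g (.inr j)⟩) (by rw [← hg, Finset.sum_add_distrib])
    rintro (j | j)
    · exact congrArg Complex.re (congrFun this j)
    · exact congrArg Complex.im (congrFun this j)

lemma dotProduct_diagonal (D : Fin n → ℝ) (c : Fin n → ℂ) :
    dotProduct (star c) ((Matrix.diagonal (RCLike.ofReal ∘ D : Fin n → ℂ)).mulVec c) =
      ((∑ j, D j * ‖c j‖ ^ 2 : ℝ) : ℂ) := by
  rw [dotProduct]
  push_cast
  refine Finset.sum_congr rfl fun j _ => ?_
  rw [Matrix.mulVec_diagonal, Pi.star_apply, Complex.star_def, ← Complex.conj_mul']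
  change _ * ((D j : ℂ) * _) = _
  ring

/-- The Levi form is diagonal in a suitable basis, with `a` negative and `b` positive coefficients. -/
def DiagonalLevi (x : M) (ξ : TangentSpace (𝓡 (2 * n + k)) x →L[ℝ] ℝ) (a b : ℕ) : Prop :=
  ∃ (e : Fin n → S.H x) (lam : Fin n → ℝ), LinearIndependent ℝ (Sum.elim e fun j => S.J x (e j)) ∧
    (∀ c : Fin n → ℂ, S.leviForm x ξ (∑ j, cmul S x (c j) (e j)) = ∑ j, lam j * ‖c j‖ ^ 2) ∧
    (Finset.univ.filter fun j => lam j < 0).card = a ∧ (Finset.univ.filter fun j => 0 < lam j).card = b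

variable {S} {x : M} {ξ : TangentSpace (𝓡 (2 * n + k)) x →L[ℝ] ℝ} {a b : ℕ}

/-- The source of the statements in degree n - q. -/
lemma DiagonalLevi.neg (h : DiagonalLevi S x ξ a b) : DiagonalLevi S x (-ξ) b a := by
  obtain ⟨e, lam, hli, hform, ha, hb⟩ := h
  refine ⟨e, fun j => -lam j, hli, fun c => ?_, by simpa using hb, by simpa using ha⟩
  have h1 : ∀ v, S.leviForm x (-ξ) v = -S.leviForm x ξ v := fun _ => rfl
  rw [h1, hform, ← Finset.sum_neg_distrib]
  exact Finset.sum_congr rfl fun j _ => (neg_mul _ _).symm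

/-- The spectral theorem: the basis is changed by the unitary matrix of eigenvectors, acting through
the complex structure `J`. -/
lemma diagonalLevi_of_leviSignature (h : S.LeviSignature x ξ a b) : DiagonalLevi S x ξ a b := by
  obtain ⟨e, A, hA, hli, hform, ha, hb⟩ := h
  let U : Matrix (Fin n) (Fin n) ℂ := hA.eigenvectorUnitary
  have hU : star U * U = 1 := Unitary.coe_star_mul_self hA.eigenvectorUnitary
  have hD : star U * A * U = Matrix.diagonal (RCLike.ofReal ∘ hA.eigenvalues) := by
    have := hA.conjStarAlgAut_star_eigenvectorUnitary
    rwa [Unitary.conjStarAlgAut_star_apply] at this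
  refine ⟨fun j => ∑ i, cmul S x (U i j) (e i), hA.eigenvalues, ?_, fun c => ?_, ha, hb⟩
  · rw [linearIndependent_iff_cmul] at hli ⊢
    intro c hc
    rw [sum_cmul_mulVec] at hc
    have h1 := hli _ hc
    have h2 : (star U).mulVec (U.mulVec c) = 0 := by rw [h1, Matrix.mulVec_zero]
    rwa [Matrix.mulVec_mulVec, hU, Matrix.one_mulVec] at h2
  · rw [sum_cmul_mulVec]
    have h1 := hform (U.mulVec c)
    simp_rw [← cmul_apply] at h1
    rw [← Complex.ofReal_inj, h1, ← dotProduct_diagonal, ← hD, Matrix.star_mulVec,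
      ← Matrix.dotProduct_mulVec, Matrix.mulVec_mulVec, Matrix.mulVec_mulVec]
    rfl

end Diagonal

/-! ### Construction of the local model -/

section Construction

variable {n k : ℕ} {M : Type*} [TopologicalSpace M]
  [ChartedSpace (EuclideanSpace ℝ (Fin (2 * n + k))) M] [IsManifold (𝓡 (2 * n + k)) ∞ M]
  (S : CRStructure n k M) (p₀ : M)

omit [IsManifold (𝓡 (2 * n + k)) ∞ M] in
lemma zero_mem_chartRange : (0 : RV (2 * n + k)) ∈ chartRange p₀ := by
  rw [chartRange, mem_setOf_eq, add_zero]; exact mem_extChartAt_target p₀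

omit [IsManifold (𝓡 (2 * n + k)) ∞ M] in
lemma eventually_pt_mem {U : Opens M} (hU : p₀ ∈ U) :
    ∀ᶠ y : RV (2 * n + k) in 𝓝 0, y ∈ chartRange p₀ ∧ pt p₀ y ∈ U := by
  obtain ⟨r, hr, h⟩ := exists_ball_chartDomain (d := 2 * n + k) p₀ ⟨U, hU⟩
  exact mem_of_superset (Metric.ball_mem_nhds 0 hr) h

/-- The complex vector `v + iJv` in the chart centred at `p₀`. -/
def hC : S.H p₀ →ₗ[ℝ] CV (2 * n + k) where
  toFun h := mkC (chartD p₀ p₀ (hVec S h)) (chartD p₀ p₀ (hJ S h))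
  map_add' h h' := by funext r; simp [mkC]; ring
  map_smul' c h := by funext r; simp [mkC]; ring

lemma hC_apply (h : S.H p₀) : hC S p₀ h = mkC (chartD p₀ p₀ (hVec S h)) (chartD p₀ p₀ (hJ S h)) := rfl

/-- The map `v ↦ v + iJv` is antilinear, because it sends `Jv` to `-i (v + iJv)`. -/
lemma hC_cmul (z : ℂ) (h : S.H p₀) : hC S p₀ (cmul S p₀ z h) = conj z • hC S p₀ h := by
  rw [cmul_apply, map_add, map_smul, map_smul, hC_apply, hC_apply, hVec_J, hJ_J]
  funext r
  simp only [mkC, Pi.add_apply, Pi.smul_apply, map_neg, PiLp.neg_apply, Complex.real_smul, smul_eq_mul,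
    Complex.ofReal_neg]
  have h1 : conj z = (z.re : ℂ) - z.im * Complex.I := by
    apply Complex.ext <;> simp
  rw [h1]
  linear_combination ((z.im : ℂ) * (chartD p₀ p₀ (hJ S h) r : ℂ)) * Complex.I_sq

lemma cvf_zero (X : ∀ x : M, S.H x) : cvf S p₀ X 0 = hC S p₀ (X p₀) := by
  have h1 : ∀ Y : ∀ x : M, TangentSpace (𝓡 (2 * n + k)) x,
      vf p₀ Y 0 = chartD (E := RV (2 * n + k)) p₀ (pt p₀ (0 : RV (2 * n + k))) (Y (pt p₀ (0 : RV (2 * n + k)))) := fun Y =>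
    (chartD_comp_ptD (zero_mem_chartRange p₀) _).symm.trans
      (congrArg (chartD (E := RV (2 * n + k)) p₀ (pt p₀ (0 : RV (2 * n + k)))) (ptD_mpullback (zero_mem_chartRange p₀) Y))
  rw [cvf, h1, h1]
  exact congrArg (fun x => mkC (chartD p₀ x (hVec S (X x))) (chartD p₀ x (hJ S (X x)))) (pt_zero p₀)

lemma chartD_self_injective : Function.Injective (chartD (E := RV (2 * n + k)) p₀ p₀) := fun v w h => by
  have h1 := chartDsymm_comp (E := RV (2 * n + k)) (mem_extChartAt_source (I := 𝓘(ℝ, RV (2 * n + k))) p₀)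
  have h2 : ∀ v, chartDsymm p₀ (extChartAt 𝓘(ℝ, RV (2 * n + k)) p₀ p₀) (chartD p₀ p₀ v) = v := fun v =>
    DFunLike.congr_fun h1 v
  rw [← h2 v, h, h2 w]

/-- A covector at `p₀` in the chart centred at `p₀`. -/
def covec (ξ : TangentSpace (𝓡 (2 * n + k)) p₀ →L[ℝ] ℝ) : RV (2 * n + k) →L[ℝ] ℝ :=
  ContinuousLinearMap.comp (show RV (2 * n + k) →L[ℝ] ℝ from ξ) (ptD p₀ 0)

lemma covec_chartD (ξ : TangentSpace (𝓡 (2 * n + k)) p₀ →L[ℝ] ℝ) (v : RV (2 * n + k)) :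
    covec p₀ ξ (chartD p₀ p₀ v) = ξ v := by
  have h := ptD_comp_chartD (zero_mem_chartRange p₀) v
  rw [pt_zero] at h
  exact congrArg (show RV (2 * n + k) →L[ℝ] ℝ from ξ) h

variable {p₀}

lemma cext_covec_hC {ξ : TangentSpace (𝓡 (2 * n + k)) p₀ →L[ℝ] ℝ} (hξ : ξ ∈ S.conormal p₀) (h : S.H p₀) :
    cext (Complex.ofRealCLM.comp (covec p₀ ξ)) (hC S p₀ h) = 0 := by
  rw [hC_apply, cext_mkC]
  have h1 : covec p₀ ξ (chartD p₀ p₀ (hVec S h)) = 0 := (covec_chartD p₀ ξ _).trans (hξ _ h.2)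
  have h2 : covec p₀ ξ (chartD p₀ p₀ (hJ S h)) = 0 := (covec_chartD p₀ ξ _).trans (hξ _ (S.J p₀ h).2)
  simp [h1, h2]

lemma mkC_neg_eq_conj {d : ℕ} (v w : RV d) : mkC v (-w) = fun r => conj (mkC v w r) := by
  funext r; simp [mkC]

/-- The Levi form in terms of derivatives of the coordinate expression of `X + iJX`. -/
lemma leviForm_eq (ξ : TangentSpace (𝓡 (2 * n + k)) p₀ →L[ℝ] ℝ) (v : S.H p₀) :
    S.leviForm p₀ ξ v = -(cext (Complex.ofRealCLM.comp (covec p₀ ξ))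
      (dV (fun r => conj (hC S p₀ v r)) (cvf S p₀ (S.extension p₀ v)) 0)).im := by
  obtain ⟨hv, U, hU, hX⟩ := (S.exists_extension p₀ v).choose_spec
  have hX : SmoothVectorFieldOn (fun y => (S.extension p₀ v y : TangentSpace (𝓡 (2 * n + k)) y)) U := hX
  have hv' : S.extension p₀ v p₀ = v := hv
  have hJX := S.J_smooth U _ hX
  have hUp : pt p₀ (0 : RV (2 * n + k)) ∈ U := by rw [pt_zero]; exact hU
  have h0 := zero_mem_chartRange (n := n) (k := k) p₀
  have dA := (contDiffAt_vf hX h0 hUp).differentiableAt (n := ∞) (by simp)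
  have dB := (contDiffAt_vf hJX h0 hUp).differentiableAt (n := ∞) (by simp)
  have h1 := ptD_lieBracket hJX hX h0 hUp
  set A := vf p₀ (fun x => (S.extension p₀ v x : TangentSpace (𝓡 (2 * n + k)) x)) with hA
  set B := vf p₀ (fun x => (S.J x (S.extension p₀ v x) : TangentSpace (𝓡 (2 * n + k)) x)) with hB
  have h2 : S.leviForm p₀ ξ v = covec p₀ ξ (VectorField.lieBracket ℝ B A 0) := by
    refine Eq.trans ?_ (congrArg (show RV (2 * n + k) →L[ℝ] ℝ from ξ) h1).symm
    exact congrArg (fun x => (show RV (2 * n + k) →L[ℝ] ℝ from ξ) (VectorField.mlieBracket (𝓡 (2 * n + k))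
      (fun y => (S.J y (S.extension p₀ v y) : TangentSpace (𝓡 (2 * n + k)) y))
      (fun y => (S.extension p₀ v y : TangentSpace (𝓡 (2 * n + k)) y)) x)) (pt_zero p₀).symm
  have h3 : (fun r => conj (hC S p₀ v r)) = mkC (A 0) (-B 0) := by
    rw [mkC_neg_eq_conj, ← hv', ← cvf_zero]; rfl
  have h4 : dV (mkC (A 0) (-B 0)) (cvf S p₀ (S.extension p₀ v)) 0 = _ := dV_mkC dA dB _ _
  rw [h2, h3, h4, cext_mkC, VectorField.lieBracket]
  simp
  exact sub_eq_add_neg _ _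

variable (p₀) in
/-- There is a local model of the CR structure near `p₀` in which the Levi form is diagonal. -/
theorem exists_localModel {ξ : TangentSpace (𝓡 (2 * n + k)) p₀ →L[ℝ] ℝ} (hξ : ξ ∈ S.conormal p₀) {q : ℕ}
    (hq : q ≤ n) (hLevi : DiagonalLevi S p₀ ξ q (n - q)) :
    ∃ X : LocalCR (2 * n + k) n k, IsLocalModel S p₀ X ∧ X.posᶜ.card = q := by
  obtain ⟨e, lam, hli, hform, hneg, hpos⟩ := hLevi
  choose Ξ hΞe U hU hΞ using fun j => S.exists_extension p₀ (e j)
  obtain ⟨U₀, hU₀, F, hF, hFb⟩ := S.exists_frame p₀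
  have hli' : LinearIndependent ℝ (Sum.elim (fun j => chartD p₀ p₀ (hVec S (e j)))
      fun j => chartD p₀ p₀ (hJ S (e j))) := by
    have h1 := hli.map' ((chartD (E := RV (2 * n + k)) p₀ p₀).toLinearMap ∘ₗ hVec S)
      (LinearMap.ker_eq_bot.2 ((chartD_self_injective p₀).comp (hVec_injective S)))
    refine Eq.subst (motive := fun f => LinearIndependent ℝ f) (funext fun i => ?_) h1
    rcases i with j | j <;> rfl
  obtain ⟨B, hBe, hBf⟩ := exists_basis_extending (k := k) rfl hli'
  let K := coordsOfBasis B
  have hKb : ∀ j, K.b (.inl j) = hC S p₀ (e j) := fun j => by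
    rw [hC_apply, ← hBe, ← hBf]; rfl
  have hKb' : ∀ j, K.b (.inr (.inl j)) = fun r => conj (hC S p₀ (e j) r) := fun j => by
    rw [hC_apply, ← hBe, ← hBf, ← mkC_neg_eq_conj]; rfl
  have hV0 : ∀ j, cvf S p₀ (Ξ j) 0 = hC S p₀ (e j) := fun j => by rw [cvf_zero, hΞe]
  have hev : ∀ᶠ y : RV (2 * n + k) in 𝓝 0, (y ∈ chartRange p₀ ∧ pt p₀ y ∈ U₀) ∧
      ∀ j, y ∈ chartRange p₀ ∧ pt p₀ y ∈ U j :=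
    (eventually_pt_mem p₀ hU₀).and (eventually_all.2 fun j => eventually_pt_mem p₀ (hU j))
  obtain ⟨ρ, hρ, hball⟩ := Metric.eventually_nhds_iff_ball.1 hev
  have hdual : ∀ i j, cext (K.y (.inl i)) (cvf S p₀ (Ξ j) 0) = if i = j then 1 else 0 := fun i j => by
    rw [hV0, ← hKb]
    split_ifs with h
    · rw [h]; exact K.dual_self _
    · exact K.dual_ne _ _ fun h' => h (Sum.inl.inj h')
  obtain ⟨L, hLs, hL0, hLy, R, hR, hRρ, hRT⟩ := exists_normal_frame (T := modelT01 S p₀)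
    (V := fun j => cvf S p₀ (Ξ j)) (y := fun i => K.y (.inl i)) hρ
    (fun j x hx => contDiffAt_cvf S (hΞ j) (hball x hx).1.1 ((hball x hx).2 j).2)
    (fun j x hx => cvf_mem S (hball x hx).1.1 _)
    (fun i j x hx => brC_cvf_mem S (U := U i ⊓ U j) (ContMDiffOn.mono (hΞ i) inter_subset_left)
      (ContMDiffOn.mono (hΞ j) inter_subset_right) (hball x hx).1.1 ⟨((hball x hx).2 i).2, ((hball x hx).2 j).2⟩)
    (fun x hx => finrank_modelT01 S (hball x hx).1.1 (by
      have h := hFb _ (hball x hx).1.2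
      rw [Module.finrank_eq_card_basis (Module.Basis.mk h.1 h.2.ge), Fintype.card_fin]))
    hdual
  have hL0' : ∀ j, L j 0 = hC S p₀ (e j) := fun j => (hL0 j).trans (hV0 j)
  have hRm : Metric.ball (0 : RV (2 * n + k)) R ⊆ chartRange p₀ := fun y hy =>
    (hball y (Metric.ball_subset_ball hRρ hy)).1.1
  -- There are q negative and n - q positive coefficients, n in all, so none is zero.
  have hne : ∀ j, lam j ≠ 0 := by
    intro j hj
    have hd : Disjoint (Finset.univ.filter fun j => lam j < 0) (Finset.univ.filter fun j => 0 < lam j) :=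
      Finset.disjoint_filter.2 fun i _ h h' => lt_asymm h h'
    have h1 := Finset.card_union_of_disjoint hd
    rw [hneg, hpos, Nat.add_sub_cancel' hq] at h1
    have h2 := (Finset.card_eq_iff_eq_univ _).1 (h1.trans (Fintype.card_fin n).symm)
    have h3 : j ∈ (Finset.univ.filter fun j => lam j < 0) ∪ (Finset.univ.filter fun j => 0 < lam j) := by
      rw [h2]; exact Finset.mem_univ j
    simp [hj] at h3
  let ξC := Complex.ofRealCLM.comp (covec p₀ ξ)
  have hlevi : ∀ g : Fin n → ℂ, (∑ j, ∑ l, conj (g j) * g l *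
      cext ξC (dV (K.b (.inr (.inl l))) (L j) 0)).im = -∑ j, lam j * ‖g j‖ ^ 2 := by
    intro g
    set v := ∑ j, cmul S p₀ (g j) (e j) with hv
    rw [← hform g, ← hv, leviForm_eq, neg_neg]
    congr 1
    have hCv : hC S p₀ v = ∑ j, conj (g j) • hC S p₀ (e j) := by
      rw [hv, map_sum]; exact Finset.sum_congr rfl fun j _ => hC_cmul S p₀ _ _
    obtain ⟨hXv, U', hU', hX⟩ := (S.exists_extension p₀ v).choose_spec
    have hU'p : pt p₀ (0 : RV (2 * n + k)) ∈ U' := by rw [pt_zero]; exact hU'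
    have hXv' : S.extension p₀ v p₀ = v := hXv
    set W := cvf S p₀ (S.extension p₀ v) with hW
    have hWd : DifferentiableAt ℝ W 0 :=
      (contDiffAt_cvf S hX (zero_mem_chartRange p₀) hU'p).differentiableAt (by simp)
    -- The extension of `v` in the definition of the Levi form is arbitrary; near the origin it is
    -- expanded in the frame, with coefficients read off by duality.
    have hWe : W =ᶠ[𝓝 0] fun y => ∑ l, cext (K.y (.inl l)) (W y) • L l y := by
      filter_upwards [Metric.ball_mem_nhds 0 hR] with y hy
      have h1 : W y ∈ T01 L y := by rw [(hRT y hy).1]; exact cvf_mem S (hRm hy) _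
      obtain ⟨c, hc⟩ := (Submodule.mem_span_range_iff_exists_fun ℂ).1 h1
      have h2 : ∀ l, cext (K.y (.inl l)) (W y) = c l := fun l => by
        rw [← hc, map_sum]; simp [map_smul, hLy]
      simp_rw [h2]; exact hc.symm
    have hW0 : ∀ l, cext (K.y (.inl l)) (W 0) = conj (g l) := fun l => by
      rw [hW, cvf_zero, hXv', hCv, map_sum]
      simp_rw [map_smul, ← hL0', hLy]
      simp
    have hZ : (fun r => conj (hC S p₀ v r)) = ∑ l, g l • K.b (.inr (.inl l)) := by
      funext r
      rw [hCv]
      simp [hKb']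
    have hgd : ∀ l, DifferentiableAt ℝ (fun y => cext (K.y (.inl l)) (W y)) 0 := fun l =>
      ((cext (K.y (.inl l))).restrictScalars ℝ).differentiableAt.comp 0 hWd
    have hdV : ∀ Z, dV Z W 0 = ∑ l, (dC Z (fun y => cext (K.y (.inl l)) (W y)) 0 • L l 0 +
        cext (K.y (.inl l)) (W 0) • dV Z (L l) 0) := fun Z => by
      rw [← dV_sum_fun_smul (fun l => (hLs l).differentiable (by simp) 0) hgd]
      funext r
      exact dC_congr _ (hWe.mono fun y hy => congrFun hy r)
    rw [hdV, map_sum]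
    refine Finset.sum_congr rfl fun j _ => ?_
    -- Terms in which a coefficient is differentiated are multiples of frame vectors at the origin,
    -- on which ξ vanishes; the Levi form thus depends on derivatives of the frame alone.
    rw [map_add, map_smul, map_smul, hL0', cext_covec_hC S hξ, smul_zero, zero_add, hW0, hZ, dV_vec_sum_smul,
      map_sum, Finset.smul_sum]
    refine Finset.sum_congr rfl fun l _ => ?_
    rw [map_smul, smul_eq_mul, smul_eq_mul, mul_assoc]
  let X : LocalCR (2 * n + k) n k :=
    { K := K
      L := L
      smooth := hLs
      y_conj := fun j v => by
        simp [K, coordsOfBasis, show conj (2 : ℂ) = 2 from map_ofNat _ 2]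
        ring
      y_real := fun i v => by simp [K, coordsOfBasis]
      L_zero := fun j => by rw [hL0', hKb]
      y_L := hLy
      R := R
      R_pos := hR
      comm := fun i j x hx => (hRT x hx).2 i j
      ξ := covec p₀ ξ
      ξ_b := fun j => by rw [hKb]; exact cext_covec_hC S hξ _
      lam := lam
      lam_ne := hne
      levi := hlevi }
  refine ⟨X, ⟨hRm, fun y hy v w => ?_⟩, ?_⟩
  · rw [← mem_modelT01, ← (hRT y hy).1]
  · have h1 : X.posᶜ = Finset.univ.filter fun j => lam j < 0 := by
      ext j
      have := hne j
      simp only [LocalCR.pos, Finset.mem_compl, Finset.mem_filter, Finset.mem_univ, true_and, not_lt, X]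
      exact ⟨fun h => lt_of_le_of_ne h this, le_of_lt⟩
    rw [h1, hneg]

end Construction

/-! ### The alternatives for local cohomology -/

section Main

variable {n k : ℕ} {M : Type*} [TopologicalSpace M]
  [ChartedSpace (EuclideanSpace ℝ (Fin (2 * n + k))) M] [IsManifold (𝓡 (2 * n + k)) ∞ M]
  {S : CRStructure n k M} {p₀ : M} {ξ : TangentSpace (𝓡 (2 * n + k)) p₀ →L[ℝ] ℝ}

/-- The alternative for the local cohomology groups in degrees `q` and `q + 1`. -/
theorem infinite_or_not_t2Space (hn : 1 ≤ n) (hξ : ξ ∈ S.conormal p₀) {q : ℕ} (hq : q ≤ n)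
    (hLevi : DiagonalLevi S p₀ ξ q (n - q)) {p : ℕ} (hp : p ≤ n + k) :
    ¬ FiniteDimensional ℂ (S.LocalCohomology p q p₀) ∨ ¬ T2Space (S.LocalCohomology p (q + 1) p₀) := by
  by_contra! h
  obtain ⟨hfin, ht2⟩ := h
  obtain ⟨X, hX, rfl⟩ := exists_localModel S p₀ hξ hq hLevi
  exact X.false_of_closedExact_of_finiteCohomology hn hp (closedExact_of_t2Space hX) (finiteCohomology_of_finiteDimensional hX)

/-- If the Poincaré lemma holds, the local cohomology vanishes. -/
lemma finiteDimensional_of_poincareLemma {p q : ℕ} (h : S.PoincareLemma p q p₀) :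
    FiniteDimensional ℂ (S.LocalCohomology p q p₀) :=
  have := subsingleton_of_poincareLemma S h
  inferInstance

lemma t2Space_of_poincareLemma {p q : ℕ} (h : S.PoincareLemma p q p₀) :
    T2Space (S.LocalCohomology p q p₀) :=
  have := subsingleton_of_poincareLemma S h
  inferInstance

end Main

end CRLocal

end

theorem mainTheorem2 {n k : ℕ} (hn : 1 ≤ n) (hk : 1 ≤ k)
    {M : Type*} [TopologicalSpace M] [T2Space M] [ParacompactSpace M] [ConnectedSpace M]
    [ChartedSpace (EuclideanSpace ℝ (Fin (2 * n + k))) M] [IsManifold (𝓡 (2 * n + k)) ∞ M]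
    (S : CRStructure n k M) (p₀ : M)
    (ξ : TangentSpace (𝓡 (2 * n + k)) p₀ →L[ℝ] ℝ) (hξ : ξ ∈ S.conormal p₀)
    (q : ℕ) (hq : q ≤ n) (hLevi : S.LeviSignature p₀ ξ q (n - q))
    (p : ℕ) (hp : p ≤ n + k) :
    ((¬ FiniteDimensional ℂ (S.LocalCohomology p q p₀) ∨
        ¬ T2Space (S.LocalCohomology p (q + 1) p₀)) ∧
      (¬ FiniteDimensional ℂ (S.LocalCohomology p (n - q) p₀) ∨
        ¬ T2Space (S.LocalCohomology p (n - q + 1) p₀))) ∧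
    ((¬ S.PoincareLemma p q p₀ ∨ ¬ S.PoincareLemma p (q + 1) p₀) ∧
      (¬ S.PoincareLemma p (n - q) p₀ ∨ ¬ S.PoincareLemma p (n - q + 1) p₀)) := by
  have hD := CRLocal.diagonalLevi_of_leviSignature hLevi
  -- The covector -ξ has n - q negative and q = n - (n - q) positive eigenvalues, so the first
  -- alternative applies to it in degree n - q.
  have hD' : CRLocal.DiagonalLevi S p₀ (-ξ) (n - q) (n - (n - q)) := by
    rw [Nat.sub_sub_self hq]; exact hD.neg
  have hξ' : -ξ ∈ S.conormal p₀ := fun v hv => by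
    rw [ContinuousLinearMap.neg_apply, hξ v hv, neg_zero]
  have h1 := CRLocal.infinite_or_not_t2Space hn hξ hq hD hp
  have h2 := CRLocal.infinite_or_not_t2Space hn hξ' (Nat.sub_le n q) hD' hp
  exact ⟨⟨h1, h2⟩,
    h1.imp (mt CRLocal.finiteDimensional_of_poincareLemma) (mt CRLocal.t2Space_of_poincareLemma),
    h2.imp (mt CRLocal.finiteDimensional_of_poincareLemma) (mt CRLocal.t2Space_of_poincareLemma)⟩
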